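/- Everything is over $\mathbb F_2$; bidegrees are pairs $(\deg^q,\deg^h)\in\mathbb Z^2$. **Target.** A dg category means a bigraded dg category with finitely many objects, with differential of bidegree $(0,1)$, equipped with an augmentation to its category of identities. An AD bimodule $N$ over $(A',A)$ is a bigraded bimodule over the idempotents with maps $\delta:(A'[1])^{\otimes n}\otimes N\to N\otimes A[1]$, $n\ge 0$, of bidegree $0$ satisfying the AD structure relation; it is finitely generated if it is finite-dimensional, and right bounded if for each $x\in N$ and each number of inputs all sufficiently long iterates of $\delta$ vanish; AD bimodules are taken strictly unital. Let $\mathrm{ADBimod}^{*,*}$ have dg categories as objects, finitely generated right bounded AD bimodules over $(A',A)$ as 1-morphisms $A\to A'$ (composed by the box tensor product $\boxtimes$), and homotopy classes of closed AD bimodule morphisms of arbitrary bidegree (finite sums of homogeneous ones, with inputs in the augmentation ideal) as 2-morphisms. **Source.** $\mathrm{BrCob}(2)^{*,*}$ is the one-object bicategory (graded monoidal category) whose 1-morphisms are words in a positive crossing $\sigma$ and a negative crossing $\sigma^{-1}$, and whose 2-morphisms are $\mathbb F_2$-combinations of movies modulo movie moves. The generating movies are: birth $\emptyset\to c$ and death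 $c\to\emptyset$ of a crossing $c=\sigma^{\pm1}$, and the Reidemeister 2 movies $\emptyset\to cc^{-1}$ and $cc^{-1}\to\emptyset$. The bidegrees are: birth of $\sigma$: $(1,0)$; death of $\sigma$: $(-1,0)$; birth of $\sigma^{-1}$: $(-1,0)$; death of $\sigma^{-1}$: $(1,0)$; Reidemeister 2 movies: $(0,0)$. The movie moves are: distant events commute; the two Reidemeister 2 movies for $cc^{-1}$ are mutually inverse; the two zigzags $c\to cc^{-1}c\to c$ are the identity; $\emptyset\to cc^{-1}$ followed by the death of either crossing is the birth of the other; the birth of a crossing next to its inverse followed by cancellation is the death of that inverse; a birth (death) of $c$ to the left of a crossing $c$ equals the one to the right of it. **The bimodules.** $\mathcal A_{1,1}$ has objects $uu,ou,uo,oo$, zero differential, endomorphism rings $\mathbb F_2$, $\mathbb F_2[U_1]$, $\mathbb F_2[U_2]$, $\mathbb F_2[U_1,U_2]$, and one more basis morphism $\lambda:ou\to uo$ with $\lambda U_1=0=U_2\lambda$; $\deg U_i=(-2,2)$, $\deg\lambda=(1,0)$. $\mathcal A_2$ has objects $u,o$, endomorphism rings $\mathbb F_2[e_1]$, $\mathbb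 F_2[e_1,e_2]$, $\deg e_i=(-2i,2i)$, no other morphisms, zero differential. We write $(a_1,\dots,a_n)\otimes x\mapsto y\otimes b$ for the terms of structure maps and morphisms. * ${}^\vee\Lambda$ over $(\mathcal A_2,\mathcal A_{1,1})$ has basis $X,Y,Z$ with (left, right) idempotents $(u,ou),(u,uo),(o,oo)$ and bidegrees $(1,-1),(0,0),(0,0)$; $\delta(X)=Y\otimes\lambda$, and $e_1$ acts by $U_1$ on $X$, $U_2$ on $Y$, while $e_1,e_2$ act on $Z$ by $U_1+U_2,\,U_1U_2$. * ${}^\vee Y$ over $(\mathcal A_{1,1},\mathcal A_2)$ has basis $A',B',W=w_1C',C'$ with idempotents $(ou,u),(uo,u),(oo,o),(oo,o)$ and bidegrees $(0,-1),(-1,0),(1,-2),(-1,0)$; $U_1^k$ acts on $A'$ and $U_2^k$ on $B'$ by $e_1^k$; $(\lambda,U_1^{k+1})\otimes A'\mapsto B'\otimes e_1^k$ and $(U_2^{k+1},\lambda)\otimes A'\mapsto B'\otimes e_1^k$; $U_1W=W\otimes e_1+C'\otimes 1$, $U_1C'=W\otimes e_2$, $U_2W=C'\otimes 1$, $U_2C'=W\otimes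 e_2+C'\otimes e_1$. * ${}^\vee X={}^\vee Y\boxtimes{}^\vee\Lambda$ (singular crossing). * ${}^\vee\eta:{}^\vee X\to\mathbb I$: $A'X\mapsto ou$, $\lambda\otimes A'Y\mapsto uo$, $B'Y\mapsto uo\otimes U_2$, $WZ\mapsto oo$, $C'Z\mapsto oo\otimes U_2$ (bidegree $(-1,2)$). * ${}^\vee\varepsilon':\mathbb I\to{}^\vee X$: $ou\mapsto A'X\otimes U_1$, $\lambda\otimes ou\mapsto B'X$, $uo\mapsto B'Y$, $oo\mapsto WZ\otimes U_1+C'Z$ (bidegree $(-1,0)$). * ${}^\vee\varepsilon:\mathbb I_{\mathcal A_2}\to{}^\vee\Lambda\boxtimes{}^\vee Y$: $u\mapsto XA'$, $o\mapsto ZW$; ${}^\vee\eta':{}^\vee\Lambda\boxtimes{}^\vee Y\to\mathbb I_{\mathcal A_2}$: $YB'\mapsto u$, $ZC'\mapsto o$. * $\cup=({}^\vee Y\boxtimes{}^\vee\varepsilon\boxtimes{}^\vee\Lambda)\circ{}^\vee\varepsilon':\mathbb I\to{}^\vee X\boxtimes{}^\vee X$ and $\cap={}^\vee\eta\circ({}^\vee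 Y\boxtimes{}^\vee\eta'\boxtimes{}^\vee\Lambda)$. * The positive crossing bimodule $P$ is (dual to) the mapping cone of $\eta$: $q\,\mathbb I\oplus{}^\vee X[-1]$ with ${}^\vee\eta:{}^\vee X\to\mathbb I$ added to $\delta$. The negative crossing bimodule $N$ is (dual to) the mapping cone of $\varepsilon'$: $q^{-1}\,\mathbb I\oplus{}^\vee X[-1]$ with ${}^\vee\varepsilon':\mathbb I\to{}^\vee X$ added to $\delta$. **Theorem.** $\mathrm{ADBimod}^{*,*}$, with the operations above, is a well-defined $\mathbb F_2$-linear $\mathbb Z^2$-graded bicategory. The bimodules $P,N$ are finitely generated right bounded AD bimodules, ${}^\vee\eta$ and ${}^\vee\varepsilon'$ are closed, and the following are closed morphisms of the bidegrees of the corresponding movies: birth of $\sigma$ $\mapsto$ inclusion $\mathbb I\to P$; death of $\sigma^{-1}$ $\mapsto$ projection $N\to\mathbb I$; birth of $\sigma^{-1}$ and death of $\sigma$ $\mapsto 0$; for $\{C,C'\}=\{P,N\}$ the Reidemeister 2 movies $\mapsto$ $\mathbb I\to C\boxtimes C'$ and $C\boxtimes C'\to\mathbb I$, whose components are the identity on the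 summand $\mathbb I\boxtimes\mathbb I$, $\cup$ (resp. $\cap$) on ${}^\vee X\boxtimes{}^\vee X$, and $0$ elsewhere. There is a functor of bicategories (pseudofunctor) $$\mathrm{BrCob}(2)^{*,*}\to\mathrm{ADBimod}^{*,*},$$ $\mathbb F_2$-linear and bidegree-preserving on 2-morphisms with structure isomorphisms of bidegree $0$, which sends the object to $\mathcal A_{1,1}$, the positive crossing to $P$, the negative crossing to $N$, and the generating movies to the morphisms just listed (up to isomorphisms of bidegree $0$ between the images of the crossings and $P,N$). These are the values of the composite of the bigraded Elias–Krasner functor to complexes in the Soergel category $\mathcal{SC}_1$ with the action of $\mathcal{SC}_1$ by AD bimodules. -/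

import Mathlib

open CategoryTheory

namespace BraidAD

noncomputable section

open scoped Classical

/-! ### dg categories and AD bimodules over `F_2`

Everything is linear over the field with two elements.  An additive map between `F_2`-vector
spaces is automatically `F_2`-linear, so linearity is expressed through additivity. -/

/-- An augmented bigraded dg category over `F_2` with finitely many objects, given as the algebra
`Mor` of all its morphisms (the direct sum of all morphism spaces) with the complete family of
orthogonal idempotents formed by the identity morphisms.  The morphisms from `s` to `t` are
`idem t * Mor * idem s`, and `b * a` is the composite `b ∘ a`.  Bidegrees are pairs `(q, h)`;
the differential has bidegree `(0, 1)`. -/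
structure DGCat where
  Obj : Type
  [objFintype : Fintype Obj]
  Mor : Type
  [morRing : Ring Mor]
  one_add_one : (1 : Mor) + 1 = 0
  idem : Obj → Mor
  idem_mul_self : ∀ s, idem s * idem s = idem s
  idem_mul_of_ne : ∀ s t, s ≠ t → idem s * idem t = 0
  sum_idem : ∑ s, idem s = 1
  gr : ℤ × ℤ → AddSubgroup Mor
  gr_internal : DirectSum.IsInternal gr
  gr_mul : ∀ p q a b, a ∈ gr p → b ∈ gr q → a * b ∈ gr (p + q)
  idem_mem : ∀ s, idem s ∈ gr 0
  d : Mor →+ Mor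
  d_mem : ∀ p a, a ∈ gr p → d a ∈ gr (p + (0, 1))
  d_d : ∀ a, d (d a) = 0
  d_mul : ∀ a b, d (a * b) = d a * b + a * d b
  d_idem : ∀ s, d (idem s) = 0
  /-- the augmentation, a dg functor to the category with only (multiples of) identities -/
  aug : Mor →+* (Obj → ZMod 2)
  aug_idem : ∀ s t, aug (idem s) t = if s = t then 1 else 0
  aug_d : ∀ a, aug (d a) = 0
  aug_gr : ∀ p a, p ≠ 0 → a ∈ gr p → aug a = 0

attribute [instance] DGCat.objFintype DGCat.morRing

/-- The sum of `F l₁ l₂` over all ways to write `l = l₁ ++ l₂`. -/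
def splitSum {α R : Type} [AddCommMonoid R] (F : List α → List α → R) (l : List α) : R :=
  ∑ i ∈ Finset.range (l.length + 1), F (l.take i) (l.drop i)

/-- The data of a finitely generated AD bimodule over `(B, A)`: a finite homogeneous basis `G`,
left and right idempotents and bidegrees of its elements, and structure maps.  The value
`δ y x [b₁, …, bₙ]` is the element of `A` standing next to `y` in
`δ (b₁ ⊗ ⋯ ⊗ bₙ ⊗ x) = ∑ y, y ⊗ δ y x [b₁, …, bₙ]`. -/
structure ADRaw (B A : DGCat) where
  G : Type
  [gFintype : Fintype G]
  l : G → B.Obj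
  r : G → A.Obj
  deg : G → ℤ × ℤ
  δ : G → G → List B.Mor → A.Mor

attribute [instance] ADRaw.gFintype

section AD

variable {A B C E : DGCat}

/-- Matrices (target index first) of functions from sequences in `B` to `A`. -/
abbrev Coch (M N : ADRaw B A) : Type := N.G → M.G → List B.Mor → A.Mor

/-- `f` is the matrix of a bilinear map `T(B[1]) ⊗ M → N ⊗ A` of bidegree `p`, where tensor
products and bilinearity are over the idempotents. -/
structure IsCochain (M N : ADRaw B A) (p : ℤ × ℤ) (f : Coch M N) : Prop where
  add : ∀ y x l₁ a b l₂,
    f y x (l₁ ++ (a + b) :: l₂) = f y x (l₁ ++ a :: l₂) + f y x (l₁ ++ b :: l₂)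
  mid : ∀ y x l₁ a s b l₂,
    f y x (l₁ ++ (a * B.idem s) :: b :: l₂) = f y x (l₁ ++ a :: (B.idem s * b) :: l₂)
  left : ∀ y x a l, f y x ((B.idem (N.l y) * a) :: l) = f y x (a :: l)
  right : ∀ y x l a, f y x (l ++ [a * B.idem (M.l x)]) = f y x (l ++ [a])
  nil : ∀ y x, N.l y ≠ M.l x → f y x [] = 0
  out : ∀ y x l, A.idem (N.r y) * f y x l * A.idem (M.r x) = f y x l
  deg : ∀ y x (l : List B.Mor) (ds : List (ℤ × ℤ)), List.Forall₂ (fun a d => a ∈ B.gr d) l ds →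
    f y x l ∈ A.gr (p + M.deg x - N.deg y + (ds.map fun d => d - (0, 1)).sum)

/-- Composition: `(g ∘ f)(b₁, …, bₙ, x)` applies `f` to a final segment of the inputs and then
`g` to the rest. -/
def compC {M N K : ADRaw B A} (g : Coch N K) (f : Coch M N) : Coch M K := fun z x l =>
  ∑ y, splitSum (fun l₁ l₂ => g z y l₁ * f y x l₂) l

/-- The terms in which the differential of `B` is applied to one input. -/
def barD : (List B.Mor → A.Mor) → List B.Mor → A.Mor
  | _, [] => 0
  | F, a :: l => F (B.d a :: l) + barD (fun t => F (a :: t)) l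

/-- The terms in which two consecutive inputs are multiplied. -/
def barM : (List B.Mor → A.Mor) → List B.Mor → A.Mor
  | _, [] => 0
  | _, [_] => 0
  | F, a :: b :: l => F (a * b :: l) + barM (fun t => F (a :: t)) (b :: l)

/-- The internal part of the differential of a cochain. -/
def intD {M N : ADRaw B A} (f : Coch M N) : Coch M N := fun y x l =>
  A.d (f y x l) + barD (f y x) l + barM (f y x) l

/-- The iterated structure maps of `N`: the sum over all sequences of exactly `j` applications
of `δ`, starting at `n`, ending at `n'` and consuming the inputs `l`, of `Φ` applied to the
sequence of the `j` outputs (the output produced first stands last). -/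
def ADRaw.iter (N : ADRaw B A) {R : Type} [AddCommMonoid R] :
    ℕ → N.G → N.G → (List A.Mor → R) → List B.Mor → R
  | 0, n', n, Φ, [] => if n' = n then Φ [] else 0
  | 0, _, _, _, _ :: _ => 0
  | j + 1, n', n, Φ, l =>
    ∑ n₁, splitSum (fun l₁ l₂ => N.iter j n₁ n (fun t => Φ (N.δ n' n₁ l₁ :: t)) l₂) l

/-- The same for sequences of exactly `j` applications of which one is an application of `f`,
those before it being applications of the structure map of `N`, those after it of `N'`. -/
def iterF {N N' : ADRaw B A} (f : Coch N N') {R : Type} [AddCommMonoid R] :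
    ℕ → N'.G → N.G → (List A.Mor → R) → List B.Mor → R
  | 0, _, _, _, _ => 0
  | j + 1, n', n, Φ, l =>
    (∑ n₁ : N.G, splitSum (fun l₁ l₂ => N.iter j n₁ n (fun t => Φ (f n' n₁ l₁ :: t)) l₂) l) +
    ∑ n₁ : N'.G, splitSum (fun l₁ l₂ => iterF f j n₁ n (fun t => Φ (N'.δ n' n₁ l₁ :: t)) l₂) l

/-- Additivity in each entry of a sequence. -/
def MultiAdd {R : Type} [AddCommGroup R] (Φ : List A.Mor → R) : Prop :=
  ∀ l₁ a b l₂, Φ (l₁ ++ (a + b) :: l₂) = Φ (l₁ ++ a :: l₂) + Φ (l₁ ++ b :: l₂)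

/-- The conditions making `M` a strictly unital right bounded AD bimodule. -/
structure IsAD (M : ADRaw B A) : Prop where
  cochain : IsCochain M M (0, 1) M.δ
  rel : intD (M := M) (N := M) M.δ + compC (M := M) (N := M) (K := M) M.δ M.δ = 0
  unital : ∀ y x s, M.δ y x [B.idem s] = if y = x ∧ M.l x = s then A.idem (M.r x) else 0
  unital_higher : ∀ y x l s, 2 ≤ l.length → B.idem s ∈ l → M.δ y x l = 0
  /-- For every `x` and number `i` of inputs, all long iterates of the structure map vanish as
  maps into tensor powers of `A`; this is tested against all multiadditive maps. -/
  bounded : ∀ x i, ∃ n, ∀ j, n < j → ∀ (R : Type) [AddCommGroup R] (Φ : List A.Mor → R),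
    MultiAdd Φ → ∀ y (l : List B.Mor), l.length = i → M.iter j y x Φ l = 0

/-- Finitely generated, right bounded AD bimodules over `(B, A)`. -/
structure ADMod (B A : DGCat) where
  raw : ADRaw B A
  isAD : IsAD raw

/-! ### Morphisms of AD bimodules -/

/-- AD bimodule morphisms of bidegree `p`.  Their inputs are taken from the augmentation ideal;
equivalently, they vanish as soon as one input is an identity morphism. -/
def homMor (M N : ADRaw B A) (p : ℤ × ℤ) : AddSubgroup (Coch M N) where
  carrier := {f | IsCochain M N p f ∧ ∀ y x l s, B.idem s ∈ l → f y x l = 0}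
  zero_mem' := by
    refine ⟨⟨?_, ?_, ?_, ?_, ?_, ?_, ?_⟩, ?_⟩ <;> intros <;> simp
  add_mem' := by
    rintro f g ⟨hf, hf'⟩ ⟨hg, hg'⟩
    refine ⟨⟨?_, ?_, ?_, ?_, ?_, ?_, ?_⟩, ?_⟩
    · intro y x l₁ a b l₂
      simp only [Pi.add_apply, hf.add, hg.add]; abel
    · intro y x l₁ a s b l₂
      simp only [Pi.add_apply, hf.mid, hg.mid]
    · intro y x a l
      simp only [Pi.add_apply, hf.left, hg.left]
    · intro y x l a
      simp only [Pi.add_apply, hf.right, hg.right]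
    · intro y x h
      simp only [Pi.add_apply, hf.nil y x h, hg.nil y x h, add_zero]
    · intro y x l
      simp only [Pi.add_apply, mul_add, add_mul, hf.out, hg.out]
    · intro y x l ds h
      exact add_mem (hf.deg y x l ds h) (hg.deg y x l ds h)
    · intro y x l s h
      simp only [Pi.add_apply, hf' y x l s h, hg' y x l s h, add_zero]
  neg_mem' := by
    rintro f ⟨hf, hf'⟩
    refine ⟨⟨?_, ?_, ?_, ?_, ?_, ?_, ?_⟩, ?_⟩
    · intro y x l₁ a b l₂
      simp only [Pi.neg_apply, hf.add]; abel
    · intro y x l₁ a s b l₂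
      simp only [Pi.neg_apply, hf.mid]
    · intro y x a l
      simp only [Pi.neg_apply, hf.left]
    · intro y x l a
      simp only [Pi.neg_apply, hf.right]
    · intro y x h
      simp only [Pi.neg_apply, hf.nil y x h, neg_zero]
    · intro y x l
      simp only [Pi.neg_apply, mul_neg, neg_mul, hf.out]
    · intro y x l ds h
      exact neg_mem (hf.deg y x l ds h)
    · intro y x l s h
      simp only [Pi.neg_apply, hf' y x l s h, neg_zero]

/-- All morphisms: finite sums of homogeneous morphisms of arbitrary bidegrees. -/
def mor (M N : ADRaw B A) : AddSubgroup (Coch M N) := ⨆ p, homMor M N p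

theorem barD_add (F F' : List B.Mor → A.Mor) (l : List B.Mor) :
    barD (F + F') l = barD F l + barD F' l := by
  induction l generalizing F F' with
  | nil => simp [barD]
  | cons a l ih =>
    have h := ih (fun t => F (a :: t)) (fun t => F' (a :: t))
    have e : (fun t => (F + F') (a :: t)) = (fun t => F (a :: t)) + fun t => F' (a :: t) := rfl
    simp only [barD, Pi.add_apply] at h ⊢
    rw [show (fun t => F (a :: t) + F' (a :: t)) =
      (fun t => F (a :: t)) + fun t => F' (a :: t) from rfl, h]
    abel

theorem barM_add (F F' : List B.Mor → A.Mor) (l : List B.Mor) :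
    barM (F + F') l = barM F l + barM F' l := by
  induction l generalizing F F' with
  | nil => simp [barM]
  | cons a l ih =>
    cases l with
    | nil => simp [barM]
    | cons b l =>
      have h := ih (fun t => F (a :: t)) (fun t => F' (a :: t))
      simp only [barM, Pi.add_apply] at h ⊢
      rw [show (fun t => F (a :: t) + F' (a :: t)) =
        (fun t => F (a :: t)) + fun t => F' (a :: t) from rfl, h]
      abel

/-- The differential on morphisms: `f ↦ D f + δ ∘ f + f ∘ δ`. -/
def dMor (M N : ADRaw B A) : Coch M N →+ Coch M N :=
  AddMonoidHom.mk'
    (fun f => intD f + compC (M := M) (N := N) (K := N) N.δ f +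
      compC (M := M) (N := M) (K := N) f M.δ)
    (by
      intro f g
      funext y x l
      have h1 : barD ((f + g) y x) l = barD (f y x) l + barD (g y x) l := barD_add _ _ _
      have h2 : barM ((f + g) y x) l = barM (f y x) l + barM (g y x) l := barM_add _ _ _
      simp only [Pi.add_apply, intD, compC, splitSum, mul_add, add_mul, Finset.sum_add_distrib,
        map_add] at h1 h2 ⊢
      rw [h1, h2]
      abel)

/-- Closed morphisms. -/
def closed (M N : ADRaw B A) : AddSubgroup (Coch M N) := mor M N ⊓ (dMor M N).ker

/-- Differentials of morphisms. -/
def bdry (M N : ADRaw B A) : AddSubgroup (Coch M N) := (mor M N).map (dMor M N)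

/-- Homotopy classes of closed morphisms. -/
abbrev HMor (M N : ADRaw B A) : Type := closed M N ⧸ (bdry M N).addSubgroupOf (closed M N)

instance HMor.addCommGroup (M N : ADRaw B A) : AddCommGroup (HMor M N) := inferInstance

/-- The homotopy class of a closed morphism. -/
def cls {M N : ADRaw B A} (f : Coch M N) (hf : f ∈ closed M N) : HMor M N :=
  QuotientAddGroup.mk ⟨f, hf⟩

/-- Homotopy classes of closed morphisms of bidegree `p`. -/
def HMor.homog (M N : ADRaw B A) (p : ℤ × ℤ) : AddSubgroup (HMor M N) :=
  ((homMor M N p).addSubgroupOf (closed M N)).map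
    (QuotientAddGroup.mk' ((bdry M N).addSubgroupOf (closed M N)))

/-- The operation on homotopy classes induced by an operation on cochains. -/
def HMor.lift {M N : ADRaw B A} {M' N' : ADRaw E C} (φ : Coch M N → Coch M' N')
    (h : ∀ f ∈ closed M N, φ f ∈ closed M' N')
    (h' : ∀ f ∈ closed M N, ∀ g ∈ closed M N, -f + g ∈ bdry M N → -φ f + φ g ∈ bdry M' N') :
    HMor M N → HMor M' N' :=
  Quotient.map' (fun f => ⟨φ f.1, h f.1 f.2⟩) (by
    intro f g hfg
    rw [QuotientAddGroup.leftRel_apply, AddSubgroup.mem_addSubgroupOf] at hfg ⊢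
    exact h' f.1 f.2 g.1 g.2 hfg)

/-- The operation on homotopy classes induced by a binary operation on cochains. -/
def HMor.lift₂ {M N K : ADRaw B A} (φ : Coch M N → Coch N K → Coch M K)
    (h : ∀ f ∈ closed M N, ∀ g ∈ closed N K, φ f g ∈ closed M K)
    (h' : ∀ f ∈ closed M N, ∀ f' ∈ closed M N, ∀ g ∈ closed N K, ∀ g' ∈ closed N K,
      -f + f' ∈ bdry M N → -g + g' ∈ bdry N K → -φ f g + φ f' g' ∈ bdry M K) :
    HMor M N → HMor N K → HMor M K :=
  Quotient.map₂ (fun f g => ⟨φ f.1 g.1, h f.1 f.2 g.1 g.2⟩) (by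
    intro f f' hf g g' hg
    change QuotientAddGroup.leftRel _ _ _ at hf
    change QuotientAddGroup.leftRel _ _ _ at hg
    change QuotientAddGroup.leftRel _ _ _
    rw [QuotientAddGroup.leftRel_apply, AddSubgroup.mem_addSubgroupOf] at hf hg ⊢
    exact h' f.1 f.2 f'.1 f'.2 g.1 g.2 g'.1 g'.2 hf hg)

/-! ### Identity bimodules, box tensor products, and the operations on morphisms -/

/-- The identity AD bimodule. -/
def ADRaw.one (A : DGCat) : ADRaw A A where
  G := A.Obj
  l := id
  r := id
  deg := 0
  δ y x l := match l with
    | [a] => A.idem y * a * A.idem x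
    | _ => 0

/-- The box tensor product of AD bimodules over `(C, B)` and `(B, A)`: the iterated structure
maps of the first feed the structure map of the second. -/
def ADRaw.box (N : ADRaw C B) (M : ADRaw B A) : ADRaw C A where
  G := {p : N.G × M.G // N.r p.1 = M.l p.2}
  l p := N.l p.1.1
  r p := M.r p.1.2
  deg p := N.deg p.1.1 + M.deg p.1.2
  δ y x l := ∑ᶠ j, N.iter j y.1.1 x.1.1 (M.δ y.1.2 x.1.2) l

/-- `N ⊠ g`. -/
def idBox (N : ADRaw C B) {M M' : ADRaw B A} (g : Coch M M') : Coch (N.box M) (N.box M') :=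
  fun y x l => ∑ᶠ j, N.iter j y.1.1 x.1.1 (g y.1.2 x.1.2) l

/-- `f ⊠ M`. -/
def boxId {N N' : ADRaw C B} (f : Coch N N') (M : ADRaw B A) : Coch (N.box M) (N'.box M) :=
  fun y x l => ∑ᶠ j, iterF f j y.1.1 x.1.1 (M.δ y.1.2 x.1.2) l

/-- The morphism without inputs induced by a map (or relation) of basis elements. -/
def relabel {M N : ADRaw B A} (φ : N.G → M.G → Prop) : Coch M N := fun y x l =>
  match l with
  | [] => if φ y x then A.idem (N.r y) else 0
  | _ :: _ => 0

/-- The identity morphism. -/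
def idC (M : ADRaw B A) : Coch M M := relabel fun y x => y = x

/-- The associativity isomorphism `(K ⊠ N) ⊠ M → K ⊠ (N ⊠ M)`. -/
def assocHom (K : ADRaw E C) (N : ADRaw C B) (M : ADRaw B A) :
    Coch ((K.box N).box M) (K.box (N.box M)) :=
  relabel fun y x => y.1.1 = x.1.1.1.1 ∧ y.1.2.1.1 = x.1.1.1.2 ∧ y.1.2.1.2 = x.1.2

/-- Its inverse. -/
def assocInv (K : ADRaw E C) (N : ADRaw C B) (M : ADRaw B A) :
    Coch (K.box (N.box M)) ((K.box N).box M) :=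
  relabel fun y x => x.1.1 = y.1.1.1.1 ∧ x.1.2.1.1 = y.1.1.1.2 ∧ x.1.2.1.2 = y.1.2

/-- The isomorphism `1 ⊠ M → M`. -/
def oneBoxHom (M : ADRaw B A) : Coch ((ADRaw.one B).box M) M := relabel fun y x => y = x.1.2

/-- Its inverse. -/
def oneBoxInv (M : ADRaw B A) : Coch M ((ADRaw.one B).box M) := relabel fun y x => y.1.2 = x

/-- The isomorphism `M ⊠ 1 → M`. -/
def boxOneHom (M : ADRaw B A) : Coch (M.box (ADRaw.one A)) M := relabel fun y x => y = x.1.1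

/-- Its inverse. -/
def boxOneInv (M : ADRaw B A) : Coch M (M.box (ADRaw.one A)) := relabel fun y x => y.1.1 = x

/-- The operations used to form the bicategory of AD bimodules are well defined: identity
bimodules and box tensor products are right bounded AD bimodules, and the operations on
morphisms preserve closed morphisms and are compatible with homotopy. -/
structure WellDefined : Prop where
  one : ∀ A : DGCat, IsAD (ADRaw.one A)
  box : ∀ {A B C : DGCat} (N : ADMod C B) (M : ADMod B A), IsAD (N.raw.box M.raw)
  id_closed : ∀ {A B : DGCat} (M : ADMod B A), idC M.raw ∈ closed M.raw M.raw
  comp_closed : ∀ {A B : DGCat} (M N K : ADMod B A), ∀ f ∈ closed M.raw N.raw,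
    ∀ g ∈ closed N.raw K.raw, compC g f ∈ closed M.raw K.raw
  comp_homotopy : ∀ {A B : DGCat} (M N K : ADMod B A), ∀ f ∈ closed M.raw N.raw,
    ∀ f' ∈ closed M.raw N.raw, ∀ g ∈ closed N.raw K.raw, ∀ g' ∈ closed N.raw K.raw,
    -f + f' ∈ bdry M.raw N.raw → -g + g' ∈ bdry N.raw K.raw →
    -compC g f + compC g' f' ∈ bdry M.raw K.raw
  idBox_closed : ∀ {A B C : DGCat} (N : ADMod C B) (M M' : ADMod B A),
    ∀ g ∈ closed M.raw M'.raw, idBox N.raw g ∈ closed (N.raw.box M.raw) (N.raw.box M'.raw)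
  idBox_homotopy : ∀ {A B C : DGCat} (N : ADMod C B) (M M' : ADMod B A),
    ∀ g ∈ closed M.raw M'.raw, ∀ g' ∈ closed M.raw M'.raw, -g + g' ∈ bdry M.raw M'.raw →
    -idBox N.raw g + idBox N.raw g' ∈ bdry (N.raw.box M.raw) (N.raw.box M'.raw)
  boxId_closed : ∀ {A B C : DGCat} (N N' : ADMod C B) (M : ADMod B A),
    ∀ f ∈ closed N.raw N'.raw, boxId f M.raw ∈ closed (N.raw.box M.raw) (N'.raw.box M.raw)
  boxId_homotopy : ∀ {A B C : DGCat} (N N' : ADMod C B) (M : ADMod B A),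
    ∀ f ∈ closed N.raw N'.raw, ∀ f' ∈ closed N.raw N'.raw, -f + f' ∈ bdry N.raw N'.raw →
    -boxId f M.raw + boxId f' M.raw ∈ bdry (N.raw.box M.raw) (N'.raw.box M.raw)
  assocHom_closed : ∀ {A B C E : DGCat} (K : ADMod E C) (N : ADMod C B) (M : ADMod B A),
    assocHom K.raw N.raw M.raw ∈
      closed ((K.raw.box N.raw).box M.raw) (K.raw.box (N.raw.box M.raw))
  assocInv_closed : ∀ {A B C E : DGCat} (K : ADMod E C) (N : ADMod C B) (M : ADMod B A),
    assocInv K.raw N.raw M.raw ∈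
      closed (K.raw.box (N.raw.box M.raw)) ((K.raw.box N.raw).box M.raw)
  oneBoxHom_closed : ∀ {A B : DGCat} (M : ADMod B A),
    oneBoxHom M.raw ∈ closed ((ADRaw.one B).box M.raw) M.raw
  oneBoxInv_closed : ∀ {A B : DGCat} (M : ADMod B A),
    oneBoxInv M.raw ∈ closed M.raw ((ADRaw.one B).box M.raw)
  boxOneHom_closed : ∀ {A B : DGCat} (M : ADMod B A),
    boxOneHom M.raw ∈ closed (M.raw.box (ADRaw.one A)) M.raw
  boxOneInv_closed : ∀ {A B : DGCat} (M : ADMod B A),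
    boxOneInv M.raw ∈ closed M.raw (M.raw.box (ADRaw.one A))

namespace WellDefined

variable (W : WellDefined)

/-- The identity AD bimodule as a 1-morphism. -/
def oneM (A : DGCat) : ADMod A A := ⟨ADRaw.one A, W.one A⟩

/-- The box tensor product as composition of 1-morphisms. -/
def boxM (N : ADMod C B) (M : ADMod B A) : ADMod C A := ⟨N.raw.box M.raw, W.box N M⟩

def hid (M : ADMod B A) : HMor M.raw M.raw := cls (idC M.raw) (W.id_closed M)

/-- `hcomp f g` is `g ∘ f`. -/
def hcomp {M N K : ADMod B A} (f : HMor M.raw N.raw) (g : HMor N.raw K.raw) :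
    HMor M.raw K.raw :=
  HMor.lift₂ (fun f g => compC g f) (W.comp_closed M N K) (W.comp_homotopy M N K) f g

def hIdBox (N : ADMod C B) {M M' : ADMod B A} (g : HMor M.raw M'.raw) :
    HMor (W.boxM N M).raw (W.boxM N M').raw :=
  HMor.lift (idBox N.raw) (W.idBox_closed N M M') (W.idBox_homotopy N M M') g

def hBoxId {N N' : ADMod C B} (f : HMor N.raw N'.raw) (M : ADMod B A) :
    HMor (W.boxM N M).raw (W.boxM N' M).raw :=
  HMor.lift (fun f => boxId f M.raw) (W.boxId_closed N N' M) (W.boxId_homotopy N N' M) f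

def hAssocHom (K : ADMod E C) (N : ADMod C B) (M : ADMod B A) :
    HMor (W.boxM (W.boxM K N) M).raw (W.boxM K (W.boxM N M)).raw :=
  cls (assocHom K.raw N.raw M.raw) (W.assocHom_closed K N M)

def hAssocInv (K : ADMod E C) (N : ADMod C B) (M : ADMod B A) :
    HMor (W.boxM K (W.boxM N M)).raw (W.boxM (W.boxM K N) M).raw :=
  cls (assocInv K.raw N.raw M.raw) (W.assocInv_closed K N M)

def hOneBoxHom (M : ADMod B A) : HMor (W.boxM (W.oneM B) M).raw M.raw :=
  cls (oneBoxHom M.raw) (W.oneBoxHom_closed M)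

def hOneBoxInv (M : ADMod B A) : HMor M.raw (W.boxM (W.oneM B) M).raw :=
  cls (oneBoxInv M.raw) (W.oneBoxInv_closed M)

def hBoxOneHom (M : ADMod B A) : HMor (W.boxM M (W.oneM A)).raw M.raw :=
  cls (boxOneHom M.raw) (W.boxOneHom_closed M)

def hBoxOneInv (M : ADMod B A) : HMor M.raw (W.boxM M (W.oneM A)).raw :=
  cls (boxOneInv M.raw) (W.boxOneInv_closed M)

end WellDefined

/-- The operations above are well defined and satisfy the axioms of an `F_2`-linear
`ℤ²`-graded bicategory. -/
structure ADBimodLaws : Prop where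
  wd : WellDefined
  id_comp : ∀ {A B : DGCat} {M N : ADMod B A} (f : HMor M.raw N.raw),
    wd.hcomp (wd.hid M) f = f
  comp_id : ∀ {A B : DGCat} {M N : ADMod B A} (f : HMor M.raw N.raw),
    wd.hcomp f (wd.hid N) = f
  assoc : ∀ {A B : DGCat} {M N K L : ADMod B A} (f : HMor M.raw N.raw) (g : HMor N.raw K.raw)
    (h : HMor K.raw L.raw), wd.hcomp (wd.hcomp f g) h = wd.hcomp f (wd.hcomp g h)
  idBox_id : ∀ {A B C : DGCat} (N : ADMod C B) (M : ADMod B A),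
    wd.hIdBox N (wd.hid M) = wd.hid (wd.boxM N M)
  idBox_comp : ∀ {A B C : DGCat} (N : ADMod C B) {M M' M'' : ADMod B A}
    (f : HMor M.raw M'.raw) (g : HMor M'.raw M''.raw),
    wd.hIdBox N (wd.hcomp f g) = wd.hcomp (wd.hIdBox N f) (wd.hIdBox N g)
  boxId_id : ∀ {A B C : DGCat} (N : ADMod C B) (M : ADMod B A),
    wd.hBoxId (wd.hid N) M = wd.hid (wd.boxM N M)
  boxId_comp : ∀ {A B C : DGCat} {N N' N'' : ADMod C B} (f : HMor N.raw N'.raw)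
    (g : HMor N'.raw N''.raw) (M : ADMod B A),
    wd.hBoxId (wd.hcomp f g) M = wd.hcomp (wd.hBoxId f M) (wd.hBoxId g M)
  exchange : ∀ {A B C : DGCat} {N N' : ADMod C B} {M M' : ADMod B A} (f : HMor N.raw N'.raw)
    (g : HMor M.raw M'.raw),
    wd.hcomp (wd.hBoxId f M) (wd.hIdBox N' g) = wd.hcomp (wd.hIdBox N g) (wd.hBoxId f M')
  assoc_hom_inv : ∀ {A B C E : DGCat} (K : ADMod E C) (N : ADMod C B) (M : ADMod B A),
    wd.hcomp (wd.hAssocHom K N M) (wd.hAssocInv K N M) = wd.hid _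
  assoc_inv_hom : ∀ {A B C E : DGCat} (K : ADMod E C) (N : ADMod C B) (M : ADMod B A),
    wd.hcomp (wd.hAssocInv K N M) (wd.hAssocHom K N M) = wd.hid _
  oneBox_hom_inv : ∀ {A B : DGCat} (M : ADMod B A),
    wd.hcomp (wd.hOneBoxHom M) (wd.hOneBoxInv M) = wd.hid _
  oneBox_inv_hom : ∀ {A B : DGCat} (M : ADMod B A),
    wd.hcomp (wd.hOneBoxInv M) (wd.hOneBoxHom M) = wd.hid _
  boxOne_hom_inv : ∀ {A B : DGCat} (M : ADMod B A),
    wd.hcomp (wd.hBoxOneHom M) (wd.hBoxOneInv M) = wd.hid _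
  boxOne_inv_hom : ∀ {A B : DGCat} (M : ADMod B A),
    wd.hcomp (wd.hBoxOneInv M) (wd.hBoxOneHom M) = wd.hid _
  one_idBox : ∀ {A B : DGCat} {M M' : ADMod B A} (f : HMor M.raw M'.raw),
    wd.hIdBox (wd.oneM B) f =
      wd.hcomp (wd.hOneBoxHom M) (wd.hcomp f (wd.hOneBoxInv M'))
  boxId_one : ∀ {A B : DGCat} {M M' : ADMod B A} (f : HMor M.raw M'.raw),
    wd.hBoxId f (wd.oneM A) =
      wd.hcomp (wd.hBoxOneHom M) (wd.hcomp f (wd.hBoxOneInv M'))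
  box_idBox : ∀ {A B C E : DGCat} (K : ADMod E C) (N : ADMod C B) {M M' : ADMod B A}
    (f : HMor M.raw M'.raw), wd.hIdBox (wd.boxM K N) f =
      wd.hcomp (wd.hAssocHom K N M)
        (wd.hcomp (wd.hIdBox K (wd.hIdBox N f)) (wd.hAssocInv K N M'))
  boxId_box : ∀ {A B C E : DGCat} {K K' : ADMod E C} (f : HMor K.raw K'.raw) (N : ADMod C B)
    (M : ADMod B A), wd.hBoxId f (wd.boxM N M) =
      wd.hcomp (wd.hAssocInv K N M)
        (wd.hcomp (wd.hBoxId (wd.hBoxId f N) M) (wd.hAssocHom K' N M))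
  idBox_boxId : ∀ {A B C E : DGCat} (K : ADMod E C) {N N' : ADMod C B} (f : HMor N.raw N'.raw)
    (M : ADMod B A), wd.hIdBox K (wd.hBoxId f M) =
      wd.hcomp (wd.hAssocInv K N M)
        (wd.hcomp (wd.hBoxId (wd.hIdBox K f) M) (wd.hAssocHom K N' M))
  pentagon : ∀ {A B C E H : DGCat} (L : ADMod H E) (K : ADMod E C) (N : ADMod C B)
    (M : ADMod B A),
    wd.hcomp (wd.hIdBox L (wd.hAssocInv K N M))
      (wd.hcomp (wd.hAssocInv L (wd.boxM K N) M) (wd.hBoxId (wd.hAssocInv L K N) M)) =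
    wd.hcomp (wd.hAssocInv L K (wd.boxM N M)) (wd.hAssocInv (wd.boxM L K) N M)
  triangle : ∀ {A B C : DGCat} (N : ADMod C B) (M : ADMod B A),
    wd.hcomp (wd.hAssocInv N (wd.oneM B) M) (wd.hBoxId (wd.hBoxOneHom N) M) =
      wd.hIdBox N (wd.hOneBoxHom M)
  homog_internal : ∀ {A B : DGCat} (M N : ADMod B A),
    DirectSum.IsInternal (HMor.homog M.raw N.raw)
  comp_add : ∀ {A B : DGCat} {M N K : ADMod B A} (f : HMor M.raw N.raw)
    (g g' : HMor N.raw K.raw), wd.hcomp f (g + g') = wd.hcomp f g + wd.hcomp f g'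
  add_comp : ∀ {A B : DGCat} {M N K : ADMod B A} (f f' : HMor M.raw N.raw)
    (g : HMor N.raw K.raw), wd.hcomp (f + f') g = wd.hcomp f g + wd.hcomp f' g
  idBox_add : ∀ {A B C : DGCat} (N : ADMod C B) {M M' : ADMod B A} (f g : HMor M.raw M'.raw),
    wd.hIdBox N (f + g) = wd.hIdBox N f + wd.hIdBox N g
  boxId_add : ∀ {A B C : DGCat} {N N' : ADMod C B} (f g : HMor N.raw N'.raw) (M : ADMod B A),
    wd.hBoxId (f + g) M = wd.hBoxId f M + wd.hBoxId g M
  comp_homog : ∀ {A B : DGCat} {M N K : ADMod B A} (p q : ℤ × ℤ), ∀ f ∈ HMor.homog M.raw N.raw p,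
    ∀ g ∈ HMor.homog N.raw K.raw q, wd.hcomp f g ∈ HMor.homog M.raw K.raw (p + q)
  idBox_homog : ∀ {A B C : DGCat} (N : ADMod C B) {M M' : ADMod B A} (p : ℤ × ℤ),
    ∀ f ∈ HMor.homog M.raw M'.raw p, wd.hIdBox N f ∈ HMor.homog _ _ p
  boxId_homog : ∀ {A B C : DGCat} {N N' : ADMod C B} (p : ℤ × ℤ),
    ∀ f ∈ HMor.homog N.raw N'.raw p, ∀ M : ADMod B A, wd.hBoxId f M ∈ HMor.homog _ _ p
  id_homog : ∀ {A B : DGCat} (M : ADMod B A), wd.hid M ∈ HMor.homog _ _ 0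
  assocHom_homog : ∀ {A B C E : DGCat} (K : ADMod E C) (N : ADMod C B) (M : ADMod B A),
    wd.hAssocHom K N M ∈ HMor.homog _ _ 0 ∧ wd.hAssocInv K N M ∈ HMor.homog _ _ 0
  oneBox_homog : ∀ {A B : DGCat} (M : ADMod B A),
    wd.hOneBoxHom M ∈ HMor.homog _ _ 0 ∧ wd.hOneBoxInv M ∈ HMor.homog _ _ 0
  boxOne_homog : ∀ {A B : DGCat} (M : ADMod B A),
    wd.hBoxOneHom M ∈ HMor.homog _ _ 0 ∧ wd.hBoxOneInv M ∈ HMor.homog _ _ 0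

/-- The graded bicategory of AD bimodules.  Objects are dg categories; a 1-morphism from `A` to
`A'` is a finitely generated right bounded AD bimodule over `(A', A)`; 2-morphisms are homotopy
classes of closed AD bimodule morphisms of arbitrary bidegree. -/
def ADBimod (_ : ADBimodLaws) : Type 1 := DGCat

instance (L : ADBimodLaws) : CategoryStruct (ADBimod L) where
  Hom A A' := ADMod (A' : DGCat) (A : DGCat)
  id A := L.wd.oneM A
  comp f g := L.wd.boxM g f

instance (L : ADBimodLaws) (A A' : ADBimod L) : Category (A ⟶ A') where
  Hom M N := HMor M.raw N.raw
  id M := L.wd.hid M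
  comp f g := L.wd.hcomp f g
  id_comp := L.id_comp
  comp_id := L.comp_id
  assoc := L.assoc

instance (L : ADBimodLaws) : Bicategory (ADBimod L) where
  homCategory _ _ := inferInstance
  whiskerLeft f _ _ η := L.wd.hBoxId η f
  whiskerRight η h := L.wd.hIdBox h η
  associator f g h :=
    { hom := L.wd.hAssocInv h g f
      inv := L.wd.hAssocHom h g f
      hom_inv_id := L.assoc_inv_hom h g f
      inv_hom_id := L.assoc_hom_inv h g f }
  leftUnitor f :=
    { hom := L.wd.hBoxOneHom f
      inv := L.wd.hBoxOneInv f
      hom_inv_id := L.boxOne_hom_inv f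
      inv_hom_id := L.boxOne_inv_hom f }
  rightUnitor f :=
    { hom := L.wd.hOneBoxHom f
      inv := L.wd.hOneBoxInv f
      hom_inv_id := L.oneBox_hom_inv f
      inv_hom_id := L.oneBox_inv_hom f }
  whiskerLeft_id f g := L.boxId_id g f
  whiskerLeft_comp f _ _ _ η θ := L.boxId_comp η θ f
  id_whiskerLeft η := L.boxId_one η
  comp_whiskerLeft f g _ _ η := L.boxId_box η g f
  id_whiskerRight f g := L.idBox_id g f
  comp_whiskerRight η θ i := L.idBox_comp i η θ
  whiskerRight_id η := L.one_idBox η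
  whiskerRight_comp η g h := L.box_idBox h g η
  whisker_assoc f _ _ η h := L.idBox_boxId h η f
  whisker_exchange η θ := L.exchange θ η
  pentagon f g h i := L.pentagon i h g f
  triangle f g := L.triangle g f

instance {L : ADBimodLaws} {A A' : ADBimod L} (f g : A ⟶ A') : AddCommGroup (f ⟶ g) :=
  HMor.addCommGroup f.raw g.raw

/-- The 2-morphisms of bidegree `p` in the bicategory of AD bimodules. -/
def ADBimod.homog {L : ADBimodLaws} {A A' : ADBimod L} {f g : A ⟶ A'} (p : ℤ × ℤ) :
    Set (f ⟶ g) :=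
  {η | (show HMor f.raw g.raw from η) ∈ HMor.homog f.raw g.raw p}

end AD

/-! ### Two-strand braid cobordisms -/

/-- Crossings of two strands. -/
inductive Crossing
  | pos
  | neg

def Crossing.inv : Crossing → Crossing
  | .pos => .neg
  | .neg => .pos

/-- Two-strand braid diagrams. -/
abbrev BWord : Type := List Crossing

/-- The generating two-strand movies: births and deaths of crossings, and both directions of
Reidemeister 2 moves. -/
inductive MovieGen
  | birth (c : Crossing)
  | death (c : Crossing)
  | create (c : Crossing)
  | annih (c : Crossing)

def MovieGen.src : MovieGen → BWord
  | birth _ => []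
  | death c => [c]
  | create _ => []
  | annih c => [c, c.inv]

def MovieGen.tgt : MovieGen → BWord
  | birth c => [c]
  | death _ => []
  | create c => [c, c.inv]
  | annih _ => []

def MovieGen.deg : MovieGen → ℤ × ℤ
  | birth .pos => (1, 0)
  | death .pos => (-1, 0)
  | birth .neg => (-1, 0)
  | death .neg => (1, 0)
  | create _ => 0
  | annih _ => 0

/-- A generating movie happening between two unchanged words. -/
@[ext] structure Event where
  left : BWord
  gen : MovieGen
  right : BWord

namespace Event

def src (e : Event) : BWord := e.left ++ (e.gen.src ++ e.right)

def tgt (e : Event) : BWord := e.left ++ (e.gen.tgt ++ e.right)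

/-- Place unchanged words on both sides. -/
def whisk (x y : BWord) (e : Event) : Event := ⟨x ++ e.left, e.gen, e.right ++ y⟩

end Event

/-- `es` is a movie from `w` to `w'`. -/
def IsMovie : BWord → List Event → BWord → Prop
  | w, [], w' => w = w'
  | w, e :: es, w' => w = e.src ∧ IsMovie e.tgt es w'

/-- The two-strand movie moves. -/
inductive BaseMove : List Event → List Event → Prop
  /-- distant events commute -/
  | exchange (g₁ g₂ : MovieGen) (x : BWord) : BaseMove
      [⟨[], g₁, x ++ g₂.src⟩, ⟨g₁.tgt ++ x, g₂, []⟩]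
      [⟨g₁.src ++ x, g₂, []⟩, ⟨[], g₁, x ++ g₂.tgt⟩]
  /-- creating a cancelling pair and removing it again -/
  | hoop (c : Crossing) : BaseMove [⟨[], .create c, []⟩, ⟨[], .annih c, []⟩] []
  /-- removing a cancelling pair and creating it again -/
  | saddle (c : Crossing) : BaseMove [⟨[], .annih c, []⟩, ⟨[], .create c, []⟩] []
  /-- creating a pair on the left of a crossing and removing the pair on its right -/
  | zigzagLeft (c : Crossing) : BaseMove [⟨[], .create c, [c]⟩, ⟨[c], .annih c.inv, []⟩] []
  /-- creating a pair on the right of a crossing and removing the pair on its left -/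
  | zigzagRight (c : Crossing) : BaseMove [⟨[c], .create c.inv, []⟩, ⟨[], .annih c, [c]⟩] []
  /-- death of a crossing of a newly created pair -/
  | createDeathLeft (c : Crossing) : BaseMove
      [⟨[], .create c, []⟩, ⟨[], .death c, [c.inv]⟩] [⟨[], .birth c.inv, []⟩]
  | createDeathRight (c : Crossing) : BaseMove
      [⟨[], .create c, []⟩, ⟨[c], .death c.inv, []⟩] [⟨[], .birth c, []⟩]
  /-- a newly born crossing cancelling with a given one -/
  | birthAnnihRight (c : Crossing) : BaseMove
      [⟨[c], .birth c.inv, []⟩, ⟨[], .annih c, []⟩] [⟨[], .death c, []⟩]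
  | birthAnnihLeft (c : Crossing) : BaseMove
      [⟨[], .birth c, [c.inv]⟩, ⟨[], .annih c, []⟩] [⟨[], .death c.inv, []⟩]
  /-- births and deaths slide past a crossing of the same sign -/
  | birthPast (c : Crossing) : BaseMove [⟨[], .birth c, [c]⟩] [⟨[c], .birth c, []⟩]
  | deathPast (c : Crossing) : BaseMove [⟨[], .death c, [c]⟩] [⟨[c], .death c, []⟩]

/-- Application of a movie move inside a movie. -/
inductive Move : List Event → List Event → Prop
  | mk (pre post : List Event) (x y : BWord) (a b : List Event) (h : BaseMove a b) :
      Move (pre ++ (a.map (Event.whisk x y) ++ post)) (pre ++ (b.map (Event.whisk x y) ++ post))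

/-- Movies from `w` to `w'`. -/
def Movie (w w' : BWord) : Type := {es : List Event // IsMovie w es w'}

/-- Movies modulo movie moves. -/
def MovieClass (w w' : BWord) : Type := Quot fun m m' : Movie w w' => Move m.1 m'.1

theorem IsMovie.append {w w' w'' : BWord} {es es' : List Event} (h : IsMovie w es w')
    (h' : IsMovie w' es' w'') : IsMovie w (es ++ es') w'' := by
  induction es generalizing w with
  | nil => cases h; exact h'
  | cons e es ih => exact ⟨h.1, ih h.2⟩

theorem IsMovie.whisk {w w' : BWord} {es : List Event} (h : IsMovie w es w') (x y : BWord) :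
    IsMovie (x ++ (w ++ y)) (es.map (Event.whisk x y)) (x ++ (w' ++ y)) := by
  induction es generalizing w with
  | nil => cases h; rfl
  | cons e es ih =>
    refine ⟨?_, ?_⟩
    · rw [h.1]; simp [Event.src, Event.whisk]
    · have := ih h.2
      simpa [Event.tgt, Event.whisk] using this

theorem IsMovie.whiskL {w w' : BWord} {es : List Event} (h : IsMovie w es w') (x : BWord) :
    IsMovie (x ++ w) (es.map (Event.whisk x [])) (x ++ w') := by
  simpa using h.whisk x []

theorem Event.whisk_whisk (x y x' y' : BWord) (e : Event) :
    (e.whisk x' y').whisk x y = e.whisk (x ++ x') (y' ++ y) := by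
  simp [Event.whisk]

theorem Event.whisk_nil (e : Event) : e.whisk [] [] = e := by
  simp [Event.whisk]

theorem Move.append_left (es : List Event) {a b : List Event} (h : Move a b) :
    Move (es ++ a) (es ++ b) := by
  cases h with
  | mk pre post x y a b h =>
    simpa only [List.append_assoc] using Move.mk (es ++ pre) post x y a b h

theorem Move.append_right (es : List Event) {a b : List Event} (h : Move a b) :
    Move (a ++ es) (b ++ es) := by
  cases h with
  | mk pre post x y a b h =>
    simpa only [List.append_assoc] using Move.mk pre (post ++ es) x y a b h

theorem Move.whisk (x y : BWord) {a b : List Event} (h : Move a b) :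
    Move (a.map (Event.whisk x y)) (b.map (Event.whisk x y)) := by
  cases h with
  | mk pre post x' y' a b h =>
    have := Move.mk (pre.map (Event.whisk x y)) (post.map (Event.whisk x y)) (x ++ x') (y' ++ y)
      a b h
    simpa only [List.map_append, List.map_map, Function.comp_def, Event.whisk_whisk] using this

namespace MovieClass

def mk {w w' : BWord} (es : List Event) (h : IsMovie w es w') : MovieClass w w' :=
  Quot.mk _ ⟨es, h⟩

theorem ind {w w' : BWord} {P : MovieClass w w' → Prop} (h : ∀ es hes, P (mk es hes))
    (m : MovieClass w w') : P m := by
  obtain ⟨⟨es, hes⟩⟩ := m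
  exact h es hes

theorem sound {w w' : BWord} {es es' : List Event} (h : IsMovie w es w') (h' : IsMovie w es' w')
    (hm : Move es es') : mk es h = mk es' h' :=
  Quot.sound hm

/-- Run one movie after another. -/
def comp {w w' w'' : BWord} : MovieClass w w' → MovieClass w' w'' → MovieClass w w'' :=
  Quot.map₂ (fun m n => ⟨m.1 ++ n.1, m.2.append n.2⟩)
    (fun m _ _ h => Move.append_left m.1 h) (fun _ _ n h => Move.append_right n.1 h)

/-- Place an unchanged word on the left. -/
def whiskL {w w' : BWord} (x : BWord) : MovieClass w w' → MovieClass (x ++ w) (x ++ w') :=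
  Quot.map (fun m => ⟨m.1.map (Event.whisk x []), m.2.whiskL x⟩)
    fun _ _ h => h.whisk x []

/-- Place an unchanged word on the right. -/
def whiskR {w w' : BWord} (y : BWord) : MovieClass w w' → MovieClass (w ++ y) (w' ++ y) :=
  Quot.map (fun m => ⟨m.1.map (Event.whisk [] y), m.2.whisk [] y⟩) fun _ _ h => h.whisk [] y

/-- The movie in which nothing happens. -/
def ofEq {w w' : BWord} (h : w = w') : MovieClass w w' := mk [] h

theorem comp_mk {w w' w'' : BWord} {es es' : List Event} (h : IsMovie w es w')
    (h' : IsMovie w' es' w'') : comp (mk es h) (mk es' h') = mk (es ++ es') (h.append h') := rfl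

theorem whiskL_mk {w w' : BWord} {es : List Event} (h : IsMovie w es w') (x : BWord) :
    whiskL x (mk es h) = mk (es.map (Event.whisk x [])) (h.whiskL x) := rfl

theorem whiskR_mk {w w' : BWord} {es : List Event} (h : IsMovie w es w') (x : BWord) :
    whiskR x (mk es h) = mk (es.map (Event.whisk [] x)) (h.whisk [] x) := rfl

theorem mk_eq {w w' : BWord} {es es' : List Event} (h : IsMovie w es w') (h' : IsMovie w es' w')
    (e : es = es') : mk es h = mk es' h' := by
  subst e; rfl

theorem comp_assoc {w₁ w₂ w₃ w₄ : BWord} (a : MovieClass w₁ w₂) (b : MovieClass w₂ w₃)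
    (c : MovieClass w₃ w₄) : comp (comp a b) c = comp a (comp b c) := by
  induction a using ind; induction b using ind; induction c using ind
  exact mk_eq _ _ (List.append_assoc _ _ _)

theorem ofEq_comp {w w' : BWord} (a : MovieClass w w') : comp (ofEq rfl) a = a := by
  induction a using ind
  rfl

theorem comp_ofEq {w w' : BWord} (a : MovieClass w w') : comp a (ofEq rfl) = a := by
  induction a using ind
  exact mk_eq _ _ (List.append_nil _)

theorem ofEq_comp_ofEq {w₁ w₂ w₃ : BWord} (h : w₁ = w₂) (h' : w₂ = w₃) :
    comp (ofEq h) (ofEq h') = ofEq (h.trans h') := rfl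

theorem whiskL_ofEq {w w' : BWord} (x : BWord) (h : w = w') :
    whiskL x (ofEq h) = ofEq (h ▸ rfl) := rfl

theorem whiskR_ofEq {w w' : BWord} (x : BWord) (h : w = w') :
    whiskR x (ofEq h) = ofEq (h ▸ rfl) := rfl

theorem whiskL_comp {w w' w'' : BWord} (x : BWord) (a : MovieClass w w') (b : MovieClass w' w'') :
    whiskL x (comp a b) = comp (whiskL x a) (whiskL x b) := by
  induction a using ind; induction b using ind
  exact mk_eq _ _ List.map_append

theorem whiskR_comp {w w' w'' : BWord} (x : BWord) (a : MovieClass w w') (b : MovieClass w' w'') :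
    whiskR x (comp a b) = comp (whiskR x a) (whiskR x b) := by
  induction a using ind; induction b using ind
  exact mk_eq _ _ List.map_append

theorem conj_nil_left {w w' : BWord} (a : MovieClass w w') :
    whiskL [] a = comp (ofEq rfl) (comp a (ofEq rfl)) := by
  induction a using ind with | h es hes =>
  refine mk_eq _ _ ?_
  simp only [List.nil_append, List.append_nil]
  exact (List.map_congr_left fun e _ => e.whisk_nil).trans (List.map_id' _)

theorem conj_nil_right {w w' : BWord} (a : MovieClass w w') :
    whiskR [] a =
      comp (ofEq (List.append_nil w)) (comp a (ofEq (List.append_nil w').symm)) := by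
  induction a using ind with | h es hes =>
  refine mk_eq _ _ ?_
  simp only [List.nil_append, List.append_nil]
  exact (List.map_congr_left fun e _ => e.whisk_nil).trans (List.map_id' _)

theorem whiskR_whiskR {w w' : BWord} (x y : BWord) (a : MovieClass w w') :
    whiskR (x ++ y) a = comp (ofEq (List.append_assoc w x y).symm)
      (comp (whiskR y (whiskR x a)) (ofEq (List.append_assoc w' x y))) := by
  induction a using ind with | h es hes =>
  refine mk_eq _ _ ?_
  simp [List.map_map, Function.comp_def, Event.whisk_whisk]

theorem whiskL_whiskL {w w' : BWord} (x y : BWord) (a : MovieClass w w') :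
    whiskL (x ++ y) a = comp (ofEq (List.append_assoc x y w))
      (comp (whiskL x (whiskL y a)) (ofEq (List.append_assoc x y w').symm)) := by
  induction a using ind with | h es hes =>
  refine mk_eq _ _ ?_
  simp [List.map_map, Function.comp_def, Event.whisk_whisk]

theorem whiskL_whiskR {w w' : BWord} (x y : BWord) (a : MovieClass w w') :
    whiskL x (whiskR y a) = comp (ofEq (List.append_assoc x w y).symm)
      (comp (whiskR y (whiskL x a)) (ofEq (List.append_assoc x w' y))) := by
  induction a using ind with | h es hes =>
  refine mk_eq _ _ ?_
  simp [List.map_map, Function.comp_def, Event.whisk_whisk]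

theorem exchange_one {v v' : BWord} (e : Event) (es : List Event) (h : IsMovie v es v') :
    comp (whiskL e.src (mk es h)) (whiskR v' (mk (w := e.src) [e] ⟨rfl, rfl⟩)) =
      comp (whiskR v (mk (w := e.src) [e] ⟨rfl, rfl⟩)) (whiskL e.tgt (mk es h)) := by
  induction es generalizing v with
  | nil =>
    cases h
    exact mk_eq _ _ rfl
  | cons f fs ih =>
    obtain ⟨rfl, h2⟩ := h
    have e1 : mk (f :: fs) (⟨rfl, h2⟩ : IsMovie f.src (f :: fs) v') =
        comp (mk (w := f.src) [f] ⟨rfl, rfl⟩) (mk fs h2) := rfl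
    rw [e1, whiskL_comp, whiskL_comp, comp_assoc, ih h2, ← comp_assoc, ← comp_assoc]
    congr 1
    have hm := Move.mk [] [] e.left f.right _ _
      (BaseMove.exchange e.gen f.gen (e.right ++ f.left))
    simp only [List.nil_append, List.append_nil] at hm
    refine (sound _ _ ?_).symm
    simpa [Event.whisk, Event.src, Event.tgt] using hm

theorem exchange {w w' v v' : BWord} (a : MovieClass w w') (b : MovieClass v v') :
    comp (whiskL w b) (whiskR v' a) = comp (whiskR v a) (whiskL w' b) := by
  induction a using ind with | h es hes =>
  induction b using ind with | h fs hfs =>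
  induction es generalizing w with
  | nil =>
    cases hes
    have e1 : mk (w := w') (w' := w') [] rfl = ofEq rfl := rfl
    rw [e1, whiskR_ofEq, whiskR_ofEq, ofEq_comp, comp_ofEq]
  | cons e es ih =>
    obtain ⟨rfl, h2⟩ := hes
    have e1 : mk (e :: es) (⟨rfl, h2⟩ : IsMovie e.src (e :: es) w') =
        comp (mk (w := e.src) [e] ⟨rfl, rfl⟩) (mk es h2) := rfl
    rw [e1, whiskR_comp, whiskR_comp, ← comp_assoc, exchange_one, comp_assoc, ih h2, comp_assoc]

end MovieClass

/-- The `F_2`-vector space spanned by movies from `w` to `w'` modulo movie moves. -/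
abbrev BrHom (w w' : BWord) : Type := MovieClass w w' →₀ ZMod 2

namespace BrHom

def of {w w' : BWord} (m : MovieClass w w') : BrHom w w' := Finsupp.single m 1

theorem ind {w w' : BWord} {P : BrHom w w' → Prop} (h0 : P 0)
    (hadd : ∀ f g, P f → P g → P (f + g)) (hof : ∀ m, P (of m)) (f : BrHom w w') : P f := by
  refine Finsupp.induction_linear f h0 (fun f g => hadd f g) fun m c => ?_
  have : c = 0 ∨ c = 1 := by revert c; decide
  rcases this with rfl | rfl
  · simpa using h0
  · exact hof m

/-- Bilinear extension of the composition of movies. -/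
def comp {w w' w'' : BWord} (f : BrHom w w') (g : BrHom w' w'') : BrHom w w'' :=
  f.sum fun m a => g.sum fun n b => Finsupp.single (m.comp n) (a * b)

/-- Linear extension of a map of movies. -/
def map {w w' v v' : BWord} (φ : MovieClass w w' → MovieClass v v') (f : BrHom w w') :
    BrHom v v' := Finsupp.mapDomain φ f

section lemmas

variable {w w' w'' w₁ w₂ w₃ w₄ v v' : BWord}

theorem zero_comp (g : BrHom w' w'') : comp (0 : BrHom w w') g = 0 := by simp [comp]

theorem comp_zero (f : BrHom w w') : comp f (0 : BrHom w' w'') = 0 := by simp [comp]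

theorem add_comp (f f' : BrHom w w') (g : BrHom w' w'') :
    comp (f + f') g = comp f g + comp f' g := by
  unfold comp
  refine Finsupp.sum_add_index' (fun m => by simp) fun m a b => ?_
  rw [← Finsupp.sum_add]
  simp [add_mul]

theorem comp_add (f : BrHom w w') (g g' : BrHom w' w'') :
    comp f (g + g') = comp f g + comp f g' := by
  unfold comp
  rw [← Finsupp.sum_add]
  refine Finsupp.sum_congr fun m _ => ?_
  exact Finsupp.sum_add_index' (fun n => by simp) fun n a b => by simp [mul_add]

theorem of_comp_of (m : MovieClass w w') (n : MovieClass w' w'') :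
    comp (of m) (of n) = of (m.comp n) := by
  unfold comp of
  rw [Finsupp.sum_single_index (by simp), Finsupp.sum_single_index (by simp), mul_one]

theorem map_zero (φ : MovieClass w w' → MovieClass v v') : map φ 0 = 0 := Finsupp.mapDomain_zero

theorem map_add (φ : MovieClass w w' → MovieClass v v') (f g : BrHom w w') :
    map φ (f + g) = map φ f + map φ g := Finsupp.mapDomain_add

theorem map_of (φ : MovieClass w w' → MovieClass v v') (m : MovieClass w w') :
    map φ (of m) = of (φ m) := Finsupp.mapDomain_single

theorem comp_assoc (f : BrHom w₁ w₂) (g : BrHom w₂ w₃) (h : BrHom w₃ w₄) :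
    comp (comp f g) h = comp f (comp g h) := by
  induction f using ind with
  | h0 => simp only [zero_comp]
  | hadd f f' hf hf' => simp only [add_comp, hf, hf']
  | hof a =>
    induction g using ind with
    | h0 => simp only [zero_comp, comp_zero]
    | hadd f f' hf hf' => simp only [add_comp, comp_add, hf, hf']
    | hof b =>
      induction h using ind with
      | h0 => simp only [comp_zero]
      | hadd f f' hf hf' => simp only [comp_add, hf, hf']
      | hof c => simp only [of_comp_of, MovieClass.comp_assoc]

/-- The identification of equal words. -/
def ofEq (h : w = w') : BrHom w w' := of (MovieClass.ofEq h)

theorem ofEq_comp (f : BrHom w w') : comp (ofEq rfl) f = f := by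
  induction f using ind with
  | h0 => simp only [comp_zero]
  | hadd f f' hf hf' => simp only [comp_add, hf, hf']
  | hof c => simp only [ofEq, of_comp_of, MovieClass.ofEq_comp]

theorem comp_ofEq (f : BrHom w w') : comp f (ofEq rfl) = f := by
  induction f using ind with
  | h0 => simp only [zero_comp]
  | hadd f f' hf hf' => simp only [add_comp, hf, hf']
  | hof c => simp only [ofEq, of_comp_of, MovieClass.comp_ofEq]

theorem ofEq_comp_ofEq (h : w = w') (h' : w' = w'') :
    comp (ofEq h) (ofEq h') = ofEq (h.trans h') := of_comp_of _ _

theorem map_comp (φ : MovieClass w w' → MovieClass v v')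
    {v'' : BWord} (ψ : MovieClass w' w'' → MovieClass v' v'')
    (χ : MovieClass w w'' → MovieClass v v'') (h : ∀ a b, χ (a.comp b) = (φ a).comp (ψ b))
    (f : BrHom w w') (g : BrHom w' w'') : map χ (comp f g) = comp (map φ f) (map ψ g) := by
  induction f using ind with
  | h0 => simp only [zero_comp, map_zero]
  | hadd f f' hf hf' => simp only [add_comp, map_add, hf, hf']
  | hof a =>
    induction g using ind with
    | h0 => simp only [comp_zero, map_zero]
    | hadd f f' hf hf' => simp only [comp_add, map_add, hf, hf']
    | hof b => simp only [of_comp_of, map_of, h]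

theorem map_conj (φ : MovieClass w w' → MovieClass v v') (ψ : MovieClass w w' → MovieClass w₁ w₂)
    (h : v = w₁) (h' : w₂ = v')
    (H : ∀ a, φ a = (MovieClass.ofEq h).comp ((ψ a).comp (MovieClass.ofEq h')))
    (f : BrHom w w') : map φ f = comp (ofEq h) (comp (map ψ f) (ofEq h')) := by
  induction f using ind with
  | h0 => simp only [comp_zero, zero_comp, map_zero]
  | hadd f f' hf hf' => simp only [comp_add, add_comp, map_add, hf, hf']
  | hof a => simp only [ofEq, of_comp_of, map_of, H]

theorem map_map {w₁ w₂ : BWord} (φ : MovieClass w w' → MovieClass v v')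
    (ψ : MovieClass v v' → MovieClass w₁ w₂) (f : BrHom w w') :
    map ψ (map φ f) = map (fun a => ψ (φ a)) f := (Finsupp.mapDomain_comp).symm

theorem map_id (f : BrHom w w') : map (fun a => a) f = f := Finsupp.mapDomain_id

theorem exchange (f : BrHom w w') (g : BrHom v v') :
    comp (map (MovieClass.whiskL w) g) (map (MovieClass.whiskR v') f) =
      comp (map (MovieClass.whiskR v) f) (map (MovieClass.whiskL w') g) := by
  induction f using ind with
  | h0 => simp only [comp_zero, zero_comp, map_zero]
  | hadd f f' hf hf' => simp only [comp_add, add_comp, map_add, hf, hf']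
  | hof a =>
    induction g using ind with
    | h0 => simp only [comp_zero, zero_comp, map_zero]
    | hadd f f' hf hf' => simp only [comp_add, add_comp, map_add, hf, hf']
    | hof b => simp only [of_comp_of, map_of, MovieClass.exchange]

end lemmas

/-- The combinations of movies of bidegree `p`. -/
def homog (w w' : BWord) (p : ℤ × ℤ) : AddSubgroup (BrHom w w') :=
  AddSubgroup.closure
    {f | ∃ es hes, (es.map fun e : Event => e.gen.deg).sum = p ∧ f = of (MovieClass.mk es hes)}

end BrHom

/-- The graded monoidal category of two-strand braid cobordisms, as a bicategory with one object.
1-morphisms are braid words, the composite `f ≫ g` being the word `g ++ f`; 2-morphisms are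
combinations of movies modulo movie moves. -/
inductive BrCob
  | star

instance : CategoryStruct BrCob where
  Hom _ _ := BWord
  id _ := []
  comp f g := (g ++ f : List Crossing)

instance (a b : BrCob) : Category (a ⟶ b) where
  Hom w w' := BrHom w w'
  id w := BrHom.ofEq (rfl : (w : BWord) = w)
  comp f g := BrHom.comp f g
  id_comp f := BrHom.ofEq_comp f
  comp_id f := BrHom.comp_ofEq f
  assoc f g h := BrHom.comp_assoc f g h

/-- The 2-isomorphism between equal words. -/
def BrCob.isoOfEq {a b : BrCob} {f g : a ⟶ b} (h : (f : BWord) = g) : f ≅ g where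
  hom := BrHom.ofEq h
  inv := BrHom.ofEq h.symm
  hom_inv_id := BrHom.ofEq_comp_ofEq h h.symm
  inv_hom_id := BrHom.ofEq_comp_ofEq h.symm h

instance : Bicategory BrCob where
  homCategory _ _ := inferInstance
  whiskerLeft f _ _ η := BrHom.map (MovieClass.whiskR f) η
  whiskerRight η h := BrHom.map (MovieClass.whiskL h) η
  associator f g h := BrCob.isoOfEq (List.append_assoc (h : BWord) g f).symm
  leftUnitor f := BrCob.isoOfEq (List.append_nil (f : BWord))
  rightUnitor _ := BrCob.isoOfEq rfl
  whiskerLeft_id _ _ := BrHom.map_of _ _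
  whiskerLeft_comp f _ _ _ η θ := BrHom.map_comp _ _ _ (MovieClass.whiskR_comp f) η θ
  id_whiskerLeft {a b f g} η :=
    (BrHom.map_conj _ (fun x => x) (List.append_nil (f : BWord)) (List.append_nil (g : BWord)).symm
      MovieClass.conj_nil_right η).trans (by rw [BrHom.map_id]; rfl)
  comp_whiskerLeft {a b c d} f g {h h'} η :=
    (BrHom.map_conj _ _ _ _ (MovieClass.whiskR_whiskR g f) η).trans (by rw [← BrHom.map_map]; rfl)
  id_whiskerRight _ _ := BrHom.map_of _ _
  comp_whiskerRight η θ i := BrHom.map_comp _ _ _ (MovieClass.whiskL_comp i) η θ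
  whiskerRight_id {a b f g} η :=
    (BrHom.map_conj _ (fun x => x) rfl rfl MovieClass.conj_nil_left η).trans
      (by rw [BrHom.map_id]; rfl)
  whiskerRight_comp η g h :=
    (BrHom.map_conj _ _ _ _ (MovieClass.whiskL_whiskL h g) η).trans (by rw [← BrHom.map_map]; rfl)
  whisker_assoc f _ _ η h :=
    ((BrHom.map_map _ _ _).trans (BrHom.map_conj _ _ _ _ (MovieClass.whiskL_whiskR h f) η)).trans
      (by rw [← BrHom.map_map]; rfl)
  whisker_exchange η θ := BrHom.exchange θ η |>.symm
  pentagon f g h i := by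
    change BrHom.comp (BrHom.map _ (BrHom.ofEq _)) (BrHom.comp (BrHom.ofEq _)
      (BrHom.map _ (BrHom.ofEq _))) = BrHom.comp (BrHom.ofEq _) (BrHom.ofEq _)
    simp only [BrHom.ofEq, BrHom.map_of, BrHom.of_comp_of, MovieClass.whiskL_ofEq,
      MovieClass.whiskR_ofEq, MovieClass.ofEq_comp_ofEq]
  triangle f g := by
    change BrHom.comp (BrHom.ofEq _) (BrHom.map _ (BrHom.ofEq _)) = BrHom.map _ (BrHom.ofEq _)
    simp only [BrHom.ofEq, BrHom.map_of, BrHom.of_comp_of, MovieClass.whiskL_ofEq,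
      MovieClass.whiskR_ofEq, MovieClass.ofEq_comp_ofEq]

instance {a b : BrCob} (f g : a ⟶ b) : AddCommGroup (f ⟶ g) :=
  inferInstanceAs (AddCommGroup (BrHom f g))

/-- The 2-morphisms of bidegree `p` between braid words. -/
def BrCob.homog {a b : BrCob} {f g : a ⟶ b} (p : ℤ × ℤ) : Set (f ⟶ g) :=
  {η | (show BrHom f g from η) ∈ BrHom.homog f g p}

/-! ### The dg categories of two strands -/

/-- The vectors whose nonzero coordinates all have degree `p`. -/
def coordGr {V ι : Type} [AddCommGroup V] (c : V →+ (ι → ZMod 2)) (deg : ι → ℤ × ℤ)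
    (p : ℤ × ℤ) : AddSubgroup V where
  carrier := {v | ∀ i, c v i ≠ 0 → deg i = p}
  zero_mem' := by intro i h; simp at h
  add_mem' := by
    intro v w hv hw i h
    by_cases h1 : c v i = 0
    · refine hw i fun h2 => h ?_
      simp [h1, h2]
    · exact hv i h1
  neg_mem' := by
    intro v hv i h
    refine hv i fun h2 => h ?_
    simp [h2]

theorem coordGr_internal {V ι : Type} [AddCommGroup V] (c : V →+ (ι → ZMod 2))
    (deg : ι → ℤ × ℤ) (hc : Function.Injective c)
    (hs : ∀ S : AddSubgroup V, (∀ p, coordGr c deg p ≤ S) → S = ⊤) :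
    DirectSum.IsInternal (coordGr c deg) := by
  constructor
  · have hind : iSupIndep (coordGr c deg) := by
      intro p
      rw [disjoint_iff, eq_bot_iff]
      intro v hv
      obtain ⟨h1, h2⟩ := AddSubgroup.mem_inf.mp hv
      let T : AddSubgroup V :=
        { carrier := {v | ∀ i, deg i = p → c v i = 0}
          zero_mem' := by intro i _; simp
          add_mem' := by intro v w hv hw i h; simp [hv i h, hw i h]
          neg_mem' := by intro v hv i h; simp [hv i h] }
      have hT : (⨆ j, ⨆ (_ : j ≠ p), coordGr c deg j) ≤ T := by
        refine iSup_le fun j => iSup_le fun hj v hv i hi => ?_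
        by_contra h
        exact hj ((hv i h).symm.trans hi)
      have h3 : c v = 0 := by
        funext i
        by_contra h
        exact h (hT h2 i (h1 i h))
      exact AddSubgroup.mem_bot.mpr (hc (h3.trans (map_zero c).symm))
    exact hind.dfinsuppSumAddHom_injective
  · have h := hs (DirectSum.coeAddMonoidHom (coordGr c deg)).range fun p v hv =>
      ⟨DirectSum.of (fun p => coordGr c deg p) p ⟨v, hv⟩, by simp⟩
    exact AddMonoidHom.range_eq_top.mp h

open Polynomial in
/-- The algebra of `A_{1,1}`: a copy of `F_2` on the object `uu`, `F_2[U₁]` on `ou`, `F_2[U₂]` on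
`uo`, `F_2[U₁, U₂]` on `oo`, and one further basis element `λ : ou → uo` with
`λ U₁ = 0 = U₂ λ`. -/
@[ext] structure Alg11 where
  uu : ZMod 2
  ou : (ZMod 2)[X]
  uo : (ZMod 2)[X]
  lam : ZMod 2
  oo : MvPolynomial (Fin 2) (ZMod 2)

namespace Alg11

instance : Zero Alg11 := ⟨⟨0, 0, 0, 0, 0⟩⟩
instance : One Alg11 := ⟨⟨1, 1, 1, 0, 1⟩⟩
instance : Add Alg11 := ⟨fun a b => ⟨a.uu + b.uu, a.ou + b.ou, a.uo + b.uo, a.lam + b.lam,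
  a.oo + b.oo⟩⟩
instance : Neg Alg11 := ⟨fun a => ⟨-a.uu, -a.ou, -a.uo, -a.lam, -a.oo⟩⟩
instance : Mul Alg11 := ⟨fun a b => ⟨a.uu * b.uu, a.ou * b.ou, a.uo * b.uo,
  a.uo.coeff 0 * b.lam + a.lam * b.ou.coeff 0, a.oo * b.oo⟩⟩

@[simp] theorem zero_uu : (0 : Alg11).uu = 0 := rfl
@[simp] theorem zero_ou : (0 : Alg11).ou = 0 := rfl
@[simp] theorem zero_uo : (0 : Alg11).uo = 0 := rfl
@[simp] theorem zero_lam : (0 : Alg11).lam = 0 := rfl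
@[simp] theorem zero_oo : (0 : Alg11).oo = 0 := rfl
@[simp] theorem one_uu : (1 : Alg11).uu = 1 := rfl
@[simp] theorem one_ou : (1 : Alg11).ou = 1 := rfl
@[simp] theorem one_uo : (1 : Alg11).uo = 1 := rfl
@[simp] theorem one_lam : (1 : Alg11).lam = 0 := rfl
@[simp] theorem one_oo : (1 : Alg11).oo = 1 := rfl
@[simp] theorem add_uu (a b : Alg11) : (a + b).uu = a.uu + b.uu := rfl
@[simp] theorem add_ou (a b : Alg11) : (a + b).ou = a.ou + b.ou := rfl
@[simp] theorem add_uo (a b : Alg11) : (a + b).uo = a.uo + b.uo := rfl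
@[simp] theorem add_lam (a b : Alg11) : (a + b).lam = a.lam + b.lam := rfl
@[simp] theorem add_oo (a b : Alg11) : (a + b).oo = a.oo + b.oo := rfl
@[simp] theorem neg_uu (a : Alg11) : (-a).uu = -a.uu := rfl
@[simp] theorem neg_ou (a : Alg11) : (-a).ou = -a.ou := rfl
@[simp] theorem neg_uo (a : Alg11) : (-a).uo = -a.uo := rfl
@[simp] theorem neg_lam (a : Alg11) : (-a).lam = -a.lam := rfl
@[simp] theorem neg_oo (a : Alg11) : (-a).oo = -a.oo := rfl
@[simp] theorem mul_uu (a b : Alg11) : (a * b).uu = a.uu * b.uu := rfl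
@[simp] theorem mul_ou (a b : Alg11) : (a * b).ou = a.ou * b.ou := rfl
@[simp] theorem mul_uo (a b : Alg11) : (a * b).uo = a.uo * b.uo := rfl
@[simp] theorem mul_lam (a b : Alg11) :
    (a * b).lam = a.uo.coeff 0 * b.lam + a.lam * b.ou.coeff 0 := rfl
@[simp] theorem mul_oo (a b : Alg11) : (a * b).oo = a.oo * b.oo := rfl

instance : Ring Alg11 where
  add_assoc a b c := by ext1 <;> simp [add_assoc]
  zero_add a := by ext1 <;> simp
  add_zero a := by ext1 <;> simp
  add_comm a b := by ext1 <;> simp [add_comm]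
  neg_add_cancel a := by ext1 <;> exact neg_add_cancel _
  left_distrib a b c := by ext1 <;> simp <;> ring
  right_distrib a b c := by ext1 <;> simp <;> ring
  zero_mul a := by ext1 <;> simp
  mul_zero a := by ext1 <;> simp
  mul_assoc a b c := by ext1 <;> simp [Polynomial.mul_coeff_zero] <;> ring
  one_mul a := by ext1 <;> simp
  mul_one a := by ext1 <;> simp
  nsmul := nsmulRec
  zsmul := zsmulRec

/-- The monomial basis. -/
inductive Mono
  | uu
  | ou (n : ℕ)
  | uo (n : ℕ)
  | lam
  | oo (m : Fin 2 →₀ ℕ)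

/-- The bidegrees: each `U_i` has bidegree `(-2, 2)`, and `λ` has bidegree `(1, 0)`. -/
def Mono.deg : Mono → ℤ × ℤ
  | uu => 0
  | ou n => (-2 * n, 2 * n)
  | uo n => (-2 * n, 2 * n)
  | lam => (1, 0)
  | oo m => (-2 * (m 0 + m 1), 2 * (m 0 + m 1))

/-- Coordinates in the monomial basis. -/
def coord : Alg11 →+ (Mono → ZMod 2) where
  toFun a
    | .uu => a.uu
    | .ou n => a.ou.coeff n
    | .uo n => a.uo.coeff n
    | .lam => a.lam
    | .oo m => a.oo.coeff m
  map_zero' := by funext i; cases i <;> simp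
  map_add' a b := by funext i; cases i <;> simp

theorem coord_injective : Function.Injective coord := by
  intro a b h
  ext n
  · exact congrFun h .uu
  · exact congrArg (·) (congrFun h (.ou n))
  · exact congrFun h (.uo n)
  · exact congrFun h .lam
  · exact congrFun h (.oo n)

/-- The objects of `A_{1,1}`. -/
inductive Ob
  | uu
  | ou
  | uo
  | oo

instance : Fintype Ob := ⟨{.uu, .ou, .uo, .oo}, by intro x; cases x <;> simp⟩

def idem : Ob → Alg11
  | .uu => ⟨1, 0, 0, 0, 0⟩
  | .ou => ⟨0, 1, 0, 0, 0⟩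
  | .uo => ⟨0, 0, 1, 0, 0⟩
  | .oo => ⟨0, 0, 0, 0, 1⟩

def aug : Alg11 →+* (Ob → ZMod 2) where
  toFun a
    | .uu => a.uu
    | .ou => a.ou.coeff 0
    | .uo => a.uo.coeff 0
    | .oo => MvPolynomial.constantCoeff a.oo
  map_zero' := by funext i; cases i <;> simp
  map_one' := by funext i; cases i <;> simp
  map_add' a b := by funext i; cases i <;> simp
  map_mul' a b := by funext i; cases i <;> simp [Polynomial.mul_coeff_zero]

theorem gr_top (S : AddSubgroup Alg11) (hS : ∀ p, coordGr coord Mono.deg p ≤ S) : S = ⊤ := by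
  have h1 : ∀ c : ZMod 2, (⟨c, 0, 0, 0, 0⟩ : Alg11) ∈ S := fun c => hS (Mono.deg .uu) (by
    rintro (_ | n | n | _ | m) h <;> simp_all [coord])
  have h2 : ∀ c : ZMod 2, (⟨0, 0, 0, c, 0⟩ : Alg11) ∈ S := fun c => hS (Mono.deg .lam) (by
    rintro (_ | n | n | _ | m) h <;> simp_all [coord])
  have h3 : ∀ f, (⟨0, f, 0, 0, 0⟩ : Alg11) ∈ S := by
    intro f
    induction f using Polynomial.induction_on' with
    | add f g hf hg =>
      have := S.add_mem hf hg
      convert this using 1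
      ext1 <;> simp
    | monomial k c =>
      refine hS (Mono.deg (.ou k)) ?_
      rintro (_ | n | n | _ | m) h <;> simp_all [coord, Polynomial.coeff_monomial]
  have h4 : ∀ f, (⟨0, 0, f, 0, 0⟩ : Alg11) ∈ S := by
    intro f
    induction f using Polynomial.induction_on' with
    | add f g hf hg =>
      have := S.add_mem hf hg
      convert this using 1
      ext1 <;> simp
    | monomial k c =>
      refine hS (Mono.deg (.uo k)) ?_
      rintro (_ | n | n | _ | m) h <;> simp_all [coord, Polynomial.coeff_monomial]
  have h5 : ∀ f, (⟨0, 0, 0, 0, f⟩ : Alg11) ∈ S := by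
    intro f
    induction f using MvPolynomial.induction_on' with
    | add f g hf hg =>
      have := S.add_mem hf hg
      convert this using 1
      ext1 <;> simp
    | monomial k c =>
      refine hS (Mono.deg (.oo k)) ?_
      rintro (_ | n | n | _ | m) h <;> simp_all [coord, MvPolynomial.coeff_monomial]
  rw [eq_top_iff]
  rintro ⟨a, b, c, e, f⟩ -
  have := S.add_mem (S.add_mem (S.add_mem (S.add_mem (h1 a) (h3 b)) (h4 c)) (h2 e)) (h5 f)
  convert this using 1
  ext1 <;> simp

theorem coeff_mul_ne {f g : Polynomial (ZMod 2)} {n : ℕ} (h : (f * g).coeff n ≠ 0) :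
    ∃ i j, i + j = n ∧ f.coeff i ≠ 0 ∧ g.coeff j ≠ 0 := by
  rw [Polynomial.coeff_mul] at h
  obtain ⟨⟨i, j⟩, hij, h⟩ := Finset.exists_ne_zero_of_sum_ne_zero h
  exact ⟨i, j, by simpa using hij, left_ne_zero_of_mul h, right_ne_zero_of_mul h⟩

theorem mvcoeff_mul_ne {f g : MvPolynomial (Fin 2) (ZMod 2)} {n : Fin 2 →₀ ℕ}
    (h : (f * g).coeff n ≠ 0) : ∃ i j, i + j = n ∧ f.coeff i ≠ 0 ∧ g.coeff j ≠ 0 := by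
  rw [MvPolynomial.coeff_mul] at h
  obtain ⟨⟨i, j⟩, hij, h⟩ := Finset.exists_ne_zero_of_sum_ne_zero h
  exact ⟨i, j, by simpa using hij, left_ne_zero_of_mul h, right_ne_zero_of_mul h⟩

theorem gr_mul (p q : ℤ × ℤ) (a b : Alg11) (ha : a ∈ coordGr coord Mono.deg p)
    (hb : b ∈ coordGr coord Mono.deg q) : a * b ∈ coordGr coord Mono.deg (p + q) := by
  rintro (_ | n | n | _ | m) h
  · rw [← ha .uu (left_ne_zero_of_mul h), ← hb .uu (right_ne_zero_of_mul h)]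
    simp [Mono.deg]
  · obtain ⟨i, j, rfl, hi, hj⟩ := coeff_mul_ne h
    rw [← ha (.ou i) hi, ← hb (.ou j) hj]
    simp [Mono.deg]; ring_nf; trivial
  · obtain ⟨i, j, rfl, hi, hj⟩ := coeff_mul_ne h
    rw [← ha (.uo i) hi, ← hb (.uo j) hj]
    simp [Mono.deg]; ring_nf; trivial
  · change a.uo.coeff 0 * b.lam + a.lam * b.ou.coeff 0 ≠ 0 at h
    by_cases h1 : a.uo.coeff 0 * b.lam = 0
    · rw [h1, zero_add] at h
      rw [← ha .lam (left_ne_zero_of_mul h), ← hb (.ou 0) (right_ne_zero_of_mul h)]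
      simp [Mono.deg]
    · rw [← ha (.uo 0) (left_ne_zero_of_mul h1), ← hb .lam (right_ne_zero_of_mul h1)]
      simp [Mono.deg]
  · obtain ⟨i, j, rfl, hi, hj⟩ := mvcoeff_mul_ne h
    rw [← ha (.oo i) hi, ← hb (.oo j) hj]
    simp [Mono.deg]; ring_nf; trivial

end Alg11

/-- The dg category `A_{1,1}`, with zero differential. -/
def A11 : DGCat where
  Obj := Alg11.Ob
  Mor := Alg11
  one_add_one := by
    ext1 <;> simp [CharTwo.add_self_eq_zero]
  idem := Alg11.idem
  idem_mul_self s := by cases s <;> ext1 <;> simp [Alg11.idem]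
  idem_mul_of_ne s t h := by
    cases s <;> cases t <;> first | exact absurd rfl h | ext1 <;> simp [Alg11.idem]
  sum_idem := by
    change ∑ s ∈ ({.uu, .ou, .uo, .oo} : Finset Alg11.Ob), Alg11.idem s = 1
    rw [Finset.sum_insert (by simp), Finset.sum_insert (by simp), Finset.sum_insert (by simp),
      Finset.sum_singleton]
    ext1 <;> simp [Alg11.idem]
  gr := coordGr Alg11.coord Alg11.Mono.deg
  gr_internal := coordGr_internal _ _ Alg11.coord_injective Alg11.gr_top
  gr_mul := Alg11.gr_mul
  idem_mem s := by
    cases s <;> rintro (_ | n | n | _ | m) h <;>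
      simp_all [Alg11.coord, Alg11.idem, Alg11.Mono.deg, Polynomial.coeff_one,
        MvPolynomial.coeff_one]
    subst h; simp
  d := 0
  d_mem _ _ _ := zero_mem _
  d_d _ := rfl
  d_mul a b := by simp
  d_idem _ := rfl
  aug := Alg11.aug
  aug_idem s t := by cases s <;> cases t <;> simp [Alg11.aug, Alg11.idem]
  aug_d _ := map_zero _
  aug_gr p a hp ha := by
    funext s
    by_contra h
    cases s
    · exact hp (ha .uu h).symm
    · exact hp (ha (.ou 0) h).symm
    · exact hp (ha (.uo 0) h).symm
    · exact hp (ha (.oo 0) h).symm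

/-- The algebra of `A_2`: `F_2[e₁]` on the object `u` and `F_2[e₁, e₂]` on the object `o`. -/
abbrev Alg2 : Type := Polynomial (ZMod 2) × MvPolynomial (Fin 2) (ZMod 2)

namespace Alg2

/-- The monomial basis. -/
inductive Mono
  | u (n : ℕ)
  | o (m : Fin 2 →₀ ℕ)

/-- The bidegrees: `e_i` has bidegree `(-2 i, 2 i)`. -/
def Mono.deg : Mono → ℤ × ℤ
  | u n => (-2 * n, 2 * n)
  | o m => (-2 * (m 0 + 2 * m 1), 2 * (m 0 + 2 * m 1))

/-- Coordinates in the monomial basis. -/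
def coord : Alg2 →+ (Mono → ZMod 2) where
  toFun a
    | .u n => a.1.coeff n
    | .o m => a.2.coeff m
  map_zero' := by funext i; cases i <;> simp
  map_add' a b := by funext i; cases i <;> simp

theorem coord_injective : Function.Injective coord := by
  intro a b h
  refine Prod.ext (Polynomial.ext fun n => ?_) (MvPolynomial.ext _ _ fun m => ?_)
  · exact congrFun h (.u n)
  · exact congrFun h (.o m)

/-- The objects of `A_2`. -/
inductive Ob
  | u
  | o

instance : Fintype Ob := ⟨{.u, .o}, by intro x; cases x <;> simp⟩

def idem : Ob → Alg2
  | .u => (1, 0)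
  | .o => (0, 1)

def aug : Alg2 →+* (Ob → ZMod 2) where
  toFun a
    | .u => a.1.coeff 0
    | .o => MvPolynomial.constantCoeff a.2
  map_zero' := by funext i; cases i <;> simp
  map_one' := by funext i; cases i <;> simp
  map_add' a b := by funext i; cases i <;> simp
  map_mul' a b := by funext i; cases i <;> simp [Polynomial.mul_coeff_zero]

theorem gr_top (S : AddSubgroup Alg2) (hS : ∀ p, coordGr coord Mono.deg p ≤ S) : S = ⊤ := by
  have h3 : ∀ f, ((f, 0) : Alg2) ∈ S := by
    intro f
    induction f using Polynomial.induction_on' with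
    | add f g hf hg => simpa using S.add_mem hf hg
    | monomial k c =>
      refine hS (Mono.deg (.u k)) ?_
      rintro (n | m) h <;> simp_all [coord, Polynomial.coeff_monomial]
  have h5 : ∀ f, ((0, f) : Alg2) ∈ S := by
    intro f
    induction f using MvPolynomial.induction_on' with
    | add f g hf hg => simpa using S.add_mem hf hg
    | monomial k c =>
      refine hS (Mono.deg (.o k)) ?_
      rintro (n | m) h <;> simp_all [coord, MvPolynomial.coeff_monomial]
  rw [eq_top_iff]
  rintro ⟨a, b⟩ -
  simpa using S.add_mem (h3 a) (h5 b)

theorem gr_mul (p q : ℤ × ℤ) (a b : Alg2) (ha : a ∈ coordGr coord Mono.deg p)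
    (hb : b ∈ coordGr coord Mono.deg q) : a * b ∈ coordGr coord Mono.deg (p + q) := by
  rintro (n | m) h
  · obtain ⟨i, j, rfl, hi, hj⟩ := Alg11.coeff_mul_ne h
    rw [← ha (.u i) hi, ← hb (.u j) hj]
    simp [Mono.deg]; ring_nf; trivial
  · obtain ⟨i, j, rfl, hi, hj⟩ := Alg11.mvcoeff_mul_ne h
    rw [← ha (.o i) hi, ← hb (.o j) hj]
    simp [Mono.deg]; ring_nf; trivial

end Alg2

/-- The dg category `A_2`, with zero differential. -/
def A2 : DGCat where
  Obj := Alg2.Ob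
  Mor := Alg2
  one_add_one := by
    ext1 <;> simp [CharTwo.add_self_eq_zero]
  idem := Alg2.idem
  idem_mul_self s := by cases s <;> simp [Alg2.idem]
  idem_mul_of_ne s t h := by cases s <;> cases t <;> simp_all [Alg2.idem]
  sum_idem := by
    change ∑ s ∈ ({.u, .o} : Finset Alg2.Ob), Alg2.idem s = 1
    rw [Finset.sum_insert (by simp), Finset.sum_singleton]
    simp [Alg2.idem, Prod.ext_iff]
  gr := coordGr Alg2.coord Alg2.Mono.deg
  gr_internal := coordGr_internal _ _ Alg2.coord_injective Alg2.gr_top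
  gr_mul := Alg2.gr_mul
  idem_mem s := by
    cases s <;> rintro (n | m) h <;>
      simp_all [Alg2.coord, Alg2.idem, Alg2.Mono.deg, Polynomial.coeff_one,
        MvPolynomial.coeff_one]
    subst h; simp
  d := 0
  d_mem _ _ _ := zero_mem _
  d_d _ := rfl
  d_mul a b := by simp
  d_idem _ := rfl
  aug := Alg2.aug
  aug_idem s t := by cases s <;> cases t <;> simp [Alg2.aug, Alg2.idem]
  aug_d _ := map_zero _
  aug_gr p a hp ha := by
    funext s
    by_contra h
    cases s
    · exact hp (ha (.u 0) h).symm
    · exact hp (ha (.o 0) h).symm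

/-! ### The AD bimodules of trivalent vertices and of a singular crossing -/

/-- Basis of the bimodule `Λ`. -/
inductive LamG
  | X
  | Y
  | Z

instance : Fintype LamG := ⟨{.X, .Y, .Z}, by intro x; cases x <;> simp⟩

/-- The AD bimodule over `(A_2, A_{1,1})` of one trivalent vertex. -/
def Lam : ADRaw A2 A11 where
  G := LamG
  l
    | .X => Alg2.Ob.u
    | .Y => Alg2.Ob.u
    | .Z => Alg2.Ob.o
  r
    | .X => Alg11.Ob.ou
    | .Y => Alg11.Ob.uo
    | .Z => Alg11.Ob.oo
  deg
    | .X => (1, -1)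
    | .Y => 0
    | .Z => 0
  δ
    | .Y, .X, [] => (⟨0, 0, 0, 1, 0⟩ : Alg11)
    | .X, .X, [a] => (⟨0, (a : Alg2).1, 0, 0, 0⟩ : Alg11)
    | .Y, .Y, [a] => (⟨0, 0, (a : Alg2).1, 0, 0⟩ : Alg11)
    | .Z, .Z, [a] => (⟨0, 0, 0, 0, MvPolynomial.aeval
        ![MvPolynomial.X 0 + MvPolynomial.X 1, MvPolynomial.X 0 * MvPolynomial.X 1]
        (a : Alg2).2⟩ : Alg11)
    | _, _, _ => (0 : Alg11)

/-- Basis of the bimodule `Y`; `W` stands for `w₁ C`. -/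
inductive YG
  | A
  | B
  | W
  | C

instance : Fintype YG := ⟨{.A, .B, .W, .C}, by intro x; cases x <;> simp⟩

/-- The matrix of `U₁` on the two generators `W`, `C`, over `F_2[e₁, e₂]`. -/
def matU1 : Matrix (Fin 2) (Fin 2) (MvPolynomial (Fin 2) (ZMod 2)) :=
  !![MvPolynomial.X 0, 1; MvPolynomial.X 1, 0]

/-- The matrix of `U₂`. -/
def matU2 : Matrix (Fin 2) (Fin 2) (MvPolynomial (Fin 2) (ZMod 2)) :=
  !![0, 1; MvPolynomial.X 1, MvPolynomial.X 0]

/-- The matrix of a polynomial in `U₁`, `U₂`. -/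
def matOf (f : MvPolynomial (Fin 2) (ZMod 2)) :
    Matrix (Fin 2) (Fin 2) (MvPolynomial (Fin 2) (ZMod 2)) :=
  ∑ m ∈ f.support, f.coeff m • (matU1 ^ m 0 * matU2 ^ m 1)

/-- The AD bimodule over `(A_{1,1}, A_2)` of the other trivalent vertex. -/
def Ybim : ADRaw A11 A2 where
  G := YG
  l
    | .A => Alg11.Ob.ou
    | .B => Alg11.Ob.uo
    | .W => Alg11.Ob.oo
    | .C => Alg11.Ob.oo
  r
    | .A => Alg2.Ob.u
    | .B => Alg2.Ob.u
    | .W => Alg2.Ob.o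
    | .C => Alg2.Ob.o
  deg
    | .A => (0, -1)
    | .B => (-1, 0)
    | .W => (1, -2)
    | .C => (-1, 0)
  δ
    | .A, .A, [a] => (((a : Alg11).ou, 0) : Alg2)
    | .B, .B, [a] => (((a : Alg11).uo, 0) : Alg2)
    | .B, .A, [a, b] => (((a : Alg11).lam • (b : Alg11).ou.divX +
        (b : Alg11).lam • (a : Alg11).uo.divX, 0) : Alg2)
    | .W, .W, [a] => ((0, matOf (a : Alg11).oo 0 0) : Alg2)
    | .C, .W, [a] => ((0, matOf (a : Alg11).oo 0 1) : Alg2)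
    | .W, .C, [a] => ((0, matOf (a : Alg11).oo 1 0) : Alg2)
    | .C, .C, [a] => ((0, matOf (a : Alg11).oo 1 1) : Alg2)
    | _, _, _ => (0 : Alg2)

/-- The AD bimodule over `(A_{1,1}, A_{1,1})` of a singular crossing. -/
def Xbim : ADRaw A11 A11 := Ybim.box Lam

/-- The identity bimodule of `A_{1,1}`. -/
abbrev one11 : ADRaw A11 A11 := ADRaw.one A11

/-! ### The morphisms between them -/

/-- The dual of `η`, from `X` to the identity bimodule. -/
def etaC : Coch Xbim one11 := fun y x l =>
  match (y : Alg11.Ob), (x.1 : YG × LamG), l with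
  | .ou, (.A, .X), [] => (⟨0, 1, 0, 0, 0⟩ : Alg11)
  | .uo, (.A, .Y), [a] => (⟨0, 0, Polynomial.C (a : Alg11).lam, 0, 0⟩ : Alg11)
  | .uo, (.B, .Y), [] => (⟨0, 0, Polynomial.X, 0, 0⟩ : Alg11)
  | .oo, (.W, .Z), [] => (⟨0, 0, 0, 0, 1⟩ : Alg11)
  | .oo, (.C, .Z), [] => (⟨0, 0, 0, 0, MvPolynomial.X 1⟩ : Alg11)
  | _, _, _ => (0 : Alg11)

/-- The dual of `ε'`, from the identity bimodule to `X`. -/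
def epsC : Coch one11 Xbim := fun y x l =>
  match (y.1 : YG × LamG), (x : Alg11.Ob), l with
  | (.A, .X), .ou, [] => (⟨0, Polynomial.X, 0, 0, 0⟩ : Alg11)
  | (.B, .X), .ou, [a] => (⟨0, Polynomial.C (a : Alg11).lam, 0, 0, 0⟩ : Alg11)
  | (.B, .Y), .uo, [] => (⟨0, 0, 1, 0, 0⟩ : Alg11)
  | (.W, .Z), .oo, [] => (⟨0, 0, 0, 0, MvPolynomial.X 0⟩ : Alg11)
  | (.C, .Z), .oo, [] => (⟨0, 0, 0, 0, 1⟩ : Alg11)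
  | _, _, _ => (0 : Alg11)

/-- The dual of `ε`, from the identity bimodule of `A_2` to `Λ ⊠ Y`. -/
def eps2C : Coch (ADRaw.one A2) (Lam.box Ybim) := fun y x l =>
  match (y.1 : LamG × YG), (x : Alg2.Ob), l with
  | (.X, .A), .u, [] => ((1, 0) : Alg2)
  | (.Z, .W), .o, [] => ((0, 1) : Alg2)
  | _, _, _ => (0 : Alg2)

/-- The dual of `η'`, from `Λ ⊠ Y` to the identity bimodule of `A_2`. -/
def eta2C : Coch (Lam.box Ybim) (ADRaw.one A2) := fun y x l =>
  match (y : Alg2.Ob), (x.1 : LamG × YG), l with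
  | .u, (.Y, .B), [] => ((1, 0) : Alg2)
  | .o, (.Z, .C), [] => ((0, 1) : Alg2)
  | _, _, _ => (0 : Alg2)

/-- The identification of basis elements of `Y ⊠ Λ` with those of `Y ⊠ (1 ⊠ Λ)`. -/
def relX (x : Xbim.G) : (Ybim.box ((ADRaw.one A2).box Lam)).G :=
  ⟨(x.1.1, ⟨(Lam.l x.1.2, x.1.2), rfl⟩), x.2⟩

/-- The identification of basis elements of `X ⊠ X = (Y ⊠ Λ) ⊠ (Y ⊠ Λ)` with those of
`Y ⊠ ((Λ ⊠ Y) ⊠ Λ)`. -/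
def relXX (x : (Xbim.box Xbim).G) : (Ybim.box ((Lam.box Ybim).box Lam)).G :=
  ⟨(x.1.1.1.1, ⟨(⟨(x.1.1.1.2, x.1.2.1.1), x.2⟩, x.1.2.1.2), x.1.2.2⟩), x.1.1.2⟩

/-- The morphism `X → X ⊠ X` of one trivalent vertex: `Y ⊠ ε ⊠ Λ`. -/
def splitC : Coch Xbim (Xbim.box Xbim) := fun y x l =>
  idBox Ybim (boxId eps2C Lam) (relXX y) (relX x) l

/-- The morphism `X ⊠ X → X` of the other trivalent vertex: `Y ⊠ η' ⊠ Λ`. -/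
def mergeC : Coch (Xbim.box Xbim) Xbim := fun y x l =>
  idBox Ybim (boxId eta2C Lam) (relX y) (relXX x) l

/-- The cup, from the identity bimodule to `X ⊠ X`. -/
def cupC : Coch one11 (Xbim.box Xbim) := compC splitC epsC

/-- The cap, from `X ⊠ X` to the identity bimodule. -/
def capC : Coch (Xbim.box Xbim) one11 := compC etaC mergeC

/-! ### Crossings -/

/-- The AD bimodule of a crossing.  It is dual to the mapping cone of `η` (positive crossing) or
of `ε'` (negative crossing): the sum of the identity bimodule with `q`-degrees shifted by
`±1` and of `X` with homological degrees shifted up by one, where the structure map is the sum of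
those of the two summands and the given morphism. -/
def crossRaw (c : Crossing) : ADRaw A11 A11 where
  G := one11.G ⊕ Xbim.G
  l := Sum.elim one11.l Xbim.l
  r := Sum.elim one11.r Xbim.r
  deg := Sum.elim (fun _ => match c with | .pos => (1, 0) | .neg => (-1, 0))
    (fun x => Xbim.deg x + (0, 1))
  δ
    | .inl y, .inl x, l => one11.δ y x l
    | .inr y, .inr x, l => Xbim.δ y x l
    | .inl y, .inr x, l => match c with
      | .pos => etaC y x l
      | .neg => 0
    | .inr y, .inl x, l => match c with
      | .pos => 0
      | .neg => epsC y x l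

/-- The birth of a positive crossing is the inclusion of the identity bimodule; the birth of a
negative crossing is zero. -/
def birthC (c : Crossing) : Coch one11 (crossRaw c) := fun y x l =>
  match c, y with
  | .pos, .inl y => idC one11 y x l
  | _, _ => 0

/-- The death of a negative crossing is the projection to the identity bimodule; the death of a
positive crossing is zero. -/
def deathC (c : Crossing) : Coch (crossRaw c) one11 := fun y x l =>
  match c, x with
  | .neg, .inl x => idC one11 y x l
  | _, _ => 0

/-- The creation of a cancelling pair: the identity on the identity summand and the cup to
`X ⊠ X`. -/
def createC (c : Crossing) : Coch one11 ((crossRaw c).box (crossRaw c.inv)) := fun y x l =>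
  match y with
  | ⟨(.inl s, .inl _), _⟩ => idC one11 s x l
  | ⟨(.inr z, .inr z'), h⟩ => cupC ⟨(z, z'), h⟩ x l
  | _ => 0

/-- The removal of a cancelling pair: the identity on the identity summand and the cap from
`X ⊠ X`. -/
def annihC (c : Crossing) : Coch ((crossRaw c).box (crossRaw c.inv)) one11 := fun y x l =>
  match x with
  | ⟨(.inl s, .inl _), _⟩ => idC one11 y s l
  | ⟨(.inr z, .inr z'), h⟩ => capC y ⟨(z, z'), h⟩ l
  | _ => 0

/-- The crossing bimodules are right bounded AD bimodules and the morphisms assigned to the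
generating movies are closed of the required bidegrees. -/
structure CrossingLaws : Prop where
  isAD : ∀ c, IsAD (crossRaw c)
  birth_closed : ∀ c, birthC c ∈ closed one11 (crossRaw c)
  death_closed : ∀ c, deathC c ∈ closed (crossRaw c) one11
  create_closed : ∀ c, createC c ∈ closed one11 ((crossRaw c).box (crossRaw c.inv))
  annih_closed : ∀ c, annihC c ∈ closed ((crossRaw c).box (crossRaw c.inv)) one11
  birth_homog : ∀ c, birthC c ∈ homMor one11 (crossRaw c) (MovieGen.birth c).deg
  death_homog : ∀ c, deathC c ∈ homMor (crossRaw c) one11 (MovieGen.death c).deg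
  create_homog : ∀ c, createC c ∈ homMor one11 ((crossRaw c).box (crossRaw c.inv)) 0
  annih_homog : ∀ c, annihC c ∈ homMor ((crossRaw c).box (crossRaw c.inv)) one11 0
  eta_closed : etaC ∈ closed Xbim one11
  eta_homog : etaC ∈ homMor Xbim one11 (-1, 2)
  eps_closed : epsC ∈ closed one11 Xbim
  eps_homog : epsC ∈ homMor one11 Xbim (-1, 0)

/-- An endomorphism of an object for each crossing and 2-morphisms for the generating movies. -/
structure CrossingData {L : ADBimodLaws} (X : ADBimod L) where
  cross : Crossing → (X ⟶ X)
  birth : ∀ c, 𝟙 X ⟶ cross c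
  death : ∀ c, cross c ⟶ 𝟙 X
  create : ∀ c, 𝟙 X ⟶ cross c.inv ≫ cross c
  annih : ∀ c, cross c.inv ≫ cross c ⟶ 𝟙 X

/-- The dg category `A_{1,1}` as an object. -/
def A11obj (L : ADBimodLaws) : ADBimod L := A11

/-- The mapping cones and the 2-morphisms constructed above. -/
def crossingData (L : ADBimodLaws) (W : CrossingLaws) : CrossingData (A11obj L) where
  cross c := (⟨crossRaw c, W.isAD c⟩ : ADMod A11 A11)
  birth c := cls (birthC c) (W.birth_closed c)
  death c := cls (deathC c) (W.death_closed c)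
  create c := cls (createC c) (W.create_closed c)
  annih c := cls (annihC c) (W.annih_closed c)

/-- A generating movie as a 2-morphism. -/
def BrCob.gen (g : MovieGen) {f f' : BrCob.star ⟶ BrCob.star} (hf : (f : BWord) = g.src)
    (hf' : g.tgt = (f' : BWord)) : f ⟶ f' :=
  BrHom.of (MovieClass.mk [⟨[], g, []⟩]
    ⟨hf.trans (by simp [Event.src]), Eq.trans (by simp [Event.tgt]) hf'⟩)

/-- The 1-morphism of a single crossing. -/
def BrCob.crossing (c : Crossing) : BrCob.star ⟶ BrCob.star := ([c] : BWord)

open Bicategory in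
/-- `F` sends crossings and generating movies to the given data, up to isomorphisms of bidegree
zero from the images of the crossings to the given 1-morphisms. -/
def Realizes {L : ADBimodLaws} (F : Pseudofunctor BrCob (ADBimod L))
    (D : CrossingData (F.obj .star)) : Prop :=
  ∃ θ : ∀ c, F.map (BrCob.crossing c) ≅ D.cross c,
    (∀ c, (θ c).hom ∈ ADBimod.homog 0 ∧ (θ c).inv ∈ ADBimod.homog 0) ∧
    (∀ c, F.map₂ (BrCob.gen (.birth c) (f := 𝟙 BrCob.star) (f' := BrCob.crossing c) rfl rfl) ≫
      (θ c).hom = (F.mapId .star).hom ≫ D.birth c) ∧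
    (∀ c, F.map₂ (BrCob.gen (.death c) (f := BrCob.crossing c) (f' := 𝟙 BrCob.star) rfl rfl) ≫
      (F.mapId .star).hom = (θ c).hom ≫ D.death c) ∧
    (∀ c, F.map₂ (BrCob.gen (.create c) (f := 𝟙 BrCob.star)
        (f' := BrCob.crossing c.inv ≫ BrCob.crossing c) rfl rfl) ≫
      (F.mapComp (BrCob.crossing c.inv) (BrCob.crossing c)).hom ≫
      ((θ c.inv).hom ▷ F.map (BrCob.crossing c)) ≫ (D.cross c.inv ◁ (θ c).hom) =
      (F.mapId .star).hom ≫ D.create c) ∧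
    (∀ c, F.map₂ (BrCob.gen (.annih c) (f := BrCob.crossing c.inv ≫ BrCob.crossing c)
        (f' := 𝟙 BrCob.star) rfl rfl) ≫ (F.mapId .star).hom =
      (F.mapComp (BrCob.crossing c.inv) (BrCob.crossing c)).hom ≫
      ((θ c.inv).hom ▷ F.map (BrCob.crossing c)) ≫ (D.cross c.inv ◁ (θ c).hom) ≫ D.annih c)

/-- `F` is a functor of `F_2`-linear `ℤ²`-graded bicategories: it is additive and preserves
bidegrees of 2-morphisms, and its structure isomorphisms have bidegree zero. -/
structure IsGradedLinear {L : ADBimodLaws} (F : Pseudofunctor BrCob (ADBimod L)) : Prop where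
  map₂_add : ∀ {f g : BrCob.star ⟶ BrCob.star} (η θ : f ⟶ g),
    F.map₂ (η + θ) = F.map₂ η + F.map₂ θ
  map₂_homog : ∀ {f g : BrCob.star ⟶ BrCob.star} (p : ℤ × ℤ) (η : f ⟶ g),
    η ∈ BrCob.homog p → F.map₂ η ∈ ADBimod.homog p
  mapId_homog : (F.mapId .star).hom ∈ ADBimod.homog 0 ∧ (F.mapId .star).inv ∈ ADBimod.homog 0
  mapComp_homog : ∀ f g : BrCob.star ⟶ BrCob.star,
    (F.mapComp f g).hom ∈ ADBimod.homog 0 ∧ (F.mapComp f g).inv ∈ ADBimod.homog 0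

end

end BraidAD

open CategoryTheory

namespace BraidAD

noncomputable section

open scoped Classical

/-! ### Splittings of sequences -/

section Split

variable {α R R' : Type}

section Monoid

variable [AddCommMonoid R] [AddCommMonoid R']

lemma splitSum_nil (F : List α → List α → R) : splitSum F [] = F [] [] := by
  simp [splitSum]

lemma splitSum_cons (F : List α → List α → R) (a : α) (l : List α) :
    splitSum F (a :: l) = F [] (a :: l) + splitSum (fun l1 l2 => F (a :: l1) l2) l := by
  unfold splitSum
  rw [List.length_cons, Finset.sum_range_succ']
  simp [add_comm]

lemma splitSum_congr {F G : List α → List α → R} {l : List α}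
    (h : ∀ l1 l2, l1 ++ l2 = l → F l1 l2 = G l1 l2) : splitSum F l = splitSum G l :=
  Finset.sum_congr rfl fun _ _ => h _ _ (List.take_append_drop _ _)

lemma splitSum_eq_zero {F : List α → List α → R} {l : List α}
    (h : ∀ l1 l2, l1 ++ l2 = l → F l1 l2 = 0) : splitSum F l = 0 :=
  Finset.sum_eq_zero fun _ _ => h _ _ (List.take_append_drop _ _)

lemma splitSum_zero (l : List α) : splitSum (fun _ _ => (0 : R)) l = 0 :=
  splitSum_eq_zero fun _ _ _ => rfl

lemma splitSum_add (F G : List α → List α → R) (l : List α) :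
    splitSum (fun l1 l2 => F l1 l2 + G l1 l2) l = splitSum F l + splitSum G l :=
  Finset.sum_add_distrib

lemma splitSum_sum {ι : Type*} (s : Finset ι) (F : ι → List α → List α → R) (l : List α) :
    splitSum (fun l1 l2 => ∑ i ∈ s, F i l1 l2) l = ∑ i ∈ s, splitSum (F i) l :=
  Finset.sum_comm

lemma map_splitSum (φ : R →+ R') (F : List α → List α → R) (l : List α) :
    φ (splitSum F l) = splitSum (fun l1 l2 => φ (F l1 l2)) l :=
  map_sum φ _ _

lemma splitSum_assoc (F : List α → List α → List α → R) (l : List α) :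
    splitSum (fun l1 l2 => splitSum (fun m1 m2 => F l1 m1 m2) l2) l =
      splitSum (fun l1 l2 => splitSum (fun m1 m2 => F m1 m2 l2) l1) l := by
  induction l generalizing F with
  | nil => simp [splitSum_nil]
  | cons a l ih =>
    rw [splitSum_cons, splitSum_cons, splitSum_cons, splitSum_nil, ih]
    simp only [splitSum_cons]
    rw [splitSum_add, add_assoc]

/-- Splittings with empty first part. -/
lemma splitSum_left_nil (F : List α → R) (l : List α) :
    splitSum (fun l1 l2 => if l1 = [] then F l2 else 0) l = F l := by
  cases l with
  | nil => simp [splitSum_nil]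
  | cons a l => simp [splitSum_cons, splitSum_zero]

lemma splitSum_right_nil (F : List α → R) (l : List α) :
    splitSum (fun l1 l2 => if l2 = [] then F l1 else 0) l = F l := by
  induction l generalizing F with
  | nil => simp [splitSum_nil]
  | cons a l ih => rw [splitSum_cons, ih]; simp

end Monoid

/-! ### Insertion of a differential or a product -/

section Bar

variable [AddCommMonoid R] [AddCommMonoid R']

/-- Apply `d` to one entry, in all possible ways. -/
def bD (d : α → α) : (List α → R) → List α → R
  | _, [] => 0
  | F, a :: l => F (d a :: l) + bD d (fun t => F (a :: t)) l

/-- Multiply two consecutive entries, in all possible ways. -/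
def bM [Mul α] : (List α → R) → List α → R
  | _, [] => 0
  | _, [_] => 0
  | F, a :: b :: l => F (a * b :: l) + bM (fun t => F (a :: t)) (b :: l)

lemma bD_add (d : α → α) (F G : List α → R) (l : List α) :
    bD d (fun t => F t + G t) l = bD d F l + bD d G l := by
  induction l generalizing F G with
  | nil => simp [bD]
  | cons a l ih => simp only [bD, ih]; abel

lemma bM_add [Mul α] (F G : List α → R) (l : List α) :
    bM (fun t => F t + G t) l = bM F l + bM G l := by
  induction l generalizing F G with
  | nil => simp [bM]
  | cons a l ih =>
    cases l with
    | nil => simp [bM]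
    | cons b l => simp only [bM, ih]; abel

lemma bD_map (d : α → α) (φ : R →+ R') (F : List α → R) (l : List α) :
    bD d (fun t => φ (F t)) l = φ (bD d F l) := by
  induction l generalizing F with
  | nil => simp [bD]
  | cons a l ih => simp only [bD, ih, map_add]

lemma bM_map [Mul α] (φ : R →+ R') (F : List α → R) (l : List α) :
    bM (fun t => φ (F t)) l = φ (bM F l) := by
  induction l generalizing F with
  | nil => simp [bM]
  | cons a l ih =>
    cases l with
    | nil => simp [bM]
    | cons b l => simp only [bM, ih, map_add]

lemma bD_zero (d : α → α) (l : List α) : bD d (fun _ => (0 : R)) l = 0 := by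
  simpa using bD_map d (0 : R →+ R) (fun _ => 0) l

lemma bM_zero [Mul α] (l : List α) : bM (fun _ => (0 : R)) l = 0 := by
  simpa using bM_map (0 : R →+ R) (fun _ => 0) l

lemma bD_sum (d : α → α) {ι : Type*} (s : Finset ι) (F : ι → List α → R) (l : List α) :
    bD d (fun t => ∑ i ∈ s, F i t) l = ∑ i ∈ s, bD d (F i) l := by
  induction s using Finset.induction_on with
  | empty => simp [bD_zero]
  | insert a s ha ih => simp only [Finset.sum_insert ha, bD_add, ih]

lemma bM_sum [Mul α] {ι : Type*} (s : Finset ι) (F : ι → List α → R) (l : List α) :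
    bM (fun t => ∑ i ∈ s, F i t) l = ∑ i ∈ s, bM (F i) l := by
  induction s using Finset.induction_on with
  | empty => simp [bM_zero]
  | insert a s ha ih => simp only [Finset.sum_insert ha, bM_add, ih]

lemma bD_splitSum (d : α → α) (F : List α → List α → R) (l : List α) :
    bD d (splitSum F) l = splitSum (fun l1 l2 => bD d (fun t => F t l2) l1) l +
      splitSum (fun l1 l2 => bD d (F l1) l2) l := by
  induction l generalizing F with
  | nil => simp [bD, splitSum_nil]
  | cons a l ih =>
    simp only [bD, splitSum_cons, bD_add, ih, splitSum_add]
    abel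

lemma bM_splitSum [Mul α] (F : List α → List α → R) (l : List α) :
    bM (splitSum F) l = splitSum (fun l1 l2 => bM (fun t => F t l2) l1) l +
      splitSum (fun l1 l2 => bM (F l1) l2) l := by
  induction l generalizing F with
  | nil => simp [bM, splitSum_nil]
  | cons a l ih =>
    cases l with
    | nil => simp [bM, splitSum_nil, splitSum_cons]
    | cons b l =>
      have h := ih (fun l1 l2 => F (a :: l1) l2)
      rw [bM]
      simp only [splitSum_cons, bM_add] at h ⊢
      rw [h]
      simp only [bM, splitSum_add]
      abel

end Bar

end Split

section Bars

variable {A B C E : DGCat}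

lemma barD_eq (F : List B.Mor → A.Mor) (l) : barD F l = bD B.d F l := by
  induction l generalizing F with
  | nil => rfl
  | cons a l ih => simp only [barD, bD, ih]

lemma barM_eq (F : List B.Mor → A.Mor) (l) : barM F l = bM F l := by
  induction l generalizing F with
  | nil => rfl
  | cons a l ih =>
    cases l with
    | nil => rfl
    | cons b l => simp only [barM, bM, ih]

/-- Functions of sequences with values in an algebra, with the differential as in `intD`. -/
def cD (F : List B.Mor → A.Mor) : List B.Mor → A.Mor := fun l => A.d (F l) + bD B.d F l + bM F l

lemma intD_eq {M N : ADRaw B A} (f : Coch M N) (y x) : intD f y x = cD (f y x) := by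
  funext l; simp only [intD, cD, barD_eq, barM_eq]

lemma DGCat.add_self (A : DGCat) (a : A.Mor) : a + a = 0 := by
  have h : a * (1 + 1) = 0 := by rw [A.one_add_one, mul_zero]
  simpa [mul_add] using h

lemma DGCat.neg_eq (A : DGCat) (a : A.Mor) : -a = a :=
  neg_eq_of_add_eq_zero_left (A.add_self a)

/-- The convolution product of functions of sequences. -/
def conv (f g : List B.Mor → A.Mor) : List B.Mor → A.Mor :=
  splitSum fun l1 l2 => f l1 * g l2

lemma cD_conv (f g : List B.Mor → A.Mor) (l) : cD (conv f g) l = conv (cD f) g l + conv f (cD g) l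
    := by
  have h1 : ∀ l1 l2, bD B.d (fun t => f t * g l2) l1 = bD B.d f l1 * g l2 := fun l1 l2 =>
    bD_map _ (AddMonoidHom.mulRight (g l2)) f l1
  have h2 : ∀ l1 l2, bD B.d (fun t => f l1 * g t) l2 = f l1 * bD B.d g l2 := fun l1 l2 =>
    bD_map _ (AddMonoidHom.mulLeft (f l1)) g l2
  have h3 : ∀ l1 l2, bM (fun t => f t * g l2) l1 = bM f l1 * g l2 := fun l1 l2 =>
    bM_map (AddMonoidHom.mulRight (g l2)) f l1
  have h4 : ∀ l1 l2, bM (fun t => f l1 * g t) l2 = f l1 * bM g l2 := fun l1 l2 =>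
    bM_map (AddMonoidHom.mulLeft (f l1)) g l2
  simp only [cD, conv, bD_splitSum, bM_splitSum, h1, h2, h3, h4, map_splitSum, A.d_mul, add_mul,
    mul_add, splitSum_add]
  abel

lemma cD_zero (l) : cD (A := A) (fun _ : List B.Mor => (0 : A.Mor)) l = 0 := by
  simp [cD, bD_zero, bM_zero]

lemma cD_sum {ι : Type*} (s : Finset ι) (F : ι → List B.Mor → A.Mor) (l) : cD (fun t => ∑ i ∈ s, F
    i t) l = ∑ i ∈ s, cD (F i) l := by
  simp only [cD, bD_sum, bM_sum, map_sum, Finset.sum_add_distrib]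

lemma compC_apply {M N K : ADRaw B A} (g : Coch N K) (f : Coch M N) (z x l) : compC g f z x l = ∑ y,
    conv (g z y) (f y x) l := rfl

lemma conv_assoc (f g h : List B.Mor → A.Mor) (l) : conv (conv f g) h l = conv f (conv g h) l
    := by
  have h1 : ∀ l1 l2, conv f g l1 * h l2 = splitSum (fun m1 m2 => f m1 * (g m2 * h l2)) l1 :=
    fun l1 l2 => by
      rw [← AddMonoidHom.mulRight_apply, conv, map_splitSum]; simp [mul_assoc]
  have h2 : ∀ l1 l2, f l1 * conv g h l2 = splitSum (fun m1 m2 => f l1 * (g m1 * h m2)) l2 :=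
    fun l1 l2 => map_splitSum (AddMonoidHom.mulLeft (f l1)) _ l2
  change splitSum (fun l1 l2 => conv f g l1 * h l2) l = splitSum (fun l1 l2 => f l1 * conv g h l2) l
  simp only [h1, h2]
  exact (splitSum_assoc (fun a b c => f a * (g b * h c)) l).symm

lemma conv_add (f g h : List B.Mor → A.Mor) (l) : conv f (fun t => g t + h t) l = conv f g l +
    conv f h l := by
  simp only [conv, mul_add, splitSum_add]

lemma add_conv (f g h : List B.Mor → A.Mor) (l) : conv (fun t => f t + g t) h l = conv f h l +
    conv g h l := by
  simp only [conv, add_mul, splitSum_add]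

lemma conv_sum {ι : Type*} (s : Finset ι) (f : List B.Mor → A.Mor) (g : ι → List B.Mor → A.Mor)
    (l) : conv f (fun t => ∑ i ∈ s, g i t) l = ∑ i ∈ s, conv f (g i) l := by
  simp only [conv, Finset.mul_sum, splitSum_sum]

lemma sum_conv {ι : Type*} (s : Finset ι) (f : List B.Mor → A.Mor) (g : ι → List B.Mor → A.Mor)
    (l) : conv (fun t => ∑ i ∈ s, g i t) f l = ∑ i ∈ s, conv (g i) f l := by
  simp only [conv, Finset.sum_mul, splitSum_sum]

lemma conv_eq_zero_left {f g : List B.Mor → A.Mor} (h : ∀ l, f l = 0) (l) :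
    conv f g l = 0 := splitSum_eq_zero fun _ _ _ => by rw [h, zero_mul]

lemma conv_eq_zero_right {f g : List B.Mor → A.Mor} (h : ∀ l, g l = 0) (l) :
    conv f g l = 0 := splitSum_eq_zero fun _ _ _ => by rw [h, mul_zero]

lemma compC_assoc {M N K L : ADRaw B A} (h : Coch K L) (g : Coch N K) (f : Coch M N) :
    compC (compC h g) f = compC h (compC g f) := by
  funext z x l
  simp only [compC_apply]
  have e1 : ∀ y, conv ((compC h g) z y) (f y x) l = ∑ w, conv (conv (h z w) (g w y)) (f y x) l :=
    fun y => sum_conv Finset.univ (f y x) (fun w => conv (h z w) (g w y)) l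
  have e2 : ∀ w, conv (h z w) ((compC g f) w x) l = ∑ y, conv (h z w) (conv (g w y) (f y x)) l :=
    fun w => conv_sum Finset.univ (h z w) (fun y => conv (g w y) (f y x)) l
  simp only [e1, e2]
  rw [Finset.sum_comm]
  simp only [conv_assoc]

lemma compC_add {M N K : ADRaw B A} (g : Coch N K) (f f' : Coch M N) :
    compC g (f + f') = compC g f + compC g f' := by
  funext z x l
  simp only [compC_apply, Pi.add_apply, ← Finset.sum_add_distrib, ← conv_add]
  rfl

lemma add_compC {M N K : ADRaw B A} (g g' : Coch N K) (f : Coch M N) :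
    compC (g + g') f = compC g f + compC g' f := by
  funext z x l
  simp only [compC_apply, Pi.add_apply, ← Finset.sum_add_distrib, ← add_conv]
  rfl

lemma compC_zero {M N K : ADRaw B A} (g : Coch N K) : compC g (0 : Coch M N) = 0 := by
  funext z x l
  exact Finset.sum_eq_zero fun y _ => conv_eq_zero_right (fun _ => rfl) l

lemma zero_compC {M N K : ADRaw B A} (f : Coch M N) : compC (0 : Coch N K) f = 0 := by
  funext z x l
  exact Finset.sum_eq_zero fun y _ => conv_eq_zero_left (fun _ => rfl) l

lemma Coch.add_self {M N : ADRaw B A} (f : Coch M N) : f + f = 0 := by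
  funext y x l; exact A.add_self _

lemma Coch.neg_eq {M N : ADRaw B A} (f : Coch M N) : -f = f := by
  funext y x l; exact A.neg_eq _

lemma intD_compC {M N K : ADRaw B A} (g : Coch N K) (f : Coch M N) :
    intD (compC g f) = compC (intD g) f + compC g (intD f) := by
  funext z x l
  rw [intD_eq]
  have : (compC g f) z x = fun t => ∑ y, conv (g z y) (f y x) t := rfl
  rw [this, cD_sum]
  simp only [cD_conv, Finset.sum_add_distrib, Pi.add_apply, compC_apply, intD_eq]

lemma dMor_apply {M N : ADRaw B A} (f : Coch M N) :
    dMor M N f = intD f + compC (M := M) (N := N) (K := N) N.δ f +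
      compC (M := M) (N := M) (K := N) f M.δ := rfl

/-- The Leibniz rule. -/
lemma dMor_compC {M N K : ADRaw B A} (g : Coch N K) (f : Coch M N) :
    dMor M K (compC g f) = compC (dMor N K g) f + compC g (dMor M N f) := by
  simp only [dMor_apply, intD_compC, add_compC, compC_add, compC_assoc]
  have h := Coch.add_self (compC g (compC (M := M) (N := N) (K := N) N.δ f))
  generalize compC g (compC (M := M) (N := N) (K := N) N.δ f) = u at h ⊢
  calc _ = compC (intD g) f + compC g (intD f) + compC (M := M) (N := K) (K := K) K.δ (compC g f)
        + compC g (compC (M := M) (N := M) (K := N) f M.δ) + 0 := by abel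
    _ = _ := by rw [← h]; abel

end Bars

/-! ### Iterated structure maps -/

section Iter

variable {A B C E : DGCat} {R R' : Type}

section Monoid

variable [AddCommMonoid R] [AddCommMonoid R']

lemma iter_zero (N : ADRaw B A) (n' n) (Φ : List A.Mor → R) (l) : N.iter 0 n' n Φ l = if n' = n ∧
    l = [] then Φ [] else 0 := by
  cases l <;> simp [ADRaw.iter]

lemma iter_succ (N : ADRaw B A) (j n' n) (Φ : List A.Mor → R) (l) : N.iter (j + 1) n' n Φ l = ∑
    n1, splitSum (fun l1 l2 => N.iter j n1 n (fun t => Φ (N.δ n' n1 l1 :: t)) l2) l := by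
  cases l <;> rw [ADRaw.iter]

lemma iterF_zero {N N' : ADRaw B A} (f : Coch N N') (n' n) (Φ : List A.Mor → R) (l) : iterF f 0 n'
    n Φ l = 0 := by
  cases l <;> rw [iterF]

lemma iterF_succ {N N' : ADRaw B A} (f : Coch N N') (j n' n) (Φ : List A.Mor → R) (l) : iterF f (j
    + 1) n' n Φ l = (∑ n1 : N.G, splitSum (fun l1 l2 => N.iter j n1 n (fun t => Φ (f n' n1 l1 :: t))
    l2) l) + ∑ n1 : N'.G, splitSum (fun l1 l2 => iterF f j n1 n (fun t => Φ (N'.δ n' n1 l1 :: t))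
    l2) l := by
  cases l <;> rw [iterF]

lemma iter_map (N : ADRaw B A) (φ : R →+ R') (j n' n) (Φ : List A.Mor → R) (l) : N.iter j n' n
    (fun t => φ (Φ t)) l = φ (N.iter j n' n Φ l) := by
  induction j generalizing n' Φ l with
  | zero => simp only [iter_zero]; split_ifs <;> simp
  | succ j ih => simp only [iter_succ, ih, map_sum, map_splitSum]

lemma iter_add_fun (N : ADRaw B A) (j n' n) (Φ Ψ : List A.Mor → R) (l) : N.iter j n' n (fun t => Φ
    t + Ψ t) l = N.iter j n' n Φ l + N.iter j n' n Ψ l := by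
  induction j generalizing n' Φ Ψ l with
  | zero => simp only [iter_zero]; split_ifs <;> simp
  | succ j ih => simp only [iter_succ, ih, splitSum_add, Finset.sum_add_distrib]

lemma iter_zero_fun (N : ADRaw B A) (j n' n l) : N.iter j n' n (fun _ => (0 : R)) l = 0 := by
  simpa using iter_map N (0 : R →+ R) j n' n (fun _ => 0) l

lemma iter_sum_fun (N : ADRaw B A) {ι : Type*} (s : Finset ι) (j n' n) (Φ : ι → List A.Mor → R)
    (l) : N.iter j n' n (fun t => ∑ i ∈ s, Φ i t) l = ∑ i ∈ s, N.iter j n' n (Φ i) l := by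
  induction s using Finset.induction_on with
  | empty => simp [iter_zero_fun]
  | insert a s ha ih => simp only [Finset.sum_insert ha, iter_add_fun, ih]

lemma iter_congr (N : ADRaw B A) (j n' n) {Φ Ψ : List A.Mor → R} (h : ∀ t, t.length = j → Φ t = Ψ
    t) (l) : N.iter j n' n Φ l = N.iter j n' n Ψ l := by
  induction j generalizing n' Φ Ψ l with
  | zero => simp only [iter_zero, h [] rfl]
  | succ j ih =>
    simp only [iter_succ]
    refine Finset.sum_congr rfl fun n1 _ => splitSum_congr fun l1 l2 _ => ?_
    exact ih n1 (fun t ht => h _ (by simp [ht])) l2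

lemma iterF_add_fun {N N' : ADRaw B A} (f : Coch N N') (j n' n) (Φ Ψ : List A.Mor → R) (l) : iterF
    f j n' n (fun t => Φ t + Ψ t) l = iterF f j n' n Φ l + iterF f j n' n Ψ l := by
  induction j generalizing n' Φ Ψ l with
  | zero => simp [iterF_zero]
  | succ j ih =>
    simp only [iterF_succ, ih, iter_add_fun, splitSum_add, Finset.sum_add_distrib]; abel

/-- Sequences of `a + b` applications of the structure map. -/
lemma iter_plus (N : ADRaw B A) (a b n' n) (Φ : List A.Mor → R) (l) : N.iter (a + b) n' n Φ l = ∑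
    n1, splitSum (fun l1 l2 => N.iter a n' n1 (fun t => N.iter b n1 n (fun t' => Φ (t ++ t')) l2)
    l1) l := by
  induction a generalizing n' Φ l with
  | zero =>
    simp only [iter_zero, Nat.zero_add, List.nil_append]
    rw [Finset.sum_eq_single n']
    · simp only [true_and]
      exact (splitSum_left_nil (N.iter b n' n Φ) l).symm
    · intro n1 _ h
      refine splitSum_eq_zero fun l1 l2 _ => if_neg fun h' => h h'.1.symm
    · simp
  | succ a ih =>
    rw [Nat.add_right_comm]
    simp only [iter_succ, ih, splitSum_sum, List.cons_append]
    rw [Finset.sum_comm]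
    refine Finset.sum_congr rfl fun n1 _ => Finset.sum_congr rfl fun n2 _ => ?_
    exact splitSum_assoc (fun x y z => N.iter a n2 n1
      (fun t => N.iter b n1 n (fun t' => Φ (N.δ n' n2 x :: (t ++ t'))) z) y) l

end Monoid

/-! ### Additivity in the entries -/

section Multi

variable [AddCommGroup R] [AddCommGroup R'] {Φ Ψ : List A.Mor → R}

lemma MultiAdd.tail (h : MultiAdd Φ) (a) : MultiAdd fun t => Φ (a :: t) :=
  fun l1 b c l2 => h (a :: l1) b c l2

lemma MultiAdd.head (h : MultiAdd Φ) (a b t) :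
    Φ ((a + b) :: t) = Φ (a :: t) + Φ (b :: t) := h [] a b t

/-- The value as an additive function of the first entry. -/
def MultiAdd.headHom (h : MultiAdd Φ) (t : List A.Mor) : A.Mor →+ R :=
  AddMonoidHom.mk' (fun a => Φ (a :: t)) fun a b => h.head a b t

/-- The value as an additive function of one entry. -/
def MultiAdd.hom (h : MultiAdd Φ) (l1 l2 : List A.Mor) : A.Mor →+ R :=
  AddMonoidHom.mk' (fun a => Φ (l1 ++ a :: l2)) fun a b => h l1 a b l2

lemma MultiAdd.zero_entry (h : MultiAdd Φ) (l1 l2) : Φ (l1 ++ 0 :: l2) = 0 :=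
  map_zero (h.hom l1 l2)

lemma MultiAdd.zero_head (h : MultiAdd Φ) (t) : Φ (0 :: t) = 0 :=
  map_zero (h.headHom t)

lemma MultiAdd.map (h : MultiAdd Φ) (φ : R →+ R') : MultiAdd fun t => φ (Φ t) :=
  fun l1 a b l2 => by simp only [h l1 a b l2, map_add]

lemma MultiAdd.add (h : MultiAdd Φ) (h' : MultiAdd Ψ) : MultiAdd fun t => Φ t + Ψ t :=
  fun l1 a b l2 => by simp only [h l1 a b l2, h' l1 a b l2]; abel

lemma MultiAdd.zero : MultiAdd fun _ : List A.Mor => (0 : R) := fun _ _ _ _ => by simp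

lemma MultiAdd.sum {ι : Type*} (s : Finset ι) (Φ : ι → List A.Mor → R)
    (h : ∀ i ∈ s, MultiAdd (Φ i)) : MultiAdd fun t => ∑ i ∈ s, Φ i t := fun l1 a b l2 => by
  rw [← Finset.sum_add_distrib]
  exact Finset.sum_congr rfl fun i hi => h i hi l1 a b l2

lemma MultiAdd.splitSum {F : List A.Mor → List A.Mor → R} (h : ∀ t, MultiAdd fun s => F s t)
    (h' : ∀ s, MultiAdd (F s)) : MultiAdd (BraidAD.splitSum F) := by
  intro l1 a b l2
  induction l1 generalizing F with
  | nil =>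
    simp only [List.nil_append, splitSum_cons, (h' []).head]
    have : ∀ l1' l2', F ((a + b) :: l1') l2' = F (a :: l1') l2' + F (b :: l1') l2' :=
      fun l1' l2' => (h l2').head a b l1'
    simp only [this, splitSum_add]; abel
  | cons c l1 ih =>
    simp only [List.cons_append, splitSum_cons]
    rw [ih (F := fun s t => F (c :: s) t) (fun t => (h t).tail c) (fun s => h' _),
      show F [] (c :: (l1 ++ (a + b) :: l2)) = _ from h' [] (c :: l1) a b l2]
    simp only [List.cons_append]; abel

/-- The iterated structure map as an additive function of the last output. -/
def iterHead (N : ADRaw B A) (h : MultiAdd Φ) (j : ℕ) (n' n : N.G) (l : List B.Mor) :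
    A.Mor →+ R :=
  AddMonoidHom.mk' (fun a => N.iter j n' n (fun t => Φ (a :: t)) l) fun a b => by
    simp only [h.head, iter_add_fun]

lemma iterHead_apply (N : ADRaw B A) (h : MultiAdd Φ) (j n' n l a) : iterHead N h j n' n l a =
    N.iter j n' n (fun t => Φ (a :: t)) l := rfl

def iterFHead {N N' : ADRaw B A} (f : Coch N N') (h : MultiAdd Φ) (j : ℕ) (n' : N'.G) (n : N.G)
    (l : List B.Mor) : A.Mor →+ R :=
  AddMonoidHom.mk' (fun a => iterF f j n' n (fun t => Φ (a :: t)) l) fun a b => by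
    simp only [h.head, iterF_add_fun]

lemma iter_zero_head (N : ADRaw B A) (h : MultiAdd Φ) (j n' n l) :
    N.iter j n' n (fun t => Φ (0 :: t)) l = 0 := map_zero (iterHead N h j n' n l)

lemma iterF_zero_head {N N' : ADRaw B A} (f : Coch N N') (h : MultiAdd Φ) (j n' n l) : iterF f j
    n' n (fun t => Φ (0 :: t)) l = 0 :=
  map_zero (iterFHead f h j n' n l)

/-- Additivity of `iterF f` in `f`. -/
lemma iterF_add {N N' : ADRaw B A} (f g : Coch N N') (h : MultiAdd Φ) (j n' n l) : iterF (f + g) j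
    n' n Φ l = iterF f j n' n Φ l + iterF g j n' n Φ l := by
  induction j generalizing n' Φ l with
  | zero => simp [iterF_zero]
  | succ j ih =>
    simp only [iterF_succ, Pi.add_apply, h.head, iter_add_fun, ih (h.tail _), splitSum_add,
      Finset.sum_add_distrib]
    abel

lemma iterF_zero_left {N N' : ADRaw B A} (h : MultiAdd Φ) (j n' n l) : iterF (0 : Coch N N') j n'
    n Φ l = 0 := by
  have := iterF_add (0 : Coch N N') 0 h j n' n l
  simpa using this

/-! ### Compatibility with differentials -/

lemma iter_bD (N : ADRaw B A) (h : MultiAdd Φ) (j n' n l) :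
    N.iter j n' n (bD A.d Φ) l =
      iterF (N := N) (N' := N) (fun y x l => A.d (N.δ y x l)) j n' n Φ l := by
  induction j generalizing n' Φ l with
  | zero => simp [iter_zero, iterF_zero, bD]
  | succ j ih =>
    simp only [iter_succ, iterF_succ, bD, iter_add_fun, splitSum_add, Finset.sum_add_distrib,
      ih (h.tail _)]

lemma bD_iter (N : ADRaw B A) (h : MultiAdd Φ) (j n' n l) :
    bD B.d (N.iter j n' n Φ) l =
      iterF (N := N) (N' := N) (fun y x l => bD B.d (N.δ y x) l) j n' n Φ l := by
  induction j generalizing n' Φ l with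
  | zero =>
    rw [iterF_zero]
    have : N.iter 0 n' n Φ = fun l => if n' = n ∧ l = [] then Φ [] else 0 := by
      funext l; exact iter_zero ..
    cases l <;> simp [this, bD, bD_zero]
  | succ j ih =>
    have : N.iter (j + 1) n' n Φ = fun l => ∑ n1, splitSum (fun l1 l2 =>
      N.iter j n1 n (fun t => Φ (N.δ n' n1 l1 :: t)) l2) l := by
      funext l; exact iter_succ ..
    rw [this, bD_sum, iterF_succ]
    simp only [bD_splitSum, Finset.sum_add_distrib, ih (h.tail _)]
    congr 1
    refine Finset.sum_congr rfl fun n1 _ => splitSum_congr fun l1 l2 _ => ?_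
    exact bD_map B.d (iterHead N h j n1 n l2) (N.δ n' n1) l1

lemma bM_iter (N : ADRaw B A) (h : MultiAdd Φ) (j n' n l) :
    bM (N.iter j n' n Φ) l =
      iterF (N := N) (N' := N) (fun y x l => bM (N.δ y x) l) j n' n Φ l := by
  induction j generalizing n' Φ l with
  | zero =>
    rw [iterF_zero]
    have : N.iter 0 n' n Φ = fun l => if n' = n ∧ l = [] then Φ [] else 0 := by
      funext l; exact iter_zero ..
    rcases l with _ | ⟨a, _ | ⟨b, l⟩⟩ <;> simp [this, bM, bM_zero]
  | succ j ih =>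
    have : N.iter (j + 1) n' n Φ = fun l => ∑ n1, splitSum (fun l1 l2 =>
      N.iter j n1 n (fun t => Φ (N.δ n' n1 l1 :: t)) l2) l := by
      funext l; exact iter_succ ..
    rw [this, bM_sum, iterF_succ]
    simp only [bM_splitSum, Finset.sum_add_distrib, ih (h.tail _)]
    congr 1
    refine Finset.sum_congr rfl fun n1 _ => splitSum_congr fun l1 l2 _ => ?_
    exact bM_map (iterHead N h j n1 n l2) (N.δ n' n1) l1

lemma iter_bM (N : ADRaw B A) (h : MultiAdd Φ) (j n' n l) :
    N.iter (j + 1) n' n (bM Φ) l =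
      iterF (N := N) (N' := N) (compC (M := N) (N := N) (K := N) N.δ N.δ) j n' n Φ l := by
  induction j generalizing n' Φ l with
  | zero => simp [iter_succ, iter_zero, iterF_zero, bM, splitSum_zero]
  | succ j ih =>
    have e : ∀ n1 l1 l2, N.iter (j + 1) n1 n (fun t => bM Φ (N.δ n' n1 l1 :: t)) l2 =
        (∑ n2, splitSum (fun m1 m2 =>
          N.iter j n2 n (fun t => Φ (N.δ n' n1 l1 * N.δ n1 n2 m1 :: t)) m2) l2) +
        iterF (N := N) (N' := N) (compC (M := N) (N := N) (K := N) N.δ N.δ) j n1 n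
          (fun t => Φ (N.δ n' n1 l1 :: t)) l2 := by
      intro n1 l1 l2
      rw [← ih (h.tail _)]
      simp only [iter_succ, bM, iter_add_fun, splitSum_add, Finset.sum_add_distrib]
    rw [iter_succ, iterF_succ]
    simp only [e, splitSum_add, Finset.sum_add_distrib]
    congr 1
    simp only [splitSum_sum]
    rw [Finset.sum_comm]
    refine Finset.sum_congr rfl fun n2 _ => ?_
    have e2 : ∀ l1 l2, N.iter j n2 n
        (fun t => Φ (compC (M := N) (N := N) (K := N) N.δ N.δ n' n2 l1 :: t)) l2 =
        ∑ n1, splitSum (fun m1 m2 => N.iter j n2 n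
          (fun t => Φ (N.δ n' n1 m1 * N.δ n1 n2 m2 :: t)) l2) l1 := by
      intro l1 l2
      rw [← iterHead_apply N h, compC, map_sum]
      simp only [map_splitSum, iterHead_apply]
    simp only [e2, splitSum_sum]
    refine Finset.sum_congr rfl fun n1 _ => ?_
    exact splitSum_assoc (fun x y z => N.iter j n2 n
      (fun t => Φ (N.δ n' n1 x * N.δ n1 n2 y :: t)) z) l

/-- The failure of the structure relation. -/
def curv (N : ADRaw B A) : Coch N N :=
  intD (M := N) (N := N) N.δ + compC (M := N) (N := N) (K := N) N.δ N.δ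

lemma iter_bar (N : ADRaw B A) (h : MultiAdd Φ) (j n' n l) : N.iter j n' n (bD A.d Φ) l + N.iter
    (j + 1) n' n (bM Φ) l + bD B.d (N.iter j n' n Φ) l + bM (N.iter j n' n Φ) l = iterF (curv N) j
    n' n Φ l := by
  have e : curv N = (fun y x l => A.d (N.δ y x l)) + (fun y x l => bD B.d (N.δ y x) l) +
      (fun y x l => bM (N.δ y x) l) + compC (M := N) (N := N) (K := N) N.δ N.δ := by
    funext y x l
    simp only [curv, Pi.add_apply, intD, barD_eq, barM_eq]
  rw [e, iterF_add _ _ h, iterF_add _ _ h, iterF_add _ _ h, iter_bD N h, iter_bM N h, bD_iter N h,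
    bM_iter N h]
  abel

end Multi

/-- Iterated structure maps applied to a sum over splittings. -/
lemma iter_splitSum [AddCommMonoid R] (N : ADRaw B A) (j n' n) (F : List A.Mor → List A.Mor → R)
    (l) : N.iter j n' n (splitSum F) l = ∑ p ∈ Finset.HasAntidiagonal.antidiagonal j, ∑ n1, splitSum
    (fun l1 l2 => N.iter p.1 n' n1 (fun t => N.iter p.2 n1 n (F t) l2) l1) l := by
  have hzero : ∀ (j : ℕ) (n' : N.G) (F : List A.Mor → List A.Mor → R) (l : List B.Mor),
      ∑ n1, splitSum (fun l1 l2 => N.iter 0 n' n1 (fun t => N.iter j n1 n (F t) l2) l1) l =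
        N.iter j n' n (F []) l := by
    intro j n' F l
    rw [Finset.sum_eq_single n']
    · simp only [iter_zero, true_and]
      exact splitSum_left_nil (N.iter j n' n (F [])) l
    · intro n1 _ hn
      refine splitSum_eq_zero fun l1 l2 _ => ?_
      rw [iter_zero, if_neg fun h => hn h.1.symm]
    · simp
  induction j generalizing n' F l with
  | zero =>
    rw [Finset.Nat.antidiagonal_zero, Finset.sum_singleton, hzero, iter_zero, iter_zero]
    simp [splitSum_nil]
  | succ j ih =>
    rw [Finset.Nat.sum_antidiagonal_succ]
    dsimp only
    rw [hzero, iter_succ, iter_succ]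
    have e : ∀ n1 l1 l2, N.iter j n1 n (fun t => splitSum F (N.δ n' n1 l1 :: t)) l2 =
        N.iter j n1 n (fun t => F [] (N.δ n' n1 l1 :: t)) l2 +
        ∑ p ∈ Finset.HasAntidiagonal.antidiagonal j, ∑ n2, splitSum (fun m1 m2 =>
          N.iter p.1 n1 n2 (fun t => N.iter p.2 n2 n (F (N.δ n' n1 l1 :: t)) m2) m1) l2 := by
      intro n1 l1 l2
      simp only [splitSum_cons, iter_add_fun]
      congr 1
      exact ih n1 (fun t => F (N.δ n' n1 l1 :: t)) l2
    simp only [e, splitSum_add, Finset.sum_add_distrib]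
    congr 1
    · simp only [splitSum_sum]
      rw [Finset.sum_comm]
      refine Finset.sum_congr rfl fun p _ => ?_
      rw [Finset.sum_comm]
      refine Finset.sum_congr rfl fun n2 _ => ?_
      simp only [iter_succ, splitSum_sum]
      refine Finset.sum_congr rfl fun n1 _ => ?_
      exact splitSum_assoc (fun x y z => N.iter p.1 n1 n2
        (fun t => N.iter p.2 n2 n (F (N.δ n' n1 x :: t)) z) y) l

end Iter

/-! ### Bilinear functions of sequences -/

section BiLin

variable {A B C E : DGCat} {R R' : Type} [AddCommGroup R] [AddCommGroup R']

/-- Functions of sequences that are bilinear over the idempotents, with objects `p` and `q` at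
the two ends. -/
structure BiLin (p q : B.Obj) (F : List B.Mor → R) : Prop where
  add : MultiAdd F
  mid : ∀ l1 a s b l2, F (l1 ++ (a * B.idem s) :: b :: l2) = F (l1 ++ a :: (B.idem s * b) :: l2)
  left : ∀ a l, F ((B.idem p * a) :: l) = F (a :: l)
  right : ∀ l a, F (l ++ [a * B.idem q]) = F (l ++ [a])
  nil : p ≠ q → F [] = 0

lemma IsCochain.biLin {M N : ADRaw B A} {p : ℤ × ℤ} {f : Coch M N} (h : IsCochain M N p f) (y x) :
    BiLin (N.l y) (M.l x) (f y x) :=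
  ⟨h.add y x, h.mid y x, h.left y x, h.right y x, h.nil y x⟩

variable {p q o : B.Obj} {F G : List B.Mor → R}

lemma BiLin.map (h : BiLin p q F) (φ : R →+ R') : BiLin p q fun l => φ (F l) where
  add := h.add.map φ
  mid l1 a s b l2 := by rw [h.mid]
  left a l := by rw [h.left]
  right l a := by rw [h.right]
  nil hpq := by rw [h.nil hpq, map_zero]

lemma BiLin.zero : BiLin p q fun _ : List B.Mor => (0 : R) :=
  ⟨MultiAdd.zero, fun _ _ _ _ _ => rfl, fun _ _ => rfl, fun _ _ => rfl, fun _ => rfl⟩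

lemma BiLin.add_fun (h : BiLin p q F) (h' : BiLin p q G) : BiLin p q fun l => F l + G l where
  add := h.add.add h'.add
  mid l1 a s b l2 := by rw [h.mid, h'.mid]
  left a l := by rw [h.left, h'.left]
  right l a := by rw [h.right, h'.right]
  nil hpq := by rw [h.nil hpq, h'.nil hpq, add_zero]

lemma BiLin.sum {ι : Type*} (s : Finset ι) (F : ι → List B.Mor → R)
    (h : ∀ i ∈ s, BiLin p q (F i)) : BiLin p q fun l => ∑ i ∈ s, F i l where
  add := MultiAdd.sum s F fun i hi => (h i hi).add
  mid l1 a s b l2 := Finset.sum_congr rfl fun i hi => (h i hi).mid ..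
  left a l := Finset.sum_congr rfl fun i hi => (h i hi).left ..
  right l a := Finset.sum_congr rfl fun i hi => (h i hi).right ..
  nil hpq := Finset.sum_eq_zero fun i hi => (h i hi).nil hpq

/-- A first entry whose left end is not `p` gives zero. -/
lemma BiLin.head_eq_zero (h : BiLin p q F) {s : B.Obj} (hs : s ≠ p) (a l) : F ((B.idem s * a) ::
    l) = 0 := by
  rw [← h.left, ← mul_assoc, B.idem_mul_of_ne _ _ (Ne.symm hs), zero_mul]
  exact h.add.zero_head l

lemma BiLin.last_eq_zero (h : BiLin p q F) {s : B.Obj} (hs : s ≠ q) (a l) : F (l ++ [a * B.idem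
    s]) = 0 := by
  rw [← h.right, mul_assoc, B.idem_mul_of_ne _ _ hs, mul_zero]
  exact h.add.zero_entry l []

lemma BiLin.splitSum {F : List B.Mor → List B.Mor → R} (h : ∀ t, BiLin p o fun s => F s t)
    (h' : ∀ s, BiLin o q (F s)) : BiLin p q (BraidAD.splitSum F) where
  add := MultiAdd.splitSum (fun t => (h t).add) fun s => (h' s).add
  mid := by
    intro l1 a s b l2
    have key : ∀ l1, F (l1 ++ [a * B.idem s]) (b :: l2) = F (l1 ++ [a]) (B.idem s * b :: l2) := by
      intro l1
      by_cases hs : s = o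
      · subst hs
        rw [(h _).right, (h' _).left]
      · rw [(h _).last_eq_zero hs, (h' _).head_eq_zero hs]
    have hm : ∀ t l1 l2, F (l1 ++ (a * B.idem s) :: b :: l2) t =
      F (l1 ++ a :: (B.idem s * b) :: l2) t := fun t l1 l2 => (h t).mid l1 a s b l2
    have hm' : ∀ t l1 l2, F t (l1 ++ (a * B.idem s) :: b :: l2) =
      F t (l1 ++ a :: (B.idem s * b) :: l2) := fun t l1 l2 => (h' t).mid l1 a s b l2
    clear h h'
    induction l1 generalizing F with
    | nil =>
      simp only [List.nil_append, splitSum_cons]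
      have k := key []
      simp only [List.nil_append] at k
      rw [k, show F [] (a * B.idem s :: b :: l2) = _ from hm' [] [] l2]
      simp only [show ∀ t1 t2, F (a * B.idem s :: b :: t1) t2 = _ from fun t1 t2 => hm t2 [] t1,
        List.nil_append]
    | cons c l1 ih =>
      simp only [List.cons_append, splitSum_cons]
      rw [show F [] (c :: (l1 ++ a * B.idem s :: b :: l2)) = _ from hm' [] (c :: l1) l2]
      rw [ih (F := fun s t => F (c :: s) t) (fun l1 => key (c :: l1))
        (fun t l1 l2 => hm t (c :: l1) l2) fun t l1 l2 => hm' (c :: t) l1 l2]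
      simp only [List.cons_append]
  left := by
    intro a l
    simp only [splitSum_cons]
    simp only [show ∀ t1 t2, F (B.idem p * a :: t1) t2 = F (a :: t1) t2 from
      fun t1 t2 => (h t2).left a t1]
    congr 1
    by_cases hp : p = o
    · subst hp; exact (h' []).left a l
    · have e : ∀ t, F [] t = 0 := fun t => (h t).nil hp
      rw [e, e]
  right := by
    intro l a
    have e0 : F [] [a * B.idem q] + F [a * B.idem q] [] = F [] [a] + F [a] [] := by
      rw [show F [] [a * B.idem q] = F [] [a] from (h' []).right [] a]
      congr 1
      by_cases hq : o = q
      · subst hq; exact (h []).right [] a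
      · rw [(h' _).nil hq, (h' _).nil hq]
    have e1 : ∀ l, F (l ++ [a * B.idem q]) [] = F (l ++ [a]) [] := by
      intro l
      by_cases hq : o = q
      · subst hq; exact (h []).right l a
      · rw [(h' _).nil hq, (h' _).nil hq]
    have e2 : ∀ s l, F s (l ++ [a * B.idem q]) = F s (l ++ [a]) := fun s l => (h' s).right l a
    clear e0 h h'
    induction l generalizing F with
    | nil =>
      simp only [List.nil_append, splitSum_cons, splitSum_nil]
      rw [show F [] [a * B.idem q] = F [] [a] from e2 [] [],
        show F [a * B.idem q] [] = F [a] [] from e1 []]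
    | cons c l ih =>
      simp only [List.cons_append, splitSum_cons]
      rw [ih (F := fun s t => F (c :: s) t) (fun l => e1 (c :: l)) fun s l => e2 (c :: s) l,
        show F [] (c :: (l ++ [a * B.idem q])) = _ from e2 [] (c :: l)]
      simp only [List.cons_append]
  nil := by
    intro hpq
    rw [splitSum_nil]
    by_cases hp : p = o
    · subst hp; exact (h' []).nil hpq
    · exact (h []).nil hp

lemma BiLin.iter (N : ADRaw B A) (hN : ∀ y x, BiLin (N.l y) (N.l x) (N.δ y x)) {Φ : List A.Mor →
    R} (h : MultiAdd Φ) (j n' n) : BiLin (N.l n') (N.l n) (N.iter j n' n Φ) := by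
  induction j generalizing n' Φ with
  | zero =>
    have : N.iter 0 n' n Φ = fun l => if n' = n ∧ l = [] then Φ [] else 0 := by
      funext l; exact iter_zero ..
    rw [this]
    refine ⟨fun l1 a b l2 => by simp, fun l1 a s b l2 => by simp, fun a l => by simp,
      fun l a => by simp, fun hn => ?_⟩
    rw [if_neg]
    rintro ⟨rfl, -⟩
    exact hn rfl
  | succ j ih =>
    have : N.iter (j + 1) n' n Φ = fun l => ∑ n1, BraidAD.splitSum (fun l1 l2 =>
      N.iter j n1 n (fun t => Φ (N.δ n' n1 l1 :: t)) l2) l := by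
      funext l; exact iter_succ ..
    rw [this]
    refine BiLin.sum _ _ fun n1 _ => BiLin.splitSum (o := N.l n1) (fun t => ?_) fun s =>
      ih (h.tail _) n1
    exact (hN n' n1).map (iterHead N h j n1 n t)

end BiLin

/-! ### Sums over all numbers of iterations -/

section Total

variable {A B C E : DGCat} {R R' : Type}

/-- Uniform right boundedness. -/
def Bdd (N : ADRaw B A) : Prop :=
  ∀ i, ∃ J, ∀ j, J ≤ j → ∀ (R : Type) [AddCommGroup R] (Φ : List A.Mor → R), MultiAdd Φ →
    ∀ y x (l : List B.Mor), l.length ≤ i → N.iter j y x Φ l = 0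

lemma IsAD.bdd {N : ADRaw B A} (h : IsAD N) : Bdd N := by
  intro i
  choose n hn using h.bounded
  refine ⟨(Finset.univ.sup fun x => (Finset.range (i + 1)).sup (n x)) + 1,
    fun j hj R _ Φ hΦ y x l hl => hn x l.length j ?_ R Φ hΦ y l rfl⟩
  refine lt_of_le_of_lt ?_ hj
  refine le_trans ?_ (Finset.le_sup (Finset.mem_univ x))
  exact Finset.le_sup (f := n x) (Finset.mem_range.mpr (Nat.lt_succ_of_le hl))

lemma Bdd.bounded {N : ADRaw B A} (h : Bdd N) (x i) : ∃ n, ∀ j, n < j → ∀ (R : Type) [AddCommGroup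
    R] (Φ : List A.Mor → R), MultiAdd Φ → ∀ y (l), l.length = i → N.iter j y x Φ l = 0 := by
  obtain ⟨J, hJ⟩ := h i
  exact ⟨J, fun j hj R _ Φ hΦ y l hl => hJ j hj.le R Φ hΦ y x l hl.le⟩

/-- The sum of all iterated structure maps. -/
def ADRaw.T [AddCommMonoid R] (N : ADRaw B A) (n' n : N.G) (Φ : List A.Mor → R)
    (l : List B.Mor) : R := ∑ᶠ j, N.iter j n' n Φ l

/-- The same with one application of `f`. -/
def TF [AddCommMonoid R] {N N' : ADRaw B A} (f : Coch N N') (n' : N'.G) (n : N.G)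
    (Φ : List A.Mor → R) (l : List B.Mor) : R := ∑ᶠ j, iterF f j n' n Φ l

lemma finsum_eq_range [AddCommMonoid R] {s : ℕ → R} {J : ℕ} (h : ∀ j, J ≤ j → s j = 0) :
    ∑ᶠ j, s j = ∑ j ∈ Finset.range J, s j := by
  refine finsum_eq_sum_of_support_subset s fun j hj => ?_
  simp only [Finset.coe_range, Set.mem_Iio]
  by_contra h'
  exact hj (h j (not_lt.mp h'))

variable [AddCommGroup R] [AddCommGroup R'] {N : ADRaw B A} {Φ Ψ : List A.Mor → R}

lemma Bdd.T_eq (hN : Bdd N) (i) : ∃ J, ∀ (R : Type) [AddCommGroup R] (Φ : List A.Mor → R),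
    MultiAdd Φ → ∀ y x (l), l.length ≤ i → ∀ K, J ≤ K → N.T y x Φ l = ∑ j ∈ Finset.range K, N.iter j
    y x Φ l := by
  obtain ⟨J, hJ⟩ := hN i
  exact ⟨J, fun R _ Φ hΦ y x l hl K hK => finsum_eq_range fun j hj =>
    hJ j (hK.trans hj) R Φ hΦ y x l hl⟩

lemma T_add (hN : Bdd N) (h : MultiAdd Φ) (h' : MultiAdd Ψ) (y x l) : N.T y x (fun t => Φ t + Ψ t)
    l = N.T y x Φ l + N.T y x Ψ l := by
  obtain ⟨J, hJ⟩ := hN.T_eq l.length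
  rw [hJ R _ (h.add h') y x l le_rfl J le_rfl, hJ R _ h y x l le_rfl J le_rfl,
    hJ R _ h' y x l le_rfl J le_rfl, ← Finset.sum_add_distrib]
  simp only [iter_add_fun]

lemma T_map (hN : Bdd N) (h : MultiAdd Φ) (φ : R →+ R') (y x l) : N.T y x (fun t => φ (Φ t)) l = φ
    (N.T y x Φ l) := by
  obtain ⟨J, hJ⟩ := hN.T_eq l.length
  rw [hJ R' _ (h.map φ) y x l le_rfl J le_rfl, hJ R _ h y x l le_rfl J le_rfl, map_sum]
  simp only [iter_map]

lemma T_zero (N : ADRaw B A) (y x l) : N.T y x (fun _ => (0 : R)) l = 0 := by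
  simp [ADRaw.T, iter_zero_fun]

lemma T_sum (hN : Bdd N) {ι : Type*} (s : Finset ι) (Φ : ι → List A.Mor → R) (h : ∀ i ∈ s,
    MultiAdd (Φ i)) (y x l) : N.T y x (fun t => ∑ i ∈ s, Φ i t) l = ∑ i ∈ s, N.T y x (Φ i) l := by
  obtain ⟨J, hJ⟩ := hN.T_eq l.length
  rw [hJ R _ (MultiAdd.sum s Φ h) y x l le_rfl J le_rfl,
    Finset.sum_congr rfl fun i hi => hJ R _ (h i hi) y x l le_rfl J le_rfl, Finset.sum_comm]
  simp only [iter_sum_fun]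

lemma BiLin.T (hN : Bdd N) (hN' : ∀ y x, BiLin (N.l y) (N.l x) (N.δ y x)) (h : MultiAdd Φ) (y x) :
    BiLin (N.l y) (N.l x) (N.T y x Φ) := by
  have key : ∀ i, ∃ J, ∀ l : List B.Mor, l.length ≤ i →
      N.T y x Φ l = ∑ j ∈ Finset.range J, N.iter j y x Φ l := fun i => by
    obtain ⟨J, hJ⟩ := hN.T_eq i
    exact ⟨J, fun l hl => hJ R Φ h y x l hl J le_rfl⟩
  have hs : ∀ J, BiLin (N.l y) (N.l x) fun l => ∑ j ∈ Finset.range J, N.iter j y x Φ l :=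
    fun J => BiLin.sum _ _ fun j _ => BiLin.iter N hN' h j y x
  constructor
  · intro l1 a b l2
    obtain ⟨J, hJ⟩ := key (l1 ++ (a + b) :: l2).length
    rw [hJ _ le_rfl, hJ _ (by simp), hJ _ (by simp)]
    exact (hs J).add l1 a b l2
  · intro l1 a s b l2
    obtain ⟨J, hJ⟩ := key (l1 ++ (a * B.idem s) :: b :: l2).length
    rw [hJ _ le_rfl, hJ _ (by simp), (hs J).mid]
  · intro a l
    obtain ⟨J, hJ⟩ := key (a :: l).length
    rw [hJ _ (by simp), hJ _ (by simp), (hs J).left]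
  · intro l a
    obtain ⟨J, hJ⟩ := key (l ++ [a]).length
    rw [hJ _ (by simp), hJ _ (by simp), (hs J).right]
  · intro hn
    obtain ⟨J, hJ⟩ := key 0
    rw [hJ _ (by simp), (hs J).nil hn]

lemma MultiAdd.iterIter {N : ADRaw B A} {F : List A.Mor → List A.Mor → R} (h : ∀ t, MultiAdd fun s
    => F s t) (j n' n l) : MultiAdd fun t => N.iter j n' n (F t) l := by
  intro l1 a b l2
  simp only [← iter_add_fun]
  congr 1
  funext t
  exact h t l1 a b l2

lemma MultiAdd.TT (hN : Bdd N) {F : List A.Mor → List A.Mor → R} (h : ∀ t, MultiAdd fun s => F s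
    t) (h' : ∀ s, MultiAdd (F s)) (n' n l) : MultiAdd fun t => N.T n' n (F t) l := by
  intro l1 a b l2
  dsimp only
  rw [← T_add hN (h' _) (h' _)]
  congr 1
  funext t
  exact h t l1 a b l2

lemma sum_antidiagonal_range {M : Type*} [AddCommMonoid M] (J) (s : ℕ → ℕ → M) (h : ∀ a b, J ≤ a ∨
    J ≤ b → s a b = 0) : ∑ j ∈ Finset.range (2 * J), ∑ p ∈ Finset.HasAntidiagonal.antidiagonal j, s
    p.1 p.2 = ∑ a ∈ Finset.range J, ∑ b ∈ Finset.range J, s a b := by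
  rw [Finset.sum_sigma', ← Finset.sum_product']
  symm
  refine Finset.sum_of_injOn (fun p => ⟨p.1 + p.2, p⟩) ?_ ?_ ?_ ?_
  · intro p _ q _ hpq
    simpa using congrArg (fun x => x.2) hpq
  · intro p hp
    simp only [Finset.coe_product, Finset.coe_range, Set.mem_prod, Set.mem_Iio] at hp
    simp only [Finset.coe_sigma, Set.mem_sigma_iff, Finset.mem_coe, Finset.mem_range,
      Finset.HasAntidiagonal.mem_antidiagonal]
    exact ⟨by omega, trivial⟩
  · rintro ⟨j, p⟩ hp hp'
    refine h _ _ ?_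
    by_contra hc
    push Not at hc
    refine hp' ⟨p, by simpa using hc, ?_⟩
    simp only [Finset.mem_sigma, Finset.HasAntidiagonal.mem_antidiagonal] at hp
    dsimp only
    rw [hp.2]
  · intros; rfl

lemma T_splitSum (hN : Bdd N) {F : List A.Mor → List A.Mor → R} (h : ∀ t, MultiAdd fun s => F s t)
    (h' : ∀ s, MultiAdd (F s)) (n' n l) : N.T n' n (splitSum F) l = ∑ n1, splitSum (fun l1 l2 => N.T
    n' n1 (fun t => N.T n1 n (F t) l2) l1) l := by
  obtain ⟨J, hJ⟩ := hN l.length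
  have e1 : N.T n' n (splitSum F) l = ∑ j ∈ Finset.range (2 * J), N.iter j n' n (splitSum F) l :=
    finsum_eq_range fun j hj => hJ j (by omega) R _ (MultiAdd.splitSum h h') _ _ l le_rfl
  have e2 : ∀ n1 l1 l2, l1 ++ l2 = l → N.T n' n1 (fun t => N.T n1 n (F t) l2) l1 =
      ∑ a ∈ Finset.range J, ∑ b ∈ Finset.range J,
        N.iter a n' n1 (fun t => N.iter b n1 n (F t) l2) l1 := by
    intro n1 l1 l2 hl
    have e3 : ∀ t, N.T n1 n (F t) l2 = ∑ b ∈ Finset.range J, N.iter b n1 n (F t) l2 := fun t =>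
      finsum_eq_range fun j hj => hJ j hj R _ (h' t) _ _ l2 (by simp [← hl])
    have e4 : N.T n' n1 (fun t => N.T n1 n (F t) l2) l1 =
        ∑ a ∈ Finset.range J, N.iter a n' n1 (fun t => N.T n1 n (F t) l2) l1 :=
      finsum_eq_range fun j hj => hJ j hj R _ (MultiAdd.TT hN h h' n1 n l2) _ _ l1 (by simp [← hl])
    rw [e4]
    simp only [e3, iter_sum_fun]
  rw [e1]
  simp only [iter_splitSum]
  rw [sum_antidiagonal_range J (fun a b => ∑ n1, splitSum (fun l1 l2 =>
        N.iter a n' n1 (fun t => N.iter b n1 n (F t) l2) l1) l)]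
  · rw [Finset.sum_congr rfl fun n1 _ => splitSum_congr fun l1 l2 hl => e2 n1 l1 l2 hl]
    simp only [splitSum_sum]
    rw [Finset.sum_comm]
    rw [Finset.sum_congr rfl fun n1 _ => Finset.sum_comm]
    rw [Finset.sum_comm]
    rw [Finset.sum_congr rfl fun n1 _ => Finset.sum_comm]
  · intro a b hab
    refine Finset.sum_eq_zero fun n1 _ => splitSum_eq_zero fun l1 l2 hl => ?_
    rcases hab with ha | hb
    · exact hJ a ha R _ (MultiAdd.iterIter h b n1 n l2) _ _ l1 (by simp [← hl])
    · rw [show (fun t => N.iter b n1 n (F t) l2) = fun _ => 0 from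
        funext fun t => hJ b hb R _ (h' t) _ _ l2 (by simp [← hl]), iter_zero_fun]

lemma T_conv {N : ADRaw C B} (hN : Bdd N) {g h : List B.Mor → A.Mor} (hg : MultiAdd g) (hh :
    MultiAdd h) (n' n l) : N.T n' n (conv g h) l = ∑ n1, conv (N.T n' n1 g) (N.T n1 n h) l := by
  rw [conv, T_splitSum (F := fun s t => g s * h t) hN
    (fun t => hg.map (AddMonoidHom.mulRight (h t))) fun s => hh.map (AddMonoidHom.mulLeft (g s))]
  refine Finset.sum_congr rfl fun n1 _ => splitSum_congr fun l1 l2 _ => ?_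
  rw [show (fun t => N.T n1 n (fun l2 => g t * h l2) l2) = fun t =>
    AddMonoidHom.mulRight (N.T n1 n h l2) (g t) from
    funext fun t => T_map hN hh (AddMonoidHom.mulLeft (g t)) n1 n l2, T_map hN hg]
  rfl

end Total

/-! ### Cones -/

section Cone

variable {A B C E : DGCat} {R R' : Type}

/-- `Q` is the sum of `N` and `N'` (included by `i` and `i'`) with `f : N → N'` added to the
structure map. -/
structure IsCone {N N' Q : ADRaw B A} (f : Coch N N') (i : N.G → Q.G) (i' : N'.G → Q.G) :
    Prop where
  bij : Function.Bijective (Sum.elim i i')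
  δ_ii : ∀ y x, Q.δ (i y) (i x) = N.δ y x
  δ_tt : ∀ y x, Q.δ (i' y) (i' x) = N'.δ y x
  δ_ti : ∀ y x, Q.δ (i' y) (i x) = f y x
  δ_it : ∀ y x l, Q.δ (i y) (i' x) l = 0
  l_i : ∀ x, Q.l (i x) = N.l x
  l_t : ∀ x, Q.l (i' x) = N'.l x
  r_i : ∀ x, Q.r (i x) = N.r x
  r_t : ∀ x, Q.r (i' x) = N'.r x

namespace IsCone

variable {N N' Q : ADRaw B A} {f : Coch N N'} {i : N.G → Q.G} {i' : N'.G → Q.G}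

lemma sum [AddCommMonoid R] (h : IsCone f i i') (F : Q.G → R) :
    ∑ q, F q = ∑ x, F (i x) + ∑ y, F (i' y) := by
  rw [← (Equiv.ofBijective _ h.bij).sum_comp, Fintype.sum_sum_type]
  rfl

lemma cases (h : IsCone f i i') {P : Q.G → Prop} (h1 : ∀ x, P (i x)) (h2 : ∀ y, P (i' y)) (q) : P
    q := by
  obtain ⟨x | y, rfl⟩ := h.bij.2 q
  · exact h1 x
  · exact h2 y

lemma inj (h : IsCone f i i') {x y : N.G} : i x = i y ↔ x = y :=
  ⟨fun e => Sum.inl_injective (h.bij.1 (a₁ := .inl x) (a₂ := .inl y) e), fun e => e ▸ rfl⟩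

lemma inj' (h : IsCone f i i') {x y : N'.G} : i' x = i' y ↔ x = y :=
  ⟨fun e => Sum.inr_injective (h.bij.1 (a₁ := .inr x) (a₂ := .inr y) e), fun e => e ▸ rfl⟩

lemma ne (h : IsCone f i i') (x y) : i x ≠ i' y := fun e =>
  Sum.inl_ne_inr (h.bij.1 (a₁ := .inl x) (a₂ := .inr y) e)

variable [AddCommGroup R] {Φ : List A.Mor → R}

lemma iter_it (h : IsCone f i i') (hΦ : MultiAdd Φ) (j y x l) : Q.iter j (i y) (i' x) Φ l = 0
    := by
  induction j generalizing y Φ l with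
  | zero => rw [iter_zero, if_neg fun e => h.ne _ _ e.1]
  | succ j ih =>
    rw [iter_succ, h.sum]
    simp only [ih (hΦ.tail _), h.δ_it, iter_zero_head _ hΦ, splitSum_zero, Finset.sum_const_zero,
      add_zero]

lemma iter_ii (h : IsCone f i i') (hΦ : MultiAdd Φ) (j y x l) : Q.iter j (i y) (i x) Φ l = N.iter
    j y x Φ l := by
  induction j generalizing y Φ l with
  | zero => simp only [iter_zero, h.inj]
  | succ j ih =>
    rw [iter_succ, h.sum, iter_succ]
    simp only [ih (hΦ.tail _), h.δ_it, h.δ_ii, iter_zero_head _ hΦ, splitSum_zero,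
      Finset.sum_const_zero, add_zero]

lemma iter_tt (h : IsCone f i i') (hΦ : MultiAdd Φ) (j y x l) : Q.iter j (i' y) (i' x) Φ l =
    N'.iter j y x Φ l := by
  induction j generalizing y Φ l with
  | zero => simp only [iter_zero, h.inj']
  | succ j ih =>
    rw [iter_succ, h.sum, iter_succ]
    simp only [ih (hΦ.tail _), h.δ_tt, h.iter_it (hΦ.tail _), splitSum_zero,
      Finset.sum_const_zero, zero_add]

lemma iter_ti (h : IsCone f i i') (hΦ : MultiAdd Φ) (j y x l) : Q.iter j (i' y) (i x) Φ l = iterF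
    f j y x Φ l := by
  induction j generalizing y Φ l with
  | zero => rw [iter_zero, iterF_zero, if_neg fun e => h.ne _ _ e.1.symm]
  | succ j ih =>
    rw [iter_succ, h.sum, iterF_succ]
    simp only [ih (hΦ.tail _), h.δ_tt, h.δ_ti, h.iter_ii (hΦ.tail _)]

lemma T_ii (h : IsCone f i i') (hΦ : MultiAdd Φ) (y x l) : Q.T (i y) (i x) Φ l = N.T y x Φ l := by
  simp only [ADRaw.T, h.iter_ii hΦ]

lemma T_tt (h : IsCone f i i') (hΦ : MultiAdd Φ) (y x l) : Q.T (i' y) (i' x) Φ l = N'.T y x Φ l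
    := by
  simp only [ADRaw.T, h.iter_tt hΦ]

lemma T_ti (h : IsCone f i i') (hΦ : MultiAdd Φ) (y x l) : Q.T (i' y) (i x) Φ l = TF f y x Φ l
    := by
  simp only [ADRaw.T, TF, h.iter_ti hΦ]

lemma T_it (h : IsCone f i i') (hΦ : MultiAdd Φ) (y x l) : Q.T (i y) (i' x) Φ l = 0 := by
  simp only [ADRaw.T, h.iter_it hΦ, finsum_zero]

lemma bdd (h : IsCone f i i') (hN : Bdd N) (hN' : Bdd N') : Bdd Q := by
  intro k
  obtain ⟨J, hJ⟩ := hN k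
  obtain ⟨J', hJ'⟩ := hN' k
  refine ⟨J' + J, fun j hj R _ Φ hΦ y x l hl => ?_⟩
  obtain ⟨b, rfl⟩ := Nat.exists_eq_add_of_le (show J' ≤ j by omega)
  have hb : J ≤ b := by omega
  rw [iter_plus]
  refine Finset.sum_eq_zero fun q _ => splitSum_eq_zero fun l1 l2 hll => ?_
  have h1 : l1.length ≤ k := by rw [← hll] at hl; simp at hl; omega
  have h2 : l2.length ≤ k := by rw [← hll] at hl; simp at hl; omega
  have hm : ∀ t, MultiAdd fun t' => Φ (t ++ t') := fun t s a b s' => by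
    have := hΦ (t ++ s) a b s'; simpa only [List.append_assoc] using this
  have hm' : MultiAdd fun t => Q.iter b q x (fun t' => Φ (t ++ t')) l2 :=
    MultiAdd.iterIter (fun t' s a b s' => by
      have := hΦ s a b (s' ++ t'); simpa only [List.append_assoc, List.cons_append] using this)
        b q x l2
  induction q using h.cases with
  | h1 q =>
    rw [show (fun t => Q.iter b (i q) x (fun t' => Φ (t ++ t')) l2) = fun _ => 0 from ?_,
      iter_zero_fun]
    funext t
    induction x using h.cases with
    | h1 x => rw [h.iter_ii (hm t), hJ b hb R _ (hm t) _ _ _ h2]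
    | h2 x => rw [h.iter_it (hm t)]
  | h2 q =>
    induction y using h.cases with
    | h1 y => rw [h.iter_it hm']
    | h2 y => rw [h.iter_tt hm', hJ' J' le_rfl R _ hm' _ _ _ h1]

lemma iterF_cone (h : IsCone f i i') {e : Coch Q Q} (h1 : ∀ y x l, e (i y) (i x) l = 0)
    (h2 : ∀ y x l, e (i' y) (i' x) l = 0) (h3 : ∀ y x l, e (i y) (i' x) l = 0) (hΦ : MultiAdd Φ)
    (j y x l) :
    iterF e j (i' y) (i x) Φ l =
      iterF (N := N) (N' := N') (fun y x => e (i' y) (i x)) j y x Φ l := by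
  have aux : ∀ (j : ℕ) (y : N.G) (Φ : List A.Mor → R) (l : List B.Mor), MultiAdd Φ →
      iterF e j (i y) (i x) Φ l = 0 := by
    intro j
    induction j with
    | zero => intros; rw [iterF_zero]
    | succ j ih =>
      intro y Φ l hΦ
      rw [iterF_succ, h.sum, h.sum]
      simp only [h1, h3, h.δ_it, iter_zero_head _ hΦ, iterF_zero_head _ hΦ, ih _ _ _ (hΦ.tail _),
        splitSum_zero, Finset.sum_const_zero, add_zero]
  induction j generalizing y Φ l with
  | zero => simp only [iterF_zero]
  | succ j ih =>
    rw [iterF_succ, h.sum, h.sum, iterF_succ]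
    simp only [h2, iter_zero_head _ hΦ, aux _ _ _ _ (hΦ.tail _), ih (hΦ.tail _), h.δ_tt,
      h.iter_ii (hΦ.tail _), splitSum_zero, Finset.sum_const_zero, add_zero, zero_add]

/-- The structure relation of a cone. -/
lemma curv_ti (h : IsCone f i i') (y x) : curv Q (i' y) (i x) = dMor N N' f y x := by
  funext l
  rw [curv, dMor_apply, Pi.add_apply, Pi.add_apply, Pi.add_apply, intD_eq, compC_apply, h.sum]
  simp only [h.δ_ti, h.δ_ii, h.δ_tt, Pi.add_apply, compC_apply, intD_eq]
  abel

lemma curv_ii (h : IsCone f i i') (y x) : curv Q (i y) (i x) = curv N y x := by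
  funext l
  rw [curv, curv, Pi.add_apply, Pi.add_apply, Pi.add_apply, intD_eq, compC_apply, h.sum]
  simp only [h.δ_ii, Pi.add_apply, compC_apply, intD_eq, conv_eq_zero_left (h.δ_it y _),
    Finset.sum_const_zero, add_zero]

lemma curv_tt (h : IsCone f i i') (y x) : curv Q (i' y) (i' x) = curv N' y x := by
  funext l
  rw [curv, curv, Pi.add_apply, Pi.add_apply, Pi.add_apply, intD_eq, compC_apply, h.sum]
  simp only [h.δ_tt, Pi.add_apply, compC_apply, intD_eq, conv_eq_zero_right (h.δ_it _ x),
    Finset.sum_const_zero, zero_add]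

lemma curv_it (h : IsCone f i i') (y x l) : curv Q (i y) (i' x) l = 0 := by
  have e : Q.δ (i y) (i' x) = fun _ => 0 := funext (h.δ_it y x)
  rw [curv, Pi.add_apply, Pi.add_apply, Pi.add_apply, intD_eq, compC_apply, h.sum, e, cD_zero]
  simp only [conv_eq_zero_left (h.δ_it y _), conv_eq_zero_right (h.δ_it _ x),
    Finset.sum_const_zero, add_zero]

end IsCone

/-- The cone of `f`; degrees are shifted so that a morphism `f` of bidegree `p` becomes a map of
bidegree `(0, 1)`. -/
def coneRaw {N N' : ADRaw B A} (f : Coch N N') (p : ℤ × ℤ) : ADRaw B A where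
  G := N.G ⊕ N'.G
  l := Sum.elim N.l N'.l
  r := Sum.elim N.r N'.r
  deg := Sum.elim N.deg fun y => N'.deg y + (0, 1) - p
  δ
    | .inl y, .inl x => N.δ y x
    | .inr y, .inr x => N'.δ y x
    | .inr y, .inl x => f y x
    | .inl _, .inr _ => fun _ => 0

lemma exists_isCone {N N' : ADRaw B A} (f : Coch N N') (p : ℤ × ℤ) :
    ∃ (Q : ADRaw B A) (i : N.G → Q.G) (i' : N'.G → Q.G), IsCone f i i' ∧
      (∀ x, Q.deg (i x) = N.deg x) ∧ ∀ y, Q.deg (i' y) = N'.deg y + (0, 1) - p := by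
  refine ⟨coneRaw f p, Sum.inl, Sum.inr, ⟨?_, fun _ _ => rfl, fun _ _ => rfl, fun _ _ => rfl,
    fun _ _ _ => rfl, fun _ => rfl, fun _ => rfl, fun _ => rfl, fun _ => rfl⟩, fun _ => rfl,
    fun _ => rfl⟩
  change Function.Bijective (Sum.elim (Sum.inl : N.G → N.G ⊕ N'.G) Sum.inr)
  rw [Sum.elim_inl_inr]
  exact Function.bijective_id

end Cone

/-! ### The differential and iterated structure maps -/

section Diff

variable {A B C E : DGCat} {R : Type} [AddCommGroup R]

lemma bD_congr_len {α : Type} {d : α → α} {F G : List α → R} {l : List α}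
    (h : ∀ t, t.length ≤ l.length → F t = G t) : bD d F l = bD d G l := by
  induction l generalizing F G with
  | nil => rfl
  | cons a l ih =>
    simp only [bD]
    rw [h _ (by simp), ih fun t ht => h _ (by simpa using ht)]

lemma bM_congr_len {α : Type} [Mul α] {F G : List α → R} {l : List α}
    (h : ∀ t, t.length ≤ l.length → F t = G t) : bM F l = bM G l := by
  induction l generalizing F G with
  | nil => rfl
  | cons a l ih =>
    cases l with
    | nil => rfl
    | cons b l =>
      simp only [bM]
      rw [h _ (by simp), ih fun t ht => h _ (by simpa using ht)]

lemma MultiAdd.bD {Φ : List A.Mor → R} (h : MultiAdd Φ) : MultiAdd (bD A.d Φ) := by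
  intro l1 a b l2
  induction l1 generalizing Φ with
  | nil =>
    simp only [List.nil_append, BraidAD.bD, map_add, h.head, bD_add]; abel
  | cons c l1 ih =>
    simp only [List.cons_append, BraidAD.bD]
    rw [ih (h.tail c), show Φ (A.d c :: (l1 ++ (a + b) :: l2)) = _ from h (A.d c :: l1) a b l2]
    simp only [List.cons_append]; abel

lemma MultiAdd.bM {Φ : List A.Mor → R} (h : MultiAdd Φ) : MultiAdd (bM Φ) := by
  intro l1 a b l2
  induction l1 generalizing Φ with
  | nil =>
    cases l2 with
    | nil => simp [BraidAD.bM]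
    | cons c l2 => simp only [List.nil_append, BraidAD.bM, add_mul, h.head, bM_add]; abel
  | cons c l1 ih =>
    cases l1 with
    | nil =>
      have := ih (h.tail c)
      simp only [List.nil_append, List.cons_append, BraidAD.bM] at this ⊢
      rw [this, mul_add, h.head]; abel
    | cons e l1 =>
      have := ih (h.tail c)
      simp only [List.cons_append, BraidAD.bM] at this ⊢
      rw [this, show Φ (c * e :: (l1 ++ (a + b) :: l2)) = _ from h (c * e :: l1) a b l2]
      simp only [List.cons_append]; abel

lemma MultiAdd.cD {Φ : List B.Mor → A.Mor} (h : MultiAdd Φ) : MultiAdd (cD Φ) :=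
  ((h.map A.d).add h.bD).add h.bM

lemma T_cD {N : ADRaw C B} (hN : Bdd N) {Φ : List B.Mor → A.Mor} (h : MultiAdd Φ) (n' n l) : N.T
    n' n (cD Φ) l + cD (N.T n' n Φ) l = TF (curv N) n' n Φ l := by
  obtain ⟨J, hJ⟩ := hN l.length
  have hT : ∀ t : List C.Mor, t.length ≤ l.length →
      N.T n' n Φ t = ∑ j ∈ Finset.range J, N.iter j n' n Φ t := fun t ht =>
    finsum_eq_range fun j hj => hJ j hj _ _ h _ _ t ht
  have e0 : N.T n' n (cD Φ) l = A.d (N.T n' n Φ l) + N.T n' n (bD B.d Φ) l + N.T n' n (bM Φ) l := by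
    rw [show cD Φ = fun t => (A.d (Φ t) + bD B.d Φ t) + bM Φ t from rfl,
      T_add hN ((h.map A.d).add h.bD) h.bM, T_add hN (h.map A.d) h.bD, T_map hN h]
  have e1 : cD (N.T n' n Φ) l = A.d (N.T n' n Φ l) +
      ∑ j ∈ Finset.range J, bD C.d (N.iter j n' n Φ) l +
      ∑ j ∈ Finset.range J, bM (N.iter j n' n Φ) l := by
    rw [cD, bD_congr_len hT, bM_congr_len hT, bD_sum, bM_sum]
  have e2 : N.T n' n (bM Φ) l = ∑ j ∈ Finset.range J, N.iter (j + 1) n' n (bM Φ) l := by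
    rw [ADRaw.T, finsum_eq_range (J := J + 1) fun j hj => hJ j (by omega) _ _ h.bM _ _ l le_rfl,
      Finset.sum_range_succ']
    simp [iter_zero, bM]
  have e3 : N.T n' n (bD B.d Φ) l = ∑ j ∈ Finset.range J, N.iter j n' n (bD B.d Φ) l :=
    finsum_eq_range fun j hj => hJ j hj _ _ h.bD _ _ l le_rfl
  have hv : ∀ j, J ≤ j → iterF (curv N) j n' n Φ l = 0 := by
    intro j hj
    have z : ∀ t : List C.Mor, t.length ≤ l.length → N.iter j n' n Φ t = 0 :=
      fun t ht => hJ j hj _ _ h _ _ t ht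
    rw [← iter_bar N h, hJ j hj _ _ h.bD _ _ l le_rfl, hJ (j + 1) (by omega) _ _ h.bM _ _ l le_rfl,
      bD_congr_len (G := fun _ => 0) z, bM_congr_len (G := fun _ => 0) z, bD_zero, bM_zero]
    simp
  rw [e0, e1, e2, e3, TF, finsum_eq_range hv]
  simp only [← iter_bar N h, Finset.sum_add_distrib]
  have aux : ∀ d a b c e : A.Mor, d + a + b + (d + c + e) = a + b + c + e := by
    intro d a b c e
    calc _ = (d + d) + (a + b + c + e) := by abel
      _ = _ := by rw [A.add_self, zero_add]
  exact aux _ _ _ _ _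

lemma TF_zero_left {N N' : ADRaw B A} {Φ : List A.Mor → R} (h : MultiAdd Φ) (n' n l) : TF (0 :
    Coch N N') n' n Φ l = 0 := by
  simp only [TF, iterF_zero_left h, finsum_zero]

lemma exists_iterF_eq_zero {N N' : ADRaw B A} (hN : Bdd N) (hN' : Bdd N') (f : Coch N N') (i) : ∃
    J, ∀ j, J ≤ j → ∀ (R : Type) [AddCommGroup R] (Φ : List A.Mor → R), MultiAdd Φ → ∀ y x (l),
    l.length ≤ i → iterF f j y x Φ l = 0 := by
  obtain ⟨Q, ι, ι', hQ, -⟩ := exists_isCone f 0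
  obtain ⟨J, hJ⟩ := hQ.bdd hN hN' i
  refine ⟨J, fun j hj R _ Φ hΦ y x l hl => ?_⟩
  rw [← hQ.iter_ti hΦ, hJ j hj R Φ hΦ _ _ l hl]

lemma TF_add {N N' : ADRaw B A} (hN : Bdd N) (hN' : Bdd N') (f g : Coch N N') {Φ : List A.Mor → R}
    (h : MultiAdd Φ) (n' n l) : TF (f + g) n' n Φ l = TF f n' n Φ l + TF g n' n Φ l := by
  obtain ⟨J, hJ⟩ := exists_iterF_eq_zero hN hN' f l.length
  obtain ⟨J', hJ'⟩ := exists_iterF_eq_zero hN hN' g l.length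
  have e1 : ∀ j, J + J' ≤ j → iterF f j n' n Φ l = 0 := fun j hj =>
    hJ j (by omega) R Φ h n' n l le_rfl
  have e2 : ∀ j, J + J' ≤ j → iterF g j n' n Φ l = 0 := fun j hj =>
    hJ' j (by omega) R Φ h n' n l le_rfl
  have e3 : ∀ j, J + J' ≤ j → iterF (f + g) j n' n Φ l = 0 := fun j hj => by
    rw [iterF_add _ _ h, e1 j hj, e2 j hj, add_zero]
  rw [TF, TF, TF, finsum_eq_range e1, finsum_eq_range e2, finsum_eq_range e3,
    ← Finset.sum_add_distrib]
  simp only [iterF_add _ _ h]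

/-- The differential of a morphism and sums of iterated structure maps. -/
lemma TF_cD {N N' : ADRaw C B} (hN : Bdd N) (hN' : Bdd N') (hc : curv N = 0) (hc' : curv N' = 0)
    (f : Coch N N') {Φ : List B.Mor → A.Mor} (h : MultiAdd Φ) (n' n l) : TF f n' n (cD Φ) l + cD (TF
    f n' n Φ) l = TF (dMor N N' f) n' n Φ l := by
  obtain ⟨Q, ι, ι', hQ, -⟩ := exists_isCone f 0
  have e := T_cD (hQ.bdd hN hN') h (ι' n') (ι n) l
  have e2 : Q.T (ι' n') (ι n) Φ = TF f n' n Φ :=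
    funext fun l => hQ.T_ti h n' n l
  rw [hQ.T_ti h.cD, e2] at e
  rw [e]
  simp only [TF]
  congr 1
  funext j
  rw [hQ.iterF_cone _ _ _ h]
  · simp only [hQ.curv_ti]
  · intro y x l; rw [hQ.curv_ii, hc]; rfl
  · intro y x l; rw [hQ.curv_tt, hc']; rfl
  · exact hQ.curv_it

lemma TF_conv {N N' : ADRaw C B} (hN : Bdd N) (hN' : Bdd N') (f : Coch N N') {g h : List B.Mor →
    A.Mor} (hg : MultiAdd g) (hh : MultiAdd h) (n' n l) : TF f n' n (conv g h) l = ∑ n1, conv (TF f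
    n' n1 g) (N.T n1 n h) l + ∑ n1, conv (N'.T n' n1 g) (TF f n1 n h) l := by
  obtain ⟨Q, ι, ι', hQ, -⟩ := exists_isCone f 0
  have hgh : MultiAdd (conv g h) := MultiAdd.splitSum
    (fun t => hg.map (AddMonoidHom.mulRight (h t))) fun s => hh.map (AddMonoidHom.mulLeft (g s))
  rw [← hQ.T_ti hgh, T_conv (hQ.bdd hN hN') hg hh, hQ.sum]
  have e1 : ∀ y x, Q.T (ι' y) (ι x) g = TF f y x g := fun y x =>
    funext fun l => hQ.T_ti hg y x l
  have e2 : ∀ y x, Q.T (ι' y) (ι x) h = TF f y x h := fun y x =>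
    funext fun l => hQ.T_ti hh y x l
  have e3 : ∀ y x, Q.T (ι' y) (ι' x) g = N'.T y x g := fun y x =>
    funext fun l => hQ.T_tt hg y x l
  have e4 : ∀ y x, Q.T (ι y) (ι x) h = N.T y x h := fun y x =>
    funext fun l => hQ.T_ii hh y x l
  simp only [e1, e2, e3, e4]

end Diff

section Box

variable {A B C E : DGCat} {R R' : Type}

/-! ### Homogeneity and unitality of iterated structure maps -/

/-- Functions of sequences that are homogeneous, the `i`-th entry being shifted by one. -/
def HasDeg (c : ℤ × ℤ) (F : List B.Mor → A.Mor) : Prop :=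
  ∀ (l : List B.Mor) (ds : List (ℤ × ℤ)), List.Forall₂ (fun a d => a ∈ B.gr d) l ds →
    F l ∈ A.gr (c + (ds.map fun d => d - (0, 1)).sum)

lemma splitSum_mem [AddCommGroup R] {α : Type} (S : AddSubgroup R) {F : List α → List α → R}
    {l : List α} (h : ∀ i, F (l.take i) (l.drop i) ∈ S) : splitSum F l ∈ S :=
  sum_mem fun i _ => h i

lemma take_drop_sum (ds : List (ℤ × ℤ)) (i) : ((ds.take i).map fun d => d - (0, 1)).sum +
    ((ds.drop i).map fun d => d - (0, 1)).sum = (ds.map fun d => d - (0, 1)).sum := by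
  conv_rhs => rw [← List.take_append_drop i ds]
  rw [List.map_append, List.sum_append]

lemma HasDeg.conv {c c' : ℤ × ℤ} {f g : List B.Mor → A.Mor} (hf : HasDeg c f)
    (hg : HasDeg c' g) : HasDeg (c + c') (conv f g) := by
  intro l ds h
  refine splitSum_mem _ fun i => ?_
  have := A.gr_mul _ _ _ _ (hf _ _ (List.forall₂_take i h)) (hg _ _ (List.forall₂_drop i h))
  convert this using 2
  rw [← take_drop_sum ds i]
  abel

lemma HasDeg.iter {N : ADRaw C B} (hN : ∀ y x, HasDeg ((0, 1) + N.deg x - N.deg y) (N.δ y x)) {c :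
    ℤ × ℤ} {Φ : List B.Mor → A.Mor} (hΦ : HasDeg c Φ) (j y x) : HasDeg (c + N.deg x - N.deg y)
    (N.iter j y x Φ) := by
  induction j generalizing y c Φ with
  | zero =>
    intro l ds h
    rw [iter_zero]
    split_ifs with h'
    · obtain ⟨rfl, rfl⟩ := h'
      cases h
      have := hΦ [] [] List.Forall₂.nil
      simpa using this
    · exact zero_mem _
  | succ j ih =>
    intro l ds h
    rw [iter_succ]
    refine sum_mem fun n _ => splitSum_mem _ fun i => ?_
    have h₁ := hN y n _ _ (List.forall₂_take i h)
    set b := N.δ y n (l.take i) with hb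
    have h₂ : HasDeg (c + ((0, 1) + N.deg n - N.deg y +
        ((ds.take i).map fun d => d - (0, 1)).sum - (0, 1))) (fun t => Φ (b :: t)) := by
      intro t es ht
      have := hΦ (b :: t) _ (List.Forall₂.cons h₁ ht)
      convert this using 2
      simp only [List.map_cons, List.sum_cons]
      abel
    have := ih h₂ n _ _ (List.forall₂_drop i h)
    convert this using 2
    rw [← take_drop_sum ds i]
    abel

lemma iter_one [AddCommMonoid R] (N : ADRaw B A) (n' n) (Φ : List A.Mor → R) (l) : N.iter 1 n' n Φ
    l = Φ [N.δ n' n l] := by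
  rw [iter_succ, Finset.sum_eq_single n]
  · simp only [iter_zero, true_and]
    exact splitSum_right_nil (fun t => Φ [N.δ n' n t]) l
  · intro n1 _ h
    exact splitSum_eq_zero fun l1 l2 _ => by rw [iter_zero, if_neg fun h' => h h'.1]
  · simp

lemma iterF_one [AddCommMonoid R] {N N' : ADRaw B A} (f : Coch N N') (n' n) (Φ : List A.Mor → R)
    (l) : iterF f 1 n' n Φ l = Φ [f n' n l] := by
  rw [iterF_succ, Finset.sum_eq_single n]
  · simp only [iter_zero, true_and, iterF_zero, splitSum_zero, Finset.sum_const_zero, add_zero]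
    exact splitSum_right_nil (fun t => Φ [f n' n t]) l
  · intro n1 _ h
    exact splitSum_eq_zero fun l1 l2 _ => by rw [iter_zero, if_neg fun h' => h h'.1]
  · simp

lemma iter_idem [AddCommGroup R] {N : ADRaw B A} (h₁ : ∀ y x s, N.δ y x [B.idem s] = if y = x ∧
    N.l x = s then A.idem (N.r x) else 0) (h₂ : ∀ y x l s, 2 ≤ l.length → B.idem s ∈ l → N.δ y x l =
    0) {Φ : List A.Mor → R} (hΦ : MultiAdd Φ) (j) (hj : ∀ t s, t.length = j → A.idem s ∈ t → Φ t =
    0) (y x) {l : List B.Mor} {s : B.Obj} (hs : B.idem s ∈ l) : N.iter j y x Φ l = 0 := by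
  induction j generalizing y Φ l with
  | zero =>
    rw [iter_zero, if_neg]
    rintro ⟨-, rfl⟩
    simp at hs
  | succ j ih =>
    rw [iter_succ]
    refine Finset.sum_eq_zero fun n _ => splitSum_eq_zero fun l1 l2 hl => ?_
    rw [← hl, List.mem_append] at hs
    rcases hs with hs | hs
    · have z : N.δ y n l1 = 0 → N.iter j n x (fun t => Φ (N.δ y n l1 :: t)) l2 = 0 := fun e => by
        rw [e, iter_zero_head N hΦ]
      rcases l1 with _ | ⟨a, _ | ⟨b, l1⟩⟩
      · simp at hs
      · obtain rfl : B.idem s = a := by simpa using hs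
        by_cases hc : y = n ∧ N.l n = s
        · rw [h₁, if_pos hc]
          rw [iter_congr N j n x (Ψ := fun _ => 0) fun t ht => hj _ (N.r n) (by simp [ht])
            (by simp),
            iter_zero_fun]
        · exact z (by rw [h₁, if_neg hc])
      · exact z (h₂ _ _ _ s (by simp) hs)
    · exact ih (hΦ.tail _) (fun t s' ht h' => hj _ s' (by simp [ht]) (List.mem_cons_of_mem _ h')) n
        hs

/-! ### Bimodules without the structure relation -/

/-- The properties of an AD bimodule other than the structure relation. -/
structure PreAD (M : ADRaw B A) : Prop where
  cochain : IsCochain M M (0, 1) M.δ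
  unital : ∀ y x s, M.δ y x [B.idem s] = if y = x ∧ M.l x = s then A.idem (M.r x) else 0
  unital_higher : ∀ y x l s, 2 ≤ l.length → B.idem s ∈ l → M.δ y x l = 0
  bdd : Bdd M

lemma IsAD.preAD {M : ADRaw B A} (h : IsAD M) : PreAD M :=
  ⟨h.cochain, h.unital, h.unital_higher, h.bdd⟩

lemma IsAD.curv {M : ADRaw B A} (h : IsAD M) : curv M = 0 := h.rel

lemma PreAD.isAD {M : ADRaw B A} (h : PreAD M) (h' : BraidAD.curv M = 0) : IsAD M :=
  ⟨h.cochain, h', h.unital, h.unital_higher, h.bdd.bounded⟩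

/-- Bilinear cochains, not necessarily homogeneous. -/
structure BiC {M N : ADRaw B A} (f : Coch M N) : Prop where
  biLin : ∀ y x, BiLin (N.l y) (M.l x) (f y x)
  out : ∀ y x l, A.idem (N.r y) * f y x l * A.idem (M.r x) = f y x l

lemma IsCochain.biC {M N : ADRaw B A} {p : ℤ × ℤ} {f : Coch M N} (h : IsCochain M N p f) :
    BiC f := ⟨h.biLin, h.out⟩

lemma IsCochain.of_biC {M N : ADRaw B A} {p : ℤ × ℤ} {f : Coch M N} (h : BiC f)
    (h' : ∀ y x, HasDeg (p + M.deg x - N.deg y) (f y x)) : IsCochain M N p f :=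
  ⟨fun y x => (h.biLin y x).add, fun y x => (h.biLin y x).mid, fun y x => (h.biLin y x).left,
    fun y x => (h.biLin y x).right, fun y x => (h.biLin y x).nil, h.out, h'⟩

lemma BiC.out_left {M N : ADRaw B A} {f : Coch M N} (h : BiC f) (y x l) : A.idem (N.r y) * f y x l
    = f y x l := by
  rw [← h.out, ← mul_assoc, ← mul_assoc, A.idem_mul_self]

lemma BiC.out_right {M N : ADRaw B A} {f : Coch M N} (h : BiC f) (y x l) : f y x l * A.idem (M.r
    x) = f y x l := by
  rw [← h.out, mul_assoc, A.idem_mul_self]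

lemma BiC.add {M N : ADRaw B A} {f g : Coch M N} (hf : BiC f) (hg : BiC g) : BiC (f + g) :=
  ⟨fun y x => (hf.biLin y x).add_fun (hg.biLin y x), fun y x l => by
    simp only [Pi.add_apply, mul_add, add_mul, hf.out, hg.out]⟩

lemma BiC.zero {M N : ADRaw B A} : BiC (0 : Coch M N) :=
  ⟨fun _ _ => BiLin.zero, fun y x l => by simp⟩

lemma BiC.multiAdd {M N : ADRaw B A} {f : Coch M N} (h : BiC f) (y x) :
    MultiAdd (f y x) := (h.biLin y x).add

lemma BiLin.conv {p q o : B.Obj} {f g : List B.Mor → A.Mor} (hf : BiLin p o f)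
    (hg : BiLin o q g) : BiLin p q (conv f g) :=
  BiLin.splitSum (fun t => hf.map (AddMonoidHom.mulRight (g t)))
    fun s => hg.map (AddMonoidHom.mulLeft (f s))

lemma BiC.compC {M N K : ADRaw B A} {g : Coch N K} {f : Coch M N} (hg : BiC g) (hf : BiC f) :
    BiC (compC g f) := by
  refine ⟨fun z x => BiLin.sum _ _ fun y _ => (hg.biLin z y).conv (hf.biLin y x), fun z x l => ?_⟩
  simp only [compC_apply, Finset.mul_sum, Finset.sum_mul]
  refine Finset.sum_congr rfl fun y _ => ?_
  rw [show A.idem (K.r z) * BraidAD.conv (g z y) (f y x) l =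
    splitSum (fun l1 l2 => A.idem (K.r z) * (g z y l1 * f y x l2)) l from
    map_splitSum (AddMonoidHom.mulLeft (A.idem (K.r z))) _ l,
    show splitSum (fun l1 l2 => A.idem (K.r z) * (g z y l1 * f y x l2)) l * A.idem (M.r x) = _ from
    map_splitSum (AddMonoidHom.mulRight (A.idem (M.r x))) _ l]
  refine splitSum_congr fun l1 l2 _ => ?_
  simp only [AddMonoidHom.mulRight_apply]
  rw [← mul_assoc, hg.out_left, mul_assoc, hf.out_right]

lemma IsCochain.compC {M N K : ADRaw B A} {p q : ℤ × ℤ} {g : Coch N K} {f : Coch M N}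
    (hg : IsCochain N K q g) (hf : IsCochain M N p f) : IsCochain M K (p + q) (compC g f) := by
  refine IsCochain.of_biC (hg.biC.compC hf.biC) fun z x l ds h => ?_
  refine sum_mem fun y _ => ?_
  change BraidAD.conv (g z y) (f y x) l ∈ _
  have := (show HasDeg _ (g z y) from hg.deg z y).conv (show HasDeg _ (f y x) from hf.deg y x) l ds
    h
  convert this using 2
  abel

lemma homMor_compC {M N K : ADRaw B A} {p q : ℤ × ℤ} {g : Coch N K} {f : Coch M N}
    (hg : g ∈ homMor N K q) (hf : f ∈ homMor M N p) : compC g f ∈ homMor M K (p + q) := by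
  refine ⟨hg.1.compC hf.1, fun z x l s hs => Finset.sum_eq_zero fun y _ =>
    splitSum_eq_zero fun l1 l2 hl => ?_⟩
  rw [← hl, List.mem_append] at hs
  rcases hs with hs | hs
  · rw [hg.2 _ _ _ _ hs, zero_mul]
  · rw [hf.2 _ _ _ _ hs, mul_zero]

/-- Cochains between bimodules whose basis elements are mapped to those of others. -/
lemma IsCochain.restrict {M N M' N' : ADRaw B A} {p p' : ℤ × ℤ} {f : Coch M N}
    (h : IsCochain M N p f) (a : M'.G → M.G) (b : N'.G → N.G) (hal : ∀ x, M.l (a x) = M'.l x)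
    (har : ∀ x, M.r (a x) = M'.r x) (hbl : ∀ x, N.l (b x) = N'.l x)
    (hbr : ∀ x, N.r (b x) = N'.r x)
    (hd : ∀ y x, p + M.deg (a x) - N.deg (b y) = p' + M'.deg x - N'.deg y) :
    IsCochain M' N' p' (fun y x => f (b y) (a x)) :=
  IsCochain.of_biC ⟨fun y x => hbl y ▸ hal x ▸ h.biLin (b y) (a x), fun y x l => by
    rw [← hbr, ← har]; exact h.out _ _ l⟩ fun y x => hd y x ▸ h.deg (b y) (a x)

lemma homMor_restrict {M N M' N' : ADRaw B A} {p p' : ℤ × ℤ} {f : Coch M N}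
    (h : f ∈ homMor M N p) (a : M'.G → M.G) (b : N'.G → N.G) (hal : ∀ x, M.l (a x) = M'.l x)
    (har : ∀ x, M.r (a x) = M'.r x) (hbl : ∀ x, N.l (b x) = N'.l x)
    (hbr : ∀ x, N.r (b x) = N'.r x)
    (hd : ∀ y x, p + M.deg (a x) - N.deg (b y) = p' + M'.deg x - N'.deg y) :
    (fun y x => f (b y) (a x) : Coch M' N') ∈ homMor M' N' p' :=
  ⟨h.1.restrict a b hal har hbl hbr hd, fun y x l s hs => h.2 _ _ l s hs⟩

/-! ### Box tensor products -/

lemma box_δ (N : ADRaw C B) (M : ADRaw B A) :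
    (N.box M).δ = idBox N (M := M) (M' := M) M.δ := rfl

lemma idBox_apply (N : ADRaw C B) {M M' : ADRaw B A} (g : Coch M M') (y x) : idBox N g y x = N.T
    y.1.1 x.1.1 (g y.1.2 x.1.2) := rfl

/-- The operation on pairs of cochains given by sums of iterated structure maps with one
application of `f`, fed to `g`. -/
def exBox {N N' : ADRaw C B} (f : Coch N N') {M M' : ADRaw B A} (g : Coch M M') :
    Coch (N.box M) (N'.box M') := fun y x l => TF f y.1.1 x.1.1 (g y.1.2 x.1.2) l

lemma boxId_eq {N N' : ADRaw C B} (f : Coch N N') (M : ADRaw B A) :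
    boxId f M = exBox f (M := M) (M' := M) M.δ := rfl

lemma T_mismatch [AddCommGroup R] {N : ADRaw C B} (hN : ∀ y x l, B.idem (N.r y) * N.δ y x l = N.δ
    y x l) {p q : B.Obj} {Φ : List B.Mor → R} (hΦ : BiLin p q Φ) {n' n : N.G} (h : N.r n' ≠ p) (h' :
    N.r n = q) (l) : N.T n' n Φ l = 0 := by
  refine (finsum_congr fun j => ?_).trans finsum_zero
  cases j with
  | zero =>
    rw [iter_zero]
    split_ifs with hc
    · obtain ⟨rfl, -⟩ := hc
      exact hΦ.nil fun e => h (h'.trans e.symm)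
    · rfl
  | succ j =>
    rw [iter_succ]
    refine Finset.sum_eq_zero fun n1 _ => splitSum_eq_zero fun l1 l2 _ => ?_
    rw [← hN]
    simp only [hΦ.head_eq_zero h, iter_zero_fun]

lemma TF_mismatch [AddCommGroup R] {N N' : ADRaw C B} {f : Coch N N'} (hN : ∀ y x l, B.idem (N.r
    y) * N.δ y x l = N.δ y x l) (hN' : ∀ y x l, B.idem (N'.r y) * N'.δ y x l = N'.δ y x l) (hf : ∀ y
    x l, B.idem (N'.r y) * f y x l = f y x l) {p q : B.Obj} {Φ : List B.Mor → R} (hΦ : BiLin p q Φ)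
    {n' : N'.G} {n : N.G} (h : N'.r n' ≠ p) (h' : N.r n = q) (l) : TF f n' n Φ l = 0 := by
  obtain ⟨Q, i, i', hQ, -⟩ := exists_isCone f 0
  rw [← hQ.T_ti hΦ.add]
  refine T_mismatch (fun y x l => ?_) hΦ (by rwa [hQ.r_t]) (by rwa [hQ.r_i]) l
  induction y using hQ.cases with
  | h1 y =>
    induction x using hQ.cases with
    | h1 x => rw [hQ.δ_ii, hQ.r_i, hN]
    | h2 x => rw [hQ.δ_it, mul_zero]
  | h2 y =>
    induction x using hQ.cases with
    | h1 x => rw [hQ.δ_ti, hQ.r_t, hf]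
    | h2 x => rw [hQ.δ_tt, hQ.r_t, hN']

lemma sum_box [AddCommMonoid R] {N : ADRaw C B} {M : ADRaw B A} (F : N.G → M.G → R)
    (h : ∀ n m, N.r n ≠ M.l m → F n m = 0) :
    ∑ p : (N.box M).G, F p.1.1 p.1.2 = ∑ m, ∑ n, F n m := by
  rw [Finset.sum_comm, ← Fintype.sum_prod_type' F]
  symm
  refine Finset.sum_of_injOn (t := Finset.univ) (s := Finset.univ)
    (f := fun p : (N.box M).G => F p.1.1 p.1.2) (g := fun p : N.G × M.G => F p.1 p.2)
    (fun p : (N.box M).G => p.1) ?_ ?_ ?_ ?_ |>.symm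
  · intro p _ q _ e
    exact Subtype.ext e
  · intro p _; simp
  · rintro ⟨n, m⟩ - hp
    refine h n m fun e => hp ⟨⟨(n, m), e⟩, Finset.mem_coe.mpr (Finset.mem_univ _), rfl⟩
  · intro p _; rfl

lemma compC_idBox {N : ADRaw C B} (hN : Bdd N)
    (hNo : ∀ y x l, B.idem (N.r y) * N.δ y x l = N.δ y x l) {M M' M'' : ADRaw B A}
    {g : Coch M' M''} {f : Coch M M'} (hg : ∀ y x, MultiAdd (g y x))
    (hf : ∀ y x, BiLin (M'.l y) (M.l x) (f y x)) :
    compC (idBox N g) (idBox N f) = idBox N (compC g f) := by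
  funext z x l
  rw [compC_apply]
  have e := sum_box (N := N) (M := M') (fun n m => conv (N.T z.1.1 n (g z.1.2 m))
    (N.T n x.1.1 (f m x.1.2)) l) fun n m hnm => conv_eq_zero_right
      (fun t => T_mismatch hNo (hf m x.1.2) hnm x.2 t) l
  refine e.trans ?_
  rw [idBox_apply]
  have h2 : compC g f z.1.2 x.1.2 = fun l => ∑ m, conv (g z.1.2 m) (f m x.1.2) l := rfl
  rw [h2, T_sum hN]
  · exact Finset.sum_congr rfl fun m _ => (T_conv hN (hg _ _) (hf _ _).add _ _ l).symm
  · exact fun m _ => MultiAdd.splitSum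
      (fun t => (hg _ _).map (AddMonoidHom.mulRight (f m x.1.2 t)))
      fun s => (hf _ _).add.map (AddMonoidHom.mulLeft (g z.1.2 m s))

lemma exBox_compC {N N' : ADRaw C B} (hN : Bdd N) (hN' : Bdd N')
    (hNo : ∀ y x l, B.idem (N.r y) * N.δ y x l = N.δ y x l)
    (hNo' : ∀ y x l, B.idem (N'.r y) * N'.δ y x l = N'.δ y x l) {φ : Coch N N'}
    (hφ : ∀ y x l, B.idem (N'.r y) * φ y x l = φ y x l) {M M' M'' : ADRaw B A}
    {g : Coch M' M''} {f : Coch M M'} (hg : ∀ y x, MultiAdd (g y x))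
    (hf : ∀ y x, BiLin (M'.l y) (M.l x) (f y x)) :
    exBox φ (compC g f) = compC (exBox φ g) (idBox N f) + compC (idBox N' g) (exBox φ f) := by
  funext z x l
  rw [Pi.add_apply, Pi.add_apply, Pi.add_apply, compC_apply, compC_apply]
  have e1 := sum_box (N := N) (M := M') (fun n m => conv (TF φ z.1.1 n (g z.1.2 m))
    (N.T n x.1.1 (f m x.1.2)) l) fun n m hnm => conv_eq_zero_right
      (fun t => T_mismatch hNo (hf m x.1.2) hnm x.2 t) l
  have e2 := sum_box (N := N') (M := M') (fun n m => conv (N'.T z.1.1 n (g z.1.2 m))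
    (TF φ n x.1.1 (f m x.1.2)) l) fun n m hnm => conv_eq_zero_right
      (fun t => TF_mismatch hNo hNo' hφ (hf m x.1.2) hnm x.2 t) l
  refine Eq.trans ?_ (congrArg₂ (· + ·) e1 e2).symm
  obtain ⟨Q, i, i', hQ, -⟩ := exists_isCone φ 0
  have hc : ∀ m, MultiAdd (conv (g z.1.2 m) (f m x.1.2)) := fun m => MultiAdd.splitSum
      (fun t => (hg _ _).map (AddMonoidHom.mulRight (f m x.1.2 t)))
      fun s => (hf _ _).add.map (AddMonoidHom.mulLeft (g z.1.2 m s))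
  have h2 : compC g f z.1.2 x.1.2 = fun l => ∑ m, conv (g z.1.2 m) (f m x.1.2) l := rfl
  rw [exBox, h2, ← hQ.T_ti (MultiAdd.sum _ _ fun m _ => hc m), T_sum (hQ.bdd hN hN') _ _
    fun m _ => hc m, ← Finset.sum_add_distrib]
  refine Finset.sum_congr rfl fun m _ => ?_
  rw [hQ.T_ti (hc m), TF_conv hN hN' φ (hg _ _) (hf _ _).add]

lemma intD_exBox {N N' : ADRaw C B} (hN : Bdd N) (hN' : Bdd N') (hc : curv N = 0)
    (hc' : curv N' = 0) (φ : Coch N N') {M M' : ADRaw B A} {g : Coch M M'}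
    (hg : ∀ y x, MultiAdd (g y x)) :
    intD (exBox φ g) = exBox (dMor N N' φ) g + exBox φ (intD g) := by
  funext z x l
  have e := TF_cD hN hN' hc hc' φ (hg z.1.2 x.1.2) z.1.1 x.1.1 l
  rw [intD_eq, Pi.add_apply, Pi.add_apply, Pi.add_apply]
  change cD (TF φ z.1.1 x.1.1 (g z.1.2 x.1.2)) l = TF (dMor N N' φ) z.1.1 x.1.1 (g z.1.2 x.1.2) l +
    TF φ z.1.1 x.1.1 (intD g z.1.2 x.1.2) l
  rw [← e, intD_eq]
  have h := A.add_self (TF φ z.1.1 x.1.1 (cD (g z.1.2 x.1.2)) l)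
  rw [add_right_comm, h, zero_add]

lemma intD_idBox {N : ADRaw C B} (hN : Bdd N) (hc : curv N = 0) {M M' : ADRaw B A}
    {g : Coch M M'} (hg : ∀ y x, MultiAdd (g y x)) :
    intD (idBox N g) = idBox N (intD g) := by
  funext z x l
  have e := T_cD hN (hg z.1.2 x.1.2) z.1.1 x.1.1 l
  rw [hc, TF_zero_left (hg _ _)] at e
  rw [intD_eq, idBox_apply, idBox_apply, intD_eq]
  rw [← neg_eq_of_add_eq_zero_right e, A.neg_eq]

lemma idBox_add {N : ADRaw C B} (hN : Bdd N) {M M' : ADRaw B A} {g g' : Coch M M'}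
    (hg : ∀ y x, MultiAdd (g y x)) (hg' : ∀ y x, MultiAdd (g' y x)) :
    idBox N (g + g') = idBox N g + idBox N g' := by
  funext z x l
  exact T_add hN (hg _ _) (hg' _ _) _ _ l

lemma idBox_zero (N : ADRaw C B) {M M' : ADRaw B A} : idBox N (0 : Coch M M') = 0 := by
  funext z x l
  exact T_zero N _ _ l

lemma exBox_add {N N' : ADRaw C B} (hN : Bdd N) (hN' : Bdd N') (φ : Coch N N')
    {M M' : ADRaw B A} {g g' : Coch M M'}
    (hg : ∀ y x, MultiAdd (g y x)) (hg' : ∀ y x, MultiAdd (g' y x)) :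
    exBox φ (g + g') = exBox φ g + exBox φ g' := by
  funext z x l
  obtain ⟨Q, i, i', hQ, -⟩ := exists_isCone φ 0
  have := T_add (hQ.bdd hN hN') (hg z.1.2 x.1.2) (hg' z.1.2 x.1.2) (i' z.1.1) (i x.1.1) l
  rw [hQ.T_ti ((hg _ _).add (hg' _ _)), hQ.T_ti (hg _ _), hQ.T_ti (hg' _ _)] at this
  exact this

lemma add_exBox {N N' : ADRaw C B} (hN : Bdd N) (hN' : Bdd N') (φ φ' : Coch N N')
    {M M' : ADRaw B A} {g : Coch M M'} (hg : ∀ y x, MultiAdd (g y x)) :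
    exBox (φ + φ') g = exBox φ g + exBox φ' g := by
  funext z x l
  exact TF_add hN hN' φ φ' (hg _ _) _ _ l

lemma exBox_zero {N N' : ADRaw C B} (φ : Coch N N') {M M' : ADRaw B A} :
    exBox φ (0 : Coch M M') = 0 := by
  funext z x l
  obtain ⟨Q, i, i', hQ, -⟩ := exists_isCone φ 0
  have := T_zero (R := A.Mor) Q (i' z.1.1) (i x.1.1) l
  rwa [hQ.T_ti MultiAdd.zero] at this

lemma zero_exBox {N N' : ADRaw C B} {M M' : ADRaw B A} {g : Coch M M'}
    (hg : ∀ y x, MultiAdd (g y x)) : exBox (0 : Coch N N') g = 0 := by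
  funext z x l
  exact TF_zero_left (hg _ _) _ _ l

lemma BiC.intD {M N : ADRaw B A} {f : Coch M N} (hf : BiC f) :
    ∀ y x, MultiAdd (intD f y x) := fun y x => by
  rw [intD_eq]; exact (hf.multiAdd y x).cD

lemma curv_box {N : ADRaw C B} {M : ADRaw B A} (hN : Bdd N) (hNb : BiC (M := N) (N := N) N.δ)
    (hNc : curv N = 0) (hMb : BiC (M := M) (N := M) M.δ) (hMc : curv M = 0) :
    curv (N.box M) = 0 := by
  rw [curv, box_δ, intD_idBox hN hNc hMb.multiAdd, compC_idBox hN hNb.out_left hMb.multiAdd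
    hMb.biLin,
    ← idBox_add hN hMb.intD (hMb.compC hMb).multiAdd]
  rw [show BraidAD.intD (M := M) (N := M) M.δ + BraidAD.compC (M := M) (N := M) (K := M) M.δ M.δ = 0
    from hMc, idBox_zero]

lemma dMor_idBox {N : ADRaw C B} {M M' : ADRaw B A} (hN : Bdd N)
    (hNb : BiC (M := N) (N := N) N.δ) (hNc : curv N = 0) (hMb : BiC (M := M) (N := M) M.δ)
    (hMb' : BiC (M := M') (N := M') M'.δ) {g : Coch M M'} (hg : BiC g) :
    dMor (N.box M) (N.box M') (idBox N g) = idBox N (dMor M M' g) := by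
  rw [dMor_apply, dMor_apply, box_δ, box_δ, intD_idBox hN hNc hg.multiAdd,
    compC_idBox hN hNb.out_left hMb'.multiAdd hg.biLin,
    compC_idBox hN hNb.out_left hg.multiAdd hMb.biLin,
    ← idBox_add hN hg.intD (hMb'.compC hg).multiAdd, ← idBox_add hN _ (hg.compC hMb).multiAdd]
  exact fun y x => (hg.intD y x).add ((hMb'.compC hg).multiAdd y x)

lemma dMor_exBox {N N' : ADRaw C B} {M M' : ADRaw B A} (hN : Bdd N) (hN' : Bdd N')
    (hNb : BiC (M := N) (N := N) N.δ) (hNb' : BiC (M := N') (N := N') N'.δ) (hNc : curv N = 0)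
    (hNc' : curv N' = 0) (hMb : BiC (M := M) (N := M) M.δ)
    (hMb' : BiC (M := M') (N := M') M'.δ) {f : Coch N N'} (hf : BiC f) {g : Coch M M'}
    (hg : BiC g) :
    dMor (N.box M) (N'.box M') (exBox f g) = exBox (dMor N N' f) g + exBox f (dMor M M' g) +
      compC (boxId f M') (idBox N g) + compC (idBox N' g) (boxId f M) := by
  have h1 := exBox_compC hN hN' hNb.out_left hNb'.out_left hf.out_left hMb'.multiAdd hg.biLin
  have h2 := exBox_compC hN hN' hNb.out_left hNb'.out_left hf.out_left hg.multiAdd hMb.biLin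
  rw [dMor_apply (exBox f g), dMor_apply g, box_δ, box_δ, intD_exBox hN hN' hNc hNc' f hg.multiAdd,
    exBox_add (g := intD g + compC (M := M) (N := M') (K := M') M'.δ g) hN hN' f
      (fun y x => (hg.intD y x).add ((hMb'.compC hg).multiAdd y x))
      (hg.compC hMb).multiAdd, exBox_add hN hN' f hg.intD (hMb'.compC hg).multiAdd, h1, h2,
    boxId_eq, boxId_eq]
  have k1 := Coch.add_self (compC (exBox f (M := M') (M' := M') M'.δ) (idBox N g))
  have k2 := Coch.add_self (compC (idBox N' g) (exBox f (M := M) (M' := M) M.δ))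
  have aux : ∀ a b c d u v : Coch (N.box M) (N'.box M'), u + u = 0 → v + v = 0 →
      a + b + c + d = a + (b + (u + c) + (d + v)) + u + v := by
    intro a b c d u v hu hv
    calc a + b + c + d = a + b + c + d + (u + u) + (v + v) := by rw [hu, hv, add_zero, add_zero]
      _ = _ := by abel
  exact aux _ _ _ _ _ _ k1 k2

lemma dMor_boxId {N N' : ADRaw C B} {M : ADRaw B A} (hN : Bdd N) (hN' : Bdd N')
    (hNb : BiC (M := N) (N := N) N.δ) (hNb' : BiC (M := N') (N := N') N'.δ) (hNc : curv N = 0)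
    (hNc' : curv N' = 0) (hMb : BiC (M := M) (N := M) M.δ) (hMc : curv M = 0) {f : Coch N N'}
    (hf : BiC f) :
    dMor (N.box M) (N'.box M) (boxId f M) = boxId (dMor N N' f) M := by
  have h1 := exBox_compC hN hN' hNb.out_left hNb'.out_left hf.out_left hMb.multiAdd hMb.biLin
  rw [boxId_eq, boxId_eq, dMor_apply (exBox f (M := M) (M' := M) M.δ), box_δ, box_δ,
    intD_exBox hN hN' hNc hNc' f hMb.multiAdd, add_assoc (_ + _),
    add_comm (compC (idBox N' (M := M) (M' := M) M.δ) _), ← h1, add_assoc,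
    ← exBox_add hN hN' f hMb.intD (hMb.compC hMb).multiAdd]
  rw [show BraidAD.intD (M := M) (N := M) M.δ + BraidAD.compC (M := M) (N := M) (K := M) M.δ M.δ = 0
    from hMc, exBox_zero, add_zero]

end Box

section BoxAD

variable {A B C E : DGCat} {R R' : Type}

/-! ### Iterated structure maps of box tensor products -/

lemma box_iter [AddCommGroup R] {N : ADRaw C B} {M : ADRaw B A} (hN : Bdd N) (hNo : ∀ y x l,
    B.idem (N.r y) * N.δ y x l = N.δ y x l) (hMb : ∀ y x, BiLin (M.l y) (M.l x) (M.δ y x)) {Φ : List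
    A.Mor → R} (hΦ : MultiAdd Φ) (j y x l) : (N.box M).iter j y x Φ l = N.T y.1.1 x.1.1 (M.iter j
    y.1.2 x.1.2 Φ) l := by
  induction j generalizing y Φ l with
  | zero =>
    have e : N.T y.1.1 x.1.1 (M.iter 0 y.1.2 x.1.2 Φ) l =
        N.iter 0 y.1.1 x.1.1 (M.iter 0 y.1.2 x.1.2 Φ) l := by
      refine finsum_eq_single _ 0 fun k hk => ?_
      rw [iter_congr N k _ _ (Ψ := fun _ => 0) fun t ht => ?_, iter_zero_fun]
      rw [iter_zero, if_neg]
      rintro ⟨-, rfl⟩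
      exact hk ht.symm
    rw [e, iter_zero, iter_zero, iter_zero]
    have : y = x ↔ y.1.1 = x.1.1 ∧ y.1.2 = x.1.2 := by
      rw [← Prod.ext_iff]; exact Subtype.ext_iff
    simp only [this, and_true]
    by_cases h1 : y.1.1 = x.1.1 <;> by_cases h2 : l = [] <;> simp [h1, h2]
  | succ j ih =>
    rw [iter_succ]
    have e1 : ∀ y1 : (N.box M).G, splitSum (fun l1 l2 =>
        (N.box M).iter j y1 x (fun t => Φ ((N.box M).δ y y1 l1 :: t)) l2) l =
        splitSum (fun l1 l2 => N.T y1.1.1 x.1.1 (M.iter j y1.1.2 x.1.2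
          fun t => Φ (N.T y.1.1 y1.1.1 (M.δ y.1.2 y1.1.2) l1 :: t)) l2) l :=
      fun y1 => splitSum_congr fun l1 l2 _ => ih (hΦ.tail _) y1 l2
    rw [Finset.sum_congr rfl fun y1 _ => e1 y1]
    have e2 := sum_box (N := N) (M := M) (fun n m => splitSum (fun l1 l2 =>
      N.T n x.1.1 (M.iter j m x.1.2 fun t => Φ (N.T y.1.1 n (M.δ y.1.2 m) l1 :: t)) l2) l)
      fun n m hnm => splitSum_eq_zero fun l1 l2 _ =>
        T_mismatch hNo (BiLin.iter M hMb (hΦ.tail _) j m _) hnm x.2 l2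
    refine e2.trans ?_
    have e3 : M.iter (j + 1) y.1.2 x.1.2 Φ = fun t => ∑ m, splitSum (fun t1 t2 =>
        M.iter j m x.1.2 (fun s => Φ (M.δ y.1.2 m t1 :: s)) t2) t := by
      funext t; exact iter_succ ..
    have hG : ∀ m t, MultiAdd fun t1 => M.iter j m x.1.2 (fun s => Φ (M.δ y.1.2 m t1 :: s)) t :=
      fun m t => (hMb _ _).add.map (iterHead M hΦ j m _ t)
    have hG' : ∀ m t1, MultiAdd (M.iter j m x.1.2 fun s => Φ (M.δ y.1.2 m t1 :: s)) :=
      fun m t1 => (BiLin.iter M hMb (hΦ.tail _) j m _).add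
    rw [e3, T_sum hN _ _ fun m _ => MultiAdd.splitSum (hG m) (hG' m)]
    refine Finset.sum_congr rfl fun m _ => ?_
    rw [T_splitSum hN (hG m) (hG' m)]
    refine Finset.sum_congr rfl fun n _ => splitSum_congr fun l1 l2 _ => ?_
    let ψ : A.Mor →+ R := AddMonoidHom.mk' (fun b => N.T n x.1.1
      (M.iter j m x.1.2 fun s => Φ (b :: s)) l2) fun a b => by
        rw [← T_add hN (BiLin.iter M hMb (hΦ.tail _) j m _).add
          (BiLin.iter M hMb (hΦ.tail _) j m _).add]
        congr 1
        funext t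
        simp only [hΦ.head, iter_add_fun]
    exact (T_map hN (hMb y.1.2 m).add ψ y.1.1 n l1).symm

lemma box_bdd {N : ADRaw C B} {M : ADRaw B A} (hN : Bdd N)
    (hNo : ∀ y x l, B.idem (N.r y) * N.δ y x l = N.δ y x l)
    (hMb : ∀ y x, BiLin (M.l y) (M.l x) (M.δ y x)) (hM : Bdd M) : Bdd (N.box M) := by
  intro i
  obtain ⟨K, hK⟩ := hN i
  obtain ⟨J, hJ⟩ := hM K
  refine ⟨J, fun j hj R _ Φ hΦ y x l hl => ?_⟩
  rw [box_iter hN hNo hMb hΦ, ADRaw.T, finsum_eq_range fun k hk =>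
    hK k hk R _ (BiLin.iter M hMb hΦ j _ _).add _ _ l hl]
  refine Finset.sum_eq_zero fun k hk => ?_
  rw [iter_congr N k _ _ (Ψ := fun _ => 0) fun t ht => ?_, iter_zero_fun]
  exact hJ j hj R Φ hΦ _ _ t (ht.trans_le (Finset.mem_range.mp hk).le)

lemma box_T [AddCommGroup R] {N : ADRaw C B} {M : ADRaw B A} (hN : Bdd N) (hNo : ∀ y x l, B.idem
    (N.r y) * N.δ y x l = N.δ y x l) (hMb : ∀ y x, BiLin (M.l y) (M.l x) (M.δ y x)) (hM : Bdd M) {Φ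
    : List A.Mor → R} (hΦ : MultiAdd Φ) (y x l) : (N.box M).T y x Φ l = N.T y.1.1 x.1.1 (M.T y.1.2
    x.1.2 Φ) l := by
  obtain ⟨K, hK⟩ := hN l.length
  obtain ⟨J, hJ⟩ := hM K
  have hi : ∀ j, MultiAdd (M.iter j y.1.2 x.1.2 Φ) := fun j => (BiLin.iter M hMb hΦ j _ _).add
  have e1 : ∀ j, (N.box M).iter j y x Φ l =
      ∑ k ∈ Finset.range K, N.iter k y.1.1 x.1.1 (M.iter j y.1.2 x.1.2 Φ) l := fun j => by
    rw [box_iter hN hNo hMb hΦ, ADRaw.T, finsum_eq_range fun k hk =>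
      hK k hk R _ (hi j) _ _ l le_rfl]
  have e2 : ∀ t : List B.Mor, t.length ≤ K →
      M.T y.1.2 x.1.2 Φ t = ∑ j ∈ Finset.range J, M.iter j y.1.2 x.1.2 Φ t := fun t ht =>
    finsum_eq_range fun j hj => hJ j hj R Φ hΦ _ _ t ht
  have e3 : (N.box M).T y x Φ l = ∑ j ∈ Finset.range J, (N.box M).iter j y x Φ l := by
    refine finsum_eq_range fun j hj => ?_
    rw [e1]
    refine Finset.sum_eq_zero fun k hk => ?_
    rw [iter_congr N k _ _ (Ψ := fun _ => 0) fun t ht => ?_, iter_zero_fun]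
    exact hJ j hj R Φ hΦ _ _ t (ht.trans_le (Finset.mem_range.mp hk).le)
  have e4 : N.T y.1.1 x.1.1 (M.T y.1.2 x.1.2 Φ) l =
      ∑ k ∈ Finset.range K, N.iter k y.1.1 x.1.1 (M.T y.1.2 x.1.2 Φ) l :=
    finsum_eq_range fun k hk => hK k hk R _ (BiLin.T hM hMb hΦ _ _).add _ _ l le_rfl
  rw [e3, e4]
  simp only [e1]
  rw [Finset.sum_comm]
  refine Finset.sum_congr rfl fun k hk => ?_
  rw [iter_congr N k _ _ fun t ht => e2 t (ht.trans_le (Finset.mem_range.mp hk).le), iter_sum_fun]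

/-! ### Box tensor products are AD bimodules -/

lemma BiC.idBox {N : ADRaw C B} (hN : Bdd N) (hNb : BiC (M := N) (N := N) N.δ)
    {M M' : ADRaw B A} {g : Coch M M'} (hg : BiC g) : BiC (idBox N g) := by
  refine ⟨fun y x => BiLin.T hN hNb.biLin (hg.multiAdd _ _) _ _, fun y x l => ?_⟩
  have h := T_map hN (hg.multiAdd y.1.2 x.1.2) ((AddMonoidHom.mulRight (A.idem (M.r x.1.2))).comp
    (AddMonoidHom.mulLeft (A.idem (M'.r y.1.2)))) y.1.1 x.1.1 l
  refine h.symm.trans ?_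
  rw [idBox_apply]
  congr 1
  funext t
  exact hg.out _ _ t

lemma HasDeg.T {N : ADRaw C B} (hN : Bdd N) (hN' : ∀ y x, HasDeg ((0, 1) + N.deg x - N.deg y) (N.δ
    y x)) {c : ℤ × ℤ} {Φ : List B.Mor → A.Mor} (h : MultiAdd Φ) (hΦ : HasDeg c Φ) (y x) : HasDeg (c
    + N.deg x - N.deg y) (N.T y x Φ) := by
  intro l ds hl
  obtain ⟨J, hJ⟩ := hN l.length
  rw [ADRaw.T, finsum_eq_range fun j hj => hJ j hj _ _ h _ _ l le_rfl]
  exact sum_mem fun j _ => HasDeg.iter hN' hΦ j y x l ds hl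

lemma IsCochain.idBox {N : ADRaw C B} (hN : PreAD N) {M M' : ADRaw B A} {p : ℤ × ℤ}
    {g : Coch M M'} (hg : IsCochain M M' p g) :
    IsCochain (N.box M) (N.box M') p (idBox N g) := by
  refine IsCochain.of_biC (BiC.idBox hN.bdd hN.cochain.biC hg.biC) fun y x => ?_
  have := HasDeg.T hN.bdd hN.cochain.deg (hg.biC.multiAdd y.1.2 x.1.2) (hg.deg y.1.2 x.1.2)
    y.1.1 x.1.1
  have e : p + (N.box M).deg x - (N.box M').deg y =
      p + M.deg x.1.2 - M'.deg y.1.2 + N.deg x.1.1 - N.deg y.1.1 := by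
    change p + (N.deg x.1.1 + M.deg x.1.2) - (N.deg y.1.1 + M'.deg y.1.2) = _
    abel
  rw [e]
  exact this

lemma homMor_idBox {N : ADRaw C B} (hN : PreAD N) {M M' : ADRaw B A} {p : ℤ × ℤ}
    {g : Coch M M'} (hg : g ∈ homMor M M' p) :
    BraidAD.idBox N g ∈ homMor (N.box M) (N.box M') p := by
  refine ⟨hg.1.idBox hN, fun y x l s hs => (finsum_congr fun j => ?_).trans finsum_zero⟩
  exact iter_idem hN.unital hN.unital_higher (hg.1.biC.multiAdd _ _) j
    (fun t s' _ h => hg.2 _ _ t s' h) _ _ hs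

lemma PreAD.box {N : ADRaw C B} {M : ADRaw B A} (hN : PreAD N) (hM : PreAD M) :
    PreAD (N.box M) where
  cochain := hM.cochain.idBox hN
  unital y x s := by
    have e : (N.box M).δ y x [C.idem s] = N.iter 1 y.1.1 x.1.1 (M.δ y.1.2 x.1.2) [C.idem s] := by
      refine finsum_eq_single _ 1 fun j hj => ?_
      rcases j with _ | _ | j
      · simp [iter_zero]
      · exact absurd rfl hj
      · exact iter_idem hN.unital hN.unital_higher (hM.cochain.biC.multiAdd _ _) _
          (fun t s' ht h => hM.unital_higher _ _ t s' (by omega) h) _ _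
          (List.mem_singleton.mpr rfl)
    rw [e, iter_one, hN.unital]
    have hyx : y = x ↔ y.1.1 = x.1.1 ∧ y.1.2 = x.1.2 := by
      rw [← Prod.ext_iff]; exact Subtype.ext_iff
    change _ = if y = x ∧ N.l x.1.1 = s then A.idem (M.r x.1.2) else 0
    by_cases h : y.1.1 = x.1.1 ∧ N.l x.1.1 = s
    · rw [if_pos h, hM.unital]
      have : M.l x.1.2 = N.r x.1.1 := x.2.symm
      simp only [this, and_true, hyx, h.1, h.2, true_and]
    · rw [if_neg h, if_neg, (hM.cochain.biC.multiAdd _ _).zero_head]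
      rintro ⟨rfl, h'⟩
      exact h ⟨rfl, h'⟩
  unital_higher y x l s hl hs := by
    refine (finsum_congr fun j => ?_).trans finsum_zero
    rcases j with _ | _ | j
    · rw [iter_zero, if_neg]
      rintro ⟨-, rfl⟩
      simp at hl
    · rw [Nat.zero_add, iter_one, hN.unital_higher _ _ l s hl hs,
        (hM.cochain.biC.multiAdd _ _).zero_head]
    · exact iter_idem hN.unital hN.unital_higher (hM.cochain.biC.multiAdd _ _) _
          (fun t s' ht h => hM.unital_higher _ _ t s' (by omega) h) _ _ hs
  bdd := box_bdd hN.bdd hN.cochain.biC.out_left hM.cochain.biC.biLin hM.bdd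

lemma IsAD.box {N : ADRaw C B} {M : ADRaw B A} (hN : IsAD N) (hM : IsAD M) : IsAD (N.box M) :=
  (hN.preAD.box hM.preAD).isAD
    (curv_box hN.bdd hN.cochain.biC hN.curv hM.cochain.biC hM.curv)

/-! ### Cones and morphisms -/

lemma IsCone.preAD {N N' Q : ADRaw B A} {f : Coch N N'} {i : N.G → Q.G} {i' : N'.G → Q.G}
    (h : IsCone f i i') (hN : PreAD N) (hN' : PreAD N') {p : ℤ × ℤ} (hf : f ∈ homMor N N' p)
    {c : ℤ × ℤ} (hd : ∀ x, Q.deg (i x) = N.deg x + c)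
    (hd' : ∀ y, Q.deg (i' y) = N'.deg y + c + (0, 1) - p) : PreAD Q where
  cochain := by
    refine IsCochain.of_biC ⟨fun y x => ?_, fun y x l => ?_⟩ fun y x => ?_
    · induction y using h.cases with
      | h1 y =>
        induction x using h.cases with
        | h1 x => rw [h.δ_ii, h.l_i, h.l_i]; exact hN.cochain.biLin y x
        | h2 x => rw [show Q.δ (i y) (i' x) = fun _ => 0 from funext (h.δ_it y x)]; exact BiLin.zero
      | h2 y =>
        induction x using h.cases with
        | h1 x => rw [h.δ_ti, h.l_i, h.l_t]; exact hf.1.biLin y x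
        | h2 x => rw [h.δ_tt, h.l_t, h.l_t]; exact hN'.cochain.biLin y x
    · induction y using h.cases with
      | h1 y =>
        induction x using h.cases with
        | h1 x => rw [h.δ_ii, h.r_i, h.r_i]; exact hN.cochain.out y x l
        | h2 x => rw [h.δ_it]; simp
      | h2 y =>
        induction x using h.cases with
        | h1 x => rw [h.δ_ti, h.r_i, h.r_t]; exact hf.1.out y x l
        | h2 x => rw [h.δ_tt, h.r_t, h.r_t]; exact hN'.cochain.out y x l
    · induction y using h.cases with
      | h1 y =>
        induction x using h.cases with
        | h1 x =>
          rw [h.δ_ii, hd, hd, show (0, 1) + (N.deg x + c) - (N.deg y + c) =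
            (0, 1) + N.deg x - N.deg y by abel]
          exact hN.cochain.deg y x
        | h2 x =>
          rw [show Q.δ (i y) (i' x) = fun _ => 0 from funext (h.δ_it y x)]
          exact fun _ _ _ => zero_mem _
      | h2 y =>
        induction x using h.cases with
        | h1 x =>
          rw [h.δ_ti, hd, hd', show (0, 1) + (N.deg x + c) - (N'.deg y + c + (0, 1) - p) =
            p + N.deg x - N'.deg y by abel]
          exact hf.1.deg y x
        | h2 x =>
          rw [h.δ_tt, hd', hd', show (0, 1) + (N'.deg x + c + (0, 1) - p) -
            (N'.deg y + c + (0, 1) - p) = (0, 1) + N'.deg x - N'.deg y by abel]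
          exact hN'.cochain.deg y x
  unital y x s := by
    induction y using h.cases with
    | h1 y =>
      induction x using h.cases with
      | h1 x => simp only [h.δ_ii, h.l_i, h.r_i, h.inj, hN.unital]
      | h2 x => rw [h.δ_it, if_neg fun e => h.ne _ _ e.1]
    | h2 y =>
      induction x using h.cases with
      | h1 x => rw [h.δ_ti, if_neg fun e => h.ne _ _ e.1.symm, hf.2 _ _ _ s (by simp)]
      | h2 x => simp only [h.δ_tt, h.l_t, h.r_t, h.inj', hN'.unital]
  unital_higher y x l s hl hs := by
    induction y using h.cases with
    | h1 y =>
      induction x using h.cases with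
      | h1 x => rw [h.δ_ii, hN.unital_higher _ _ l s hl hs]
      | h2 x => rw [h.δ_it]
    | h2 y =>
      induction x using h.cases with
      | h1 x => rw [h.δ_ti, hf.2 _ _ l s hs]
      | h2 x => rw [h.δ_tt, hN'.unital_higher _ _ l s hl hs]
  bdd := h.bdd hN.bdd hN'.bdd

lemma IsCone.curv_eq_zero {N N' Q : ADRaw B A} {f : Coch N N'} {i : N.G → Q.G}
    {i' : N'.G → Q.G} (h : IsCone f i i') (hN : curv N = 0) (hN' : curv N' = 0)
    (hf : dMor N N' f = 0) : curv Q = 0 := by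
  funext y x l
  induction y using h.cases with
  | h1 y =>
    induction x using h.cases with
    | h1 x => rw [h.curv_ii, hN]; rfl
    | h2 x => rw [h.curv_it]; rfl
  | h2 y =>
    induction x using h.cases with
    | h1 x => rw [h.curv_ti, hf]; rfl
    | h2 x => rw [h.curv_tt, hN']; rfl

lemma exists_isCone_preAD {N N' : ADRaw B A} (hN : PreAD N) (hN' : PreAD N') {p : ℤ × ℤ}
    {f : Coch N N'} (hf : f ∈ homMor N N' p) :
    ∃ (Q : ADRaw B A) (i : N.G → Q.G) (i' : N'.G → Q.G), IsCone f i i' ∧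
      (∀ x, Q.deg (i x) = N.deg x) ∧ (∀ y, Q.deg (i' y) = N'.deg y + (0, 1) - p) ∧ PreAD Q := by
  obtain ⟨Q, i, i', hQ, h1, h2⟩ := exists_isCone f p
  refine ⟨Q, i, i', hQ, h1, h2, hQ.preAD hN hN' hf (c := 0) (fun x => ?_) fun y => ?_⟩
  · rw [h1, add_zero]
  · rw [h2, add_zero]

lemma homMor_exBox {N N' : ADRaw C B} (hN : PreAD N) (hN' : PreAD N') {M M' : ADRaw B A}
    {p q : ℤ × ℤ} {f : Coch N N'} (hf : f ∈ homMor N N' p) {g : Coch M M'}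
    (hg : g ∈ homMor M M' q) : exBox f g ∈ homMor (N.box M) (N'.box M') (p + q - (0, 1)) := by
  obtain ⟨Q, i, i', hQ, h1, h2, hQ'⟩ := exists_isCone_preAD hN hN' hf
  have h := homMor_restrict (M' := N.box M) (N' := N'.box M') (p' := p + q - (0, 1))
    (homMor_idBox hQ' hg) (fun x => ⟨(i x.1.1, x.1.2), (hQ.r_i _).trans x.2⟩)
    (fun y => ⟨(i' y.1.1, y.1.2), (hQ.r_t _).trans y.2⟩) (fun x => hQ.l_i x.1.1) (fun x => rfl)
    (fun x => hQ.l_t x.1.1) (fun x => rfl) (fun y x => ?_)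
  · convert h using 1
    funext y x l
    exact (hQ.T_ti (hg.1.biC.multiAdd _ _) _ _ l).symm
  · change q + (Q.deg (i x.1.1) + M.deg x.1.2) - (Q.deg (i' y.1.1) + M'.deg y.1.2) =
      p + q - (0, 1) + (N.deg x.1.1 + M.deg x.1.2) - (N'.deg y.1.1 + M'.deg y.1.2)
    rw [h1, h2]
    abel

lemma homMor_boxId {N N' : ADRaw C B} (hN : PreAD N) (hN' : PreAD N') {M : ADRaw B A}
    (hM : PreAD M) {p : ℤ × ℤ} {f : Coch N N'} (hf : f ∈ homMor N N' p) :
    boxId f M ∈ homMor (N.box M) (N'.box M) p := by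
  obtain ⟨Q, i, i', hQ, h1, h2, hQ'⟩ := exists_isCone_preAD hN hN' hf
  have hP := hQ'.box hM
  have e : boxId f M = fun y x => (Q.box M).δ ⟨(i' y.1.1, y.1.2), (hQ.r_t _).trans y.2⟩
      ⟨(i x.1.1, x.1.2), (hQ.r_i _).trans x.2⟩ := by
    funext y x l
    exact (hQ.T_ti (hM.cochain.biC.multiAdd _ _) _ _ l).symm
  constructor
  · have h := hP.cochain.restrict (M' := N.box M) (N' := N'.box M) (p' := p)
      (fun x => ⟨(i x.1.1, x.1.2), (hQ.r_i _).trans x.2⟩)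
      (fun y => ⟨(i' y.1.1, y.1.2), (hQ.r_t _).trans y.2⟩) (fun x => hQ.l_i x.1.1) (fun x => rfl)
      (fun x => hQ.l_t x.1.1) (fun x => rfl) (fun y x => ?_)
    · rw [e]; exact h
    · change (0, 1) + (Q.deg (i x.1.1) + M.deg x.1.2) - (Q.deg (i' y.1.1) + M.deg y.1.2) =
        p + (N.deg x.1.1 + M.deg x.1.2) - (N'.deg y.1.1 + M.deg y.1.2)
      rw [h1, h2]
      abel
  · intro y x l s hs
    rw [e]
    rcases l with _ | ⟨a, _ | ⟨b, l⟩⟩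
    · simp at hs
    · obtain rfl : C.idem s = a := by simpa using hs
      refine (hP.unital _ _ s).trans (if_neg fun h => ?_)
      exact hQ.ne x.1.1 y.1.1 (congrArg (fun z => z.1.1) h.1).symm
    · exact hP.unital_higher _ _ _ s (by simp) hs

/-! ### Identity bimodules -/

lemma one_δ (A : DGCat) (y x a) :
    (ADRaw.one A).δ y x [a] = A.idem ((ADRaw.one A).l y) * a * A.idem ((ADRaw.one A).l x) := rfl

lemma one_r (A : DGCat) (x) : (ADRaw.one A).r x = (ADRaw.one A).l x := rfl

lemma one_l_inj (A : DGCat) {y x : (ADRaw.one A).G} :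
    (ADRaw.one A).l y = (ADRaw.one A).l x ↔ y = x := Iff.rfl

lemma one_deg (A : DGCat) (x) : (ADRaw.one A).deg x = 0 := rfl

lemma one_sum (A : DGCat) : ∑ x : (ADRaw.one A).G, A.idem ((ADRaw.one A).l x) = 1 := A.sum_idem

lemma one_δ_of_ne (A : DGCat) (y x l) (h : l.length ≠ 1) : (ADRaw.one A).δ y x l = 0 := by
  rcases l with _ | ⟨a, _ | ⟨b, l⟩⟩
  · rfl
  · simp at h
  · rfl

lemma one_multiAdd (A : DGCat) (y x) : MultiAdd ((ADRaw.one A).δ y x) := by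
  intro l1 a b l2
  rcases l1 with _ | ⟨c, l1⟩
  · rcases l2 with _ | ⟨c, l2⟩
    · simp only [List.nil_append, one_δ, mul_add, add_mul]
    · rw [one_δ_of_ne _ _ _ _ (by simp), one_δ_of_ne _ _ _ _ (by simp),
        one_δ_of_ne _ _ _ _ (by simp), add_zero]
  · rw [one_δ_of_ne _ _ _ _ (by simp), one_δ_of_ne _ _ _ _ (by simp),
      one_δ_of_ne _ _ _ _ (by simp), add_zero]

lemma one_iter_of_ne (A : DGCat) [AddCommGroup R] {Φ : List A.Mor → R} (hΦ : MultiAdd Φ) (j y x l)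
    (hl : l.length ≠ j) : (ADRaw.one A).iter j y x Φ l = 0 := by
  induction j generalizing Φ y l with
  | zero =>
    rw [iter_zero, if_neg]
    rintro ⟨-, rfl⟩
    exact hl rfl
  | succ j ih =>
    rw [iter_succ]
    refine Finset.sum_eq_zero fun n _ => splitSum_eq_zero fun l1 l2 hll => ?_
    by_cases h : l1.length = 1
    · refine ih (hΦ.tail _) n l2 fun h' => hl ?_
      rw [← hll, List.length_append, h, h']; omega
    · rw [one_δ_of_ne _ _ _ _ h, iter_zero_head _ hΦ]

lemma PreAD.one (A : DGCat) : PreAD (ADRaw.one A) := by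
  refine ⟨IsCochain.of_biC ⟨fun y x => ⟨one_multiAdd A y x, fun l1 a s b l2 => ?_, fun a l => ?_,
    fun l a => ?_, fun _ => rfl⟩, fun y x l => ?_⟩ fun y x l ds h => ?_, fun y x s => ?_,
    fun y x l s hl hs => one_δ_of_ne _ _ _ _ (by omega), fun i => ⟨i + 1, ?_⟩⟩
  · rw [one_δ_of_ne _ _ _ _ (by simp; omega), one_δ_of_ne _ _ _ _ (by simp; omega)]
  · rcases l with _ | ⟨b, l⟩
    · simp only [one_δ, ← mul_assoc, A.idem_mul_self]
    · rfl
  · rcases l with _ | ⟨b, l⟩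
    · simp only [List.nil_append, one_δ, mul_assoc, A.idem_mul_self]
    · rw [one_δ_of_ne _ _ _ _ (by simp), one_δ_of_ne _ _ _ _ (by simp)]
  · rw [one_r, one_r]
    by_cases hl : l.length = 1
    · obtain ⟨a, rfl⟩ := List.length_eq_one_iff.mp hl
      simp only [one_δ, ← mul_assoc, A.idem_mul_self]
      simp only [mul_assoc, A.idem_mul_self]
    · rw [one_δ_of_ne _ _ _ _ hl, mul_zero, zero_mul]
  · rw [one_deg, one_deg]
    by_cases hl : l.length = 1
    · obtain ⟨a, rfl⟩ := List.length_eq_one_iff.mp hl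
      obtain ⟨d, ds, hd, h', rfl⟩ := List.forall₂_cons_left_iff.mp h
      obtain rfl := List.forall₂_nil_left_iff.mp h'
      rw [one_δ]
      have := A.gr_mul _ _ _ _ (A.gr_mul _ _ _ _ (A.idem_mem ((ADRaw.one A).l y)) hd)
        (A.idem_mem ((ADRaw.one A).l x))
      convert this using 2
      simp
    · rw [one_δ_of_ne _ _ _ _ hl]; exact zero_mem _
  · rw [one_δ, one_r]
    split_ifs with h
    · obtain ⟨rfl, rfl⟩ := h
      rw [A.idem_mul_self, A.idem_mul_self]
    · by_cases hys : (ADRaw.one A).l y = s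
      · subst hys
        rw [A.idem_mul_self, A.idem_mul_of_ne]
        exact fun e => h ⟨(one_l_inj A).mp e, e.symm⟩
      · rw [A.idem_mul_of_ne _ _ hys, zero_mul]
  · exact fun j hj R _ Φ hΦ y x l hl => one_iter_of_ne A hΦ j y x l (by omega)

lemma curv_one (A : DGCat) : curv (ADRaw.one A) = 0 := by
  funext y x l
  rw [curv, Pi.add_apply, Pi.add_apply, Pi.add_apply, intD_eq, compC_apply]
  rcases l with _ | ⟨a, _ | ⟨b, _ | ⟨c, l⟩⟩⟩
  · simp only [cD, conv, splitSum_nil, bD, bM, one_δ_of_ne A _ _ [] (by simp), map_zero, add_zero,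
      mul_zero, Finset.sum_const_zero]
    rfl
  · simp only [cD, conv, splitSum_cons, splitSum_nil, bD, bM, one_δ_of_ne A _ _ [] (by simp),
      mul_zero, zero_mul, add_zero, Finset.sum_const_zero, one_δ, A.d_mul, A.d_idem, zero_add]
    exact A.add_self _
  · have e : ∀ n : (ADRaw.one A).G, A.idem ((ADRaw.one A).l y) * a * A.idem ((ADRaw.one A).l n) *
        (A.idem ((ADRaw.one A).l n) * b * A.idem ((ADRaw.one A).l x)) =
        A.idem ((ADRaw.one A).l y) * a * A.idem ((ADRaw.one A).l n) *
          (b * A.idem ((ADRaw.one A).l x)) := fun n => by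
      rw [mul_assoc (A.idem ((ADRaw.one A).l n)), ← mul_assoc _ (A.idem ((ADRaw.one A).l n)),
        mul_assoc _ (A.idem ((ADRaw.one A).l n)) (A.idem ((ADRaw.one A).l n)), A.idem_mul_self]
    simp only [cD, conv, splitSum_cons, splitSum_nil, bD, bM, one_δ_of_ne A _ _ [] (by simp),
      one_δ_of_ne A _ _ [_, _] (by simp),
      mul_zero, zero_mul, add_zero, one_δ, zero_add, map_zero, e]
    rw [← Finset.sum_mul, ← Finset.mul_sum, one_sum]
    simp only [mul_assoc, one_mul]
    exact A.add_self _
  · have h1 : ∀ a b c (l : List A.Mor), (ADRaw.one A).δ y x (a :: b :: c :: l) = 0 :=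
      fun _ _ _ _ => rfl
    have h2 : ∀ a b (l : List A.Mor), (ADRaw.one A).δ y x (a :: b :: l) = 0 := fun _ _ _ => rfl
    have h3 : ∀ n, conv ((ADRaw.one A).δ y n) ((ADRaw.one A).δ n x) (a :: b :: c :: l) = 0 := by
      intro n
      refine splitSum_eq_zero fun l1 l2 hl => ?_
      by_cases h : l1.length = 1
      · rw [one_δ_of_ne A n x l2, mul_zero]
        intro h'
        have := congrArg List.length hl
        simp only [List.length_append, h, h', List.length_cons] at this
        omega
      · rw [one_δ_of_ne A y n l1 h, zero_mul]
    simp only [h3, Finset.sum_const_zero, add_zero, cD, bD, bM, h1, h2, map_zero, bD_zero, zero_add]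
    change bM (fun _ => (0 : A.Mor)) (c :: l) = 0
    exact bM_zero _

lemma IsAD.one (A : DGCat) : IsAD (ADRaw.one A) := (PreAD.one A).isAD (curv_one A)

end BoxAD

section Relabel

variable {A B C E : DGCat} {R : Type}

/-! ### Morphisms without inputs -/

lemma relabel_nil {M N : ADRaw B A} (φ : N.G → M.G → Prop) (y x) :
    (relabel φ : Coch M N) y x [] = if φ y x then A.idem (N.r y) else 0 := rfl

lemma relabel_cons {M N : ADRaw B A} (φ : N.G → M.G → Prop) (y x a l) : (relabel φ : Coch M N) y x
    (a :: l) = 0 := rfl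

lemma relabel_of_ne_nil {M N : ADRaw B A} (φ : N.G → M.G → Prop) (y x) {l : List B.Mor} (hl : l ≠
    []) : (relabel φ : Coch M N) y x l = 0 := by
  rcases l with _ | ⟨a, l⟩
  · exact absurd rfl hl
  · rfl

lemma relabel_of_not {M N : ADRaw B A} {φ : N.G → M.G → Prop} {y : N.G} {x : M.G} (h : ¬ φ y x)
    (l) : (relabel φ : Coch M N) y x l = 0 := by
  rcases l with _ | ⟨a, l⟩
  · rw [relabel_nil, if_neg h]
  · rfl

lemma relabel_congr {M N : ADRaw B A} {φ ψ : N.G → M.G → Prop} (h : ∀ y x, φ y x ↔ ψ y x) :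
    (relabel φ : Coch M N) = relabel ψ := by
  congr 1
  funext y x
  exact propext (h y x)

lemma relabel_homMor {M N : ADRaw B A} {φ : N.G → M.G → Prop} {p : ℤ × ℤ}
    (hl : ∀ y x, φ y x → N.l y = M.l x) (hr : ∀ y x, φ y x → N.r y = M.r x)
    (hd : ∀ y x, φ y x → N.deg y = p + M.deg x) : relabel φ ∈ homMor M N p := by
  refine ⟨IsCochain.of_biC ⟨fun y x => ⟨?_, ?_, fun a l => rfl, ?_, fun h => ?_⟩, fun y x l => ?_⟩
    fun y x l ds h => ?_, fun y x l s hs => ?_⟩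
  · intro l1 a b l2
    rw [relabel_of_ne_nil _ _ _ (by simp), relabel_of_ne_nil _ _ _ (by simp),
      relabel_of_ne_nil _ _ _ (by simp), add_zero]
  · intro l1 a s b l2
    rw [relabel_of_ne_nil _ _ _ (by simp), relabel_of_ne_nil _ _ _ (by simp)]
  · intro l a
    rw [relabel_of_ne_nil _ _ _ (by simp), relabel_of_ne_nil _ _ _ (by simp)]
  · exact relabel_of_not (fun hφ => h (hl _ _ hφ)) _
  · by_cases h : φ y x
    · rcases l with _ | ⟨a, l⟩
      · rw [relabel_nil, if_pos h, ← hr _ _ h, A.idem_mul_self, A.idem_mul_self]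
      · rw [relabel_cons, mul_zero, zero_mul]
    · rw [relabel_of_not h, mul_zero, zero_mul]
  · rcases h with _ | ⟨h, h'⟩
    · rw [relabel_nil]
      split_ifs with h
      · rw [hd _ _ h]
        simpa using A.idem_mem (N.r y)
      · exact zero_mem _
    · exact zero_mem _
  · rcases l with _ | ⟨a, l⟩
    · simp at hs
    · rfl

lemma cD_of_nil {F : List B.Mor → A.Mor} (h : ∀ a l, F (a :: l) = 0) (hd : A.d (F []) = 0) (l) :
    cD F l = 0 := by
  rcases l with _ | ⟨a, _ | ⟨b, l⟩⟩
  · simp only [cD, bD, bM, hd, add_zero]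
  · simp only [cD, bD, bM, h, map_zero, add_zero]
  · have h0 : (fun t => F (a :: t)) = fun _ => 0 := funext fun t => h a t
    have h1 : bM F (a :: b :: l) = 0 := by rw [bM, h, h0, bM_zero, add_zero]
    rw [cD, h1, bD, h0, bD_zero, h, h, map_zero, add_zero, add_zero, add_zero]

lemma intD_relabel {M N : ADRaw B A} (φ : N.G → M.G → Prop) :
    intD (relabel φ : Coch M N) = 0 := by
  funext y x l
  rw [intD_eq]
  refine cD_of_nil (fun a l => rfl) ?_ l
  rw [relabel_nil]
  split_ifs
  · exact A.d_idem _
  · exact map_zero _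

lemma compC_relabel {M N K : ADRaw B A} (g : Coch N K) {φ : N.G → M.G → Prop} {t : M.G → N.G} (hφ
    : ∀ y x, φ y x ↔ y = t x) (z x l) : compC g (relabel φ) z x l = g z (t x) l * A.idem (N.r (t x))
    := by
  rw [compC_apply, Finset.sum_eq_single (t x)]
  · refine Eq.trans ?_ (splitSum_right_nil (fun l1 => g z (t x) l1 * A.idem (N.r (t x))) l)
    refine splitSum_congr fun l1 l2 _ => ?_
    split_ifs with h
    · rw [h, relabel_nil, if_pos ((hφ _ _).mpr rfl)]
    · rw [relabel_of_ne_nil _ _ _ h, mul_zero]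
  · intro y _ hy
    exact conv_eq_zero_right (fun l => relabel_of_not (fun h => hy ((hφ _ _).mp h)) l) l
  · simp

lemma relabel_compC {M N K : ADRaw B A} (f : Coch M N) {φ : K.G → N.G → Prop} {s : K.G → N.G} (hφ
    : ∀ z y, φ z y ↔ y = s z) (z x l) : compC (relabel φ : Coch N K) f z x l = A.idem (K.r z) * f (s
    z) x l := by
  rw [compC_apply, Finset.sum_eq_single (s z)]
  · refine Eq.trans ?_ (splitSum_left_nil (fun l1 => A.idem (K.r z) * f (s z) x l1) l)
    refine splitSum_congr fun l1 l2 _ => ?_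
    split_ifs with h
    · rw [h, relabel_nil, if_pos ((hφ _ _).mpr rfl)]
    · rw [relabel_of_ne_nil _ _ _ h, zero_mul]
  · intro y _ hy
    exact conv_eq_zero_left (fun l => relabel_of_not (fun h => hy ((hφ _ _).mp h)) l) l
  · simp

lemma idC_compC {M N : ADRaw B A} {f : Coch M N} (hf : BiC f) : compC (idC N) f = f := by
  funext z x l
  exact (relabel_compC f (φ := fun z y => z = y) (s := id) (fun z y => eq_comm) z x l).trans
    (hf.out_left z x l)

lemma compC_idC {M N : ADRaw B A} {f : Coch M N} (hf : BiC f) : compC f (idC M) = f := by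
  funext z x l
  exact (compC_relabel f (φ := fun z y => z = y) (t := id) (fun z y => Iff.rfl) z x l).trans
    (hf.out_right z x l)

lemma relabel_compC_relabel {M N K : ADRaw B A} {φ : K.G → N.G → Prop} {ψ : N.G → M.G → Prop}
    {t : M.G → N.G} (hψ : ∀ y x, ψ y x ↔ y = t x) (hr : ∀ z y, φ z y → K.r z = N.r y) :
    compC (relabel φ : Coch N K) (relabel ψ : Coch M N) = relabel fun z x => φ z (t x) := by
  funext z x l
  rw [compC_relabel _ hψ]
  rcases l with _ | ⟨a, l⟩
  · rw [relabel_nil, relabel_nil]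
    split_ifs with h
    · rw [hr _ _ h, A.idem_mul_self]
    · rw [zero_mul]
  · rw [relabel_cons, relabel_cons, zero_mul]

/-! ### Sums of iterated structure maps applied to short sequences -/

lemma T_of_short [AddCommMonoid R] (N : ADRaw B A) {Φ : List A.Mor → R} (hΦ : ∀ t : List A.Mor, 2
    ≤ t.length → Φ t = 0) (y x l) : N.T y x Φ l = (if y = x ∧ l = [] then Φ [] else 0) + Φ [N.δ y x
    l] := by
  have h : ∀ j, 2 ≤ j → N.iter j y x Φ l = 0 := fun j hj => by
    rw [iter_congr N j _ _ (Ψ := fun _ => 0) fun t ht => hΦ t (by omega), iter_zero_fun]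
  rw [ADRaw.T, finsum_eq_range h, Finset.sum_range_succ, Finset.sum_range_one, iter_zero, iter_one]

lemma TF_of_short [AddCommMonoid R] {N N' : ADRaw B A} (f : Coch N N') {Φ : List A.Mor → R} (h : ∀
    j, 2 ≤ j → ∀ y x l, iterF f j y x Φ l = 0) (y x l) : TF f y x Φ l = Φ [f y x l] := by
  rw [TF, finsum_eq_range fun j hj => h j hj y x l, Finset.sum_range_succ, Finset.sum_range_one,
    iterF_zero, iterF_one, zero_add]

lemma iterF_congr [AddCommMonoid R] {N N' : ADRaw B A} (f : Coch N N') (j y x) {Φ Ψ : List A.Mor →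
    R} (h : ∀ t : List A.Mor, t.length = j → Φ t = Ψ t) (l) : iterF f j y x Φ l = iterF f j y x Ψ l
    := by
  induction j generalizing y Φ Ψ l with
  | zero => rw [iterF_zero, iterF_zero]
  | succ j ih =>
    rw [iterF_succ, iterF_succ]
    congr 1
    · refine Finset.sum_congr rfl fun n _ => splitSum_congr fun l1 l2 _ => ?_
      exact iter_congr N j _ _ (fun t ht => h _ (by simp [ht])) _
    · refine Finset.sum_congr rfl fun n _ => splitSum_congr fun l1 l2 _ => ?_
      exact ih n (fun t ht => h _ (by simp [ht])) _

lemma iterF_zero_fun [AddCommMonoid R] {N N' : ADRaw B A} (f : Coch N N') (j y x l) : iterF f j y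
    x (fun _ => (0 : R)) l = 0 := by
  induction j generalizing y l with
  | zero => rw [iterF_zero]
  | succ j ih =>
    rw [iterF_succ]
    simp only [iter_zero_fun, ih, splitSum_zero, Finset.sum_const_zero, add_zero]

lemma iterF_idem [AddCommGroup R] {N N' : ADRaw B A} {f : Coch N N'} (hf : ∀ y x l, f y x l = 0 ∨
    ∃ s, f y x l = A.idem s) (j y x) {Φ : List A.Mor → R} (hΦ : MultiAdd Φ) (h : ∀ (t) s, t.length =
    j → A.idem s ∈ t → Φ t = 0) (l) : iterF f j y x Φ l = 0 := by
  induction j generalizing y Φ l with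
  | zero => rw [iterF_zero]
  | succ j ih =>
    rw [iterF_succ, Finset.sum_eq_zero, Finset.sum_eq_zero, add_zero]
    · intro n _
      refine splitSum_eq_zero fun l1 l2 _ => ih n (hΦ.tail _) (fun t s ht hs => ?_) l2
      exact h _ s (by simp [ht]) (List.mem_cons_of_mem _ hs)
    · intro n _
      refine splitSum_eq_zero fun l1 l2 _ => ?_
      rcases hf y n l1 with e | ⟨s, e⟩
      · rw [e, iter_zero_head N hΦ]
      · rw [e, iter_congr N j _ _ (Ψ := fun _ => 0) fun t ht => h _ s (by simp [ht]) (by simp),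
          iter_zero_fun]

lemma relabel_eq_or {M N : ADRaw B A} (φ : N.G → M.G → Prop) (y x l) : (relabel φ : Coch M N) y x
    l = 0 ∨ ∃ s, (relabel φ : Coch M N) y x l = A.idem s := by
  rcases l with _ | ⟨a, l⟩
  · rw [relabel_nil]
    split_ifs
    · exact .inr ⟨_, rfl⟩
    · exact .inl rfl
  · exact .inl rfl

lemma boxId_relabel {N N' : ADRaw C B} {M : ADRaw B A} (hM : PreAD M) (φ : N'.G → N.G → Prop)
    (hφ : ∀ y x, φ y x → N'.r y = N.r x) :
    boxId (relabel φ : Coch N N') M =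
      relabel fun (y : (N'.box M).G) (x : (N.box M).G) => φ y.1.1 x.1.1 ∧ y.1.2 = x.1.2 := by
  funext y x l
  refine (TF_of_short (relabel φ) (fun j hj y' x' l => iterF_idem (relabel_eq_or φ) j y' x'
    (hM.cochain.biC.multiAdd _ _) (fun t s ht hs => hM.unital_higher _ _ t s (by omega) hs) l)
    y.1.1 x.1.1 l).trans ?_
  rcases l with _ | ⟨a, l⟩
  · rw [relabel_nil, relabel_nil]
    by_cases h : φ y.1.1 x.1.1
    · rw [if_pos h, hM.unital]
      by_cases h' : y.1.2 = x.1.2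
      · rw [if_pos ⟨h', by rw [hφ _ _ h]; exact x.2.symm⟩, if_pos ⟨h, h'⟩]
        exact congrArg (fun z => A.idem (M.r z)) h'.symm
      · rw [if_neg fun e => h' e.1, if_neg fun e => h' e.2]
    · rw [if_neg h, if_neg fun e => h e.1, (hM.cochain.biC.multiAdd _ _).zero_head]
  · rw [relabel_cons, relabel_cons, (hM.cochain.biC.multiAdd _ _).zero_head]

lemma idBox_relabel (N : ADRaw C B) {M M' : ADRaw B A} (φ : M'.G → M.G → Prop) :
    idBox N (relabel φ : Coch M M') =
      relabel fun (y : (N.box M').G) (x : (N.box M).G) => y.1.1 = x.1.1 ∧ φ y.1.2 x.1.2 := by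
  funext y x l
  refine (T_of_short N (fun t ht => relabel_of_ne_nil φ _ _ ?_) y.1.1 x.1.1 l).trans ?_
  · rintro rfl
    simp at ht
  rw [relabel_cons, add_zero]
  rcases l with _ | ⟨a, l⟩
  · rw [relabel_nil, relabel_nil]
    by_cases h : y.1.1 = x.1.1
    · simp only [h, and_true, true_and, if_true]
      rfl
    · simp only [h, false_and, if_false]
  · rw [relabel_cons, if_neg (by simp)]

/-! ### The identity bimodule as a unit -/

lemma one_iter [AddCommGroup R] (j y x) {Φ : List B.Mor → R} (h : BiLin ((ADRaw.one B).l y)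
    ((ADRaw.one B).l x) Φ) (l) (hl : l.length = j) : (ADRaw.one B).iter j y x Φ l = Φ l := by
  induction j generalizing y Φ l with
  | zero =>
    obtain rfl := List.length_eq_zero_iff.mp hl
    rw [iter_zero]
    split_ifs with e
    · rfl
    · exact (h.nil fun e' => e ⟨(one_l_inj B).mp e', rfl⟩).symm
  | succ j ih =>
    obtain ⟨a, l, rfl⟩ : ∃ a l', l = a :: l' := by
      rcases l with _ | ⟨a, l⟩
      · simp at hl
      · exact ⟨a, l, rfl⟩
    have hl' : l.length = j := by simpa using hl
    have e1 : ∀ n : (ADRaw.one B).G, splitSum (fun l1 l2 => (ADRaw.one B).iter j n x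
        (fun t => Φ ((ADRaw.one B).δ y n l1 :: t)) l2) (a :: l) =
        Φ ((a * B.idem ((ADRaw.one B).l n)) :: l) := by
      intro n
      rw [splitSum_cons, one_δ_of_ne B y n [] (by simp), iter_zero_head _ h.add, zero_add]
      rw [show splitSum (fun l1 l2 => (ADRaw.one B).iter j n x
        (fun t => Φ ((ADRaw.one B).δ y n (a :: l1) :: t)) l2) l =
        splitSum (fun l1 l2 => if l1 = [] then (ADRaw.one B).iter j n x
        (fun t => Φ ((ADRaw.one B).δ y n [a] :: t)) l2 else 0) l from ?_]
      · rw [splitSum_left_nil, ih n _ l hl']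
        · rw [one_δ, mul_assoc, h.left]
        · rw [one_δ]
          refine ⟨h.add.tail _, fun l1 b s c l2 => h.mid (_ :: l1) b s c l2, fun b l => ?_,
            fun l b => h.right (_ :: l) b, fun hn => ?_⟩
          · have := h.mid [] (B.idem ((ADRaw.one B).l y) * a * B.idem ((ADRaw.one B).l n))
              ((ADRaw.one B).l n) b l
            rw [mul_assoc _ _ (B.idem ((ADRaw.one B).l n)), B.idem_mul_self] at this
            exact this.symm
          · exact h.last_eq_zero hn _ []
      · refine splitSum_congr fun l1 l2 _ => ?_
        split_ifs with e
        · rw [e]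
        · rw [one_δ_of_ne B y n (a :: l1) (by simpa using e), iter_zero_head _ h.add]
    rw [iter_succ, Finset.sum_congr rfl fun n _ => e1 n]
    have := map_sum (h.add.headHom l) (fun n : (ADRaw.one B).G => a * B.idem ((ADRaw.one B).l n))
      Finset.univ
    rw [← Finset.mul_sum, one_sum, mul_one] at this
    exact this.symm

lemma one_T [AddCommGroup R] (y x) {Φ : List B.Mor → R} (h : BiLin ((ADRaw.one B).l y) ((ADRaw.one
    B).l x) Φ) (l) : (ADRaw.one B).T y x Φ l = Φ l := by
  rw [ADRaw.T, finsum_eq_single _ l.length fun j hj => one_iter_of_ne B h.add j y x l hj.symm,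
    one_iter _ y x h l rfl]

lemma oneBox_idBox {M M' : ADRaw B A} {f : Coch M M'} (hf : BiC f) (y : ((ADRaw.one B).box M').G)
    (x : ((ADRaw.one B).box M).G) (l) : idBox (ADRaw.one B) f y x l = f y.1.2 x.1.2 l := by
  rw [idBox_apply]
  refine one_T _ _ ?_ l
  have hy : (ADRaw.one B).l y.1.1 = M'.l y.1.2 := y.2
  have hx : (ADRaw.one B).l x.1.1 = M.l x.1.2 := x.2
  rw [hy, hx]
  exact hf.biLin _ _

lemma one_δ_idem {y x : (ADRaw.one A).G} {r r' : A.Obj} (hy : r = (ADRaw.one A).l y) (hx : r' =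
    (ADRaw.one A).l x) (a) : (ADRaw.one A).δ y x [a] = A.idem r * a * A.idem r' := by
  subst hy hx
  rfl

lemma boxOne_exBox {M M' : ADRaw B A} {f : Coch M M'} (hf : BiC f) (y : (M'.box (ADRaw.one A)).G)
    (x : (M.box (ADRaw.one A)).G) (l) : boxId f (ADRaw.one A) y x l = f y.1.1 x.1.1 l := by
  refine (TF_of_short f (fun j hj y' x' l => ?_) y.1.1 x.1.1 l).trans ?_
  · rw [iterF_congr f j _ _ (Ψ := fun _ => 0) fun t ht => one_δ_of_ne _ _ _ t (by omega),
      iterF_zero_fun]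
  · rw [one_δ_idem y.2 x.2]
    exact hf.out _ _ l

lemma boxOne_δ {M : ADRaw B A} (hM : BiC (M := M) (N := M) M.δ)
    (y x : (M.box (ADRaw.one A)).G) (l : List B.Mor) :
    (M.box (ADRaw.one A)).δ y x l = M.δ y.1.1 x.1.1 l := by
  refine (T_of_short M (Φ := (ADRaw.one A).δ y.1.2 x.1.2)
    (fun t ht => one_δ_of_ne _ _ _ t (by omega)) y.1.1 x.1.1 l).trans ?_
  rw [one_δ_of_ne A _ _ [] (by simp), ite_self, zero_add, one_δ_idem y.2 x.2]
  exact hM.out _ _ l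

end Relabel

section Closed

variable {A B C E : DGCat} {R : Type}

/-! ### Closed morphisms -/

lemma homMor_le_mor {M N : ADRaw B A} {p : ℤ × ℤ} {f : Coch M N} (h : f ∈ homMor M N p) :
    f ∈ mor M N := AddSubgroup.mem_iSup_of_mem p h

lemma mor_induction {M N : ADRaw B A} {P : Coch M N → Prop}
    (h : ∀ p, ∀ f ∈ homMor M N p, P f) (h0 : P 0) (hadd : ∀ f g, P f → P g → P (f + g))
    {f : Coch M N} (hf : f ∈ mor M N) : P f :=
  AddSubgroup.iSup_induction (homMor M N) (C := P) hf h h0 hadd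

lemma biC_of_mor {M N : ADRaw B A} {f : Coch M N} (hf : f ∈ mor M N) : BiC f :=
  mor_induction (fun _ _ h => h.1.biC) BiC.zero (fun _ _ => BiC.add) hf

lemma mor_compC {M N K : ADRaw B A} {g : Coch N K} {f : Coch M N} (hg : g ∈ mor N K)
    (hf : f ∈ mor M N) : compC g f ∈ mor M K := by
  refine mor_induction (P := fun g => compC g f ∈ mor M K) (fun q g hg => ?_) ?_
    (fun f f' h h' => ?_) hg
  · refine mor_induction (P := fun f => compC g f ∈ mor M K) (fun p f hf => ?_) ?_
      (fun f f' h h' => ?_) hf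
    · exact homMor_le_mor (homMor_compC hg hf)
    · rw [compC_zero]; exact zero_mem _
    · rw [compC_add]; exact add_mem h h'
  · rw [zero_compC]; exact zero_mem _
  · rw [add_compC]; exact add_mem h h'

lemma mor_idBox {N : ADRaw C B} (hN : IsAD N) {M M' : ADRaw B A} {g : Coch M M'}
    (hg : g ∈ mor M M') : idBox N g ∈ mor (N.box M) (N.box M') := by
  refine (mor_induction (P := fun g => BiC g ∧ idBox N g ∈ mor (N.box M) (N.box M'))
    (fun p f hf => ⟨hf.1.biC, homMor_le_mor (homMor_idBox hN.preAD hf)⟩)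
    ⟨BiC.zero, by rw [idBox_zero]; exact zero_mem _⟩ (fun f g hf hg => ⟨hf.1.add hg.1, ?_⟩) hg).2
  rw [idBox_add hN.bdd hf.1.multiAdd hg.1.multiAdd]
  exact add_mem hf.2 hg.2

lemma boxId_add {N N' : ADRaw C B} (hN : IsAD N) (hN' : IsAD N') {M : ADRaw B A} (hM : IsAD M)
    (f g : Coch N N') : boxId (f + g) M = boxId f M + boxId g M :=
  add_exBox hN.bdd hN'.bdd f g hM.cochain.biC.multiAdd

lemma boxId_zero {N N' : ADRaw C B} {M : ADRaw B A} (hM : IsAD M) :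
    boxId (0 : Coch N N') M = 0 := zero_exBox hM.cochain.biC.multiAdd

lemma mor_boxId {N N' : ADRaw C B} (hN : IsAD N) (hN' : IsAD N') {M : ADRaw B A} (hM : IsAD M)
    {f : Coch N N'} (hf : f ∈ mor N N') : boxId f M ∈ mor (N.box M) (N'.box M) := by
  refine mor_induction (P := fun f => boxId f M ∈ mor (N.box M) (N'.box M)) (fun p f hf => ?_) ?_
    (fun f g hf hg => ?_) hf
  · exact homMor_le_mor (homMor_boxId hN.preAD hN'.preAD hM.preAD hf)
  · rw [boxId_zero hM]; exact zero_mem _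
  · rw [boxId_add hN hN' hM]; exact add_mem hf hg

lemma mor_exBox {N N' : ADRaw C B} (hN : IsAD N) (hN' : IsAD N') {M M' : ADRaw B A}
    {f : Coch N N'} (hf : f ∈ mor N N') {g : Coch M M'} (hg : g ∈ mor M M') :
    exBox f g ∈ mor (N.box M) (N'.box M') := by
  have hgb := biC_of_mor hg
  refine mor_induction (P := fun f => exBox f g ∈ mor (N.box M) (N'.box M')) (fun p f hf => ?_) ?_
    (fun f f' h h' => ?_) hf
  · refine (mor_induction (P := fun g => BiC g ∧ exBox f g ∈ mor (N.box M) (N'.box M'))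
      (fun q g hg => ⟨hg.1.biC, homMor_le_mor (homMor_exBox hN.preAD hN'.preAD hf hg)⟩)
      ⟨BiC.zero, by rw [exBox_zero]; exact zero_mem _⟩ (fun g g' h h' => ⟨h.1.add h'.1, ?_⟩) hg).2
    rw [exBox_add hN.bdd hN'.bdd f h.1.multiAdd h'.1.multiAdd]
    exact add_mem h.2 h'.2
  · rw [zero_exBox hgb.multiAdd]; exact zero_mem _
  · rw [add_exBox hN.bdd hN'.bdd f f' hgb.multiAdd]; exact add_mem h h'

lemma IsAD.dMor_idBox {N : ADRaw C B} {M M' : ADRaw B A} (hN : IsAD N) (hM : IsAD M)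
    (hM' : IsAD M') {g : Coch M M'} (hg : BiC g) :
    dMor (N.box M) (N.box M') (idBox N g) = idBox N (dMor M M' g) :=
  BraidAD.dMor_idBox hN.bdd hN.cochain.biC hN.curv hM.cochain.biC hM'.cochain.biC hg

lemma IsAD.dMor_boxId {N N' : ADRaw C B} {M : ADRaw B A} (hN : IsAD N) (hN' : IsAD N')
    (hM : IsAD M) {f : Coch N N'} (hf : BiC f) :
    dMor (N.box M) (N'.box M) (boxId f M) = boxId (dMor N N' f) M :=
  BraidAD.dMor_boxId hN.bdd hN'.bdd hN.cochain.biC hN'.cochain.biC hN.curv hN'.curv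
    hM.cochain.biC hM.curv hf

lemma dMor_eq_zero {M N : ADRaw B A} {f : Coch M N} (hf : f ∈ closed M N) : dMor M N f = 0 :=
  hf.2

lemma mem_closed {M N : ADRaw B A} {f : Coch M N} (hf : f ∈ mor M N) (h : dMor M N f = 0) :
    f ∈ closed M N := ⟨hf, h⟩

lemma closed_compC {M N K : ADRaw B A} {g : Coch N K} {f : Coch M N} (hg : g ∈ closed N K)
    (hf : f ∈ closed M N) : compC g f ∈ closed M K := by
  refine mem_closed (mor_compC hg.1 hf.1) ?_
  rw [dMor_compC, dMor_eq_zero hf, dMor_eq_zero hg, zero_compC, compC_zero,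
    add_zero]

lemma closed_idBox {N : ADRaw C B} (hN : IsAD N) {M M' : ADRaw B A} (hM : IsAD M)
    (hM' : IsAD M') {g : Coch M M'} (hg : g ∈ closed M M') :
    idBox N g ∈ closed (N.box M) (N.box M') := by
  refine mem_closed (mor_idBox hN hg.1) ?_
  rw [hN.dMor_idBox hM hM' (biC_of_mor hg.1), dMor_eq_zero hg, idBox_zero]

lemma closed_boxId {N N' : ADRaw C B} (hN : IsAD N) (hN' : IsAD N') {M : ADRaw B A}
    (hM : IsAD M) {f : Coch N N'} (hf : f ∈ closed N N') :
    boxId f M ∈ closed (N.box M) (N'.box M) := by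
  refine mem_closed (mor_boxId hN hN' hM hf.1) ?_
  rw [hN.dMor_boxId hN' hM (biC_of_mor hf.1), dMor_eq_zero hf, boxId_zero hM]

lemma bdry_compC {M N K : ADRaw B A} {f f' : Coch M N} {g g' : Coch N K} (hf : f ∈ closed M N)
    (hf' : f' ∈ closed M N) (hg : g ∈ closed N K) (h : -f + f' ∈ bdry M N)
    (h' : -g + g' ∈ bdry N K) : -compC g f + compC g' f' ∈ bdry M K := by
  obtain ⟨a, ha, ha'⟩ := h
  obtain ⟨b, hb, hb'⟩ := h'
  rw [Coch.neg_eq] at ha' hb' ⊢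
  have e1 : dMor M N a ∈ closed M N := ha' ▸ add_mem hf hf'
  refine ⟨compC g a + compC b f', add_mem (mor_compC hg.1 ha) (mor_compC hb hf'.1), ?_⟩
  rw [map_add, dMor_compC, dMor_compC, dMor_eq_zero hg, dMor_eq_zero hf', zero_compC, compC_zero,
    ha', hb', compC_add, add_compC]
  have := Coch.add_self (compC g f')
  calc _ = (compC g f' + compC g f') + (compC g f + compC g' f') := by abel
    _ = _ := by rw [this, zero_add]

lemma bdry_idBox {N : ADRaw C B} (hN : IsAD N) {M M' : ADRaw B A} (hM : IsAD M)
    (hM' : IsAD M') {g g' : Coch M M'} (hg : g ∈ closed M M') (hg' : g' ∈ closed M M')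
    (h : -g + g' ∈ bdry M M') : -idBox N g + idBox N g' ∈ bdry (N.box M) (N.box M') := by
  obtain ⟨a, ha, ha'⟩ := h
  rw [Coch.neg_eq] at ha' ⊢
  refine ⟨idBox N a, mor_idBox hN ha, ?_⟩
  rw [hN.dMor_idBox hM hM' (biC_of_mor ha), ha',
    idBox_add hN.bdd (biC_of_mor hg.1).multiAdd (biC_of_mor hg'.1).multiAdd]

lemma bdry_boxId {N N' : ADRaw C B} (hN : IsAD N) (hN' : IsAD N') {M : ADRaw B A}
    (hM : IsAD M) {f f' : Coch N N'} (h : -f + f' ∈ bdry N N') :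
    -boxId f M + boxId f' M ∈ bdry (N.box M) (N'.box M) := by
  obtain ⟨a, ha, ha'⟩ := h
  rw [Coch.neg_eq] at ha' ⊢
  refine ⟨boxId a M, mor_boxId hN hN' hM ha, ?_⟩
  rw [hN.dMor_boxId hN' hM (biC_of_mor ha), ha', boxId_add hN hN' hM]

/-! ### Strict isomorphisms -/

/-- `t` (with inverse `s`) identifies the bases of two bimodules and all their structure. -/
structure StrictIso (M N : ADRaw B A) (t : M.G → N.G) (s : N.G → M.G) : Prop where
  ts : ∀ y, t (s y) = y
  st : ∀ x, s (t x) = x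
  l : ∀ x, N.l (t x) = M.l x
  r : ∀ x, N.r (t x) = M.r x
  deg : ∀ x, N.deg (t x) = M.deg x
  δ : ∀ y x a, N.δ (t y) (t x) a = M.δ y x a

lemma StrictIso.symm {M N : ADRaw B A} {t : M.G → N.G} {s : N.G → M.G} (h : StrictIso M N t s) :
    StrictIso N M s t :=
  ⟨h.st, h.ts, fun x => by rw [← h.l, h.ts], fun x => by rw [← h.r, h.ts],
    fun x => by rw [← h.deg, h.ts], fun y x a => by rw [← h.δ, h.ts, h.ts]⟩

lemma StrictIso.eq_iff {M N : ADRaw B A} {t : M.G → N.G} {s : N.G → M.G} (h : StrictIso M N t s)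
    (y x) : y = t x ↔ x = s y :=
  ⟨fun e => by rw [e, h.st], fun e => by rw [e, h.ts]⟩

lemma StrictIso.homMor {M N : ADRaw B A} {t : M.G → N.G} {s : N.G → M.G}
    (h : StrictIso M N t s) {φ : N.G → M.G → Prop} (hφ : ∀ y x, φ y x ↔ y = t x) :
    relabel φ ∈ homMor M N 0 := by
  refine relabel_homMor (fun y x e => ?_) (fun y x e => ?_) fun y x e => ?_
  · rw [(hφ y x).mp e, h.l]
  · rw [(hφ y x).mp e, h.r]
  · rw [(hφ y x).mp e, h.deg, zero_add]

lemma StrictIso.compC_right {M N K : ADRaw B A} {t : M.G → N.G} {s : N.G → M.G} (_ : StrictIso M N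
    t s) {φ : N.G → M.G → Prop} (hφ : ∀ y x, φ y x ↔ y = t x) {g : Coch N K} (hg : BiC g) (z x l) :
    compC g (relabel φ) z x l = g z (t x) l := by
  rw [compC_relabel g hφ, hg.out_right]

lemma StrictIso.compC_left {M N K : ADRaw B A} {t : M.G → N.G} {s : N.G → M.G} (h : StrictIso M N
    t s) {φ : N.G → M.G → Prop} (hφ : ∀ y x, φ y x ↔ y = t x) {f : Coch K M} (hf : BiC f) (z x l) :
    compC (relabel φ : Coch M N) f z x l = f (s z) x l := by
  rw [relabel_compC f (s := s) fun z y => (hφ z y).trans (h.eq_iff z y), h.symm.r z |>.symm,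
    hf.out_left]

lemma StrictIso.closed {M N : ADRaw B A} {t : M.G → N.G} {s : N.G → M.G}
    (h : StrictIso M N t s) (hM : IsAD M) (hN : IsAD N) {φ : N.G → M.G → Prop}
    (hφ : ∀ y x, φ y x ↔ y = t x) : relabel φ ∈ closed M N := by
  refine mem_closed (homMor_le_mor (h.homMor hφ)) ?_
  rw [dMor_apply, intD_relabel, zero_add]
  funext y x l
  rw [Pi.add_apply, Pi.add_apply, Pi.add_apply, h.compC_right hφ hN.cochain.biC,
    h.compC_left hφ hM.cochain.biC, ← h.δ, h.ts]
  exact A.add_self _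

lemma box_ext {N : ADRaw C B} {M : ADRaw B A} {p q : (N.box M).G} (h1 : p.1.1 = q.1.1)
    (h2 : p.1.2 = q.1.2) : p = q := Subtype.ext (Prod.ext h1 h2)

/-- The basis elements of `(K ⊠ N) ⊠ M` as those of `K ⊠ (N ⊠ M)`. -/
def assocMap (K : ADRaw E C) (N : ADRaw C B) (M : ADRaw B A) (x : ((K.box N).box M).G) :
    (K.box (N.box M)).G := ⟨(x.1.1.1.1, ⟨(x.1.1.1.2, x.1.2), x.2⟩), x.1.1.2⟩

def assocMapInv (K : ADRaw E C) (N : ADRaw C B) (M : ADRaw B A) (x : (K.box (N.box M)).G) :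
    ((K.box N).box M).G := ⟨(⟨(x.1.1, x.1.2.1.1), x.2⟩, x.1.2.1.2), x.1.2.2⟩

lemma assocIso {K : ADRaw E C} {N : ADRaw C B} {M : ADRaw B A} (hK : IsAD K) (hN : IsAD N)
    (hM : IsAD M) : StrictIso ((K.box N).box M) (K.box (N.box M)) (assocMap K N M)
      (assocMapInv K N M) where
  ts _ := rfl
  st _ := rfl
  l _ := rfl
  r _ := rfl
  deg _ := (add_assoc _ _ _).symm
  δ y x a := by
    refine (box_T hK.bdd hK.cochain.biC.out_left hN.cochain.biLin hN.bdd
      (hM.cochain.biC.multiAdd y.1.2 x.1.2) y.1.1 x.1.1 a).symm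

lemma assocHom_iff {K : ADRaw E C} {N : ADRaw C B} {M : ADRaw B A} (y : (K.box (N.box M)).G)
    (x : ((K.box N).box M).G) :
    (y.1.1 = x.1.1.1.1 ∧ y.1.2.1.1 = x.1.1.1.2 ∧ y.1.2.1.2 = x.1.2) ↔ y = assocMap K N M x :=
  ⟨fun ⟨h1, h2, h3⟩ => box_ext h1 (box_ext h2 h3), fun h => by subst h; exact ⟨rfl, rfl, rfl⟩⟩

lemma assocInv_iff {K : ADRaw E C} {N : ADRaw C B} {M : ADRaw B A} (y : ((K.box N).box M).G)
    (x : (K.box (N.box M)).G) :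
    (x.1.1 = y.1.1.1.1 ∧ x.1.2.1.1 = y.1.1.1.2 ∧ x.1.2.1.2 = y.1.2) ↔ y = assocMapInv K N M x :=
  ⟨fun ⟨h1, h2, h3⟩ => box_ext (box_ext h1.symm h2.symm) h3.symm,
    fun h => by subst h; exact ⟨rfl, rfl, rfl⟩⟩

def oneBoxMap (M : ADRaw B A) (x : ((ADRaw.one B).box M).G) : M.G := x.1.2

def oneBoxMapInv (M : ADRaw B A) (x : M.G) : ((ADRaw.one B).box M).G := ⟨(M.l x, x), rfl⟩

lemma oneBoxIso {M : ADRaw B A} (hM : IsAD M) :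
    StrictIso ((ADRaw.one B).box M) M (oneBoxMap M) (oneBoxMapInv M) where
  ts _ := rfl
  st x := box_ext x.2.symm rfl
  l x := x.2.symm
  r _ := rfl
  deg _ := (zero_add _).symm
  δ y x a := (oneBox_idBox hM.cochain.biC y x a).symm

lemma oneBoxInv_iff {M : ADRaw B A} (y : ((ADRaw.one B).box M).G) (x) : y.1.2 = x ↔ y =
    oneBoxMapInv M x :=
  ⟨fun h => by subst h; exact box_ext y.2 rfl, fun h => by subst h; rfl⟩

def boxOneMap (M : ADRaw B A) (x : (M.box (ADRaw.one A)).G) : M.G := x.1.1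

def boxOneMapInv (M : ADRaw B A) (x : M.G) : (M.box (ADRaw.one A)).G := ⟨(x, M.r x), rfl⟩

lemma boxOneIso {M : ADRaw B A} (hM : IsAD M) :
    StrictIso (M.box (ADRaw.one A)) M (boxOneMap M) (boxOneMapInv M) where
  ts _ := rfl
  st x := box_ext rfl x.2
  l _ := rfl
  r x := x.2
  deg _ := (add_zero _).symm
  δ y x a := (boxOne_δ hM.cochain.biC y x a).symm

lemma boxOneInv_iff {M : ADRaw B A} (y : (M.box (ADRaw.one A)).G) (x) : y.1.1 = x ↔ y =
    boxOneMapInv M x :=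
  ⟨fun h => by subst h; exact box_ext rfl y.2.symm, fun h => by subst h; rfl⟩

lemma idIso (M : ADRaw B A) : StrictIso M M id id :=
  ⟨fun _ => rfl, fun _ => rfl, fun _ => rfl, fun _ => rfl, fun _ => rfl, fun _ _ _ => rfl⟩

lemma wellDefined : WellDefined where
  one := IsAD.one
  box N M := N.isAD.box M.isAD
  id_closed M := (idIso M.raw).closed M.isAD M.isAD fun _ _ => Iff.rfl
  comp_closed _ _ _ _ hf _ hg := closed_compC hg hf
  comp_homotopy _ _ _ _ hf _ hf' _ hg _ _ h h' := bdry_compC hf hf' hg h h'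
  idBox_closed N M M' _ hg := closed_idBox N.isAD M.isAD M'.isAD hg
  idBox_homotopy N M M' _ hg _ hg' h := bdry_idBox N.isAD M.isAD M'.isAD hg hg' h
  boxId_closed N N' M _ hf := closed_boxId N.isAD N'.isAD M.isAD hf
  boxId_homotopy N N' M _ _ _ _ h := bdry_boxId N.isAD N'.isAD M.isAD h
  assocHom_closed K N M := (assocIso K.isAD N.isAD M.isAD).closed
    ((K.isAD.box N.isAD).box M.isAD) (K.isAD.box (N.isAD.box M.isAD)) assocHom_iff
  assocInv_closed K N M := (assocIso K.isAD N.isAD M.isAD).symm.closed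
    (K.isAD.box (N.isAD.box M.isAD)) ((K.isAD.box N.isAD).box M.isAD) assocInv_iff
  oneBoxHom_closed M := (oneBoxIso M.isAD).closed ((IsAD.one _).box M.isAD) M.isAD
    fun _ _ => Iff.rfl
  oneBoxInv_closed M := (oneBoxIso M.isAD).symm.closed M.isAD ((IsAD.one _).box M.isAD)
    oneBoxInv_iff
  boxOneHom_closed M := (boxOneIso M.isAD).closed (M.isAD.box (IsAD.one _)) M.isAD
    fun _ _ => Iff.rfl
  boxOneInv_closed M := (boxOneIso M.isAD).symm.closed M.isAD (M.isAD.box (IsAD.one _))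
    boxOneInv_iff

end Closed

namespace IsCone

variable {A B C E : DGCat} {R : Type} {N N' Q : ADRaw B A} {f : Coch N N'} {i : N.G → Q.G}
  {i' : N'.G → Q.G}

/-! ### Morphisms from and to cones -/

lemma biC (h : IsCone f i i') (hN : BiC (M := N) (N := N) N.δ)
    (hN' : BiC (M := N') (N := N') N'.δ) (hf : BiC f) : BiC (M := Q) (N := Q) Q.δ := by
  constructor
  · intro y x
    induction y using h.cases with
    | h1 y =>
      induction x using h.cases with
      | h1 x => rw [h.δ_ii, h.l_i, h.l_i]; exact hN.biLin y x
      | h2 x => rw [show Q.δ (i y) (i' x) = fun _ => 0 from funext (h.δ_it y x)]; exact BiLin.zero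
    | h2 y =>
      induction x using h.cases with
      | h1 x => rw [h.δ_ti, h.l_i, h.l_t]; exact hf.biLin y x
      | h2 x => rw [h.δ_tt, h.l_t, h.l_t]; exact hN'.biLin y x
  · intro y x l
    induction y using h.cases with
    | h1 y =>
      induction x using h.cases with
      | h1 x => rw [h.δ_ii, h.r_i, h.r_i]; exact hN.out y x l
      | h2 x => rw [h.δ_it]; simp
    | h2 y =>
      induction x using h.cases with
      | h1 x => rw [h.δ_ti, h.r_i, h.r_t]; exact hf.out y x l
      | h2 x => rw [h.δ_tt, h.r_t, h.r_t]; exact hN'.out y x l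

lemma boxRight (h : IsCone f i i') {A' : DGCat} {M : ADRaw A A'}
    (hM : ∀ y x, MultiAdd (M.δ y x)) :
    IsCone (Q := Q.box M) (boxId f M)
      (fun x : (N.box M).G => ⟨(i x.1.1, x.1.2), (h.r_i _).trans x.2⟩)
      (fun x : (N'.box M).G => ⟨(i' x.1.1, x.1.2), (h.r_t _).trans x.2⟩) where
  bij := by
    constructor
    · rintro (x | x) (y | y) e
      · have h₁ := h.inj.mp (congrArg (fun z => z.1.1) e)
        have h₂ := congrArg (fun z => z.1.2) e
        exact congrArg Sum.inl (box_ext h₁ h₂)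
      · exact absurd (congrArg (fun z => z.1.1) e) (h.ne _ _)
      · exact absurd (congrArg (fun z => z.1.1) e).symm (h.ne _ _)
      · have h₁ := h.inj'.mp (congrArg (fun z => z.1.1) e)
        have h₂ := congrArg (fun z => z.1.2) e
        exact congrArg Sum.inr (box_ext h₁ h₂)
    · rintro ⟨⟨q, m⟩, hq⟩
      obtain ⟨x | y, rfl⟩ := h.bij.2 q
      · exact ⟨.inl ⟨(x, m), (h.r_i x).symm.trans hq⟩, rfl⟩
      · exact ⟨.inr ⟨(y, m), (h.r_t y).symm.trans hq⟩, rfl⟩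
  δ_ii y x := funext fun l => h.T_ii (hM _ _) _ _ l
  δ_tt y x := funext fun l => h.T_tt (hM _ _) _ _ l
  δ_ti y x := funext fun l => h.T_ti (hM _ _) _ _ l
  δ_it y x l := h.T_it (hM _ _) _ _ l
  l_i x := h.l_i x.1.1
  l_t x := h.l_t x.1.1
  r_i _ := rfl
  r_t _ := rfl

lemma boxLeft (h : IsCone f i i') (K : ADRaw C B) :
    IsCone (Q := K.box Q) (idBox K f)
      (fun x : (K.box N).G => ⟨(x.1.1, i x.1.2), x.2.trans (h.l_i _).symm⟩)
      (fun x : (K.box N').G => ⟨(x.1.1, i' x.1.2), x.2.trans (h.l_t _).symm⟩) where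
  bij := by
    constructor
    · rintro (x | x) (y | y) e
      · have h₁ := congrArg (fun z => z.1.1) e
        have h₂ := h.inj.mp (congrArg (fun z => z.1.2) e)
        exact congrArg Sum.inl (box_ext h₁ h₂)
      · exact absurd (congrArg (fun z => z.1.2) e) (h.ne _ _)
      · exact absurd (congrArg (fun z => z.1.2) e).symm (h.ne _ _)
      · have h₁ := congrArg (fun z => z.1.1) e
        have h₂ := h.inj'.mp (congrArg (fun z => z.1.2) e)
        exact congrArg Sum.inr (box_ext h₁ h₂)
    · rintro ⟨⟨k, q⟩, hq⟩
      obtain ⟨x | y, rfl⟩ := h.bij.2 q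
      · exact ⟨.inl ⟨(k, x), hq.trans (h.l_i x)⟩, rfl⟩
      · exact ⟨.inr ⟨(k, y), hq.trans (h.l_t y)⟩, rfl⟩
  δ_ii y x := congrArg (K.T y.1.1 x.1.1) (h.δ_ii y.1.2 x.1.2)
  δ_tt y x := congrArg (K.T y.1.1 x.1.1) (h.δ_tt y.1.2 x.1.2)
  δ_ti y x := congrArg (K.T y.1.1 x.1.1) (h.δ_ti y.1.2 x.1.2)
  δ_it y x l := by
    have e : Q.δ (i y.1.2) (i' x.1.2) = fun _ => 0 := funext (h.δ_it y.1.2 x.1.2)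
    exact (congrArg (fun Φ => K.T y.1.1 x.1.1 Φ l) e).trans (T_zero K _ _ l)
  l_i _ := rfl
  l_t _ := rfl
  r_i x := h.r_i x.1.2
  r_t x := h.r_t x.1.2

section Components

variable {K : ADRaw B A}

lemma dMor_into_i (h : IsCone f i i') (F : Coch K Q) (y x l) : dMor K Q F (i y) x l = dMor K N
    (fun y => F (i y)) y x l := by
  simp only [dMor_apply, Pi.add_apply, intD_eq, compC_apply, h.sum, h.δ_ii,
    conv_eq_zero_left (h.δ_it _ _), Finset.sum_const_zero, add_zero]

lemma dMor_into_t (h : IsCone f i i') (F : Coch K Q) (y x l) : dMor K Q F (i' y) x l = dMor K N'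
    (fun y => F (i' y)) y x l + compC f (fun y => F (i y)) y x l := by
  simp only [dMor_apply, Pi.add_apply, intD_eq, compC_apply, h.sum, h.δ_ti, h.δ_tt]
  abel

lemma dMor_from_t (h : IsCone f i i') (F : Coch Q K) (y x l) : dMor Q K F y (i' x) l = dMor N' K
    (fun y x => F y (i' x)) y x l := by
  simp only [dMor_apply, Pi.add_apply, intD_eq, compC_apply, h.sum, h.δ_tt,
    conv_eq_zero_right (h.δ_it _ _), Finset.sum_const_zero, zero_add]

lemma dMor_from_i (h : IsCone f i i') (F : Coch Q K) (y x l) : dMor Q K F y (i x) l = dMor N K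
    (fun y x => F y (i x)) y x l + compC (fun y x => F y (i' x)) f y x l := by
  simp only [dMor_apply, Pi.add_apply, intD_eq, compC_apply, h.sum, h.δ_ti, h.δ_ii]
  abel

variable [AddCommGroup R] {Φ : List A.Mor → R}

lemma iterF_into_i (h : IsCone f i i') (F : Coch K Q) (hΦ : MultiAdd Φ) (j y x l) :
    iterF F j (i y) x Φ l = iterF (N' := N) (fun y => F (i y)) j y x Φ l := by
  induction j generalizing y Φ l with
  | zero => rw [iterF_zero, iterF_zero]
  | succ j ih =>
    rw [iterF_succ, iterF_succ, h.sum]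
    simp only [h.δ_ii, h.δ_it, iterF_zero_head _ hΦ, splitSum_zero, Finset.sum_const_zero,
      add_zero, ih (hΦ.tail _)]

lemma iterF_into_t (h : IsCone f i i') (F : Coch K Q) (hF : ∀ y x l, F (i y) x l = 0)
    (hΦ : MultiAdd Φ) (j y x l) :
    iterF F j (i' y) x Φ l = iterF (N' := N') (fun y => F (i' y)) j y x Φ l := by
  induction j generalizing y Φ l with
  | zero => rw [iterF_zero, iterF_zero]
  | succ j ih =>
    have e : (fun y => F (i y) : Coch K N) = 0 := by
      funext y x l
      exact hF y x l
    rw [iterF_succ, iterF_succ, h.sum]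
    simp only [h.δ_tt, h.iterF_into_i F (hΦ.tail _), e, iterF_zero_left (hΦ.tail _), splitSum_zero,
      Finset.sum_const_zero, zero_add, ih (hΦ.tail _)]

/-- The cochain with given components into a cone. -/
def into (_ : IsCone f i i') (a : Coch K N) (b : Coch K N') : Coch K Q := fun q x l =>
  (if hq : ∃ y, q = i y then a hq.choose x l else 0) +
    if hq : ∃ y, q = i' y then b hq.choose x l else 0

lemma into_i (h : IsCone f i i') (a : Coch K N) (b : Coch K N') (y) : h.into a b (i y) = a y := by
  funext x l
  have h1 : ∃ y', i y = i y' := ⟨y, rfl⟩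
  have h2 : ¬ ∃ y', i y = i' y' := fun ⟨y', e⟩ => h.ne _ _ e
  rw [into, dif_pos h1, dif_neg h2, add_zero]
  rw [← h.inj.mp h1.choose_spec]

lemma into_t (h : IsCone f i i') (a : Coch K N) (b : Coch K N') (y) : h.into a b (i' y) = b y
    := by
  funext x l
  have h1 : ∃ y', i' y = i' y' := ⟨y, rfl⟩
  have h2 : ¬ ∃ y', i' y = i y' := fun ⟨y', e⟩ => h.ne _ _ e.symm
  rw [into, dif_pos h1, dif_neg h2, zero_add]
  rw [← h.inj'.mp h1.choose_spec]

lemma homMor_of_into (h : IsCone f i i') {F : Coch K Q} {p p1 p2 : ℤ × ℤ}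
    (h₁ : (fun y => F (i y) : Coch K N) ∈ homMor K N p1)
    (h₂ : (fun y => F (i' y) : Coch K N') ∈ homMor K N' p2)
    (hd : ∀ y, p - Q.deg (i y) = p1 - N.deg y) (hd' : ∀ y, p - Q.deg (i' y) = p2 - N'.deg y) :
    F ∈ homMor K Q p := by
  refine ⟨IsCochain.of_biC ⟨fun y x => ?_, fun y x l => ?_⟩ fun y x => ?_, fun y x l s hs => ?_⟩ <;>
    induction y using h.cases with | h1 y => ?_ | h2 y => ?_
  · rw [h.l_i]; exact h₁.1.biLin y x
  · rw [h.l_t]; exact h₂.1.biLin y x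
  · rw [h.r_i]; exact h₁.1.out y x l
  · rw [h.r_t]; exact h₂.1.out y x l
  · rw [show p + K.deg x - Q.deg (i y) = p1 + K.deg x - N.deg y by
      rw [add_sub_right_comm, hd, add_sub_right_comm]]
    exact h₁.1.deg y x
  · rw [show p + K.deg x - Q.deg (i' y) = p2 + K.deg x - N'.deg y by
      rw [add_sub_right_comm, hd', add_sub_right_comm]]
    exact h₂.1.deg y x
  · exact h₁.2 y x l s hs
  · exact h₂.2 y x l s hs

end Components

end IsCone

section Bicat

variable {A B C E : DGCat}

/-! ### Functoriality of the box tensor product in the first variable -/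

lemma boxId_compC_homotopy {N N' N'' : ADRaw C B} {M : ADRaw B A} (hN : IsAD N) (hN' : IsAD N')
    (hN'' : IsAD N'') (hM : IsAD M) {p q : ℤ × ℤ} {f : Coch N N'} {g : Coch N' N''}
    (hf : f ∈ homMor N N' p) (hfd : dMor N N' f = 0) (hg : g ∈ homMor N' N'' q)
    (hgd : dMor N' N'' g = 0) :
    ∃ H ∈ mor (N.box M) (N''.box M), dMor (N.box M) (N''.box M) H =
      boxId (compC g f) M + compC (boxId g M) (boxId f M) := by
  obtain ⟨Q, i, i', hQ, h1, h2, hQp⟩ := exists_isCone_preAD hN'.preAD hN''.preAD hg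
  have hQA : IsAD Q := hQp.isAD (hQ.curv_eq_zero hN'.curv hN''.curv hgd)
  have hMm := hM.cochain.biC.multiAdd
  have hQM := hQ.boxRight hMm
  let F : Coch N Q := hQ.into f 0
  have hF : F ∈ homMor N Q p := by
    refine hQ.homMor_of_into (p1 := p) (p2 := p - (0, 1) + q) ?_ ?_ (fun y => ?_) fun y => ?_
    · simp only [F, hQ.into_i]; exact hf
    · simp only [F, hQ.into_t]; exact zero_mem _
    · rw [h1]
    · rw [h2]; abel
  have e1 : ∀ (y : N'.G) x l, dMor N Q F (i y) x l = 0 := fun y x l => by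
    rw [hQ.dMor_into_i]; simp only [F, hQ.into_i]; rw [hfd]; rfl
  have e2 : (fun y => dMor N Q F (i' y) : Coch N N'') = compC g f := by
    funext y x l
    rw [hQ.dMor_into_t]
    simp only [F, hQ.into_i, hQ.into_t]
    rw [show (fun y => (0 : Coch N N'') y) = 0 from rfl, map_zero]
    exact zero_add _
  have hb := homMor_boxId hN.preAD hQp hM.preAD hF
  have hd := hN.dMor_boxId hQA hM hF.1.biC
  let H : Coch (N.box M) (N''.box M) := fun y x =>
    boxId F M ⟨(i' y.1.1, y.1.2), (hQ.r_t _).trans y.2⟩ x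
  have hH : H ∈ homMor (N.box M) (N''.box M) (p - (0, 1) + q) :=
    homMor_restrict (M' := N.box M) (N' := N''.box M) hb id
      (fun y => ⟨(i' y.1.1, y.1.2), (hQ.r_t _).trans y.2⟩) (fun _ => rfl) (fun _ => rfl)
      (fun y => hQ.l_t y.1.1) (fun _ => rfl) fun y x => by
        change p + (N.deg x.1.1 + M.deg x.1.2) - (Q.deg (i' y.1.1) + M.deg y.1.2) =
          p - (0, 1) + q + (N.deg x.1.1 + M.deg x.1.2) - (N''.deg y.1.1 + M.deg y.1.2)
        rw [h2]; abel
  refine ⟨H, homMor_le_mor hH, ?_⟩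
  have e3 : (fun y x => boxId F M ⟨(i y.1.1, y.1.2), (hQ.r_i _).trans y.2⟩ x :
      Coch (N.box M) (N'.box M)) = boxId f M := by
    funext y x l
    refine finsum_congr fun j => ?_
    rw [hQ.iterF_into_i F (hMm _ _)]
    simp only [F, hQ.into_i]
  funext y x l
  have e4 := hQM.dMor_into_t (boxId F M) y x l
  rw [hd, e3] at e4
  have e5 : boxId (dMor N Q F) M ⟨(i' y.1.1, y.1.2), (hQ.r_t _).trans y.2⟩ x l =
      boxId (compC g f) M y x l := by
    refine finsum_congr fun j => ?_
    rw [hQ.iterF_into_t _ e1 (hMm _ _), e2]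
  rw [e5] at e4
  rw [Pi.add_apply, Pi.add_apply, Pi.add_apply, e4, add_assoc, A.add_self, add_zero]

lemma exchange_homotopy {N N' : ADRaw C B} {M M' : ADRaw B A} (hN : IsAD N) (hN' : IsAD N')
    (hM : IsAD M) (hM' : IsAD M') {f : Coch N N'} {g : Coch M M'} (hf : f ∈ closed N N')
    (hg : g ∈ closed M M') :
    dMor (N.box M) (N'.box M') (exBox f g) =
      compC (boxId f M') (idBox N g) + compC (idBox N' g) (boxId f M) := by
  rw [dMor_exBox hN.bdd hN'.bdd hN.cochain.biC hN'.cochain.biC hN.curv hN'.curv hM.cochain.biC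
    hM'.cochain.biC (biC_of_mor hf.1) (biC_of_mor hg.1), dMor_eq_zero hf, dMor_eq_zero hg,
    exBox_zero, zero_exBox (biC_of_mor hg.1).multiAdd, zero_add, zero_add]

/-! ### Whiskering and associativity -/

lemma boxId_boxId {K K' : ADRaw E C} {N : ADRaw C B} {M : ADRaw B A} (hK : IsAD K) (hK' : IsAD K')
    (hN : IsAD N) (hM : IsAD M) {f : Coch K K'} (hf : BiC f) (y : ((K'.box N).box M).G) (x : ((K.box
    N).box M).G) (l) : boxId (boxId f N) M y x l = boxId f (N.box M) (assocMap K' N M y) (assocMap K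
    N M x) l := by
  obtain ⟨Q, i, i', hQ, -⟩ := exists_isCone f 0
  have hMm := hM.cochain.biC.multiAdd y.1.2 x.1.2
  have hQb := hQ.biC hK.cochain.biC hK'.cochain.biC hf
  have e1 := (hQ.boxRight hN.cochain.biC.multiAdd).T_ti hMm y.1.1 x.1.1 l
  have e2 := hQ.T_ti (BiLin.T hN.bdd hN.cochain.biLin hMm y.1.1.1.2 x.1.1.1.2).add y.1.1.1.1
    x.1.1.1.1 l
  exact e1.symm.trans ((box_T (hQ.bdd hK.bdd hK'.bdd) hQb.out_left hN.cochain.biLin hN.bdd hMm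
    _ _ l).trans e2)

lemma boxId_idBox {K : ADRaw E C} {N N' : ADRaw C B} {M : ADRaw B A} (hK : IsAD K) (hN : IsAD N)
    (hN' : IsAD N') (hM : IsAD M) {f : Coch N N'} (hf : BiC f) (y : ((K.box N').box M).G) (x :
    ((K.box N).box M).G) (l) : boxId (idBox K f) M y x l = idBox K (boxId f M) (assocMap K N' M y)
    (assocMap K N M x) l := by
  obtain ⟨Q, i, i', hQ, -⟩ := exists_isCone f 0
  have hMm := hM.cochain.biC.multiAdd y.1.2 x.1.2
  have hQb := hQ.biC hN.cochain.biC hN'.cochain.biC hf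
  have e1 := (hQ.boxLeft K).T_ti hMm y.1.1 x.1.1 l
  have e2 : Q.T (i' y.1.1.1.2) (i x.1.1.1.2) (M.δ y.1.2 x.1.2) =
      TF f y.1.1.1.2 x.1.1.1.2 (M.δ y.1.2 x.1.2) := funext fun t => hQ.T_ti hMm _ _ t
  exact e1.symm.trans ((box_T hK.bdd hK.cochain.biC.out_left hQb.biLin (hQ.bdd hN.bdd hN'.bdd) hMm
    _ _ l).trans (congrArg (fun Φ => K.T y.1.1.1.1 x.1.1.1.1 Φ l) e2))

lemma idBox_idBox {K : ADRaw E C} {N : ADRaw C B} {M M' : ADRaw B A} (hK : IsAD K) (hN : IsAD N)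
    {f : Coch M M'} (hf : BiC f) (y : ((K.box N).box M').G) (x : ((K.box N).box M).G) (l) : idBox
    (K.box N) f y x l = idBox K (idBox N f) (assocMap K N M' y) (assocMap K N M x) l :=
  box_T hK.bdd hK.cochain.biC.out_left hN.cochain.biLin hN.bdd (hf.multiAdd _ _) y.1.1 x.1.1 l

/-! ### Homogeneous components -/

/-- The projection to the morphisms of bidegree `p`. -/
def DGCat.proj (A : DGCat) (p : ℤ × ℤ) : A.Mor →+ A.Mor :=
  ((A.gr p).subtype.comp (DFinsupp.evalAddMonoidHom p)).comp
    (AddEquiv.ofBijective _ A.gr_internal).symm.toAddMonoidHom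

lemma DGCat.proj_of_mem (A : DGCat) {p q : ℤ × ℤ} {a : A.Mor} (h : a ∈ A.gr q) :
    A.proj p a = if p = q then a else 0 := by
  have e : (AddEquiv.ofBijective _ A.gr_internal).symm a =
      DirectSum.of (fun p => A.gr p) q ⟨a, h⟩ := by
    rw [AddEquiv.symm_apply_eq]
    exact (DirectSum.coeAddMonoidHom_of A.gr q ⟨a, h⟩).symm
  change (((AddEquiv.ofBijective _ A.gr_internal).symm a) p : A.Mor) = _
  rw [e]
  split_ifs with hpq
  · subst hpq
    rw [DirectSum.of_eq_same]
  · rw [DirectSum.of_eq_of_ne _ _ _ hpq]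
    rfl

lemma DGCat.gr_induction (A : DGCat) {P : A.Mor → Prop} (h : ∀ p, ∀ a ∈ A.gr p, P a) (h0 : P 0)
    (hadd : ∀ a b, P a → P b → P (a + b)) (a) : P a := by
  obtain ⟨v, rfl⟩ := A.gr_internal.2 a
  induction v using DirectSum.induction_on with
  | zero => simpa using h0
  | of p v => rw [DirectSum.coeAddMonoidHom_of]; exact h p v v.2
  | add v w hv hw => rw [map_add]; exact hadd _ _ hv hw

lemma MultiAdd.eq_zero {R : Type} [AddCommGroup R] {Φ : List A.Mor → R} (hΦ : MultiAdd Φ) (h : ∀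
    (l) (ds : List (ℤ × ℤ)), List.Forall₂ (fun a d => a ∈ A.gr d) l ds → Φ l = 0) (l) : Φ l = 0
    := by
  induction l generalizing Φ with
  | nil => exact h [] [] .nil
  | cons a l ih =>
    induction a using A.gr_induction with
    | h p a ha => exact ih (hΦ.tail a) fun l ds hl => h _ _ (.cons ha hl)
    | h0 => exact hΦ.zero_head l
    | hadd a b ha hb => rw [hΦ.head, ha, hb, add_zero]

/-- Multiadditive cochains of bidegree `p`. -/
def HomogC {M N : ADRaw B A} (p : ℤ × ℤ) (f : Coch M N) : Prop :=
  ∀ y x, MultiAdd (f y x) ∧ HasDeg (p + M.deg x - N.deg y) (f y x)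

lemma homogC_of_homMor {M N : ADRaw B A} {p : ℤ × ℤ} {f : Coch M N} (h : f ∈ homMor M N p) :
    HomogC p f := fun y x => ⟨h.1.biC.multiAdd y x, h.1.deg y x⟩

lemma HomogC.add {M N : ADRaw B A} {p : ℤ × ℤ} {f g : Coch M N} (hf : HomogC p f)
    (hg : HomogC p g) : HomogC p (f + g) := fun y x =>
  ⟨(hf y x).1.add (hg y x).1, fun l ds h => add_mem ((hf y x).2 l ds h) ((hg y x).2 l ds h)⟩

lemma HomogC.sum_eq_zero {M N : ADRaw B A} (s : Finset (ℤ × ℤ)) (f : ℤ × ℤ → Coch M N)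
    (hf : ∀ p ∈ s, HomogC p (f p)) (h : ∑ p ∈ s, f p = 0) (p : ℤ × ℤ) (hp : p ∈ s) : f p = 0 := by
  funext y x l
  refine (hf p hp y x).1.eq_zero (fun l ds hl => ?_) l
  have e := congrArg (fun F : Coch M N => A.proj
    (p + M.deg x - N.deg y + (ds.map fun d => d - (0, 1)).sum) (F y x l)) h
  simp only [Finset.sum_apply, map_sum, Pi.zero_apply, map_zero] at e
  rw [Finset.sum_eq_single p, A.proj_of_mem ((hf p hp y x).2 l ds hl), if_pos rfl] at e
  · exact e
  · intro q hq hqp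
    rw [A.proj_of_mem ((hf q hq y x).2 l ds hl), if_neg]
    intro e
    apply hqp
    have := add_right_cancel e
    have := sub_left_injective this
    exact (add_right_cancel this).symm
  · exact fun h => absurd hp h

lemma HasDeg.bD {c : ℤ × ℤ} {F : List B.Mor → A.Mor} (h : HasDeg c F) :
    HasDeg (c + (0, 1)) (bD B.d F) := by
  intro l ds hl
  induction hl generalizing c F with
  | nil => exact zero_mem _
  | @cons a d l ds ha hl ih =>
    rw [BraidAD.bD]
    refine add_mem ?_ ?_
    · have := h (B.d a :: l) ((d + (0, 1)) :: ds) (.cons (B.d_mem _ _ ha) hl)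
      convert this using 2
      simp only [List.map_cons, List.sum_cons]; abel
    · have := ih (c := c + (d - (0, 1))) (F := fun t => F (a :: t)) fun t es ht => by
        have := h (a :: t) (d :: es) (.cons ha ht)
        convert this using 2
        simp only [List.map_cons, List.sum_cons]; abel
      convert this using 2
      simp only [List.map_cons, List.sum_cons]; abel

lemma HasDeg.bM {c : ℤ × ℤ} {F : List B.Mor → A.Mor} (h : HasDeg c F) :
    HasDeg (c + (0, 1)) (bM F) := by
  intro l ds hl
  induction hl generalizing c F with
  | nil => exact zero_mem _
  | @cons a d l ds ha hl ih =>
    rcases hl with _ | ⟨hb, hl'⟩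
    · exact zero_mem _
    · rename_i b e l ds
      rw [BraidAD.bM]
      refine add_mem ?_ ?_
      · have := h (a * b :: l) ((d + e) :: ds) (.cons (B.gr_mul _ _ _ _ ha hb) hl')
        convert this using 2
        simp only [List.map_cons, List.sum_cons]; abel
      · have := ih (c := c + (d - (0, 1))) (F := fun t => F (a :: t)) fun t es ht => by
          have := h (a :: t) (d :: es) (.cons ha ht)
          convert this using 2
          simp only [List.map_cons, List.sum_cons]; abel
        convert this using 2
        simp only [List.map_cons, List.sum_cons]; abel

lemma HasDeg.cD {c : ℤ × ℤ} {F : List B.Mor → A.Mor} (h : HasDeg c F) :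
    HasDeg (c + (0, 1)) (cD F) := by
  intro l ds hl
  refine add_mem (add_mem ?_ (h.bD l ds hl)) (h.bM l ds hl)
  have := A.d_mem _ _ (h l ds hl)
  convert this using 2
  abel

lemma HomogC.dMor {M N : ADRaw B A} (hM : IsAD M) (hN : IsAD N) {p : ℤ × ℤ} {f : Coch M N}
    (hf : f ∈ homMor M N p) : HomogC (p + (0, 1)) (dMor M N f) := by
  have h1 : HomogC (p + (0, 1)) (intD f) := fun y x => by
    refine ⟨hf.1.biC.intD y x, ?_⟩
    rw [intD_eq]
    have := HasDeg.cD (show HasDeg _ (f y x) from hf.1.deg y x)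
    convert this using 1
    abel
  have h2 : HomogC (p + (0, 1)) (compC (M := M) (N := N) (K := N) N.δ f) := fun y x =>
    ⟨(hN.cochain.biC.compC hf.1.biC).multiAdd y x, (hN.cochain.compC hf.1).deg y x⟩
  have h3 : HomogC (p + (0, 1)) (compC (M := M) (N := M) (K := N) f M.δ) := fun y x =>
    ⟨(hf.1.biC.compC hM.cochain.biC).multiAdd y x, by
      have := (hf.1.compC hM.cochain).deg y x
      rw [add_comm (0, 1) p] at this
      exact this⟩
  exact (h1.add h2).add h3

/-- A finite sum of homogeneous morphisms. -/
lemma exists_sum_of_mor {M N : ADRaw B A} {f : Coch M N} (hf : f ∈ mor M N) :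
    ∃ (s : Finset (ℤ × ℤ)) (F : ℤ × ℤ → Coch M N), (∀ p, F p ∈ homMor M N p) ∧
      (∀ p, p ∉ s → F p = 0) ∧ f = ∑ p ∈ s, F p := by
  refine mor_induction (P := fun f => ∃ (s : Finset (ℤ × ℤ)) (F : ℤ × ℤ → Coch M N),
    (∀ p, F p ∈ homMor M N p) ∧ (∀ p, p ∉ s → F p = 0) ∧ f = ∑ p ∈ s, F p) (fun p f hf => ?_) ?_
    ?_ hf
  · refine ⟨{p}, fun q => if q = p then f else 0, fun q => ?_, fun q hq => ?_, ?_⟩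
    · by_cases h : q = p
      · simp only [h, if_true]; exact hf
      · simp only [h, if_false]; exact zero_mem _
    · exact if_neg (by simpa using hq)
    · simp
  · exact ⟨∅, 0, fun _ => zero_mem _, fun _ _ => rfl, by simp⟩
  · rintro f g ⟨s, F, h1, h2, rfl⟩ ⟨t, G, h3, h4, rfl⟩
    refine ⟨s ∪ t, F + G, fun p => add_mem (h1 p) (h3 p), fun p hp => ?_, ?_⟩
    · rw [Finset.notMem_union] at hp
      rw [Pi.add_apply, h2 p hp.1, h4 p hp.2, add_zero]
    · simp only [Pi.add_apply, Finset.sum_add_distrib]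
      rw [Finset.sum_subset Finset.subset_union_left fun p _ hp => h2 p hp,
        Finset.sum_subset Finset.subset_union_right fun p _ hp => h4 p hp]

lemma exists_sum_of_closed {M N : ADRaw B A} (hM : IsAD M) (hN : IsAD N) {f : Coch M N}
    (hf : f ∈ closed M N) :
    ∃ (s : Finset (ℤ × ℤ)) (F : ℤ × ℤ → Coch M N), (∀ p, F p ∈ homMor M N p) ∧
      (∀ p, F p ∈ closed M N) ∧ f = ∑ p ∈ s, F p := by
  obtain ⟨s, F, h1, h2, rfl⟩ := exists_sum_of_mor hf.1
  refine ⟨s, F, h1, fun p => mem_closed (homMor_le_mor (h1 p)) ?_, rfl⟩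
  by_cases hp : p ∈ s
  · have e : ∑ q ∈ s.image (· + ((0, 1) : ℤ × ℤ)), dMor M N (F (q - (0, 1))) = 0 := by
      rw [Finset.sum_image (by simp)]
      simp only [add_sub_cancel_right]
      rw [← map_sum]
      exact dMor_eq_zero hf
    have := HomogC.sum_eq_zero _ _ (fun q hq => ?_) e (p + (0, 1)) (Finset.mem_image_of_mem _ hp)
    · simpa using this
    · have := HomogC.dMor hM hN (h1 (q - (0, 1)))
      rwa [sub_add_cancel] at this
  · rw [h2 p hp, map_zero]

lemma closed_induction {M N : ADRaw B A} (hM : IsAD M) (hN : IsAD N) {P : Coch M N → Prop}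
    (h : ∀ p, ∀ f ∈ homMor M N p, f ∈ closed M N → P f) (h0 : P 0)
    (hadd : ∀ f ∈ closed M N, ∀ g ∈ closed M N, P f → P g → P (f + g)) {f : Coch M N}
    (hf : f ∈ closed M N) : P f := by
  obtain ⟨s, F, h1, h2, rfl⟩ := exists_sum_of_closed hM hN hf
  have : ∀ s : Finset (ℤ × ℤ), P (∑ p ∈ s, F p) := fun s => by
    induction s using Finset.induction_on with
    | empty => simpa using h0
    | insert p s hp ih =>
      rw [Finset.sum_insert hp]
      exact hadd _ (h2 p) _ (sum_mem fun q _ => h2 q) (h p _ (h1 p) (h2 p)) ih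
  exact this s

/-! ### Homotopy classes -/

lemma HMor.exists_cls {M N : ADRaw B A} (f : HMor M N) :
    ∃ g, ∃ hg : g ∈ closed M N, f = cls g hg := by
  obtain ⟨⟨g, hg⟩, rfl⟩ := QuotientAddGroup.mk_surjective f
  exact ⟨g, hg, rfl⟩

lemma cls_eq_iff {M N : ADRaw B A} {f g : Coch M N} (hf : f ∈ closed M N) (hg : g ∈ closed M N) :
    cls f hf = cls g hg ↔ ∃ h ∈ mor M N, dMor M N h = f + g := by
  rw [cls, cls, QuotientAddGroup.eq, AddSubgroup.mem_addSubgroupOf]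
  change -f + g ∈ bdry M N ↔ _
  rw [Coch.neg_eq]
  rfl

lemma cls_congr {M N : ADRaw B A} {f g : Coch M N} (hf : f ∈ closed M N) (hg : g ∈ closed M N)
    (h : f = g) : cls f hf = cls g hg := by
  subst h; rfl

lemma cls_add {M N : ADRaw B A} {f g : Coch M N} (hf : f ∈ closed M N) (hg : g ∈ closed M N) :
    cls f hf + cls g hg = cls (f + g) (add_mem hf hg) := rfl

lemma cls_homog {M N : ADRaw B A} {f : Coch M N} (hf : f ∈ closed M N) {p : ℤ × ℤ}
    (h : f ∈ homMor M N p) : cls f hf ∈ HMor.homog M N p :=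
  ⟨⟨f, hf⟩, h, rfl⟩

lemma HMor.exists_of_homog {M N : ADRaw B A} {p : ℤ × ℤ} {f : HMor M N}
    (h : f ∈ HMor.homog M N p) : ∃ g, ∃ hg : g ∈ closed M N, g ∈ homMor M N p ∧ f = cls g hg := by
  obtain ⟨⟨g, hg⟩, h, rfl⟩ := h
  exact ⟨g, hg, h, rfl⟩

lemma cls_sum {M N : ADRaw B A} (s : Finset (ℤ × ℤ)) (F : ℤ × ℤ → Coch M N)
    (h : ∀ p, F p ∈ closed M N) :
    ∑ p ∈ s, cls (F p) (h p) = cls (∑ p ∈ s, F p) (sum_mem fun p _ => h p) := by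
  induction s using Finset.induction_on with
  | empty => rfl
  | insert p s hp ih =>
    rw [Finset.sum_insert hp, ih, cls_add]
    exact cls_congr _ _ (Finset.sum_insert hp).symm

lemma homog_internal {M N : ADRaw B A} (hM : IsAD M) (hN : IsAD N) :
    DirectSum.IsInternal (HMor.homog M N) := by
  constructor
  · rw [injective_iff_map_eq_zero]
    intro v hv
    have hex : ∀ p, ∃ g, ∃ hg : g ∈ closed M N, g ∈ homMor M N p ∧ (v p : HMor M N) = cls g hg :=
      fun p => HMor.exists_of_homog (v p).2
    choose F hF hFp hv' using hex
    rw [DirectSum.coeAddMonoidHom_eq_dfinsuppSum, DFinsupp.sum] at hv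
    rw [Finset.sum_congr rfl fun p _ => hv' p, cls_sum] at hv
    obtain ⟨a, ha, hda⟩ := (cls_eq_iff (sum_mem fun p _ => hF p) (zero_mem _)).mp hv
    rw [add_zero] at hda
    obtain ⟨s, G, hG, hG0, rfl⟩ := exists_sum_of_mor ha
    have hcl : ∀ p ∈ DFinsupp.support v ∪ s.image (· + ((0, 1) : ℤ × ℤ)),
        (if p ∈ DFinsupp.support v then F p else 0) + dMor M N (G (p - (0, 1))) = 0 := by
      refine HomogC.sum_eq_zero _ _ (fun p _ => HomogC.add ?_ ?_) ?_
      · refine homogC_of_homMor ?_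
        split_ifs
        · exact hFp p
        · exact zero_mem _
      · have := HomogC.dMor hM hN (hG (p - (0, 1)))
        rwa [sub_add_cancel] at this
      · rw [Finset.sum_add_distrib, ← Finset.sum_subset Finset.subset_union_left,
          ← Finset.sum_subset (Finset.subset_union_right (s₁ := DFinsupp.support v)),
          Finset.sum_image (by simp), Finset.sum_congr rfl fun p hp => if_pos hp]
        · simp only [add_sub_cancel_right]
          rw [← hda, map_sum]
          exact Coch.add_self _
        · intro p _ hp
          rw [hG0, map_zero]
          intro hp'
          exact hp (Finset.mem_image.mpr ⟨_, hp', by simp⟩)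
        · intro p _ hp
          exact if_neg hp
    ext p
    by_cases hp : p ∈ DFinsupp.support v
    · have h := hcl p (Finset.mem_union_left _ hp)
      rw [if_pos hp] at h
      rw [hv' p]
      refine (cls_eq_iff (hF p) (zero_mem _)).mpr ⟨G (p - (0, 1)), homMor_le_mor (hG _), ?_⟩
      rw [add_zero]
      have := eq_neg_of_add_eq_zero_right h
      rwa [Coch.neg_eq] at this
    · rw [DFinsupp.notMem_support_iff.mp hp]
      rfl
  · intro f
    obtain ⟨g, hg, rfl⟩ := f.exists_cls
    obtain ⟨s, F, h1, h2, rfl⟩ := exists_sum_of_closed hM hN hg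
    refine ⟨∑ p ∈ s, DirectSum.of (fun p => HMor.homog M N p) p
      ⟨cls (F p) (h2 p), cls_homog (h2 p) (h1 p)⟩, ?_⟩
    rw [map_sum]
    simp only [DirectSum.coeAddMonoidHom_of]
    exact cls_sum s F h2

end Bicat

section Laws

variable {A B C E H : DGCat}

/-! ### The bicategory of AD bimodules -/

lemma StrictIso.inv_compC {M N : ADRaw B A} {t : M.G → N.G} {s : N.G → M.G}
    (h : StrictIso M N t s) {φ : N.G → M.G → Prop} (hφ : ∀ y x, φ y x ↔ y = t x)
    {ψ : M.G → N.G → Prop} (hψ : ∀ x y, ψ x y ↔ x = s y) :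
    compC (relabel ψ : Coch N M) (relabel φ : Coch M N) = idC M := by
  rw [relabel_compC_relabel hφ fun x y e => by rw [(hψ _ _).mp e, h.symm.r]]
  refine relabel_congr fun x x' => ?_
  rw [hψ, h.st]

lemma boxId_compC_homotopic {N N' N'' : ADRaw C B} {M : ADRaw B A} (hN : IsAD N)
    (hN' : IsAD N') (hN'' : IsAD N'') (hM : IsAD M) {f : Coch N N'} {g : Coch N' N''}
    (hf : f ∈ closed N N') (hg : g ∈ closed N' N'') :
    ∃ H ∈ mor (N.box M) (N''.box M), dMor (N.box M) (N''.box M) H =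
      boxId (compC g f) M + compC (boxId g M) (boxId f M) := by
  refine closed_induction hN hN' (P := fun f => ∃ H ∈ mor (N.box M) (N''.box M),
    dMor (N.box M) (N''.box M) H = boxId (compC g f) M + compC (boxId g M) (boxId f M))
    (fun p f hf hf' => ?_) ⟨0, zero_mem _, ?_⟩ ?_ hf
  · refine closed_induction hN' hN'' (P := fun g => ∃ H ∈ mor (N.box M) (N''.box M),
      dMor (N.box M) (N''.box M) H = boxId (compC g f) M + compC (boxId g M) (boxId f M))
      (fun q g hg hg' => ?_) ⟨0, zero_mem _, ?_⟩ ?_ hg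
    · exact boxId_compC_homotopy hN hN' hN'' hM hf (dMor_eq_zero hf') hg (dMor_eq_zero hg')
    · rw [zero_compC, boxId_zero hM, boxId_zero hM, zero_compC, map_zero, add_zero]
    · rintro g - g' - ⟨a, ha, ha'⟩ ⟨b, hb, hb'⟩
      refine ⟨a + b, add_mem ha hb, ?_⟩
      rw [map_add, ha', hb', add_compC, boxId_add hN hN'' hM, boxId_add hN' hN'' hM, add_compC]
      abel
  · rw [compC_zero, boxId_zero hM, boxId_zero hM, compC_zero, map_zero, add_zero]
  · rintro g - g' - ⟨a, ha, ha'⟩ ⟨b, hb, hb'⟩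
    refine ⟨a + b, add_mem ha hb, ?_⟩
    rw [map_add, ha', hb', compC_add, boxId_add hN hN'' hM, boxId_add hN hN' hM, compC_add]
    abel

lemma idBox_idC (N : ADRaw C B) (M : ADRaw B A) : idBox N (idC M) = idC (N.box M) := by
  rw [idC, idBox_relabel]
  exact relabel_congr fun y x => ⟨fun h => box_ext h.1 h.2, fun h => by subst h; exact ⟨rfl, rfl⟩⟩

lemma boxId_idC (N : ADRaw C B) {M : ADRaw B A} (hM : IsAD M) :
    boxId (idC N) M = idC (N.box M) := by
  rw [idC, boxId_relabel hM.preAD _ fun y x h => by rw [h]]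
  exact relabel_congr fun y x => ⟨fun h => box_ext h.1 h.2, fun h => by subst h; exact ⟨rfl, rfl⟩⟩

lemma pentagon_relabel (L : ADRaw H E) (K : ADRaw E C) (N : ADRaw C B) {M : ADRaw B A}
    (hM : IsAD M) :
    compC (compC (boxId (assocInv L K N) M) (assocInv L (K.box N) M)) (idBox L (assocInv K N M)) =
      compC (assocInv (L.box K) N M) (assocInv L K (N.box M)) := by
  have e1 : idBox L (assocInv K N M) = _ := idBox_relabel L _
  have e2 : boxId (assocInv L K N) M = _ := boxId_relabel hM.preAD _ fun y x h => by
    rw [(assocInv_iff y x).mp h]; rfl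
  rw [e1, e2]
  unfold assocInv
  rw [relabel_compC_relabel (t := assocMapInv L (K.box N) M) assocInv_iff, relabel_compC_relabel
    (t := fun x : (L.box (K.box (N.box M))).G =>
      (⟨(x.1.1, assocMapInv K N M x.1.2), x.2⟩ : (L.box ((K.box N).box M)).G)),
    relabel_compC_relabel (t := assocMapInv L K (N.box M)) assocInv_iff]
  · refine relabel_congr fun y x => ⟨?_, ?_⟩
    · rintro ⟨⟨h1, h2, h3⟩, h4⟩
      exact ⟨box_ext h1 h2, h3, h4.symm⟩
    · rintro ⟨h1, h2, h3⟩
      exact ⟨⟨congrArg (fun z => z.1.1) h1, congrArg (fun z => z.1.2) h1, h2⟩, h3.symm⟩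
  · intro z y h
    exact congrArg M.r h.2.2.symm
  · intro y x
    constructor
    · rintro ⟨h1, h2⟩
      exact box_ext h1 ((assocInv_iff _ _).mp h2)
    · rintro rfl
      exact ⟨rfl, rfl, rfl, rfl⟩
  · rintro z y ⟨-, h⟩
    exact congrArg M.r h
  · rintro z y ⟨-, h⟩
    exact congrArg M.r h

lemma triangle_relabel (N : ADRaw C B) {M : ADRaw B A} (hM : IsAD M) :
    compC (boxId (boxOneHom N) M) (assocInv N (ADRaw.one B) M) = idBox N (oneBoxHom M) := by
  have e1 : idBox N (oneBoxHom M) = _ := idBox_relabel N _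
  have e2 : boxId (boxOneHom N) M = _ := boxId_relabel hM.preAD _ fun y x h => by
    rw [h]; exact x.2
  rw [e1, e2]
  unfold assocInv
  rw [relabel_compC_relabel (t := assocMapInv N (ADRaw.one B) M) assocInv_iff]
  · exact relabel_congr fun y x => Iff.rfl
  · rintro z y ⟨-, h⟩
    exact congrArg M.r h

set_option maxHeartbeats 4000000 in
lemma adBimodLaws : ADBimodLaws where
  wd := wellDefined
  id_comp f := by
    obtain ⟨g, hg, rfl⟩ := f.exists_cls
    exact cls_congr _ _ (compC_idC (biC_of_mor hg.1))
  comp_id f := by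
    obtain ⟨g, hg, rfl⟩ := f.exists_cls
    exact cls_congr _ _ (idC_compC (biC_of_mor hg.1))
  assoc f g h := by
    obtain ⟨f, hf, rfl⟩ := f.exists_cls
    obtain ⟨g, hg, rfl⟩ := g.exists_cls
    obtain ⟨h, hh, rfl⟩ := h.exists_cls
    exact cls_congr _ _ (compC_assoc h g f).symm
  idBox_id N M := cls_congr _ _ (idBox_idC N.raw M.raw)
  idBox_comp N M M' M'' f g := by
    obtain ⟨f, hf, rfl⟩ := f.exists_cls
    obtain ⟨g, hg, rfl⟩ := g.exists_cls
    exact cls_congr _ _ (compC_idBox N.isAD.bdd N.isAD.cochain.biC.out_left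
      (biC_of_mor hg.1).multiAdd (biC_of_mor hf.1).biLin).symm
  boxId_id N M := cls_congr _ _ (boxId_idC N.raw M.isAD)
  boxId_comp {A B C N N' N''} f g M := by
    obtain ⟨f, hf, rfl⟩ := f.exists_cls
    obtain ⟨g, hg, rfl⟩ := g.exists_cls
    exact (cls_eq_iff _ _).mpr (boxId_compC_homotopic N.isAD N'.isAD N''.isAD M.isAD hf hg)
  exchange {A B C N N' M M'} f g := by
    obtain ⟨f, hf, rfl⟩ := f.exists_cls
    obtain ⟨g, hg, rfl⟩ := g.exists_cls
    exact (cls_eq_iff _ _).mpr ⟨exBox f g, mor_exBox N.isAD N'.isAD hf.1 hg.1,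
      (exchange_homotopy N.isAD N'.isAD M.isAD M'.isAD hf hg).trans (add_comm _ _)⟩
  assoc_hom_inv K N M := cls_congr _ _
    ((assocIso K.isAD N.isAD M.isAD).inv_compC assocHom_iff assocInv_iff)
  assoc_inv_hom K N M := cls_congr _ _
    ((assocIso K.isAD N.isAD M.isAD).symm.inv_compC assocInv_iff assocHom_iff)
  oneBox_hom_inv M := cls_congr _ _
    ((oneBoxIso M.isAD).inv_compC (fun _ _ => Iff.rfl) oneBoxInv_iff)
  oneBox_inv_hom M := cls_congr _ _
    ((oneBoxIso M.isAD).symm.inv_compC oneBoxInv_iff fun _ _ => Iff.rfl)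
  boxOne_hom_inv M := cls_congr _ _
    ((boxOneIso M.isAD).inv_compC (fun _ _ => Iff.rfl) boxOneInv_iff)
  boxOne_inv_hom M := cls_congr _ _
    ((boxOneIso M.isAD).symm.inv_compC boxOneInv_iff fun _ _ => Iff.rfl)
  one_idBox {A B M M'} f := by
    obtain ⟨f, hf, rfl⟩ := f.exists_cls
    refine cls_congr _ _ ?_
    have hb := biC_of_mor hf.1
    funext y x l
    refine (oneBox_idBox hb y x l).trans (((oneBoxIso M.isAD).compC_right (fun _ _ => Iff.rfl)
      (BiC.compC (biC_of_mor (wellDefined.oneBoxInv_closed M').1) hb) y x l).trans ?_).symm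
    exact (oneBoxIso M'.isAD).symm.compC_left oneBoxInv_iff hb y _ l
  boxId_one {A B M M'} f := by
    obtain ⟨f, hf, rfl⟩ := f.exists_cls
    refine cls_congr _ _ ?_
    have hb := biC_of_mor hf.1
    funext y x l
    refine (boxOne_exBox hb y x l).trans (((boxOneIso M.isAD).compC_right (fun _ _ => Iff.rfl)
      (BiC.compC (biC_of_mor (wellDefined.boxOneInv_closed M').1) hb) y x l).trans ?_).symm
    exact (boxOneIso M'.isAD).symm.compC_left boxOneInv_iff hb y _ l
  box_idBox {A B C E} K N {M M'} f := by
    obtain ⟨f, hf, rfl⟩ := f.exists_cls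
    refine cls_congr _ _ ?_
    have hb := biC_of_mor (closed_idBox K.isAD (N.isAD.box M.isAD) (N.isAD.box M'.isAD)
      (closed_idBox N.isAD M.isAD M'.isAD hf)).1
    funext y x l
    refine (idBox_idBox K.isAD N.isAD (biC_of_mor hf.1) y x l).trans
      (((assocIso K.isAD N.isAD M.isAD).compC_right assocHom_iff
      (BiC.compC (biC_of_mor (wellDefined.assocInv_closed K N M').1) hb) y x l).trans ?_).symm
    exact (assocIso K.isAD N.isAD M'.isAD).symm.compC_left assocInv_iff hb y _ l
  boxId_box {A B C E K K'} f N M := by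
    obtain ⟨f, hf, rfl⟩ := f.exists_cls
    refine cls_congr _ _ ?_
    have hb := biC_of_mor (closed_boxId (K.isAD.box N.isAD) (K'.isAD.box N.isAD) M.isAD
      (closed_boxId K.isAD K'.isAD N.isAD hf)).1
    funext y x l
    refine (((assocIso K.isAD N.isAD M.isAD).symm.compC_right assocInv_iff
      (BiC.compC (biC_of_mor (wellDefined.assocHom_closed K' N M).1) hb) y x l).trans
      (((assocIso K'.isAD N.isAD M.isAD).compC_left assocHom_iff hb y _ l).trans ?_)).symm
    exact boxId_boxId K.isAD K'.isAD N.isAD M.isAD (biC_of_mor hf.1) _ _ l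
  idBox_boxId {A B C E} K {N N'} f M := by
    obtain ⟨f, hf, rfl⟩ := f.exists_cls
    refine cls_congr _ _ ?_
    have hb := biC_of_mor (closed_boxId (K.isAD.box N.isAD) (K.isAD.box N'.isAD) M.isAD
      (closed_idBox K.isAD N.isAD N'.isAD hf)).1
    funext y x l
    refine (((assocIso K.isAD N.isAD M.isAD).symm.compC_right assocInv_iff
      (BiC.compC (biC_of_mor (wellDefined.assocHom_closed K N' M).1) hb) y x l).trans
      (((assocIso K.isAD N'.isAD M.isAD).compC_left assocHom_iff hb y _ l).trans ?_)).symm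
    exact boxId_idBox K.isAD N.isAD N'.isAD M.isAD (biC_of_mor hf.1) _ _ l
  pentagon L K N M := cls_congr _ _ (pentagon_relabel L.raw K.raw N.raw M.isAD)
  triangle N M := cls_congr _ _ (triangle_relabel N.raw M.isAD)
  homog_internal M N := homog_internal M.isAD N.isAD
  comp_add f g g' := by
    obtain ⟨f, hf, rfl⟩ := f.exists_cls
    obtain ⟨g, hg, rfl⟩ := g.exists_cls
    obtain ⟨g', hg', rfl⟩ := g'.exists_cls
    exact cls_congr _ _ (add_compC g g' f)
  add_comp f f' g := by
    obtain ⟨f, hf, rfl⟩ := f.exists_cls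
    obtain ⟨f', hf', rfl⟩ := f'.exists_cls
    obtain ⟨g, hg, rfl⟩ := g.exists_cls
    exact cls_congr _ _ (compC_add g f f')
  idBox_add N M M' f g := by
    obtain ⟨f, hf, rfl⟩ := f.exists_cls
    obtain ⟨g, hg, rfl⟩ := g.exists_cls
    exact cls_congr _ _ (idBox_add N.isAD.bdd (biC_of_mor hf.1).multiAdd (biC_of_mor hg.1).multiAdd)
  boxId_add {A B C N N'} f g M := by
    obtain ⟨f, hf, rfl⟩ := f.exists_cls
    obtain ⟨g, hg, rfl⟩ := g.exists_cls
    exact cls_congr _ _ (boxId_add N.isAD N'.isAD M.isAD f g)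
  comp_homog p q f hf g hg := by
    obtain ⟨f, hf, hp, rfl⟩ := HMor.exists_of_homog hf
    obtain ⟨g, hg, hq, rfl⟩ := HMor.exists_of_homog hg
    exact cls_homog _ (homMor_compC hq hp)
  idBox_homog N M M' p f hf := by
    obtain ⟨f, hf, hp, rfl⟩ := HMor.exists_of_homog hf
    exact cls_homog _ (homMor_idBox N.isAD.preAD hp)
  boxId_homog {A B C N N'} p f hf M := by
    obtain ⟨f, hf, hp, rfl⟩ := HMor.exists_of_homog hf
    exact cls_homog _ (homMor_boxId N.isAD.preAD N'.isAD.preAD M.isAD.preAD hp)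
  id_homog M := cls_homog _ ((idIso M.raw).homMor fun _ _ => Iff.rfl)
  assocHom_homog K N M :=
    ⟨cls_homog _ ((assocIso K.isAD N.isAD M.isAD).homMor assocHom_iff),
      cls_homog _ ((assocIso K.isAD N.isAD M.isAD).symm.homMor assocInv_iff)⟩
  oneBox_homog M := ⟨cls_homog _ ((oneBoxIso M.isAD).homMor fun _ _ => Iff.rfl),
    cls_homog _ ((oneBoxIso M.isAD).symm.homMor oneBoxInv_iff)⟩
  boxOne_homog M := ⟨cls_homog _ ((boxOneIso M.isAD).homMor fun _ _ => Iff.rfl),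
    cls_homog _ ((boxOneIso M.isAD).symm.homMor boxOneInv_iff)⟩

end Laws

/-! ### Components of the algebras of two strands -/

def pUU : A11.Mor →+* ZMod 2 where
  toFun a := (a : Alg11).uu
  map_zero' := rfl
  map_one' := rfl
  map_add' _ _ := rfl
  map_mul' _ _ := rfl

def pOU : A11.Mor →+* Polynomial (ZMod 2) where
  toFun a := (a : Alg11).ou
  map_zero' := rfl
  map_one' := rfl
  map_add' _ _ := rfl
  map_mul' _ _ := rfl

def pUO : A11.Mor →+* Polynomial (ZMod 2) where
  toFun a := (a : Alg11).uo
  map_zero' := rfl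
  map_one' := rfl
  map_add' _ _ := rfl
  map_mul' _ _ := rfl

def pLam : A11.Mor →+ ZMod 2 where
  toFun a := (a : Alg11).lam
  map_zero' := rfl
  map_add' _ _ := rfl

def pOO : A11.Mor →+* MvPolynomial (Fin 2) (ZMod 2) where
  toFun a := (a : Alg11).oo
  map_zero' := rfl
  map_one' := rfl
  map_add' _ _ := rfl
  map_mul' _ _ := rfl

@[simp] lemma pLam_mul (a b) :
    pLam (a * b) = (pUO a).coeff 0 * pLam b + pLam a * (pOU b).coeff 0 := rfl

lemma ext11 {a b : A11.Mor} (h₁ : pUU a = pUU b) (h₂ : pOU a = pOU b) (h3 : pUO a = pUO b)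
    (h4 : pLam a = pLam b) (h5 : pOO a = pOO b) : a = b := Alg11.ext h₁ h₂ h3 h4 h5

def iOU : Polynomial (ZMod 2) →+ A11.Mor where
  toFun f := (⟨0, f, 0, 0, 0⟩ : Alg11)
  map_zero' := rfl
  map_add' _ _ := Alg11.ext (add_zero 0).symm rfl (add_zero 0).symm (add_zero 0).symm
    (add_zero 0).symm

def iUO : Polynomial (ZMod 2) →+ A11.Mor where
  toFun f := (⟨0, 0, f, 0, 0⟩ : Alg11)
  map_zero' := rfl
  map_add' _ _ := Alg11.ext (add_zero 0).symm (add_zero 0).symm rfl (add_zero 0).symm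
    (add_zero 0).symm

def iLam : ZMod 2 →+ A11.Mor where
  toFun c := (⟨0, 0, 0, c, 0⟩ : Alg11)
  map_zero' := rfl
  map_add' _ _ := Alg11.ext (add_zero 0).symm (add_zero 0).symm (add_zero 0).symm rfl
    (add_zero 0).symm

def iOO : MvPolynomial (Fin 2) (ZMod 2) →+ A11.Mor where
  toFun f := (⟨0, 0, 0, 0, f⟩ : Alg11)
  map_zero' := rfl
  map_add' _ _ := Alg11.ext (add_zero 0).symm (add_zero 0).symm (add_zero 0).symm (add_zero 0).symm
    rfl


section simps

variable (f : Polynomial (ZMod 2)) (c : ZMod 2) (g : MvPolynomial (Fin 2) (ZMod 2))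

@[simp] lemma pUU_iOU : pUU (iOU f) = 0 := rfl
@[simp] lemma pUU_iUO : pUU (iUO f) = 0 := rfl
@[simp] lemma pUU_iLam : pUU (iLam c) = 0 := rfl
@[simp] lemma pUU_iOO : pUU (iOO g) = 0 := rfl
@[simp] lemma pOU_iOU : pOU (iOU f) = f := rfl
@[simp] lemma pOU_iUO : pOU (iUO f) = 0 := rfl
@[simp] lemma pOU_iLam : pOU (iLam c) = 0 := rfl
@[simp] lemma pOU_iOO : pOU (iOO g) = 0 := rfl
@[simp] lemma pUO_iOU : pUO (iOU f) = 0 := rfl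
@[simp] lemma pUO_iUO : pUO (iUO f) = f := rfl
@[simp] lemma pUO_iLam : pUO (iLam c) = 0 := rfl
@[simp] lemma pUO_iOO : pUO (iOO g) = 0 := rfl
@[simp] lemma pLam_iOU : pLam (iOU f) = 0 := rfl
@[simp] lemma pLam_iUO : pLam (iUO f) = 0 := rfl
@[simp] lemma pLam_iLam : pLam (iLam c) = c := rfl
@[simp] lemma pLam_iOO : pLam (iOO g) = 0 := rfl
@[simp] lemma pOO_iOU : pOO (iOU f) = 0 := rfl
@[simp] lemma pOO_iUO : pOO (iUO f) = 0 := rfl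
@[simp] lemma pOO_iLam : pOO (iLam c) = 0 := rfl
@[simp] lemma pOO_iOO : pOO (iOO g) = g := rfl


end simps

lemma idem_uu : A11.idem Alg11.Ob.uu = (⟨1, 0, 0, 0, 0⟩ : Alg11) := rfl
lemma idem_ou : A11.idem Alg11.Ob.ou = iOU 1 := rfl
lemma idem_uo : A11.idem Alg11.Ob.uo = iUO 1 := rfl
lemma idem_oo : A11.idem Alg11.Ob.oo = iOO 1 := rfl

def qU : A2.Mor →+* Polynomial (ZMod 2) := RingHom.fst (Polynomial (ZMod 2)) _

def qO : A2.Mor →+* MvPolynomial (Fin 2) (ZMod 2) := RingHom.snd (Polynomial (ZMod 2)) _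

lemma ext2 {a b : A2.Mor} (h₁ : qU a = qU b) (h₂ : qO a = qO b) : a = b := Prod.ext h₁ h₂

def jU : Polynomial (ZMod 2) →+ A2.Mor where
  toFun f := ((f, 0) : Alg2)
  map_zero' := rfl
  map_add' _ _ := Prod.ext rfl (add_zero 0).symm


def jO : MvPolynomial (Fin 2) (ZMod 2) →+ A2.Mor where
  toFun f := ((0, f) : Alg2)
  map_zero' := rfl
  map_add' _ _ := Prod.ext (add_zero 0).symm rfl


section simps

variable (f : Polynomial (ZMod 2)) (g : MvPolynomial (Fin 2) (ZMod 2))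

@[simp] lemma qU_jU : qU (jU f) = f := rfl
@[simp] lemma qU_jO : qU (jO g) = 0 := rfl
@[simp] lemma qO_jU : qO (jU f) = 0 := rfl
@[simp] lemma qO_jO : qO (jO g) = g := rfl

end simps

lemma idem_u : A2.idem Alg2.Ob.u = jU 1 := rfl
lemma idem_o : A2.idem Alg2.Ob.o = jO 1 := rfl

/-! ### Homogeneous components -/

lemma mem_gr11 {a : A11.Mor} {d : ℤ × ℤ} : a ∈ A11.gr d ↔ (pUU a ≠ 0 → d = 0) ∧
    (∀ n, (pOU a).coeff n ≠ 0 → ((-2 * n, 2 * n) : ℤ × ℤ) = d) ∧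
    (∀ n, (pUO a).coeff n ≠ 0 → ((-2 * n, 2 * n) : ℤ × ℤ) = d) ∧ (pLam a ≠ 0 → (1, 0) = d) ∧
    ∀ m, (pOO a).coeff m ≠ 0 → ((-2 * (m 0 + m 1), 2 * (m 0 + m 1)) : ℤ × ℤ) = d := by
  constructor
  · exact fun h => ⟨fun e => (h .uu e).symm, fun n => h (.ou n), fun n => h (.uo n), h .lam,
      fun m => h (.oo m)⟩
  · rintro ⟨h₁, h₂, h3, h4, h5⟩ (_ | n | n | _ | m) e
    · exact (h₁ e).symm
    · exact h₂ n e
    · exact h3 n e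
    · exact h4 e
    · exact h5 m e

lemma mem_gr2 {a : A2.Mor} {d : ℤ × ℤ} : a ∈ A2.gr d ↔
    (∀ n, (qU a).coeff n ≠ 0 → ((-2 * n, 2 * n) : ℤ × ℤ) = d) ∧
    ∀ m, (qO a).coeff m ≠ 0 → ((-2 * (m 0 + 2 * m 1), 2 * (m 0 + 2 * m 1)) : ℤ × ℤ) = d := by
  constructor
  · exact fun h => ⟨fun n => h (.u n), fun m => h (.o m)⟩
  · rintro ⟨h₁, h₂⟩ (n | m) e
    · exact h₁ n e
    · exact h₂ m e

lemma iOU_mem {f : Polynomial (ZMod 2)} {d : ℤ × ℤ} :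
    iOU f ∈ A11.gr d ↔ ∀ n, f.coeff n ≠ 0 → ((-2 * n, 2 * n) : ℤ × ℤ) = d := by simp [mem_gr11]

lemma iUO_mem {f : Polynomial (ZMod 2)} {d : ℤ × ℤ} :
    iUO f ∈ A11.gr d ↔ ∀ n, f.coeff n ≠ 0 → ((-2 * n, 2 * n) : ℤ × ℤ) = d := by simp [mem_gr11]

lemma iOO_mem {f : MvPolynomial (Fin 2) (ZMod 2)} {d : ℤ × ℤ} : iOO f ∈ A11.gr d ↔
    ∀ m, f.coeff m ≠ 0 → ((-2 * (m 0 + m 1), 2 * (m 0 + m 1)) : ℤ × ℤ) = d := by simp [mem_gr11]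

lemma iLam_mem {c : ZMod 2} {d : ℤ × ℤ} : iLam c ∈ A11.gr d ↔ (c ≠ 0 → (1, 0) = d) := by
  simp [mem_gr11]

lemma jU_mem {f : Polynomial (ZMod 2)} {d : ℤ × ℤ} :
    jU f ∈ A2.gr d ↔ ∀ n, f.coeff n ≠ 0 → ((-2 * n, 2 * n) : ℤ × ℤ) = d := by simp [mem_gr2]

lemma jO_mem {f : MvPolynomial (Fin 2) (ZMod 2)} {d : ℤ × ℤ} : jO f ∈ A2.gr d ↔
    ∀ m, f.coeff m ≠ 0 → ((-2 * (m 0 + 2 * m 1), 2 * (m 0 + 2 * m 1)) : ℤ × ℤ) = d := by simp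
      [mem_gr2]

lemma iOO_mul (f g : MvPolynomial (Fin 2) (ZMod 2)) : iOO (f * g) = iOO f * iOO g := by
  apply ext11 <;> simp

lemma jO_mul (f g : MvPolynomial (Fin 2) (ZMod 2)) : jO (f * g) = jO f * jO g := by
  apply ext2 <;> simp

/-- Symmetric polynomials in two variables. -/
def symHom : MvPolynomial (Fin 2) (ZMod 2) →ₐ[ZMod 2] MvPolynomial (Fin 2) (ZMod 2) :=
  MvPolynomial.aeval
    ![MvPolynomial.X 0 + MvPolynomial.X 1, MvPolynomial.X 0 * MvPolynomial.X 1]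

open MvPolynomial in
lemma iOO_one_mem : iOO 1 ∈ A11.gr 0 := A11.idem_mem Alg11.Ob.oo

open MvPolynomial in
lemma iOO_X_mem (i : Fin 2) : iOO (X i) ∈ A11.gr (-2, 2) := by
  rw [iOO_mem]
  intro m hm
  rw [coeff_X] at hm
  have : Finsupp.single i 1 = m := by by_contra h; simp [h] at hm
  subst this
  fin_cases i <;> simp [Finsupp.single_apply]

lemma iOO_pow_mem {f : MvPolynomial (Fin 2) (ZMod 2)} {d : ℤ × ℤ} (h : iOO f ∈ A11.gr d) (n) : iOO
    (f ^ n) ∈ A11.gr (n • d) := by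
  induction n with
  | zero => rw [pow_zero, zero_smul]; exact iOO_one_mem
  | succ n ih => rw [pow_succ, iOO_mul, succ_nsmul]; exact A11.gr_mul _ _ _ _ ih h

open MvPolynomial in
lemma symHom_mem {f : MvPolynomial (Fin 2) (ZMod 2)} {d : ℤ × ℤ} (h : jO f ∈ A2.gr d) :
    iOO (symHom f) ∈ A11.gr d := by
  rw [jO_mem] at h
  have key : ∀ m, f.coeff m ≠ 0 → iOO (symHom (monomial m (f.coeff m))) ∈ A11.gr d := by
    intro m hm
    rw [← h m hm, monomial_eq, map_mul symHom, Finsupp.prod_fintype _ _ (by simp),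
      Fin.prod_univ_two,
      map_mul symHom, map_pow, map_pow]
    simp only [symHom, aeval_X, Matrix.cons_val_zero, Matrix.cons_val_one, aeval_C]
    have h1 : iOO (X 0 + X 1) ∈ A11.gr (-2, 2) := by
      rw [map_add]; exact add_mem (iOO_X_mem 0) (iOO_X_mem 1)
    have h2 : iOO (X 0 * X 1) ∈ A11.gr ((-2, 2) + (-2, 2)) := by
      rw [iOO_mul]; exact A11.gr_mul _ _ _ _ (iOO_X_mem 0) (iOO_X_mem 1)
    have hc : f.coeff m = 1 := by
      generalize f.coeff m = c at hm; revert c; decide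
    rw [hc, (algebraMap _ _).map_one, one_mul, iOO_mul]
    have := A11.gr_mul _ _ _ _ (iOO_pow_mem h1 (m 0)) (iOO_pow_mem h2 (m 1))
    convert this using 2
    ext <;> simp <;> ring
  rw [f.as_sum, map_sum]
  have : ∀ s : Finset (Fin 2 →₀ ℕ), (∀ m ∈ s, f.coeff m ≠ 0) →
      iOO (∑ m ∈ s, symHom (monomial m (f.coeff m))) ∈ A11.gr d := by
    intro s
    induction s using Finset.induction_on with
    | empty => intro _; rw [Finset.sum_empty, map_zero]; exact zero_mem _
    | insert m s hm ih =>
      intro hs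
      rw [Finset.sum_insert hm, map_add]
      exact add_mem (key m (hs m (by simp))) (ih fun k hk => hs k (by simp [hk]))
  exact this _ fun m hm => mem_support_iff.mp hm

/-! ### The matrices of polynomials in `U₁`, `U₂` -/

lemma matU1_comm : Commute matU1 matU2 := by
  rw [Commute, SemiconjBy, matU1, matU2, Matrix.mul_fin_two, Matrix.mul_fin_two]
  ext1 i j
  fin_cases i <;> fin_cases j <;> simp
  · rw [CharTwo.add_self_eq_zero]
  · rw [mul_comm, CharTwo.add_self_eq_zero]

lemma matOf_eq (f : MvPolynomial (Fin 2) (ZMod 2)) {s : Finset (Fin 2 →₀ ℕ)}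
    (hs : f.support ⊆ s) : matOf f = ∑ m ∈ s, f.coeff m • (matU1 ^ m 0 * matU2 ^ m 1) := by
  refine Finset.sum_subset hs fun m _ hm => ?_
  rw [MvPolynomial.notMem_support_iff.mp hm, zero_smul]

lemma matOf_add (f g : MvPolynomial (Fin 2) (ZMod 2)) : matOf (f + g) = matOf f + matOf g := by
  rw [matOf_eq f (s := f.support ∪ g.support) Finset.subset_union_left,
    matOf_eq g (s := f.support ∪ g.support) Finset.subset_union_right,
    matOf_eq (f + g) MvPolynomial.support_add, ← Finset.sum_add_distrib]
  simp only [MvPolynomial.coeff_add, add_smul]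

lemma matOf_zero : matOf 0 = 0 := by simp [matOf]

lemma matOf_monomial (m : Fin 2 →₀ ℕ) (c : ZMod 2) :
    matOf (MvPolynomial.monomial m c) = c • (matU1 ^ m 0 * matU2 ^ m 1) := by
  rw [matOf_eq _ MvPolynomial.support_monomial_subset, Finset.sum_singleton,
    MvPolynomial.coeff_monomial, if_pos rfl]

lemma matU1_pow_mul (a b c d) : matU1 ^ (a + b) * matU2 ^ (c + d) = matU1 ^ a * matU2 ^ c * (matU1
    ^ b * matU2 ^ d) := by
  have h : matU1 ^ b * matU2 ^ c = matU2 ^ c * matU1 ^ b := (matU1_comm.pow_pow b c).eq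
  rw [pow_add, pow_add, mul_assoc, ← mul_assoc (matU1 ^ b), h, mul_assoc, mul_assoc]

lemma matOf_mul (f g : MvPolynomial (Fin 2) (ZMod 2)) : matOf (f * g) = matOf f * matOf g := by
  induction f using MvPolynomial.induction_on' with
  | add f f' hf hf' => rw [add_mul, matOf_add, hf, hf', matOf_add, add_mul]
  | monomial m c =>
    induction g using MvPolynomial.induction_on' with
    | add f f' hf hf' => rw [mul_add, matOf_add, hf, hf', matOf_add, mul_add]
    | monomial m' c' =>
      rw [MvPolynomial.monomial_mul, matOf_monomial, matOf_monomial, matOf_monomial,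
        smul_mul_assoc, mul_smul_comm, ← mul_smul, Finsupp.add_apply, Finsupp.add_apply,
        matU1_pow_mul]

lemma matOf_one : matOf 1 = 1 := by
  have := matOf_monomial 0 1
  simpa using this

lemma matOf_X0 : matOf (MvPolynomial.X 0) = matU1 := by
  refine (matOf_monomial (Finsupp.single 0 1) 1).trans ?_
  simp

lemma matOf_X1 : matOf (MvPolynomial.X 1) = matU2 := by
  refine (matOf_monomial (Finsupp.single 1 1) 1).trans ?_
  simp

lemma matOf_symHom (f : MvPolynomial (Fin 2) (ZMod 2)) :
    matOf (symHom f) = f • (1 : Matrix (Fin 2) (Fin 2) (MvPolynomial (Fin 2) (ZMod 2))) := by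
  induction f using MvPolynomial.induction_on with
  | C c =>
    have h : c = 0 ∨ c = 1 := by revert c; decide
    rcases h with rfl | rfl
    · simp [matOf_zero]
    · simp [matOf_one]
  | add f g hf hg => rw [map_add, matOf_add, hf, hg, add_smul]
  | mul_X f i hf =>
    rw [map_mul, matOf_mul, hf, mul_smul, smul_mul_assoc, one_mul]
    congr 1
    fin_cases i
    · simp only [symHom, Fin.zero_eta, MvPolynomial.aeval_X, Matrix.cons_val_zero, matOf_add,
        matOf_X0, matOf_X1, matU1, matU2]
      ext1 i j
      fin_cases i <;> fin_cases j <;> simp [CharTwo.add_self_eq_zero]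
    · simp only [symHom, Fin.mk_one, MvPolynomial.aeval_X, Matrix.cons_val_one,
        Matrix.cons_val_zero, Matrix.cons_val_fin_one]
      rw [matOf_mul, matOf_X0, matOf_X1, matU1, matU2, Matrix.mul_fin_two]
      ext1 i j
      fin_cases i <;> fin_cases j <;> simp [CharTwo.add_self_eq_zero, mul_comm]

/-- The bidegrees of `W` and `C`. -/
def wDeg : Fin 2 → ℤ × ℤ := ![(1, -2), (-1, 0)]

/-- Homogeneous matrices. -/
def GrMat (d : ℤ × ℤ) (m : Matrix (Fin 2) (Fin 2) (MvPolynomial (Fin 2) (ZMod 2))) : Prop :=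
  ∀ i j, jO (m i j) ∈ A2.gr (d + wDeg i - wDeg j)

lemma GrMat.mul {d d' : ℤ × ℤ} {m m' : Matrix (Fin 2) (Fin 2) (MvPolynomial (Fin 2) (ZMod 2))}
    (h : GrMat d m) (h' : GrMat d' m') : GrMat (d + d') (m * m') := by
  intro i j
  rw [Matrix.mul_apply, Fin.sum_univ_two, map_add, jO_mul, jO_mul]
  refine add_mem ?_ ?_
  · have := A2.gr_mul _ _ _ _ (h i 0) (h' 0 j)
    convert this using 2
    abel
  · have := A2.gr_mul _ _ _ _ (h i 1) (h' 1 j)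
    convert this using 2
    abel

lemma GrMat.one : GrMat 0 1 := by
  intro i j
  have h1 : jO 1 ∈ A2.gr 0 := A2.idem_mem Alg2.Ob.o
  rw [Matrix.one_apply]
  split_ifs with h
  · subst h; simpa using h1
  · rw [map_zero]; exact zero_mem _

lemma GrMat.pow {d : ℤ × ℤ} {m : Matrix (Fin 2) (Fin 2) (MvPolynomial (Fin 2) (ZMod 2))} (h :
    GrMat d m) (n) : GrMat (n • d) (m ^ n) := by
  induction n with
  | zero => rw [pow_zero, zero_smul]; exact GrMat.one
  | succ n ih => rw [pow_succ, succ_nsmul]; exact ih.mul h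

lemma jO_X_mem (i : Fin 2) : jO (MvPolynomial.X i) ∈ A2.gr (-2 * (i + 1), 2 * (i + 1)) := by
  rw [jO_mem]
  intro m hm
  rw [MvPolynomial.coeff_X] at hm
  have : Finsupp.single i 1 = m := by by_contra h; simp [h] at hm
  subst this
  fin_cases i <;> simp [Finsupp.single_apply]

lemma GrMat.U1 : GrMat (-2, 2) matU1 := by
  have h0 := jO_X_mem 0
  have h1 := jO_X_mem 1
  have h2 : jO 1 ∈ A2.gr 0 := A2.idem_mem Alg2.Ob.o
  intro i j
  fin_cases i <;> fin_cases j <;> simp [matU1, wDeg] at h0 h1 ⊢ <;> assumption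

lemma GrMat.U2 : GrMat (-2, 2) matU2 := by
  have h0 := jO_X_mem 0
  have h1 := jO_X_mem 1
  have h2 : jO 1 ∈ A2.gr 0 := A2.idem_mem Alg2.Ob.o
  intro i j
  fin_cases i <;> fin_cases j <;> simp [matU2, wDeg] at h0 h1 ⊢ <;> assumption

lemma GrMat.matOf {f : MvPolynomial (Fin 2) (ZMod 2)} {d : ℤ × ℤ} (h : iOO f ∈ A11.gr d) :
    GrMat d (matOf f) := by
  rw [iOO_mem] at h
  have : ∀ s : Finset (Fin 2 →₀ ℕ), (∀ m ∈ s, f.coeff m ≠ 0) →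
      GrMat d (∑ m ∈ s, f.coeff m • (matU1 ^ m 0 * matU2 ^ m 1)) := by
    intro s
    induction s using Finset.induction_on with
    | empty => intro _ i j; rw [Finset.sum_empty, Matrix.zero_apply, map_zero]; exact zero_mem _
    | insert m s hm ih =>
      intro hs i j
      rw [Finset.sum_insert hm, Matrix.add_apply, map_add]
      refine add_mem ?_ (ih (fun k hk => hs k (by simp [hk])) i j)
      have hm := hs m (by simp)
      have hc : f.coeff m = 1 := by
        generalize f.coeff m = c at hm; revert c; decide
      rw [hc, one_smul, ← h m hm]
      have := ((GrMat.U1.pow (m 0)).mul (GrMat.U2.pow (m 1))) i j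
      convert this using 4
      ext <;> simp <;> ring
  exact this _ fun m hm => MvPolynomial.mem_support_iff.mp hm

/-! ### Functions of sequences of length at most two -/

section Seq

variable {A B C : DGCat}

/-- The function of sequences with given values on sequences of length at most two, and zero on
longer sequences. -/
def seq (c : A.Mor) (m : B.Mor →+ A.Mor) (b : B.Mor →+ B.Mor →+ A.Mor) : List B.Mor → A.Mor
  | [] => c
  | [a] => m a
  | [a, a'] => b a a'
  | _ => 0

variable {c c' : A.Mor} {m m' : B.Mor →+ A.Mor} {b b' : B.Mor →+ B.Mor →+ A.Mor}

@[simp] lemma seq_nil : seq c m b [] = c := rfl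
@[simp] lemma seq_one (x) : seq c m b [x] = m x := rfl
@[simp] lemma seq_two (x y) : seq c m b [x, y] = b x y := rfl
@[simp] lemma seq_three (x y z l) : seq c m b (x :: y :: z :: l) = 0 := rfl

lemma seq_of_length {l : List B.Mor} (h : 3 ≤ l.length) : seq c m b l = 0 := by
  rcases l with _ | ⟨x, _ | ⟨y, _ | ⟨z, l⟩⟩⟩ <;> simp_all

lemma seq_of_length_two {l : List B.Mor} (h : 2 ≤ l.length) : seq c m 0 l = 0 := by
  rcases l with _ | ⟨x, _ | ⟨y, _ | ⟨z, l⟩⟩⟩ <;> simp_all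

lemma seq_zero (l : List B.Mor) : seq (A := A) 0 0 0 l = 0 := by
  rcases l with _ | ⟨x, _ | ⟨y, _ | ⟨z, l⟩⟩⟩ <;> rfl

lemma BiLin.seq {p q : B.Obj} (hc : p ≠ q → c = 0) (hm : ∀ a, m (B.idem p * a) = m a)
    (hm' : ∀ a, m (a * B.idem q) = m a) (hb : ∀ a a', b (B.idem p * a) a' = b a a')
    (hb' : ∀ a a', b a (a' * B.idem q) = b a a')
    (hb'' : ∀ a s a', b (a * B.idem s) a' = b a (B.idem s * a')) :
    BiLin p q (BraidAD.seq c m b) where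
  add l1 x y l2 := by
    rcases l1 with _ | ⟨u, _ | ⟨v, _ | ⟨w, l1⟩⟩⟩ <;> rcases l2 with _ | ⟨z, _ | ⟨t, l2⟩⟩ <;> simp
  mid l1 x s y l2 := by
    rcases l1 with _ | ⟨u, _ | ⟨v, _ | ⟨w, l1⟩⟩⟩ <;> rcases l2 with _ | ⟨z, _ | ⟨t, l2⟩⟩ <;>
      simp [hb'']
  left x l := by rcases l with _ | ⟨z, _ | ⟨t, l2⟩⟩ <;> simp [hm, hb]
  right l x := by rcases l with _ | ⟨u, _ | ⟨v, _ | ⟨w, l1⟩⟩⟩ <;> simp [hm', hb']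
  nil h := by simp [hc h]

lemma seq_out {e e' : A.Mor} (hc : e * c * e' = c) (hm : ∀ a, e * m a * e' = m a) (hb : ∀ a a', e
    * b a a' * e' = b a a') (l) : e * seq c m b l * e' = seq c m b l := by
  rcases l with _ | ⟨x, _ | ⟨y, _ | ⟨z, l⟩⟩⟩ <;> simp [*]

lemma HasDeg.seq {d : ℤ × ℤ} (hc : c ∈ A.gr d)
    (hm : ∀ p, ∀ a ∈ B.gr p, m a ∈ A.gr (d + (p - (0, 1))))
    (hb : ∀ p, ∀ a ∈ B.gr p, ∀ p', ∀ a' ∈ B.gr p',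
      b a a' ∈ A.gr (d + ((p - (0, 1)) + (p' - (0, 1))))) : HasDeg d (BraidAD.seq c m b) := by
  intro l ds h
  rcases h with _ | ⟨h1, _ | ⟨h2, _ | ⟨h3, h⟩⟩⟩
  · simpa using hc
  · simpa using hm _ _ h1
  · simpa using hb _ _ h1 _ _ h2
  · exact zero_mem _

lemma cD_seq (hA : ∀ a, A.d a = 0) (hB : ∀ a, B.d a = 0) (l : List B.Mor) :
    cD (seq c m b) l = match l with
      | [x, y] => m (x * y)
      | [x, y, z] => b (x * y) z + b x (y * z)
      | _ => 0 := by
  have hD : ∀ {F : List B.Mor → A.Mor}, MultiAdd F → bD B.d F l = 0 := by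
    intro F hF
    induction l generalizing F with
    | nil => rfl
    | cons a l ih =>
      simp only [bD]
      rw [hB, ih (hF.tail a), add_zero]
      exact hF.zero_head l
  rw [cD, hA, zero_add, hD, zero_add]
  · rcases l with _ | ⟨x, _ | ⟨y, _ | ⟨z, _ | ⟨w, l⟩⟩⟩⟩ <;> simp [bM, bM_zero]
  · intro l1 x y l2
    rcases l1 with _ | ⟨u, _ | ⟨v, _ | ⟨w, l1⟩⟩⟩ <;> rcases l2 with _ | ⟨z, _ | ⟨t, l2⟩⟩ <;> simp

lemma conv_seq_long {l : List B.Mor} (h : 5 ≤ l.length) : conv (seq c m b) (seq c' m' b') l = 0 :=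
    by
  refine splitSum_eq_zero fun l1 l2 hl => ?_
  by_cases h1 : 3 ≤ l1.length
  · rw [seq_of_length h1, zero_mul]
  · rw [seq_of_length (l := l2), mul_zero]
    rw [← hl, List.length_append] at h
    omega

end Seq

section Short

variable {A B : DGCat}

/-- A cochain is determined by its values on sequences of length at most two. -/
structure Short {M N : ADRaw B A} (f : Coch M N) (c : N.G → M.G → A.Mor)
    (m : N.G → M.G → B.Mor →+ A.Mor) (b : N.G → M.G → B.Mor →+ B.Mor →+ A.Mor) : Prop where
  eq : ∀ y x, f y x = seq (c y x) (m y x) (b y x)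

lemma bdd_of_weight {N : ADRaw B A} (w : N.G → ℕ) (K) (h : ∀ y x l, N.δ y x l ≠ 0 → 1 + w x ≤ w y
    + K * l.length) : Bdd N := by
  have key : ∀ (j : ℕ) (R : Type) [AddCommGroup R] (Φ : List A.Mor → R), MultiAdd Φ →
      ∀ y x (l : List B.Mor), N.iter j y x Φ l ≠ 0 → j + w x ≤ w y + K * l.length := by
    intro j
    induction j with
    | zero =>
      intro R _ Φ hΦ y x l hl
      rw [iter_zero] at hl
      by_cases e : y = x ∧ l = []
      · rw [e.1]; omega
      · rw [if_neg e] at hl; exact absurd rfl hl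
    | succ j ih =>
      intro R _ Φ hΦ y x l hl
      rw [iter_succ] at hl
      obtain ⟨n, -, hn⟩ := Finset.exists_ne_zero_of_sum_ne_zero hl
      obtain ⟨i, -, hi⟩ := Finset.exists_ne_zero_of_sum_ne_zero hn
      have h1 : N.δ y n (l.take i) ≠ 0 := fun e => hi (by beta_reduce; rw [e, iter_zero_head N hΦ])
      have h2 := h _ _ _ h1
      have h3 := ih R _ (hΦ.tail _) n x _ hi
      have h4 : K * (l.take i).length + K * (l.drop i).length = K * l.length := by
        rw [← mul_add, ← List.length_append, List.take_append_drop]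
      omega
  intro i
  refine ⟨Finset.univ.sup w + K * i + 1, fun j hj R _ Φ hΦ y x l hl => ?_⟩
  by_contra hn
  have h1 := key j R Φ hΦ y x l hn
  have h2 : w y ≤ Finset.univ.sup w := Finset.le_sup (Finset.mem_univ y)
  have h3 : K * l.length ≤ K * i := Nat.mul_le_mul_left K hl
  omega

variable {M N : ADRaw B A} {c : N.G → M.G → A.Mor} {m : N.G → M.G → B.Mor →+ A.Mor}
  {b : N.G → M.G → B.Mor →+ B.Mor →+ A.Mor}

lemma Short.isCochain {f : Coch M N} (h : Short f c m b) {p : ℤ × ℤ}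
    (hc : ∀ y x, N.l y ≠ M.l x → c y x = 0) (hm : ∀ y x a, m y x (B.idem (N.l y) * a) = m y x a)
    (hm' : ∀ y x a, m y x (a * B.idem (M.l x)) = m y x a)
    (hb : ∀ y x a a', b y x (B.idem (N.l y) * a) a' = b y x a a')
    (hb' : ∀ y x a a', b y x a (a' * B.idem (M.l x)) = b y x a a')
    (hb'' : ∀ y x a s a', b y x (a * B.idem s) a' = b y x a (B.idem s * a'))
    (oc : ∀ y x, A.idem (N.r y) * c y x * A.idem (M.r x) = c y x)
    (om : ∀ y x a, A.idem (N.r y) * m y x a * A.idem (M.r x) = m y x a)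
    (ob : ∀ y x a a', A.idem (N.r y) * b y x a a' * A.idem (M.r x) = b y x a a')
    (dc : ∀ y x, c y x ∈ A.gr (p + M.deg x - N.deg y))
    (dm : ∀ y x p', ∀ a ∈ B.gr p', m y x a ∈ A.gr (p + M.deg x - N.deg y + (p' - (0, 1))))
    (db : ∀ y x q, ∀ a ∈ B.gr q, ∀ q', ∀ a' ∈ B.gr q',
      b y x a a' ∈ A.gr (p + M.deg x - N.deg y + ((q - (0, 1)) + (q' - (0, 1))))) :
    IsCochain M N p f := by
  refine IsCochain.of_biC ⟨fun y x => ?_, fun y x l => ?_⟩ fun y x => ?_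
  · rw [h.eq]
    exact BiLin.seq (hc y x) (hm y x) (hm' y x) (hb y x) (hb' y x) (hb'' y x)
  · rw [h.eq]
    exact seq_out (oc y x) (om y x) (ob y x) l
  · rw [h.eq]
    exact HasDeg.seq (dc y x) (dm y x) (db y x)

variable {K : ADRaw B A} {c' : K.G → N.G → A.Mor} {m' : K.G → N.G → B.Mor →+ A.Mor}
  {b' : K.G → N.G → B.Mor →+ B.Mor →+ A.Mor} {f : Coch M N} {g : Coch N K}

lemma Short.compC_nil (hg : Short g c' m' b') (hf : Short f c m b) (y x) : compC g f y x [] = ∑ n,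
    c' y n * c n x := by
  simp [compC, hg.eq, hf.eq, splitSum_nil]

lemma Short.compC_one (hg : Short g c' m' b') (hf : Short f c m b) (y x a1) : compC g f y x [a1] =
    ∑ n, (c' y n * m n x a1 + m' y n a1 * c n x) := by
  simp [compC, hg.eq, hf.eq, splitSum_nil, splitSum_cons]

lemma Short.compC_two (hg : Short g c' m' b') (hf : Short f c m b) (y x a1 a2) : compC g f y x
    [a1, a2] = ∑ n, (c' y n * b n x a1 a2 + m' y n a1 * m n x a2 + b' y n a1 a2 * c n x) := by
  simp [compC, hg.eq, hf.eq, splitSum_nil, splitSum_cons, add_assoc]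

lemma Short.compC_three (hg : Short g c' m' b') (hf : Short f c m b) (y x a1 a2 a3) : compC g f y
    x [a1, a2, a3] = ∑ n, (m' y n a1 * b n x a2 a3 + b' y n a1 a2 * m n x a3) := by
  simp [compC, hg.eq, hf.eq, splitSum_nil, splitSum_cons, add_assoc]

lemma Short.compC_four (hg : Short g c' m' b') (hf : Short f c m b) (y x a1 a2 a3 a4) : compC g f
    y x [a1, a2, a3, a4] = ∑ n, b' y n a1 a2 * b n x a3 a4 := by
  simp [compC, hg.eq, hf.eq, splitSum_nil, splitSum_cons, add_assoc]

lemma Short.compC_long (hg : Short g c' m' b') (hf : Short f c m b) (y x) {l : List B.Mor} (h : 5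
    ≤ l.length) : compC g f y x l = 0 := by
  rw [compC_apply]
  refine Finset.sum_eq_zero fun n _ => ?_
  rw [hg.eq, hf.eq, conv_seq_long h]

lemma Short.curv_eq_zero {c m b} (h : Short (M := M) (N := M) M.δ c m b)
    (hA : ∀ a, A.d a = 0) (hB : ∀ a, B.d a = 0) (h0 : ∀ y x, ∑ n, c y n * c n x = 0)
    (h1 : ∀ y x a, ∑ n, (c y n * m n x a + m y n a * c n x) = 0)
    (h2 : ∀ y x a1 a2, ∑ n, (c y n * b n x a1 a2 + m y n a1 * m n x a2 + b y n a1 a2 * c n x) =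
      m y x (a1 * a2))
    (h3 : ∀ y x a1 a2 a3, ∑ n, (m y n a1 * b n x a2 a3 + b y n a1 a2 * m n x a3) =
      b y x (a1 * a2) a3 + b y x a1 (a2 * a3))
    (h4 : ∀ y x a1 a2 a3 a4, ∑ n, b y n a1 a2 * b n x a3 a4 = 0) : curv M = 0 := by
  funext y x l
  rw [curv, Pi.add_apply, Pi.add_apply, Pi.add_apply, intD_eq, h.eq, cD_seq hA hB]
  rcases l with _ | ⟨a1, _ | ⟨a2, _ | ⟨a3, _ | ⟨a4, _ | ⟨a5, l⟩⟩⟩⟩⟩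
  · rw [h.compC_nil h, h0]; exact add_zero _
  · rw [h.compC_one h, h1]; exact add_zero _
  · rw [h.compC_two h, h2]; exact A.add_self _
  · rw [h.compC_three h, h3]; exact A.add_self _
  · rw [h.compC_four h, h4]; exact add_zero _
  · rw [h.compC_long h _ _ (by simp)]; exact add_zero _

lemma Short.dMor_eq_zero (h : Short f c m b) {cM mM bM cN mN bN}
    (hM : Short (M := M) (N := M) M.δ cM mM bM) (hN : Short (M := N) (N := N) N.δ cN mN bN)
    (hA : ∀ a, A.d a = 0) (hB : ∀ a, B.d a = 0)
    (h0 : ∀ y x, ∑ n, cN y n * c n x = ∑ n, c y n * cM n x)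
    (h1 : ∀ y x a, ∑ n, (cN y n * m n x a + mN y n a * c n x) =
      ∑ n, (c y n * mM n x a + m y n a * cM n x))
    (h2 : ∀ y x a1 a2,
      ∑ n, (cN y n * b n x a1 a2 + mN y n a1 * m n x a2 + bN y n a1 a2 * c n x) =
      m y x (a1 * a2) +
        ∑ n, (c y n * bM n x a1 a2 + m y n a1 * mM n x a2 + b y n a1 a2 * cM n x))
    (h3 : ∀ y x a1 a2 a3, ∑ n, (mN y n a1 * b n x a2 a3 + bN y n a1 a2 * m n x a3) =
      (b y x (a1 * a2) a3 + b y x a1 (a2 * a3)) +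
        ∑ n, (m y n a1 * bM n x a2 a3 + b y n a1 a2 * mM n x a3))
    (h4 : ∀ y x a1 a2 a3 a4, ∑ n, bN y n a1 a2 * b n x a3 a4 =
      ∑ n, b y n a1 a2 * bM n x a3 a4) : dMor M N f = 0 := by
  funext y x l
  rw [dMor_apply, Pi.add_apply, Pi.add_apply, Pi.add_apply, Pi.add_apply, Pi.add_apply,
    Pi.add_apply, intD_eq, h.eq, cD_seq hA hB]
  rcases l with _ | ⟨a1, _ | ⟨a2, _ | ⟨a3, _ | ⟨a4, _ | ⟨a5, l⟩⟩⟩⟩⟩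
  · rw [hN.compC_nil h, h.compC_nil hM, h0, add_assoc]; exact (zero_add _).trans (A.add_self _)
  · rw [hN.compC_one h, h.compC_one hM, h1, add_assoc]; exact (zero_add _).trans (A.add_self _)
  · rw [hN.compC_two h, h.compC_two hM, h2, add_right_comm]; exact A.add_self _
  · rw [hN.compC_three h, h.compC_three hM, h3, add_right_comm]; exact A.add_self _
  · rw [hN.compC_four h, h.compC_four hM, h4, add_assoc]; exact (zero_add _).trans (A.add_self _)
  · rw [hN.compC_long h _ _ (by simp), h.compC_long hM _ _ (by simp)]; simp

end Short

/-! ### The bimodules of trivalent vertices -/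

lemma A11_d (a) : A11.d a = 0 := rfl
lemma A2_d (a) : A2.d a = 0 := rfl

def lamC : LamG → LamG → A11.Mor
  | .Y, .X => iLam 1
  | _, _ => 0

def lamM : LamG → LamG → A2.Mor →+ A11.Mor
  | .X, .X => iOU.comp qU.toAddMonoidHom
  | .Y, .Y => iUO.comp qU.toAddMonoidHom
  | .Z, .Z => (iOO.comp symHom.toRingHom.toAddMonoidHom).comp qO.toAddMonoidHom
  | _, _ => 0

lemma short_Lam : Short (M := Lam) (N := Lam) Lam.δ lamC lamM (fun _ _ => 0) where
  eq y x := by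
    funext l
    rcases y with _ | _ | _ <;> rcases x with _ | _ | _ <;>
      rcases l with _ | ⟨u, _ | ⟨v, _ | ⟨w, l⟩⟩⟩ <;> rfl

lemma Lam_sum {R : Type*} [AddCommMonoid R] (F : LamG → R) :
    ∑ x : Lam.G, F x = F .X + F .Y + F .Z := by
  change ∑ x ∈ ({.X, .Y, .Z} : Finset LamG), F x = _
  rw [Finset.sum_insert (by simp), Finset.sum_insert (by simp), Finset.sum_singleton, add_assoc]

lemma Ybim_sum {R : Type*} [AddCommMonoid R] (F : YG → R) :
    ∑ x : Ybim.G, F x = F .A + F .B + F .W + F .C := by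
  change ∑ x ∈ ({.A, .B, .W, .C} : Finset YG), F x = _
  rw [Finset.sum_insert (by simp), Finset.sum_insert (by simp), Finset.sum_insert (by simp),
    Finset.sum_singleton, add_assoc, add_assoc]

@[simp] lemma Lam_l_X : Lam.l .X = Alg2.Ob.u := rfl
@[simp] lemma Lam_l_Y : Lam.l .Y = Alg2.Ob.u := rfl
@[simp] lemma Lam_l_Z : Lam.l .Z = Alg2.Ob.o := rfl
@[simp] lemma Lam_r_X : Lam.r .X = Alg11.Ob.ou := rfl
@[simp] lemma Lam_r_Y : Lam.r .Y = Alg11.Ob.uo := rfl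
@[simp] lemma Lam_r_Z : Lam.r .Z = Alg11.Ob.oo := rfl
@[simp] lemma Lam_deg_X : Lam.deg .X = (1, -1) := rfl
@[simp] lemma Lam_deg_Y : Lam.deg .Y = 0 := rfl
@[simp] lemma Lam_deg_Z : Lam.deg .Z = 0 := rfl
@[simp] lemma Ybim_l_A : Ybim.l .A = Alg11.Ob.ou := rfl
@[simp] lemma Ybim_l_B : Ybim.l .B = Alg11.Ob.uo := rfl
@[simp] lemma Ybim_l_W : Ybim.l .W = Alg11.Ob.oo := rfl
@[simp] lemma Ybim_l_C : Ybim.l .C = Alg11.Ob.oo := rfl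
@[simp] lemma Ybim_r_A : Ybim.r .A = Alg2.Ob.u := rfl
@[simp] lemma Ybim_r_B : Ybim.r .B = Alg2.Ob.u := rfl
@[simp] lemma Ybim_r_W : Ybim.r .W = Alg2.Ob.o := rfl
@[simp] lemma Ybim_r_C : Ybim.r .C = Alg2.Ob.o := rfl
@[simp] lemma Ybim_deg_A : Ybim.deg .A = (0, -1) := rfl
@[simp] lemma Ybim_deg_B : Ybim.deg .B = (-1, 0) := rfl
@[simp] lemma Ybim_deg_W : Ybim.deg .W = (1, -2) := rfl
@[simp] lemma Ybim_deg_C : Ybim.deg .C = (-1, 0) := rfl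

attribute [simp] idem_u idem_o idem_ou idem_uo idem_oo lamC lamM matOf_one matOf_zero

@[simp] lemma pOU_uu : pOU (A11.idem Alg11.Ob.uu) = 0 := rfl
@[simp] lemma pUO_uu : pUO (A11.idem Alg11.Ob.uu) = 0 := rfl
@[simp] lemma pLam_uu : pLam (A11.idem Alg11.Ob.uu) = 0 := rfl
@[simp] lemma pOO_uu : pOO (A11.idem Alg11.Ob.uu) = 0 := rfl

lemma iOU_qU_mem {p : ℤ × ℤ} {a : A2.Mor} (h : a ∈ A2.gr p) : iOU (qU a) ∈ A11.gr p :=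
  iOU_mem.mpr (mem_gr2.mp h).1

lemma iUO_qU_mem {p : ℤ × ℤ} {a : A2.Mor} (h : a ∈ A2.gr p) : iUO (qU a) ∈ A11.gr p :=
  iUO_mem.mpr (mem_gr2.mp h).1

lemma jO_qO_mem {p : ℤ × ℤ} {a : A2.Mor} (h : a ∈ A2.gr p) : jO (qO a) ∈ A2.gr p :=
  jO_mem.mpr (mem_gr2.mp h).2

lemma isAD_Lam : IsAD Lam := by
  refine PreAD.isAD ⟨?_, ?_, ?_, ?_⟩ ?_
  · apply short_Lam.isCochain
    · rintro (_ | _ | _) (_ | _ | _) h <;> first | rfl | exact absurd rfl h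
    · rintro (_ | _ | _) (_ | _ | _) a <;> simp
    · rintro (_ | _ | _) (_ | _ | _) a <;> simp
    · simp
    · simp
    · simp
    · rintro (_ | _ | _) (_ | _ | _) <;> apply ext11 <;> simp
    · rintro (_ | _ | _) (_ | _ | _) a <;> apply ext11 <;> simp
    · simp
    · rintro (_ | _ | _) (_ | _ | _) <;> simp [zero_mem, iLam_mem]
    · intro y x p a ha
      have h : ∀ d : ℤ × ℤ, (0, 1) + d - d + (p - (0, 1)) = p := fun d => by abel
      rcases y with _ | _ | _ <;> rcases x with _ | _ | _ <;>
        first | exact zero_mem _ | (rw [h]; first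
          | exact iOU_qU_mem ha | exact iUO_qU_mem ha | exact symHom_mem (jO_qO_mem ha))
    · intros; exact zero_mem _
  · intro y x s
    rw [short_Lam.eq]
    rcases y with _ | _ | _ <;> rcases x with _ | _ | _ <;> rcases s with _ | _ <;>
      simp [-reduceCtorEq] <;>
      first
      | exact (if_pos ⟨rfl, rfl⟩).symm
      | (refine (if_neg fun h => ?_).symm; obtain ⟨h, -⟩ := h; cases h; done)
      | (refine (if_neg fun h => ?_).symm; obtain ⟨-, h⟩ := h; cases h; done)
  · intro y x l s hl h
    rw [short_Lam.eq]
    rcases l with _ | ⟨a1, _ | ⟨a2, _ | ⟨a3, l⟩⟩⟩ <;> simp at hl ⊢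
  · refine bdd_of_weight (fun x => match (x : LamG) with | .Y => 1 | _ => 0) 1 ?_
    intro y x l
    rw [short_Lam.eq]
    rcases y with _ | _ | _ <;> rcases x with _ | _ | _ <;>
      rcases l with _ | ⟨u, _ | ⟨v, _ | ⟨w, l⟩⟩⟩ <;> simp
  · apply short_Lam.curv_eq_zero A11_d A2_d
    · rintro (_ | _ | _) (_ | _ | _) <;> refine (Lam_sum _).trans ?_ <;> apply ext11 <;> simp
    · rintro (_ | _ | _) (_ | _ | _) a <;> refine (Lam_sum _).trans ?_ <;> apply ext11 <;> simp
      exact CharTwo.add_self_eq_zero _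
    · rintro (_ | _ | _) (_ | _ | _) a b <;> refine (Lam_sum _).trans ?_ <;> apply ext11 <;> simp
    · simp
    · simp

/-- The component of the structure map of `Y` with two inputs. -/
def yTwo : A11.Mor →+ A11.Mor →+ A2.Mor :=
  AddMonoidHom.mk' (fun a => AddMonoidHom.mk'
    (fun b => jU (pLam a • (pOU b).divX + pLam b • (pUO a).divX))
    fun b b' => by simp only [map_add, Polynomial.divX_add, smul_add, add_smul]; abel)
    fun a a' => by
      ext b
      simp only [AddMonoidHom.mk'_apply, AddMonoidHom.add_apply, map_add, Polynomial.divX_add,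
        smul_add, add_smul]
      abel

lemma yTwo_apply (a b) : yTwo a b = jU (Polynomial.C (pLam a) * (pOU b).divX + Polynomial.C (pLam
    b) * (pUO a).divX) := by
  simp only [← Polynomial.smul_eq_C_mul]; rfl

/-- The matrix entries of multiplication operators. -/
def matHom (i j : Fin 2) : A11.Mor →+ A2.Mor :=
  AddMonoidHom.mk' (fun a => jO (matOf (pOO a) i j)) fun a b => by
    simp only [map_add, matOf_add, Matrix.add_apply]

lemma matHom_apply (i j : Fin 2) (a) : matHom i j a = jO (matOf (pOO a) i j) := rfl

def yM : YG → YG → A11.Mor →+ A2.Mor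
  | .A, .A => jU.comp pOU.toAddMonoidHom
  | .B, .B => jU.comp pUO.toAddMonoidHom
  | .W, .W => matHom 0 0
  | .C, .W => matHom 0 1
  | .W, .C => matHom 1 0
  | .C, .C => matHom 1 1
  | _, _ => 0

def yB : YG → YG → A11.Mor →+ A11.Mor →+ A2.Mor
  | .B, .A => yTwo
  | _, _ => 0

attribute [simp] yM yB matHom_apply yTwo_apply

lemma short_Ybim : Short (M := Ybim) (N := Ybim) Ybim.δ (fun _ _ => 0) yM yB where
  eq y x := by
    funext l
    rcases y with _ | _ | _ | _ <;> rcases x with _ | _ | _ | _ <;>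
      rcases l with _ | ⟨u, _ | ⟨v, _ | ⟨w, l⟩⟩⟩ <;> rfl

lemma divX_mul (f g : Polynomial (ZMod 2)) :
    (f * g).divX = f.divX * g + Polynomial.C (f.coeff 0) * g.divX := by
  conv_lhs => rw [← Polynomial.divX_mul_X_add f]
  rw [add_mul, Polynomial.divX_add, Polynomial.divX_C_mul, mul_right_comm]
  congr 1
  ext n
  simp [Polynomial.coeff_divX]

lemma yTwo_rel (a b c) : jU (pUO a) * yTwo b c + yTwo a b * jU (pOU c) = yTwo (a * b) c + yTwo a
    (b * c) := by
  apply ext2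
  · simp only [yTwo_apply, map_add, map_mul, qU_jU, pLam_mul, divX_mul]
    obtain ⟨f, hf⟩ : ∃ f, f = (pUO a).divX := ⟨_, rfl⟩
    obtain ⟨g, hg⟩ : ∃ g, g = (pOU c).divX := ⟨_, rfl⟩
    have ha := Polynomial.divX_mul_X_add (pUO a)
    have hc := Polynomial.divX_mul_X_add (pOU c)
    have h2 : (2 : Polynomial (ZMod 2)) = 0 := CharTwo.two_eq_zero
    rw [← hf] at ha ⊢
    rw [← hg] at hc ⊢
    generalize Polynomial.C ((pUO a).coeff 0) = a0 at ha ⊢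
    generalize Polynomial.C ((pOU c).coeff 0) = c0 at hc ⊢
    have hb := Polynomial.divX_mul_X_add (pUO b)
    generalize Polynomial.C ((pUO b).coeff 0) = b0 at hb ⊢
    generalize (pUO b).divX = fb at hb ⊢
    rw [← ha, ← hb, ← hc]
    linear_combination (f * Polynomial.X * Polynomial.C (pLam b) * g -
      f * Polynomial.C (pLam c) * b0 -
      g * Polynomial.C (pLam a) * Polynomial.C ((pOU b).coeff 0)) * h2
  · simp

lemma yTwo_mem {q q' : ℤ × ℤ} {a a' : A11.Mor} (h : a ∈ A11.gr q) (h' : a' ∈ A11.gr q') :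
    yTwo a a' ∈ A2.gr ((0, 1) + (0, -1) - (-1, 0) + ((q - (0, 1)) + (q' - (0, 1)))) := by
  rw [yTwo_apply, map_add]
  obtain ⟨-, -, h1, h₂, -⟩ := mem_gr11.mp h
  obtain ⟨-, h3, -, h4, -⟩ := mem_gr11.mp h'
  refine add_mem (jU_mem.mpr fun n hn => ?_) (jU_mem.mpr fun n hn => ?_) <;>
    rw [Polynomial.coeff_C_mul, Polynomial.coeff_divX] at hn
  · rw [← h₂ (left_ne_zero_of_mul hn), ← h3 _ (right_ne_zero_of_mul hn)]
    ext <;> simp <;> ring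
  · rw [← h4 (left_ne_zero_of_mul hn), ← h1 _ (right_ne_zero_of_mul hn)]
    ext <;> simp <;> ring

lemma isAD_Ybim : IsAD Ybim := by
  refine PreAD.isAD ⟨?_, ?_, ?_, ?_⟩ ?_
  · apply short_Ybim.isCochain
    · intros; rfl
    · rintro (_ | _ | _ | _) (_ | _ | _ | _) a <;> simp
    · rintro (_ | _ | _ | _) (_ | _ | _ | _) a <;> simp
    · rintro (_ | _ | _ | _) (_ | _ | _ | _) a a' <;> simp
    · rintro (_ | _ | _ | _) (_ | _ | _ | _) a a' <;> simp
    · rintro (_ | _ | _ | _) (_ | _ | _ | _) a (_ | _ | _ | _) a' <;> simp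
    · intros; simp
    · rintro (_ | _ | _ | _) (_ | _ | _ | _) a <;> apply ext2 <;> simp
    · rintro (_ | _ | _ | _) (_ | _ | _ | _) a a' <;> apply ext2 <;> simp
    · intros; exact zero_mem _
    · intro y x p a ha
      have h : ∀ d : ℤ × ℤ, (0, 1) + d - d + (p - (0, 1)) = p := fun d => by abel
      have hm : ∀ i j, matHom i j a ∈ A2.gr ((0, 1) + wDeg i - wDeg j + (p - (0, 1))) :=
        fun i j => by
          have := GrMat.matOf (iOO_mem.mpr (mem_gr11.mp ha).2.2.2.2) i j
          rw [matHom_apply]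
          convert this using 2
          abel
      rcases y with _ | _ | _ | _ <;> rcases x with _ | _ | _ | _ <;>
        simp only [yM, AddMonoidHom.zero_apply, zero_mem]
      · rw [h]; exact jU_mem.mpr (mem_gr11.mp ha).2.1
      · rw [h]; exact jU_mem.mpr (mem_gr11.mp ha).2.2.1
      · exact hm 0 0
      · exact hm 1 0
      · exact hm 0 1
      · exact hm 1 1
    · intro y x q a ha q' a' ha'
      rcases y with _ | _ | _ | _ <;> rcases x with _ | _ | _ | _ <;>
        simp only [yB, AddMonoidHom.zero_apply, zero_mem]
      exact yTwo_mem ha ha'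
  · intro y x s
    rw [short_Ybim.eq]
    rcases y with _ | _ | _ | _ <;> rcases x with _ | _ | _ | _ <;> rcases s with _ | _ | _ | _ <;>
      simp [-reduceCtorEq] <;>
      first
      | exact (if_pos ⟨rfl, rfl⟩).symm
      | (refine (if_neg fun h => ?_).symm; obtain ⟨h, -⟩ := h; cases h; done)
      | (refine (if_neg fun h => ?_).symm; obtain ⟨-, h⟩ := h; cases h; done)
  · intro y x l s hl h
    rw [short_Ybim.eq]
    rcases y with _ | _ | _ | _ <;> rcases x with _ | _ | _ | _ <;>
      rcases l with _ | ⟨a1, _ | ⟨a2, _ | ⟨a3, l⟩⟩⟩ <;> simp at hl ⊢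
    simp only [List.mem_cons, List.not_mem_nil, or_false] at h
    rcases s with _ | _ | _ | _ <;> rcases h with rfl | rfl <;> simp
  · refine bdd_of_weight (fun x => 0) 1 ?_
    intro y x l
    rw [short_Ybim.eq]
    rcases l with _ | ⟨u, l⟩ <;> simp
  · apply short_Ybim.curv_eq_zero A2_d A11_d
    · intros; simp
    · intros; simp
    · rintro (_ | _ | _ | _) (_ | _ | _ | _) a b <;> refine (Ybim_sum _).trans ?_ <;>
        apply ext2 <;> simp <;> rw [mul_comm (pOO a), matOf_mul, Matrix.mul_apply,
          Fin.sum_univ_two] <;> ring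
    · rintro (_ | _ | _ | _) (_ | _ | _ | _) a b c <;> refine (Ybim_sum _).trans ?_ <;>
        first
        | simp only [yM, yB, AddMonoidHom.zero_apply, mul_zero, zero_mul, add_zero]; done
        | (simp only [yM, yB, AddMonoidHom.zero_apply, mul_zero, zero_mul, add_zero, zero_add]
           refine Eq.trans ?_ (yTwo_rel a b c)
           exact add_comm _ _)
    · rintro (_ | _ | _ | _) (_ | _ | _ | _) a b c d <;> refine (Ybim_sum _).trans ?_ <;> simp

section Short

variable {A B C E : DGCat} {R : Type}

/-! ### Box tensor products with short cochains -/

lemma iter_two [AddCommMonoid R] (N : ADRaw B A) (y x) (Φ : List A.Mor → R) (l) : N.iter 2 y x Φ l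
    = ∑ n, splitSum (fun l1 l2 => Φ [N.δ y n l1, N.δ n x l2]) l := by
  rw [iter_succ]
  simp only [iter_one]

lemma iterF_two [AddCommMonoid R] {N N' : ADRaw B A} (f : Coch N N') (y x) (Φ : List A.Mor → R)
    (l) : iterF f 2 y x Φ l = ∑ n, splitSum (fun l1 l2 => Φ [f y n l1, N.δ n x l2]) l + ∑ n,
    splitSum (fun l1 l2 => Φ [N'.δ y n l1, f n x l2]) l := by
  rw [iterF_succ]
  simp only [iter_one, iterF_one]

lemma T_seq (N : ADRaw C B) (y x c) (m : B.Mor →+ A.Mor) (b : B.Mor →+ B.Mor →+ A.Mor) (l) : N.T y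
    x (seq c m b) l = (if y = x ∧ l = [] then c else 0) + m (N.δ y x l) + ∑ n, splitSum (fun l1 l2
    => b (N.δ y n l1) (N.δ n x l2)) l := by
  have h : ∀ j, 3 ≤ j → N.iter j y x (seq c m b) l = 0 := fun j hj => by
    rw [iter_congr N j _ _ (Ψ := fun _ => 0) fun t ht => seq_of_length (by omega), iter_zero_fun]
  rw [ADRaw.T, finsum_eq_range h, Finset.sum_range_succ, Finset.sum_range_succ,
    Finset.sum_range_one, iter_zero, iter_one, iter_two]
  rfl

lemma TF_seq {N N' : ADRaw C B} (f : Coch N N') (y x c) (m : B.Mor →+ A.Mor) (b : B.Mor →+ B.Mor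
    →+ A.Mor) (l) : TF f y x (seq c m b) l = m (f y x l) + (∑ n, splitSum (fun l1 l2 => b (f y n l1)
    (N.δ n x l2)) l + ∑ n, splitSum (fun l1 l2 => b (N'.δ y n l1) (f n x l2)) l) := by
  have h : ∀ j, 3 ≤ j → iterF f j y x (seq c m b) l = 0 := fun j hj => by
    rw [iterF_congr f j _ _ (Ψ := fun _ => 0) fun t ht => seq_of_length (by omega),
      iterF_zero_fun]
  rw [TF, finsum_eq_range h, Finset.sum_range_succ, Finset.sum_range_succ,
    Finset.sum_range_one, iterF_zero, iterF_one, iterF_two, zero_add]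
  rfl

variable {M M' : ADRaw B A} {g : Coch M M'} {c : M'.G → M.G → A.Mor}
  {m : M'.G → M.G → B.Mor →+ A.Mor}

lemma Short.idBox_apply (hg : Short g c m fun _ _ => 0) (N : ADRaw C B) (y x l) : idBox N g y x l
    = (if y.1.1 = x.1.1 ∧ l = [] then c y.1.2 x.1.2 else 0) + m y.1.2 x.1.2 (N.δ y.1.1 x.1.1 l)
    := by
  rw [BraidAD.idBox_apply, hg.eq, T_seq]
  simp [splitSum_zero]

lemma Short.exBox_apply (hg : Short g c m fun _ _ => 0) {N N' : ADRaw C B} (f : Coch N N') (y x l)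
    : exBox f g y x l = m y.1.2 x.1.2 (f y.1.1 x.1.1 l) := by
  refine (congrArg (fun Φ => TF f y.1.1 x.1.1 Φ l) (hg.eq y.1.2 x.1.2)).trans ?_
  beta_reduce
  rw [TF_seq]
  simp [splitSum_zero]

lemma Short.idBox (hg : Short g c m fun _ _ => 0) {N : ADRaw C B} {cN mN bN}
    (hN : Short (M := N) (N := N) N.δ cN mN bN) : Short (BraidAD.idBox N g)
      (fun y x => (if y.1.1 = x.1.1 then c y.1.2 x.1.2 else 0) + m y.1.2 x.1.2 (cN y.1.1 x.1.1))
      (fun y x => (m y.1.2 x.1.2).comp (mN y.1.1 x.1.1))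
      (fun y x => (bN y.1.1 x.1.1).compr₂ (m y.1.2 x.1.2)) where
  eq y x := by
    funext l
    rw [hg.idBox_apply, hN.eq]
    rcases l with _ | ⟨u, _ | ⟨v, _ | ⟨w, l⟩⟩⟩ <;> simp

/-! ### Strict isomorphisms of box tensor products -/

lemma StrictIso.inj {M N : ADRaw B A} {t : M.G → N.G} {s : N.G → M.G} (h : StrictIso M N t s)
    {x y : M.G} (e : t x = t y) : x = y := by rw [← h.st x, e, h.st]

lemma StrictIso.trans {M N K : ADRaw B A} {t : M.G → N.G} {s : N.G → M.G} {t' : N.G → K.G}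
    {s' : K.G → N.G} (h : StrictIso M N t s) (h' : StrictIso N K t' s') :
    StrictIso M K (fun x => t' (t x)) (fun y => s (s' y)) where
  ts y := by rw [h.ts, h'.ts]
  st x := by rw [h'.st, h.st]
  l x := by rw [h'.l, h.l]
  r x := by rw [h'.r, h.r]
  deg x := by rw [h'.deg, h.deg]
  δ y x a := by rw [h'.δ, h.δ]

lemma StrictIso.boxLeft {M N : ADRaw B A} {t : M.G → N.G} {s : N.G → M.G}
    (h : StrictIso M N t s) (K : ADRaw C B) : StrictIso (K.box M) (K.box N)
      (fun x => ⟨(x.1.1, t x.1.2), x.2.trans (h.l _).symm⟩)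
      (fun x => ⟨(x.1.1, s x.1.2), x.2.trans (h.symm.l _).symm⟩) where
  ts y := box_ext rfl (h.ts _)
  st x := box_ext rfl (h.st _)
  l x := rfl
  r x := h.r _
  deg x := congrArg (K.deg x.1.1 + ·) (h.deg _)
  δ y x a := by
    have e : N.δ (t y.1.2) (t x.1.2) = M.δ y.1.2 x.1.2 := funext (h.δ _ _)
    exact congrArg (fun Φ => K.T y.1.1 x.1.1 Φ a) e

lemma IsCone.congr {N N' Q : ADRaw B A} {f f' : Coch N N'} {i : N.G → Q.G} {i' : N'.G → Q.G}
    (h : IsCone f i i') (e : f = f') : IsCone f' i i' := e ▸ h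

lemma IsCone.transport {N N' Q N₁ N₁' Q1 : ADRaw B A} {f : Coch N N'} {i : N.G → Q.G}
    {i' : N'.G → Q.G} (h : IsCone f i i') {t s t' s' u v} (hN : StrictIso N₁ N t s)
    (hN' : StrictIso N₁' N' t' s') (hQ : StrictIso Q1 Q u v) :
    IsCone (N := N₁) (N' := N₁') (Q := Q1) (fun y x => f (t' y) (t x)) (fun x => v (i (t x)))
      (fun x => v (i' (t' x))) where
  bij := by
    constructor
    · rintro (x | x) (y | y) e
      · have := h.inj.mp (hQ.symm.inj e)
        exact congrArg Sum.inl (hN.inj this)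
      · exact absurd (hQ.symm.inj e) (h.ne _ _)
      · exact absurd (hQ.symm.inj e).symm (h.ne _ _)
      · have := h.inj'.mp (hQ.symm.inj e)
        exact congrArg Sum.inr (hN'.inj this)
    · intro q
      obtain ⟨x | y, e⟩ := h.bij.2 (u q)
      · refine ⟨.inl (s x), ?_⟩
        change v (i (t (s x))) = q
        rw [hN.ts]
        exact (congrArg v e).trans (hQ.st q)
      · refine ⟨.inr (s' y), ?_⟩
        change v (i' (t' (s' y))) = q
        rw [hN'.ts]
        exact (congrArg v e).trans (hQ.st q)
  δ_ii y x := funext fun l => by rw [hQ.symm.δ, h.δ_ii, hN.δ]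
  δ_tt y x := funext fun l => by rw [hQ.symm.δ, h.δ_tt, hN'.δ]
  δ_ti y x := funext fun l => by rw [hQ.symm.δ, h.δ_ti]
  δ_it y x l := by rw [hQ.symm.δ, h.δ_it]
  l_i x := by rw [hQ.symm.l, h.l_i, hN.l]
  l_t x := by rw [hQ.symm.l, h.l_t, hN'.l]
  r_i x := by rw [hQ.symm.r, h.r_i, hN.r]
  r_t x := by rw [hQ.symm.r, h.r_t, hN'.r]

end Short

/-! ### The decomposition of `Λ ⊠ Y` and of `X ⊠ X` -/

lemma isAD_Xbim : IsAD Xbim := isAD_Ybim.box isAD_Lam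

def lamOne : Alg2.Ob → LamG
  | .u => .X
  | .o => .Z

def lamTwo : Alg2.Ob → LamG
  | .u => .Y
  | .o => .Z

def yOne : Alg2.Ob → YG
  | .u => .A
  | .o => .W

def yTwoG : Alg2.Ob → YG
  | .u => .B
  | .o => .C

attribute [simp] lamOne lamTwo yOne yTwoG

/-- The first summand of `Λ ⊠ Y`. -/
def vOne (s : (ADRaw.one A2).G) : (Lam.box Ybim).G := ⟨(lamOne s, yOne s), by cases s <;> rfl⟩

/-- The second summand of `Λ ⊠ Y`. -/
def vTwo (s : (ADRaw.one A2).G) : (Lam.box Ybim).G := ⟨(lamTwo s, yTwoG s), by cases s <;> rfl⟩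

lemma LamY_δ (y x l) : (Lam.box Ybim).δ y x l = yM y.1.2 x.1.2 (seq (lamC y.1.1 x.1.1) (lamM y.1.1
    x.1.1) 0 l) + ∑ n : Lam.G, splitSum (fun l1 l2 => yB y.1.2 x.1.2 (seq (lamC y.1.1 n) (lamM y.1.1
    n) 0 l1) (seq (lamC n x.1.1) (lamM n x.1.1) 0 l2)) l := by
  refine (congrArg (fun Φ => Lam.T y.1.1 x.1.1 Φ l) (short_Ybim.eq y.1.2 x.1.2)).trans ?_
  beta_reduce
  rw [T_seq]
  simp only [short_Lam.eq]
  simp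

lemma LamY_δ_of_length (y x) {l : List A2.Mor} (h : 2 ≤ l.length) : (Lam.box Ybim).δ y x l = 0
    := by
  rw [LamY_δ, seq_of_length_two h, map_zero, zero_add]
  refine Finset.sum_eq_zero fun n _ => splitSum_eq_zero fun l1 l2 e => ?_
  obtain ⟨⟨y1, y2⟩, hy⟩ := y
  obtain ⟨⟨x1, x2⟩, hx⟩ := x
  rw [← e, List.length_append] at h
  by_cases h1 : 2 ≤ l1.length
  · rw [seq_of_length_two h1, map_zero, AddMonoidHom.zero_apply]
  by_cases h2 : 2 ≤ l2.length
  · rw [seq_of_length_two h2, map_zero]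
  obtain ⟨a, rfl⟩ := List.length_eq_one_iff.mp (show l1.length = 1 by omega)
  obtain ⟨b, rfl⟩ := List.length_eq_one_iff.mp (show l2.length = 1 by omega)
  rcases y2 with _ | _ | _ | _ <;> rcases x2 with _ | _ | _ | _ <;> try rfl
  rcases y1 with _ | _ | _ <;> (try (cases hy; done)) <;>
  rcases x1 with _ | _ | _ <;> (try (cases hx; done)) <;>
  rcases n with _ | _ | _ <;> simp

lemma LamY_δ_nil (y x : LamG × YG) (hy hx) :
    (Lam.box Ybim).δ ⟨y, hy⟩ ⟨x, hx⟩ [] = yM y.2 x.2 (lamC y.1 x.1) +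
      (yB y.2 x.2 (lamC y.1 .X) (lamC .X x.1) + yB y.2 x.2 (lamC y.1 .Y) (lamC .Y x.1) +
        yB y.2 x.2 (lamC y.1 .Z) (lamC .Z x.1)) := by
  refine (LamY_δ _ _ _).trans ?_
  simp only [splitSum_nil, seq_nil]
  exact congrArg _ (Lam_sum _)

lemma LamY_δ_one (y x : LamG × YG) (hy hx) (a) : (Lam.box Ybim).δ ⟨y, hy⟩ ⟨x, hx⟩ [a] = yM y.2 x.2
    (lamM y.1 x.1 a) + ((yB y.2 x.2 (lamC y.1 .X) (lamM .X x.1 a) + yB y.2 x.2 (lamM y.1 .X a) (lamC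
    .X x.1)) + (yB y.2 x.2 (lamC y.1 .Y) (lamM .Y x.1 a) + yB y.2 x.2 (lamM y.1 .Y a) (lamC .Y x.1))
    + (yB y.2 x.2 (lamC y.1 .Z) (lamM .Z x.1 a) + yB y.2 x.2 (lamM y.1 .Z a) (lamC .Z x.1))) := by
  refine (LamY_δ _ _ _).trans ?_
  simp only [splitSum_nil, splitSum_cons, seq_nil, seq_one]
  exact congrArg _ (Lam_sum _)

lemma one2_δ (y x : Alg2.Ob) (a) :
    (ADRaw.one A2).δ y x [a] = A2.idem y * a * A2.idem x := rfl

lemma one_δ_two {A : DGCat} (y x) {l : List A.Mor} (h : 2 ≤ l.length) :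
    (ADRaw.one A).δ y x l = 0 := one_δ_of_ne A y x l (by omega)

lemma isCone_LamY : IsCone (N := ADRaw.one A2) (N' := ADRaw.one A2) (Q := Lam.box Ybim) 0
    vOne vTwo where
  bij := by
    constructor
    · rintro ((_ | _) | (_ | _)) ((_ | _) | (_ | _)) h <;>
        first | rfl | (have := congrArg (fun z : (Lam.box Ybim).G => z.1) h; cases this; done)
    · rintro ⟨⟨_ | _ | _, _ | _ | _ | _⟩, h⟩ <;> first | (cases h; done) | skip
      exacts [⟨.inl Alg2.Ob.u, rfl⟩, ⟨.inr Alg2.Ob.u, rfl⟩, ⟨.inl Alg2.Ob.o, rfl⟩,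
        ⟨.inr Alg2.Ob.o, rfl⟩]
  δ_ii y x := by
    funext l
    rcases l with _ | ⟨a, _ | ⟨b, l⟩⟩
    · cases y <;> cases x <;> refine (LamY_δ_nil _ _ _ _).trans
        (Eq.trans ?_ (rfl : (0 : A2.Mor) = _))
        <;> apply ext2 <;> simp
    · cases y <;> cases x <;> refine (LamY_δ_one _ _ _ _ a).trans (Eq.trans ?_
        (one2_δ _ _ a).symm) <;> apply ext2 <;>
        simp [matOf_symHom, CharTwo.add_self_eq_zero]
    · exact (LamY_δ_of_length _ _ (by simp)).trans (one_δ_two _ _ (by simp)).symm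
  δ_tt y x := by
    funext l
    rcases l with _ | ⟨a, _ | ⟨b, l⟩⟩
    · cases y <;> cases x <;> refine (LamY_δ_nil _ _ _ _).trans
        (Eq.trans ?_ (rfl : (0 : A2.Mor) = _))
        <;> apply ext2 <;> simp
    · cases y <;> cases x <;> refine (LamY_δ_one _ _ _ _ a).trans (Eq.trans ?_
        (one2_δ _ _ a).symm) <;> apply ext2 <;>
        simp [matOf_symHom, CharTwo.add_self_eq_zero]
    · exact (LamY_δ_of_length _ _ (by simp)).trans (one_δ_two _ _ (by simp)).symm
  δ_ti y x := by
    funext l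
    rcases l with _ | ⟨a, _ | ⟨b, l⟩⟩
    · cases y <;> cases x <;> refine (LamY_δ_nil _ _ _ _).trans
        (Eq.trans ?_ (rfl : (0 : A2.Mor) = _))
        <;> apply ext2 <;> simp
    · cases y <;> cases x <;> refine (LamY_δ_one _ _ _ _ a).trans
        (Eq.trans ?_ (rfl : (0 : A2.Mor) = _)) <;>
        apply ext2 <;>
        simp [matOf_symHom, CharTwo.add_self_eq_zero]
    · exact LamY_δ_of_length _ _ (by simp)
  δ_it y x l := by
    rcases l with _ | ⟨a, _ | ⟨b, l⟩⟩
    · cases y <;> cases x <;> refine (LamY_δ_nil _ _ _ _).trans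
        (Eq.trans ?_ (rfl : (0 : A2.Mor) = _))
        <;> apply ext2 <;> simp
    · cases y <;> cases x <;> refine (LamY_δ_one _ _ _ _ a).trans
        (Eq.trans ?_ (rfl : (0 : A2.Mor) = _)) <;>
        apply ext2 <;>
        simp [matOf_symHom, CharTwo.add_self_eq_zero]
    · exact LamY_δ_of_length _ _ (by simp)
  l_i x := by cases x <;> rfl
  l_t x := by cases x <;> rfl
  r_i x := by cases x <;> rfl
  r_t x := by cases x <;> rfl

/-- The first summand of `X ⊠ X`. -/
def xOne (x : Xbim.G) : (Xbim.box Xbim).G :=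
  ⟨(⟨(x.1.1, lamOne (Lam.l x.1.2)), x.2.trans (isCone_LamY.l_i (Lam.l x.1.2)).symm⟩,
    ⟨(yOne (Lam.l x.1.2), x.1.2), isCone_LamY.r_i (Lam.l x.1.2)⟩), (vOne (Lam.l x.1.2)).2⟩

/-- The second summand of `X ⊠ X`. -/
def xTwo (x : Xbim.G) : (Xbim.box Xbim).G :=
  ⟨(⟨(x.1.1, lamTwo (Lam.l x.1.2)), x.2.trans (isCone_LamY.l_t (Lam.l x.1.2)).symm⟩,
    ⟨(yTwoG (Lam.l x.1.2), x.1.2), isCone_LamY.r_t (Lam.l x.1.2)⟩), (vTwo (Lam.l x.1.2)).2⟩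

lemma isCone_XX : IsCone (N := Xbim) (N' := Xbim) (Q := Xbim.box Xbim) 0 xOne xTwo := by
  have hX := (oneBoxIso isAD_Lam).symm.boxLeft Ybim
  have hXX := (assocIso isAD_Ybim isAD_Lam isAD_Xbim).trans
    ((assocIso isAD_Lam isAD_Ybim isAD_Lam).symm.boxLeft Ybim)
  have h := ((isCone_LamY.boxRight isAD_Lam.cochain.biC.multiAdd).boxLeft Ybim).transport hX hX hXX
  refine h.congr ?_
  rw [boxId_eq, zero_exBox isAD_Lam.cochain.biC.multiAdd, idBox_zero]
  rfl

lemma eps2C_eq : eps2C = relabel fun y x => y = vOne x := by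
  funext y x l
  rcases l with _ | ⟨a, l⟩
  · rw [relabel_nil]
    obtain ⟨⟨_ | _ | _, _ | _ | _ | _⟩, h⟩ := y <;> (try (cases h; done)) <;>
    rcases x with _ | _ <;> symm <;>
    first
    | exact if_pos rfl
    | (refine if_neg fun e => ?_
       have := congrArg (fun z : (Lam.box Ybim).G => z.1) e
       cases this
       done)
  · rw [relabel_cons]
    obtain ⟨⟨_ | _ | _, _ | _ | _ | _⟩, h⟩ := y <;> rcases x with _ | _ <;> rfl

lemma eta2C_eq : eta2C = relabel fun y x => x = vTwo y := by
  funext y x l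
  rcases l with _ | ⟨a, l⟩
  · rw [relabel_nil]
    obtain ⟨⟨_ | _ | _, _ | _ | _ | _⟩, h⟩ := x <;> (try (cases h; done)) <;>
    rcases y with _ | _ <;> symm <;>
    first
    | exact if_pos rfl
    | (refine if_neg fun e => ?_
       have := congrArg (fun z : (Lam.box Ybim).G => z.1) e
       cases this
       done)
  · rw [relabel_cons]
    obtain ⟨⟨_ | _ | _, _ | _ | _ | _⟩, h⟩ := x <;> rcases y with _ | _ <;> rfl

lemma relabel_congr' {A B : DGCat} {M N M' N' : ADRaw B A} {φ : N.G → M.G → Prop} {ψ : N'.G → M'.G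
    → Prop} {y : N.G} {x : M.G} {y' : N'.G} {x' : M'.G} (h : φ y x ↔ ψ y' x') (hr : N.r y = N'.r y')
    (l) : (relabel φ : Coch M N) y x l = (relabel ψ : Coch M' N') y' x' l := by
  rcases l with _ | ⟨a, l⟩
  · rw [relabel_nil, relabel_nil, hr]
    exact if_congr h rfl rfl
  · rfl

lemma splitC_eq : splitC = relabel fun y x => y = xOne x := by
  funext y x l
  rw [splitC, eps2C_eq, boxId_relabel isAD_Lam.preAD _ fun y x h => by rw [h, isCone_LamY.r_i],
    idBox_relabel]
  refine relabel_congr' (y' := y) (x' := x) ⟨fun h => ?_, fun h => ?_⟩ ?_ l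
  · obtain ⟨h1, h2, h3⟩ := h
    change y.1.1.1.1 = x.1.1 at h1
    change (⟨(y.1.1.1.2, y.1.2.1.1), y.2⟩ : (Lam.box Ybim).G) = vOne (Lam.l x.1.2) at h2
    change y.1.2.1.2 = x.1.2 at h3
    exact box_ext (box_ext h1 (congrArg (fun z => z.1.1) h2))
      (box_ext (congrArg (fun z => z.1.2) h2) h3)
  · subst h
    exact ⟨rfl, rfl, rfl⟩
  · rfl

lemma mergeC_eq : mergeC = relabel fun y x => x = xTwo y := by
  funext y x l
  rw [mergeC, eta2C_eq, boxId_relabel isAD_Lam.preAD _ fun y x h => by rw [h, isCone_LamY.r_t],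
    idBox_relabel]
  refine relabel_congr' (y' := y) (x' := x) ⟨fun h => ?_, fun h => ?_⟩ ?_ l
  · obtain ⟨h1, h2, h3⟩ := h
    change y.1.1 = x.1.1.1.1 at h1
    change (⟨(x.1.1.1.2, x.1.2.1.1), x.2⟩ : (Lam.box Ybim).G) = vTwo (Lam.l y.1.2) at h2
    change y.1.2 = x.1.2.1.2 at h3
    exact box_ext (box_ext h1.symm (congrArg (fun z => z.1.1) h2))
      (box_ext (congrArg (fun z => z.1.2) h2) h3.symm)
  · subst h
    exact ⟨rfl, rfl, rfl⟩
  · rfl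

/-! ### The singular crossing -/

def xC (y x : YG × LamG) : A11.Mor := if y.1 = x.1 then lamC y.2 x.2 else 0

def xM (y x : YG × LamG) : A11.Mor →+ A11.Mor := (lamM y.2 x.2).comp (yM y.1 x.1)

def xB (y x : YG × LamG) : A11.Mor →+ A11.Mor →+ A11.Mor := (yB y.1 x.1).compr₂ (lamM y.2 x.2)

lemma short_Xbim : Short (M := Xbim) (N := Xbim) Xbim.δ (fun y x => xC y.1 x.1)
    (fun y x => xM y.1 x.1) (fun y x => xB y.1 x.1) where
  eq y x := by
    refine ((short_Lam.idBox short_Ybim).eq y x).trans ?_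
    rw [map_zero, add_zero]
    rfl

@[elab_as_elim]
lemma Xbim_ind {p : Xbim.G → Prop} (h1 : p ⟨(.A, .X), rfl⟩) (h2 : p ⟨(.A, .Y), rfl⟩)
    (h3 : p ⟨(.B, .X), rfl⟩) (h4 : p ⟨(.B, .Y), rfl⟩) (h5 : p ⟨(.W, .Z), rfl⟩)
    (h6 : p ⟨(.C, .Z), rfl⟩) (x : Xbim.G) : p x := by
  obtain ⟨⟨_ | _ | _ | _, _ | _ | _⟩, h⟩ := x
  all_goals first | assumption | cases h

/-- An enumeration of the basis of `X`. -/
def xIdx : Fin 6 → Xbim.G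
  | 0 => ⟨(.A, .X), rfl⟩
  | 1 => ⟨(.A, .Y), rfl⟩
  | 2 => ⟨(.B, .X), rfl⟩
  | 3 => ⟨(.B, .Y), rfl⟩
  | 4 => ⟨(.W, .Z), rfl⟩
  | 5 => ⟨(.C, .Z), rfl⟩

lemma xIdx_bijective : Function.Bijective xIdx := by
  constructor
  · intro i j h
    have h := congrArg (fun x : Xbim.G => (x.1 : YG × LamG)) h
    fin_cases i <;> fin_cases j <;> first | rfl | (cases h; done)
  · exact Xbim_ind ⟨0, rfl⟩ ⟨1, rfl⟩ ⟨2, rfl⟩ ⟨3, rfl⟩ ⟨4, rfl⟩ ⟨5, rfl⟩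

lemma Xbim_sum {R : Type*} [AddCommMonoid R] (F : YG × LamG → R) :
    ∑ x : Xbim.G, F x.1 = F (.A, .X) + F (.A, .Y) + F (.B, .X) + F (.B, .Y) + F (.W, .Z) +
      F (.C, .Z) :=
  (xIdx_bijective.sum_comp fun x => F x.1).symm.trans (Fin.sum_univ_six _)

lemma one11_sum {R : Type*} [AddCommMonoid R] (F : Alg11.Ob → R) :
    ∑ x : one11.G, F x = F .uu + F .ou + F .uo + F .oo := by
  change ∑ x ∈ ({.uu, .ou, .uo, .oo} : Finset Alg11.Ob), F x = _
  rw [Finset.sum_insert (by simp), Finset.sum_insert (by simp), Finset.sum_insert (by simp),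
    Finset.sum_singleton, add_assoc, add_assoc]

def oneM11 (y x : Alg11.Ob) : A11.Mor →+ A11.Mor :=
  (AddMonoidHom.mulRight (A11.idem x)).comp (AddMonoidHom.mulLeft (A11.idem y))

lemma short_one11 : Short (M := one11) (N := one11) one11.δ (fun _ _ => 0) oneM11
    (fun _ _ => 0) where
  eq y x := by
    funext l
    rcases l with _ | ⟨u, _ | ⟨v, _ | ⟨w, l⟩⟩⟩ <;> rfl

def etaZ : Alg11.Ob → YG × LamG → A11.Mor
  | .ou, (.A, .X) => iOU 1
  | .uo, (.B, .Y) => iUO Polynomial.X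
  | .oo, (.W, .Z) => iOO 1
  | .oo, (.C, .Z) => iOO (MvPolynomial.X 1)
  | _, _ => 0

def etaM : Alg11.Ob → YG × LamG → A11.Mor →+ A11.Mor
  | .uo, (.A, .Y) => (iUO.comp Polynomial.C.toAddMonoidHom).comp pLam
  | _, _ => 0

lemma short_eta : Short etaC (fun y x => etaZ y x.1) (fun y x => etaM y x.1)
    (fun _ _ => 0) where
  eq y x := by
    funext l
    induction x using Xbim_ind <;> cases y <;> rcases l with _ | ⟨u, _ | ⟨v, _ | ⟨w, l⟩⟩⟩ <;> rfl

def epsZ : YG × LamG → Alg11.Ob → A11.Mor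
  | (.A, .X), .ou => iOU Polynomial.X
  | (.B, .Y), .uo => iUO 1
  | (.W, .Z), .oo => iOO (MvPolynomial.X 0)
  | (.C, .Z), .oo => iOO 1
  | _, _ => 0

def epsM : YG × LamG → Alg11.Ob → A11.Mor →+ A11.Mor
  | (.B, .X), .ou => (iOU.comp Polynomial.C.toAddMonoidHom).comp pLam
  | _, _ => 0

lemma short_eps : Short epsC (fun y x => epsZ y.1 x) (fun y x => epsM y.1 x)
    (fun _ _ => 0) where
  eq y x := by
    funext l
    induction y using Xbim_ind <;> cases x <;> rcases l with _ | ⟨u, _ | ⟨v, _ | ⟨w, l⟩⟩⟩ <;> rfl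

attribute [simp] etaZ etaM epsZ epsM xC xM xB oneM11

open MvPolynomial in
lemma matOf_eta_eps (f : MvPolynomial (Fin 2) (ZMod 2)) :
    symHom (matOf f 0 0) + X 1 * symHom (matOf f 0 1) = f ∧
      symHom (matOf f 1 0) + X 1 * symHom (matOf f 1 1) = f * X 1 ∧
      symHom (matOf f 0 0) * X 0 + symHom (matOf f 1 0) = f * X 0 ∧
      symHom (matOf f 0 1) * X 0 + symHom (matOf f 1 1) = f := by
  have h2 : (2 : MvPolynomial (Fin 2) (ZMod 2)) = 0 := CharTwo.two_eq_zero
  induction f using MvPolynomial.induction_on with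
  | C c =>
    have h : c = 0 ∨ c = 1 := by revert c; decide
    rcases h with rfl | rfl <;> simp
  | add f g hf hg =>
    obtain ⟨a, b, c, d⟩ := hf
    obtain ⟨a', b', c', d'⟩ := hg
    simp only [matOf_add, Matrix.add_apply, map_add]
    refine ⟨?_, ?_, ?_, ?_⟩
    · linear_combination a + a'
    · linear_combination b + b'
    · linear_combination c + c'
    · linear_combination d + d'
  | mul_X f i hf =>
    have e1 := matOf_mul f (X i)
    have e2 := matOf_mul (X i) f
    rw [mul_comm] at e2
    obtain ⟨a, b, c, d⟩ := hf
    rw [← and_assoc]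
    constructor
    · rw [e1]
      fin_cases i <;> simp [matOf_X0, matOf_X1, matU1, matU2, Matrix.mul_apply, symHom] at a b ⊢ <;>
        constructor
      · linear_combination X 0 * a + X 1 * h2 * bind₁ _ (matOf f 0 0)
      · linear_combination X 0 * b + X 1 * h2 * bind₁ _ (matOf f 1 0)
      · linear_combination X 1 * a + X 0 * X 1 * h2 * bind₁ _ (matOf f 0 1)
      · linear_combination X 1 * b + X 0 * X 1 * h2 * bind₁ _ (matOf f 1 1)
    · rw [e2]
      fin_cases i <;> simp [matOf_X0, matOf_X1, matU1, matU2, Matrix.mul_apply, symHom] at c d ⊢ <;>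
        constructor
      · linear_combination X 0 * c + X 0 * X 1 * h2 * bind₁ _ (matOf f 0 0)
      · linear_combination X 0 * d + X 0 * X 1 * h2 * bind₁ _ (matOf f 0 1)
      · linear_combination X 1 * c + X 0 * h2 * bind₁ _ (matOf f 1 0)
      · linear_combination X 1 * d + X 0 * h2 * bind₁ _ (matOf f 1 1)

lemma Short.dMor_eq_zero_of_one {A B : DGCat} {M N : ADRaw B A} {f : Coch M N} {c m}
    (h : Short f c m fun _ _ => 0) {cM mM bM cN mN bN}
    (hM : Short (M := M) (N := M) M.δ cM mM bM) (hN : Short (M := N) (N := N) N.δ cN mN bN)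
    (hA : ∀ a, A.d a = 0) (hB : ∀ a, B.d a = 0)
    (h0 : ∀ y x, ∑ n, cN y n * c n x = ∑ n, c y n * cM n x)
    (h1 : ∀ y x a, ∑ n, (cN y n * m n x a + mN y n a * c n x) =
      ∑ n, (c y n * mM n x a + m y n a * cM n x))
    (h₂ : ∀ y x a1 a2, ∑ n, (mN y n a1 * m n x a2 + bN y n a1 a2 * c n x) =
      m y x (a1 * a2) + ∑ n, (c y n * bM n x a1 a2 + m y n a1 * mM n x a2))
    (h3 : ∀ y x a1 a2 a3, ∑ n, bN y n a1 a2 * m n x a3 = ∑ n, m y n a1 * bM n x a2 a3) :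
    dMor M N f = 0 := by
  refine h.dMor_eq_zero hM hN hA hB h0 h1 (fun y x a1 a2 => ?_) (fun y x a1 a2 a3 => ?_) ?_
  · simpa using h₂ y x a1 a2
  · simpa using h3 y x a1 a2 a3
  · simp

lemma C_coeff_add (f : Polynomial (ZMod 2)) :
    Polynomial.C (f.coeff 0) = f + Polynomial.X * f.divX := by
  have h := Polynomial.divX_mul_X_add f
  have h2 : (2 : Polynomial (ZMod 2)) = 0 := CharTwo.two_eq_zero
  linear_combination h - f.divX * Polynomial.X * h2

section

attribute [local simp] lamC lamM yM yB

lemma eta_dMor : dMor Xbim one11 etaC = 0 := by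
  apply short_eta.dMor_eq_zero_of_one short_Xbim short_one11 A11_d A11_d
  · intro y x
    refine Eq.trans ?_ (Xbim_sum fun n => etaZ y n * xC n x.1).symm
    rw [Finset.sum_eq_zero (by intros; exact zero_mul _)]
    induction x using Xbim_ind <;> cases y <;>
    simp
    apply ext11 <;> simp
  · intro y x a
    refine (one11_sum fun n => 0 * etaM n x.1 a + oneM11 y n a * etaZ n x.1).trans
      (Eq.trans ?_ (Xbim_sum fun n => etaZ y n * xM n x.1 a + etaM y n a * xC n x.1).symm)
    induction x using Xbim_ind <;> cases y <;>
    simp <;> apply ext11 <;> simp [mul_comm]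
    · exact (matOf_eta_eps _).1.symm
    · rw [(matOf_eta_eps _).2.1, mul_comm]
  · intro y x a b
    refine (one11_sum fun n => oneM11 y n a * etaM n x.1 b + 0 * etaZ n x.1).trans
      (Eq.trans ?_ (congrArg _ (Xbim_sum fun n => etaZ y n * xB n x.1 a b +
        etaM y n a * xM n x.1 b).symm))
    induction x using Xbim_ind <;> cases y <;>
    simp <;> apply ext11 <;> simp
    rw [C_coeff_add, C_coeff_add]
    have h2 : (2 : Polynomial (ZMod 2)) = 0 := CharTwo.two_eq_zero
    linear_combination -(Polynomial.X * (pUO a).divX * Polynomial.C (pLam b) +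
      Polynomial.C (pLam a) * pOU b + Polynomial.C (pLam a) * Polynomial.X * (pOU b).divX) * h2
  · intro y x a b c
    refine Eq.trans ?_ (Xbim_sum fun n => etaM y n a * xB n x.1 b c).symm
    rw [Finset.sum_eq_zero (by intros; exact zero_mul _)]
    induction x using Xbim_ind <;> cases y <;>
    simp

lemma eps_dMor : dMor one11 Xbim epsC = 0 := by
  apply short_eps.dMor_eq_zero_of_one short_one11 short_Xbim A11_d A11_d
  · intro y x
    refine (Xbim_sum fun n => xC y.1 n * epsZ n x).trans ?_
    rw [Finset.sum_eq_zero (by intros; exact mul_zero _)]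
    induction y using Xbim_ind <;> cases x <;>
    simp
    apply ext11 <;> simp
  · intro y x a
    refine (Xbim_sum fun n => xC y.1 n * epsM n x a + xM y.1 n a * epsZ n x).trans
      (Eq.trans ?_ (one11_sum fun n => epsZ y.1 n * oneM11 n x a + epsM y.1 n a * 0).symm)
    induction y using Xbim_ind <;> cases x <;>
    simp <;> apply ext11 <;> simp [mul_comm]
    · rw [mul_comm, (matOf_eta_eps _).2.2.1, mul_comm]
    · rw [mul_comm, (matOf_eta_eps _).2.2.2]
  · intro y x a b
    refine (Xbim_sum fun n => xM y.1 n a * epsM n x b + xB y.1 n a b * epsZ n x).trans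
      (Eq.trans ?_ (congrArg _ (one11_sum fun n => epsZ y.1 n * 0 +
        epsM y.1 n a * oneM11 n x b).symm))
    induction y using Xbim_ind <;> cases x <;>
    simp <;> apply ext11 <;> simp
    rw [C_coeff_add, C_coeff_add]
    have h2 : (2 : Polynomial (ZMod 2)) = 0 := CharTwo.two_eq_zero
    linear_combination -(Polynomial.C (pLam a) * pOU b) * h2
  · intro y x a b c
    refine (Xbim_sum fun n => xB y.1 n a b * epsM n x c).trans ?_
    rw [Finset.sum_eq_zero (by intros; exact mul_zero _)]
    induction y using Xbim_ind <;> cases x <;>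
    simp

end

lemma iOU_one_mem : iOU 1 ∈ A11.gr 0 := A11.idem_mem Alg11.Ob.ou

lemma iUO_one_mem : iUO 1 ∈ A11.gr 0 := A11.idem_mem Alg11.Ob.uo

lemma iOU_X_mem : iOU Polynomial.X ∈ A11.gr (-2, 2) := by
  rw [iOU_mem]
  intro n hn
  rw [Polynomial.coeff_X] at hn
  obtain rfl : 1 = n := by by_contra h; simp [h] at hn
  simp

lemma iUO_X_mem : iUO Polynomial.X ∈ A11.gr (-2, 2) := by
  rw [iUO_mem, ← iOU_mem]
  exact iOU_X_mem

lemma iOU_C_mem {p : ℤ × ℤ} {a : A11.Mor} (h : a ∈ A11.gr p) :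
    iOU (Polynomial.C (pLam a)) ∈ A11.gr (p - (1, 0)) := by
  rw [iOU_mem]
  intro n hn
  rw [Polynomial.coeff_C] at hn
  obtain rfl : n = 0 := by by_contra h; simp [h] at hn
  rw [← (mem_gr11.mp h).2.2.2.1 (by simpa using hn)]
  simp

lemma iUO_C_mem {p : ℤ × ℤ} {a : A11.Mor} (h : a ∈ A11.gr p) :
    iUO (Polynomial.C (pLam a)) ∈ A11.gr (p - (1, 0)) := by
  rw [iUO_mem, ← iOU_mem]
  exact iOU_C_mem h

lemma pLam_idem (s : Alg11.Ob) : pLam (A11.idem s) = 0 := by cases s <;> rfl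

lemma Short.apply_idem {A B : DGCat} {M N : ADRaw B A} {f : Coch M N} {c m} (h : Short f c m fun _
    _ => 0) (hm : ∀ y x s, m y x (B.idem s) = 0) (y x l) (s : B.Obj) (hs : B.idem s ∈ l) : f y x l =
    0 := by
  rw [h.eq]
  rcases l with _ | ⟨a, _ | ⟨b, l⟩⟩
  · simp at hs
  · obtain rfl : B.idem s = a := by simpa using hs
    exact hm y x s
  · exact seq_of_length_two (by simp)

lemma eta_homMor : etaC ∈ homMor Xbim one11 (-1, 2) := by
  refine ⟨?_, short_eta.apply_idem fun y x s => ?_⟩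
  · apply short_eta.isCochain
    · intro y x h
      change y ≠ Ybim.l x.1.1 at h
      induction x using Xbim_ind <;> cases y <;>
        first | rfl | exact absurd rfl h
    · intro y x a
      change etaM y x.1 (A11.idem y * a) = etaM y x.1 a
      induction x using Xbim_ind <;> cases y <;> simp
    · intro y x a
      change etaM y x.1 (a * A11.idem (Ybim.l x.1.1)) = etaM y x.1 a
      induction x using Xbim_ind <;> cases y <;> simp
    iterate 3 · intros; rfl
    · intro y x
      change A11.idem y * etaZ y x.1 * A11.idem (Lam.r x.1.2) = etaZ y x.1
      induction x using Xbim_ind <;> cases y <;>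
        simp only [etaZ, mul_zero, zero_mul] <;> apply ext11 <;> simp
    · intro y x a
      change A11.idem y * etaM y x.1 a * A11.idem (Lam.r x.1.2) = etaM y x.1 a
      induction x using Xbim_ind <;> cases y <;>
        simp only [etaM, mul_zero, zero_mul, AddMonoidHom.zero_apply] <;> apply ext11 <;> simp
    · intros; simp
    · intro y x
      change etaZ y x.1 ∈ A11.gr ((-1, 2) + (Ybim.deg x.1.1 + Lam.deg x.1.2) - 0)
      induction x using Xbim_ind <;> cases y <;>
        simp only [etaZ, zero_mem]
      · exact iOU_one_mem
      · exact iUO_X_mem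
      · exact iOO_one_mem
      · exact iOO_X_mem 1
    · intro y x p a ha
      change etaM y x.1 a ∈ A11.gr ((-1, 2) + (Ybim.deg x.1.1 + Lam.deg x.1.2) - 0 + (p - (0, 1)))
      induction x using Xbim_ind <;> cases y <;>
        simp only [etaM, zero_mem, AddMonoidHom.zero_apply]
      change iUO (Polynomial.C (pLam a)) ∈ _
      convert iUO_C_mem ha using 2
      ext <;> simp <;> ring
    · intros; exact zero_mem _
  · induction x using Xbim_ind <;> cases y <;>
      first | rfl | exact (congrArg (fun t => iUO (Polynomial.C t)) (pLam_idem s)).trans (by simp)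

lemma eps_homMor : epsC ∈ homMor one11 Xbim (-1, 0) := by
  refine ⟨?_, short_eps.apply_idem fun y x s => ?_⟩
  · apply short_eps.isCochain
    · intro y x h
      change Ybim.l y.1.1 ≠ x at h
      induction y using Xbim_ind <;> cases x <;>
        first | rfl | exact absurd rfl h
    · intro y x a
      change epsM y.1 x (A11.idem (Ybim.l y.1.1) * a) = epsM y.1 x a
      induction y using Xbim_ind <;> cases x <;> simp
    · intro y x a
      change epsM y.1 x (a * A11.idem x) = epsM y.1 x a
      induction y using Xbim_ind <;> cases x <;> simp
    iterate 3 · intros; rfl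
    · intro y x
      change A11.idem (Lam.r y.1.2) * epsZ y.1 x * A11.idem x = epsZ y.1 x
      induction y using Xbim_ind <;> cases x <;>
        simp only [epsZ, mul_zero, zero_mul] <;> apply ext11 <;> simp
    · intro y x a
      change A11.idem (Lam.r y.1.2) * epsM y.1 x a * A11.idem x = epsM y.1 x a
      induction y using Xbim_ind <;> cases x <;>
        simp only [epsM, mul_zero, zero_mul, AddMonoidHom.zero_apply] <;> apply ext11 <;> simp
    · intros; simp
    · intro y x
      change epsZ y.1 x ∈ A11.gr ((-1, 0) + 0 - (Ybim.deg y.1.1 + Lam.deg y.1.2))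
      induction y using Xbim_ind <;> cases x <;>
        simp only [epsZ, zero_mem]
      · exact iOU_X_mem
      · exact iUO_one_mem
      · exact iOO_X_mem 0
      · exact iOO_one_mem
    · intro y x p a ha
      change epsM y.1 x a ∈ A11.gr ((-1, 0) + 0 - (Ybim.deg y.1.1 + Lam.deg y.1.2) + (p - (0, 1)))
      induction y using Xbim_ind <;> cases x <;>
        simp only [epsM, zero_mem, AddMonoidHom.zero_apply]
      change iOU (Polynomial.C (pLam a)) ∈ _
      convert iOU_C_mem ha using 2
      ext <;> simp <;> ring
    · intros; exact zero_mem _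
  · induction y using Xbim_ind <;> cases x <;>
      first | rfl | exact (congrArg (fun t => iOU (Polynomial.C t)) (pLam_idem s)).trans (by simp)

/-! ### The components of `η` and `ε'` on `X ⊠ X` -/

lemma pLam_X_of_ne_nil (y x) {l : List A11.Mor} (hl : l ≠ []) : pLam (Xbim.δ y x l) = 0 := by
  rw [short_Xbim.eq]
  obtain ⟨⟨y, μ⟩, hy⟩ := y
  obtain ⟨⟨x, ν⟩, hx⟩ := x
  rcases l with _ | ⟨a, _ | ⟨b, _ | ⟨c, l⟩⟩⟩
  · exact absurd rfl hl
  iterate 2 cases μ <;> cases ν <;> simp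
  simp

lemma eta_coeff (y x l) : pLam (etaC y x l) = 0 ∧ (pOU (etaC y x l)).divX = 0 ∧
    (l ≠ [] → (pUO (etaC y x l)).divX = 0) := by
  rw [short_eta.eq]
  induction x using Xbim_ind <;> cases y <;>
    rcases l with _ | ⟨a, _ | ⟨b, l⟩⟩ <;> simp [seq_of_length_two]

lemma eps_coeff (y x l) : pLam (epsC y x l) = 0 ∧ (pUO (epsC y x l)).divX = 0 ∧
    (l ≠ [] → (pOU (epsC y x l)).divX = 0) := by
  rw [short_eps.eq]
  induction y using Xbim_ind <;> cases x <;>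
    rcases l with _ | ⟨a, _ | ⟨b, l⟩⟩ <;> simp [seq_of_length_two]

lemma yB_eq_zero {y x : YG} {a b : A11.Mor} (h : yTwo a b = 0) : yB y x a b = 0 := by
  cases y <;> cases x <;> first | rfl | exact h

lemma xB_eq_zero {y x : YG × LamG} {a b : A11.Mor} (h : yTwo a b = 0) : xB y x a b = 0 := by
  rw [xB, AddMonoidHom.compr₂_apply, yB_eq_zero h, map_zero]

lemma splitSum_eq_ite {α R : Type} [AddCommMonoid R] {F : List α → List α → R}
    (h : ∀ l1 l2, l1 ++ l2 ≠ [] → F l1 l2 = 0) (l : List α) :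
    splitSum F l = if l = [] then F [] [] else 0 := by
  split_ifs with hl
  · rw [hl, splitSum_nil]
  · exact splitSum_eq_zero fun l1 l2 e => h l1 l2 (e ▸ hl)

lemma sum_ite_const {ι R : Type*} [Fintype ι] [AddCommMonoid R] (p : Prop) [Decidable p]
    (f : ι → R) : (∑ i, if p then f i else 0) = if p then ∑ i, f i else 0 := by
  split_ifs <;> simp

lemma short_boxId_eta : Short (boxId etaC Xbim)
    (fun y x => xM y.1.2.1 x.1.2.1 (etaZ y.1.1 x.1.1.1) +
      ∑ n : Xbim.G, xB y.1.2.1 x.1.2.1 (etaZ y.1.1 n.1) (xC n.1 x.1.1.1))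
    (fun y x => (xM y.1.2.1 x.1.2.1).comp (etaM y.1.1 x.1.1.1)) (fun _ _ => 0) where
  eq y x := by
    funext l
    rw [boxId_eq]
    refine (congrArg (fun Φ => TF etaC y.1.1 x.1.1 Φ l) (short_Xbim.eq y.1.2 x.1.2)).trans ?_
    beta_reduce
    rw [TF_seq, Finset.sum_congr rfl fun n _ => splitSum_eq_ite (fun l1 l2 hl => ?_) l,
      Finset.sum_eq_zero fun n _ => splitSum_eq_zero fun l1 l2 _ => ?_, add_zero, sum_ite_const]
    · simp only [short_eta.eq, short_Xbim.eq]
      rcases l with _ | ⟨a, _ | ⟨b, l⟩⟩ <;> simp [seq_of_length_two]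
    · apply xB_eq_zero
      rw [yTwo_apply, (eta_coeff _ _ _).1, (eta_coeff _ _ _).2.1, map_zero, zero_mul, mul_zero,
        add_zero, map_zero]
    · apply xB_eq_zero
      rw [yTwo_apply, (eta_coeff _ _ _).1, map_zero, zero_mul, zero_add]
      by_cases h2 : l2 = []
      · rw [(eta_coeff _ _ _).2.2 (by simpa [h2] using hl), mul_zero, map_zero]
      · rw [pLam_X_of_ne_nil _ _ h2, map_zero, zero_mul, map_zero]

lemma short_boxId_eps : Short (boxId epsC Xbim)
    (fun y x => xM y.1.2.1 x.1.2.1 (epsZ y.1.1.1 x.1.1) +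
      ∑ n : Xbim.G, xB y.1.2.1 x.1.2.1 (xC y.1.1.1 n.1) (epsZ n.1 x.1.1))
    (fun y x => (xM y.1.2.1 x.1.2.1).comp (epsM y.1.1.1 x.1.1)) (fun _ _ => 0) where
  eq y x := by
    funext l
    rw [boxId_eq]
    refine (congrArg (fun Φ => TF epsC y.1.1 x.1.1 Φ l) (short_Xbim.eq y.1.2 x.1.2)).trans ?_
    beta_reduce
    rw [TF_seq, Finset.sum_eq_zero fun n _ => splitSum_eq_zero fun l1 l2 _ => ?_,
      Finset.sum_congr rfl fun n _ => splitSum_eq_ite (fun l1 l2 hl => ?_) l, zero_add,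
      sum_ite_const]
    · simp only [short_eps.eq, short_Xbim.eq]
      rcases l with _ | ⟨a, _ | ⟨b, l⟩⟩ <;> simp [seq_of_length_two]
    · apply xB_eq_zero
      rw [yTwo_apply, (eps_coeff _ _ _).1, map_zero, zero_mul, add_zero]
      by_cases h1 : l1 = []
      · rw [(eps_coeff _ _ _).2.2 (by simpa [h1] using hl), mul_zero, map_zero]
      · rw [pLam_X_of_ne_nil _ _ h1, map_zero, zero_mul, map_zero]
    · apply xB_eq_zero
      rw [yTwo_apply, (eps_coeff _ _ _).1, (eps_coeff _ _ _).2.1, map_zero, zero_mul, mul_zero,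
        add_zero, map_zero]

lemma etaM_eq_zero {s : Alg11.Ob} {x : YG × LamG} {a : A11.Mor} (h : pLam a = 0) :
    etaM s x a = 0 := by
  rcases x with ⟨y, z⟩; cases y <;> cases z <;> cases s <;>
    first | rfl | simp [h]

lemma epsM_eq_zero {s : Alg11.Ob} {x : YG × LamG} {a : A11.Mor} (h : pLam a = 0) :
    epsM x s a = 0 := by
  rcases x with ⟨y, z⟩; cases y <;> cases z <;> cases s <;>
    first | rfl | simp [h]

lemma Short.idBox_X {M N : ADRaw A11 A11} {f : Coch M N} {c m} (h : Short f c m fun _ _ => 0)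
    (hm : ∀ y x a, pLam a = 0 → m y x a = 0) (y x l) : BraidAD.idBox Xbim f y x l =
    seq ((if @Eq YG y.1.1.1.1 x.1.1.1.1 ∧ @Eq LamG y.1.1.1.2 x.1.1.1.2 then c y.1.2 x.1.2 else 0) +
      m y.1.2 x.1.2 (xC y.1.1.1 x.1.1.1)) 0 0 l := by
  rw [h.idBox_apply]
  rcases l with _ | ⟨a, l⟩
  · rw [short_Xbim.eq]
    exact congrArg (· + _) (if_congr ((and_iff_left rfl).trans
      (Subtype.ext_iff.trans Prod.ext_iff)) rfl rfl)
  · refine (congrArg₂ (· + ·) (if_neg (by simp)) (hm _ _ _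
      (pLam_X_of_ne_nil y.1.1 x.1.1 (List.cons_ne_nil a l)))).trans ?_
    rw [add_zero]
    rcases l with _ | ⟨b, l⟩
    · rfl
    · exact (seq_of_length_two (by simp)).symm

lemma exBox_eta {M N : ADRaw A11 A11} {f : Coch M N} (h : ∀ y x l, pLam (f y x l) = 0) :
    exBox f etaC = 0 := by
  funext y x l
  exact (short_eta.exBox_apply _ _ _ _).trans (etaM_eq_zero (h _ _ _))

lemma exBox_eps {M N : ADRaw A11 A11} {f : Coch M N} (h : ∀ y x l, pLam (f y x l) = 0) :
    exBox f epsC = 0 := by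
  funext y x l
  exact (short_eps.exBox_apply _ _ _ _).trans (epsM_eq_zero (h _ _ _))

lemma sum_xB_eta (s : Alg11.Ob) (w x1 x2 : YG × LamG) :
    ∑ n : Xbim.G, xB w x2 (etaZ s n.1) (xC n.1 x1) =
      xB w x2 (etaZ s (.B, .Y)) (xC (.B, .Y) x1) := by
  have h : ∀ n, n ≠ (.B, .Y) → yTwo (etaZ s n) (xC n x1) = 0 := by
    rintro ⟨_ | _ | _ | _, _ | _ | _⟩ hn <;> cases s <;>
      first | exact absurd rfl hn | simp
  refine (Xbim_sum fun n => xB w x2 (etaZ s n) (xC n x1)).trans ?_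
  rw [xB_eq_zero (h _ (by simp)), xB_eq_zero (h _ (by simp)), xB_eq_zero (h _ (by simp)),
    xB_eq_zero (h (.W, .Z) (by simp)), xB_eq_zero (h (.C, .Z) (by simp))]
  simp only [add_zero, zero_add]

lemma sum_xB_eps (s : Alg11.Ob) (w y1 y2 : YG × LamG) :
    ∑ n : Xbim.G, xB y2 w (xC y1 n.1) (epsZ n.1 s) =
      xB y2 w (xC y1 (.A, .X)) (epsZ (.A, .X) s) := by
  have h : ∀ n, n ≠ (.A, .X) → yTwo (xC y1 n) (epsZ n s) = 0 := by
    rintro ⟨_ | _ | _ | _, _ | _ | _⟩ hn <;> cases s <;>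
      first | exact absurd rfl hn | simp
  refine (Xbim_sum fun n => xB y2 w (xC y1 n) (epsZ n s)).trans ?_
  rw [xB_eq_zero (h (.A, .Y) (by simp)), xB_eq_zero (h (.B, .X) (by simp)),
    xB_eq_zero (h (.B, .Y) (by simp)), xB_eq_zero (h (.W, .Z) (by simp)),
    xB_eq_zero (h (.C, .Z) (by simp))]
  simp only [add_zero]

lemma boxId_eta_apply (s : Alg11.Ob) (w x1 x2) (h h') (l) : boxId etaC Xbim ⟨(s, w), h⟩ ⟨(x1, x2),
    h'⟩ l = seq (xM w.1 x2.1 (etaZ s x1.1) + xB w.1 x2.1 (etaZ s (.B, .Y)) (xC (.B, .Y) x1.1)) ((xM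
    w.1 x2.1).comp (etaM s x1.1)) 0 l := by
  refine (congrFun (short_boxId_eta.eq _ _) l).trans ?_
  exact congrArg (fun t => seq (xM w.1 x2.1 (etaZ s x1.1) + t)
    ((xM w.1 x2.1).comp (etaM s x1.1)) 0 l) (sum_xB_eta s w.1 x1.1 x2.1)

lemma boxId_eps_apply (s : Alg11.Ob) (w y1 y2) (h h') (l) : boxId epsC Xbim ⟨(y1, y2), h⟩ ⟨(s, w),
    h'⟩ l = seq (xM y2.1 w.1 (epsZ y1.1 s) + xB y2.1 w.1 (xC y1.1 (.A, .X)) (epsZ (.A, .X) s)) ((xM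
    y2.1 w.1).comp (epsM y1.1 s)) 0 l := by
  refine (congrFun (short_boxId_eps.eq _ _) l).trans ?_
  exact congrArg (fun t => seq (xM y2.1 w.1 (epsZ y1.1 s) + t)
    ((xM y2.1 w.1).comp (epsM y1.1 s)) 0 l) (sum_xB_eps s w.1 y1.1 y2.1)

lemma relabel_eq_seq {A B : DGCat} {M N : ADRaw B A} (φ : N.G → M.G → Prop) (y x l) : (relabel φ :
    Coch M N) y x l = seq (if φ y x then A.idem (N.r y) else 0) 0 0 l := by
  rcases l with _ | ⟨a, _ | ⟨b, _ | ⟨c, l⟩⟩⟩ <;> rfl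

@[elab_as_elim]
lemma Xbim_ind' {p : ∀ x : YG × LamG, Ybim.r x.1 = Lam.l x.2 → Prop} (h1 : p (.A, .X) rfl)
    (h2 : p (.A, .Y) rfl) (h3 : p (.B, .X) rfl) (h4 : p (.B, .Y) rfl) (h5 : p (.W, .Z) rfl)
    (h6 : p (.C, .Z) rfl) (x h) : p x h :=
  Xbim_ind (p := fun x => p x.1 x.2) h1 h2 h3 h4 h5 h6 ⟨x, h⟩

lemma seq_congr {A B : DGCat} {c c' : A.Mor} {m m' : B.Mor →+ A.Mor} (hc : c = c') (hm : ∀ a, m a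
    = m' a) (l) : seq c m 0 l = seq c' m' 0 l := by
  rw [hc, AddMonoidHom.ext hm]

lemma divX_X : (Polynomial.X : Polynomial (ZMod 2)).divX = 1 := by
  ext n
  rw [Polynomial.coeff_divX, Polynomial.coeff_X, Polynomial.coeff_one]
  simp [eq_comm]

lemma symHom_X0 : symHom (MvPolynomial.X 0) = MvPolynomial.X 0 + MvPolynomial.X 1 := by
  simp [symHom]

lemma symHom_X1 : symHom (MvPolynomial.X 1) = MvPolynomial.X 0 * MvPolynomial.X 1 := by
  simp [symHom]

lemma X_eq_add_add {i j : Fin 2} : (MvPolynomial.X i : MvPolynomial (Fin 2) (ZMod 2)) =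
    MvPolynomial.X j + MvPolynomial.X i + MvPolynomial.X j := by
  rw [add_right_comm, CharTwo.add_self_eq_zero, zero_add]

lemma Xbim_eq_iff {y x : Xbim.G} :
    (@Eq YG y.1.1 x.1.1 ∧ @Eq LamG y.1.2 x.1.2) ↔ y = x :=
  Prod.ext_iff.symm.trans Subtype.ext_iff.symm

section

attribute [local simp] xOne xTwo oneBoxMapInv boxOneMapInv divX_X
  matU1 matU2 matOf_X0 matOf_X1 symHom_X0 symHom_X1 CharTwo.add_self_eq_zero

lemma boxId_eta_xOne (y x l) : boxId etaC Xbim y (xOne x) l = oneBoxInv Xbim y x l := by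
  obtain ⟨⟨s, ⟨y, hy⟩⟩, h⟩ := y
  obtain ⟨x, hx⟩ := x
  obtain rfl : s = Ybim.l y.1 := h
  refine (boxId_eta_apply _ _ _ _ _ _ _).trans ((seq_congr ?_ ?_ l).trans
    (relabel_eq_seq _ _ _ _).symm)
  · refine Eq.trans ?_ (if_congr Xbim_eq_iff (rfl : A11.idem (Lam.r y.2) = _) rfl)
    induction x, hx using Xbim_ind' <;> induction y, hy using Xbim_ind' <;> apply ext11 <;> simp
  · intro a
    induction x, hx using Xbim_ind' <;> induction y, hy using Xbim_ind' <;> simp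

lemma boxId_eps_xTwo (y x l) : boxId epsC Xbim (xTwo y) x l = oneBoxHom Xbim y x l := by
  obtain ⟨⟨s, ⟨x, hx⟩⟩, h⟩ := x
  obtain ⟨y, hy⟩ := y
  obtain rfl : s = Ybim.l x.1 := h
  refine (boxId_eps_apply _ _ _ _ _ _ _).trans ((seq_congr ?_ ?_ l).trans
    (relabel_eq_seq _ _ _ _).symm)
  · refine Eq.trans ?_ (if_congr Xbim_eq_iff (rfl : A11.idem (Lam.r y.2) = _) rfl)
    induction x, hx using Xbim_ind' <;> induction y, hy using Xbim_ind' <;> apply ext11 <;> simp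
  · intro a
    induction x, hx using Xbim_ind' <;> induction y, hy using Xbim_ind' <;> simp

lemma idBox_eta_xOne (y x l) : idBox Xbim etaC y (xOne x) l = boxOneInv Xbim y x l := by
  obtain ⟨⟨⟨y, hy⟩, s⟩, h⟩ := y
  obtain ⟨x, hx⟩ := x
  obtain rfl : Lam.r y.2 = s := h
  refine (short_eta.idBox_X (fun _ _ _ => etaM_eq_zero) _ _ _).trans ((seq_congr ?_ ?_ l).trans
    (relabel_eq_seq _ _ _ _).symm)
  · refine Eq.trans ?_ (if_congr Xbim_eq_iff (rfl : A11.idem (Lam.r y.2) = _) rfl)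
    induction x, hx using Xbim_ind' <;> induction y, hy using Xbim_ind' <;> apply ext11 <;> simp
  · exact fun _ => rfl

lemma idBox_eps_xTwo (y x l) : idBox Xbim epsC (xTwo y) x l = boxOneHom Xbim y x l := by
  obtain ⟨⟨⟨x, hx⟩, s⟩, h⟩ := x
  obtain ⟨y, hy⟩ := y
  obtain rfl : Lam.r x.2 = s := h
  refine (short_eps.idBox_X (fun _ _ _ => epsM_eq_zero) _ _ _).trans ((seq_congr ?_ ?_ l).trans
    (relabel_eq_seq _ _ _ _).symm)
  · refine Eq.trans ?_ (if_congr Xbim_eq_iff (rfl : A11.idem (Lam.r y.2) = _) rfl)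
    induction x, hx using Xbim_ind' <;> induction y, hy using Xbim_ind' <;> apply ext11 <;> simp
  · exact fun _ => rfl

lemma seq_add_seq {A B : DGCat} (c c') (m m' : B.Mor →+ A.Mor) (l) : seq c m 0 l + seq c' m' 0 l =
    seq (c + c') (m + m') 0 l := by
  rcases l with _ | ⟨a, _ | ⟨b, l⟩⟩
  · rfl
  · rfl
  · rw [seq_of_length_two, seq_of_length_two, seq_of_length_two, add_zero] <;> simp

lemma short_eps_comp_eta : Short (compC epsC etaC)
    (fun y x => epsZ y.1 .ou * etaZ .ou x.1 + epsZ y.1 .uo * etaZ .uo x.1 +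
      epsZ y.1 .oo * etaZ .oo x.1)
    (fun y x => (AddMonoidHom.mulLeft (epsZ y.1 .uo)).comp (etaM .uo x.1) +
      (AddMonoidHom.mulRight (etaZ .ou x.1)).comp (epsM y.1 .ou)) (fun _ _ => 0) where
  eq y x := by
    funext l
    have e1 : ∀ s a, s ≠ .uo → etaM s x.1 a = 0 := by
      intro s a hs
      induction x using Xbim_ind <;> cases s <;>
        first | rfl | exact absurd rfl hs
    have e2 : ∀ s a, s ≠ .ou → epsM y.1 s a = 0 := by
      intro s a hs
      induction y using Xbim_ind <;> cases s <;>
        first | rfl | exact absurd rfl hs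
    have e3 : etaZ .uu x.1 = 0 := by
      induction x using Xbim_ind <;> rfl
    rcases l with _ | ⟨a, _ | ⟨b, _ | ⟨c, _ | ⟨d, _ | ⟨e, l⟩⟩⟩⟩⟩
    · refine (short_eps.compC_nil short_eta y x).trans ?_
      refine (one11_sum fun s => epsZ y.1 s * etaZ s x.1).trans ?_
      rw [e3, mul_zero, zero_add]; rfl
    · refine (short_eps.compC_one short_eta y x a).trans ?_
      refine (one11_sum fun s => epsZ y.1 s * etaM s x.1 a + epsM y.1 s a * etaZ s x.1).trans ?_
      rw [e1 .uu _ (by simp), e1 .ou _ (by simp), e1 .oo _ (by simp), e2 .uu _ (by simp),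
        e2 .uo _ (by simp), e2 .oo _ (by simp)]
      simp only [mul_zero, zero_mul, add_zero, zero_add]
      exact add_comm _ _
    · refine (short_eps.compC_two short_eta y x a b).trans ?_
      refine (one11_sum fun s => epsZ y.1 s * 0 + epsM y.1 s a * etaM s x.1 b +
        0 * etaZ s x.1).trans ?_
      rw [e1 .uu _ (by simp), e1 .ou _ (by simp), e1 .oo _ (by simp), e2 .uo _ (by simp)]
      simp only [mul_zero, zero_mul, add_zero, zero_add]
      rfl
    · refine (short_eps.compC_three short_eta y x a b c).trans ?_
      simp
    · refine (short_eps.compC_four short_eta y x a b c d).trans ?_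
      simp
    · rw [short_eps.compC_long short_eta y x (by simp)]
      rfl

lemma eps_comp_eta_left (y x l) : compC epsC etaC y x l = boxId etaC Xbim (oneBoxMapInv Xbim y)
    (xTwo x) l + idBox Xbim epsC (xOne y) (boxOneMapInv Xbim x) l := by
  refine (congrFun (short_eps_comp_eta.eq y x) l).trans ?_
  refine Eq.trans ?_ (congrArg₂ (· + ·) (boxId_eta_apply _ _ _ _ _ _ _)
    (short_eps.idBox_X (fun _ _ _ => epsM_eq_zero) _ _ _)).symm
  obtain ⟨y, hy⟩ := y
  obtain ⟨x, hx⟩ := x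
  refine Eq.trans (seq_congr ?_ ?_ l) (seq_add_seq _ _ _ _ _).symm
  · change epsZ y .ou * etaZ .ou x + epsZ y .uo * etaZ .uo x + epsZ y .oo * etaZ .oo x =
      xM y (yTwoG (Lam.l x.2), x.2) (etaZ (Ybim.l y.1) (x.1, lamTwo (Lam.l x.2))) +
      xB y (yTwoG (Lam.l x.2), x.2) (etaZ (Ybim.l y.1) (.B, .Y))
        (xC (.B, .Y) (x.1, lamTwo (Lam.l x.2))) +
      ((if @Eq YG y.1 x.1 ∧ @Eq LamG (lamOne (Lam.l y.2)) x.2 then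
        epsZ (yOne (Lam.l y.2), y.2) (Lam.r x.2) else 0) + epsM (yOne (Lam.l y.2), y.2) (Lam.r x.2)
          (xC (y.1, lamOne (Lam.l y.2)) x))
    induction x, hx using Xbim_ind' <;> induction y, hy using Xbim_ind' <;> apply ext11 <;> simp
    exact X_eq_add_add
  · intro a
    change epsZ y .uo * etaM .uo x a + epsM y .ou a * etaZ .ou x =
      xM y (yTwoG (Lam.l x.2), x.2) (etaM (Ybim.l y.1) (x.1, lamTwo (Lam.l x.2)) a) + 0
    induction x, hx using Xbim_ind' <;> induction y, hy using Xbim_ind' <;> apply ext11 <;> simp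

lemma eps_comp_eta_right (y x l) : compC epsC etaC y x l = boxId epsC Xbim (xOne y) (oneBoxMapInv
    Xbim x) l + idBox Xbim etaC (boxOneMapInv Xbim y) (xTwo x) l := by
  refine (congrFun (short_eps_comp_eta.eq y x) l).trans ?_
  refine Eq.trans ?_ (congrArg₂ (· + ·) (boxId_eps_apply _ _ _ _ _ _ _)
    (short_eta.idBox_X (fun _ _ _ => etaM_eq_zero) _ _ _)).symm
  obtain ⟨y, hy⟩ := y
  obtain ⟨x, hx⟩ := x
  refine Eq.trans (seq_congr ?_ ?_ l) (seq_add_seq _ _ _ _ _).symm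
  · change epsZ y .ou * etaZ .ou x + epsZ y .uo * etaZ .uo x + epsZ y .oo * etaZ .oo x =
      xM (yOne (Lam.l y.2), y.2) x (epsZ (y.1, lamOne (Lam.l y.2)) (Ybim.l x.1)) +
      xB (yOne (Lam.l y.2), y.2) x (xC (y.1, lamOne (Lam.l y.2)) (.A, .X))
        (epsZ (.A, .X) (Ybim.l x.1)) +
      ((if @Eq YG y.1 x.1 ∧ @Eq LamG y.2 (lamTwo (Lam.l x.2)) then
        etaZ (Lam.r y.2) (yTwoG (Lam.l x.2), x.2) else 0) + etaM (Lam.r y.2)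
          (yTwoG (Lam.l x.2), x.2) (xC y (x.1, lamTwo (Lam.l x.2))))
    induction x, hx using Xbim_ind' <;> induction y, hy using Xbim_ind' <;> apply ext11 <;> simp
    rw [add_assoc, CharTwo.add_self_eq_zero, add_zero]
  · intro a
    change epsZ y .uo * etaM .uo x a + epsM y .ou a * etaZ .ou x =
      xM (yOne (Lam.l y.2), y.2) x (epsM (y.1, lamOne (Lam.l y.2)) (Ybim.l x.1) a) + 0
    induction x, hx using Xbim_ind' <;> induction y, hy using Xbim_ind' <;> apply ext11 <;> simp

end

namespace IsCone

variable {A B C : DGCat} {N N' Q K : ADRaw B A} {f : Coch N N'} {i : N.G → Q.G} {i' : N'.G → Q.G}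

/-! ### Inclusions and projections of cones -/

/-- The inclusion of the first summand. -/
def inI (_ : IsCone f i i') : Coch N Q := relabel fun q x => q = i x

/-- The inclusion of the second summand. -/
def inT (_ : IsCone f i i') : Coch N' Q := relabel fun q x => q = i' x

/-- The projection to the first summand. -/
def prI (_ : IsCone f i i') : Coch Q N := relabel fun x q => q = i x

/-- The projection to the second summand. -/
def prT (_ : IsCone f i i') : Coch Q N' := relabel fun x q => q = i' x

variable (h : IsCone f i i')

lemma inI_i (y x) : h.inI (i y) x = idC N y x :=
  funext fun l => relabel_congr' h.inj (h.r_i y) l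

lemma inI_t (y x l) : h.inI (i' y) x l = 0 :=
  relabel_of_not (fun e => h.ne x y e.symm) l

lemma inT_t (y x) : h.inT (i' y) x = idC N' y x :=
  funext fun l => relabel_congr' h.inj' (h.r_t y) l

lemma inT_i (y x l) : h.inT (i y) x l = 0 :=
  relabel_of_not (h.ne y x) l

lemma prI_i (y x) : h.prI y (i x) = idC N y x :=
  funext fun l => relabel_congr' (φ := fun y q => q = i y) (ψ := fun y x => y = x)
    (h.inj.trans eq_comm) rfl l

lemma prI_t (y x l) : h.prI y (i' x) l = 0 :=
  relabel_of_not (fun e => h.ne y x e.symm) l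

lemma prT_t (y x) : h.prT y (i' x) = idC N' y x :=
  funext fun l => relabel_congr' (φ := fun y q => q = i' y) (ψ := fun y x => y = x)
    (h.inj'.trans eq_comm) rfl l

lemma prT_i (y x l) : h.prT y (i x) l = 0 :=
  relabel_of_not (φ := fun y q => q = i' y) (h.ne x y) l

lemma comp_inI {g : Coch Q K} (hg : BiC g) (y x l) : compC g h.inI y x l = g y (i x) l :=
  (compC_relabel g (fun _ _ => Iff.rfl) y x l).trans (hg.out_right _ _ _)

lemma comp_inT {g : Coch Q K} (hg : BiC g) (y x l) : compC g h.inT y x l = g y (i' x) l :=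
  (compC_relabel g (fun _ _ => Iff.rfl) y x l).trans (hg.out_right _ _ _)

lemma prI_comp {g : Coch K Q} (hg : BiC g) (y x l) : compC h.prI g y x l = g (i y) x l := by
  refine (relabel_compC g (fun _ _ => Iff.rfl) y x l).trans ?_
  rw [← h.r_i]
  exact hg.out_left _ _ _

lemma prT_comp {g : Coch K Q} (hg : BiC g) (y x l) : compC h.prT g y x l = g (i' y) x l := by
  refine (relabel_compC g (fun _ _ => Iff.rfl) y x l).trans ?_
  rw [← h.r_t]
  exact hg.out_left _ _ _

lemma compC_eq_of {M N K M' K' : ADRaw B A} {g : Coch N K} {f : Coch M N} {f' : Coch M' N} {g' :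
    Coch N K'} {y : K.G} {y' : K'.G} {x : M.G} {x' : M'.G} (hg : ∀ n, g y n = g' y' n) (hf : ∀ n, f
    n x = f' n x') (l) : compC g f y x l = compC g' f' y' x' l := by
  simp only [compC_apply, hg, hf]

lemma compC_eq_zero_left {M N K : ADRaw B A} {g : Coch N K} {f : Coch M N} {y : K.G} (x) (hg : ∀ n
    l, g y n l = 0) (l) : compC g f y x l = 0 :=
  Finset.sum_eq_zero fun n _ => conv_eq_zero_left (hg n) l

lemma compC_eq_zero_right {M N K : ADRaw B A} {g : Coch N K} {f : Coch M N} (y) {x : M.G} (hf : ∀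
    n l, f n x l = 0) (l) : compC g f y x l = 0 :=
  Finset.sum_eq_zero fun n _ => conv_eq_zero_right (hf n) l

lemma inI_comp_i {g : Coch K N} (hg : BiC g) (y x l) : compC h.inI g (i y) x l = g y x l :=
  (compC_eq_of (h.inI_i y) (fun _ => rfl) l).trans (by rw [idC_compC hg])

lemma inI_comp_t (g : Coch K N) (y x l) :
    compC h.inI g (i' y) x l = 0 := compC_eq_zero_left x (h.inI_t y) l

lemma inT_comp_t {g : Coch K N'} (hg : BiC g) (y x l) : compC h.inT g (i' y) x l = g y x l :=
  (compC_eq_of (h.inT_t y) (fun _ => rfl) l).trans (by rw [idC_compC hg])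

lemma inT_comp_i (g : Coch K N') (y x l) :
    compC h.inT g (i y) x l = 0 := compC_eq_zero_left x (h.inT_i y) l

lemma comp_prI_i {g : Coch N K} (hg : BiC g) (y x l) : compC g h.prI y (i x) l = g y x l :=
  (compC_eq_of (fun _ => rfl) (fun n => h.prI_i n x) l).trans (by rw [compC_idC hg])

lemma comp_prI_t (g : Coch N K) (y x l) :
    compC g h.prI y (i' x) l = 0 := compC_eq_zero_right y (fun n => h.prI_t n x) l

lemma comp_prT_t {g : Coch N' K} (hg : BiC g) (y x l) : compC g h.prT y (i' x) l = g y x l :=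
  (compC_eq_of (fun _ => rfl) (fun n => h.prT_t n x) l).trans (by rw [compC_idC hg])

lemma comp_prT_i (g : Coch N' K) (y x l) :
    compC g h.prT y (i x) l = 0 := compC_eq_zero_right y (fun n => h.prT_i n x) l

lemma biC_relabel {M N : ADRaw B A} {φ : N.G → M.G → Prop}
    (hl : ∀ y x, φ y x → N.l y = M.l x) (hr : ∀ y x, φ y x → N.r y = M.r x) :
    BiC (relabel φ : Coch M N) := by
  let N₀ : ADRaw B A := { N with deg := fun _ => 0 }
  let M0 : ADRaw B A := { M with deg := fun _ => 0 }
  have h : (relabel φ : Coch M0 N₀) ∈ homMor M0 N₀ 0 :=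
    relabel_homMor hl hr fun _ _ _ => (add_zero _).symm
  exact ⟨h.1.biLin, h.1.out⟩

lemma biC_inI : BiC h.inI :=
  biC_relabel (fun _ _ e => by rw [e, h.l_i]) fun _ _ e => by rw [e, h.r_i]

lemma biC_inT : BiC h.inT :=
  biC_relabel (fun _ _ e => by rw [e, h.l_t]) fun _ _ e => by rw [e, h.r_t]

lemma biC_prI : BiC h.prI :=
  biC_relabel (fun _ _ e => by rw [e, h.l_i]) fun _ _ e => by rw [e, h.r_i]

lemma biC_prT : BiC h.prT :=
  biC_relabel (fun _ _ e => by rw [e, h.l_t]) fun _ _ e => by rw [e, h.r_t]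

lemma prI_inI : compC h.prI h.inI = idC N := by
  funext y x l
  rw [h.prI_comp h.biC_inI, h.inI_i]

lemma prT_inT : compC h.prT h.inT = idC N' := by
  funext y x l
  rw [h.prT_comp h.biC_inT, h.inT_t]

lemma prI_inT : compC h.prI h.inT = 0 := by
  funext y x l
  rw [h.prI_comp h.biC_inT, h.inT_i]; rfl

lemma prT_inI : compC h.prT h.inI = 0 := by
  funext y x l
  rw [h.prT_comp h.biC_inI, h.inI_t]; rfl

lemma sum_in_pr : compC h.inI h.prI + compC h.inT h.prT = idC Q := by
  funext y x l
  rw [Pi.add_apply, Pi.add_apply, Pi.add_apply]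
  induction x using h.cases with
  | h1 x =>
    rw [h.comp_prI_i h.biC_inI, h.comp_prT_i, add_zero]; rfl
  | h2 x =>
    rw [h.comp_prT_t h.biC_inT, h.comp_prI_t, zero_add]; rfl

lemma dMor_idC (hN : BiC (M := N) (N := N) N.δ) : dMor N N (idC N) = 0 := by
  rw [dMor_apply, compC_idC hN, idC_compC hN, idC, intD_relabel, zero_add, Coch.add_self]

section Diff

variable (hN : BiC (M := N) (N := N) N.δ) (hN' : BiC (M := N') (N := N') N'.δ) (hf : BiC f)

include hN hf in
lemma dMor_inI : dMor N Q h.inI = compC h.inT f := by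
  funext y x l
  have e1 : (fun y => h.inI (i y) : Coch N N) = idC N := funext fun y => funext fun x => h.inI_i y x
  have e2 : (fun y => h.inI (i' y) : Coch N N') = 0 :=
    funext fun y => funext fun x => funext fun l => h.inI_t y x l
  induction y using h.cases with
  | h1 y => rw [h.dMor_into_i, e1, dMor_idC hN, h.inT_comp_i]; rfl
  | h2 y =>
    rw [h.dMor_into_t, e1, e2, map_zero, compC_idC hf, h.inT_comp_t hf]; exact zero_add _

include hN' in
lemma dMor_inT : dMor N' Q h.inT = 0 := by
  funext y x l
  have e1 : (fun y => h.inT (i' y) : Coch N' N') = idC N' :=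
    funext fun y => funext fun x => h.inT_t y x
  have e2 : (fun y => h.inT (i y) : Coch N' N) = 0 :=
    funext fun y => funext fun x => funext fun l => h.inT_i y x l
  induction y using h.cases with
  | h1 y => rw [h.dMor_into_i, e2, map_zero]; rfl
  | h2 y => rw [h.dMor_into_t, e1, e2, compC_zero, dMor_idC hN']; exact zero_add _

include hN in
lemma dMor_prI : dMor Q N h.prI = 0 := by
  funext y x l
  have e1 : (fun y x => h.prI y (i x) : Coch N N) = idC N :=
    funext fun y => funext fun x => h.prI_i y x
  have e2 : (fun y x => h.prI y (i' x) : Coch N' N) = 0 :=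
    funext fun y => funext fun x => funext fun l => h.prI_t y x l
  induction x using h.cases with
  | h1 x => rw [h.dMor_from_i, e1, e2, zero_compC, dMor_idC hN]; exact zero_add _
  | h2 x => rw [h.dMor_from_t, e2, map_zero]; rfl

include hN' hf in
lemma dMor_prT : dMor Q N' h.prT = compC f h.prI := by
  funext y x l
  have e1 : (fun y x => h.prT y (i' x) : Coch N' N') = idC N' :=
    funext fun y => funext fun x => h.prT_t y x
  have e2 : (fun y x => h.prT y (i x) : Coch N N') = 0 :=
    funext fun y => funext fun x => funext fun l => h.prT_i y x l
  induction x using h.cases with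
  | h1 x =>
    rw [h.dMor_from_i, e1, e2, map_zero, idC_compC hf, h.comp_prI_i hf]; exact zero_add _
  | h2 x => rw [h.dMor_from_t, e1, dMor_idC hN', h.comp_prI_t]; rfl

end Diff

end IsCone

/-! ### Squares -/

/-- `Q` is the sum of `S`, `U`, `V`, `T`, with `b`, `a`, `e`, `c` added to the structure map. -/
structure IsSquare {A B : DGCat} {S U V T Q : ADRaw B A} (b : Coch S U) (a : Coch S V)
    (e : Coch U T) (c : Coch V T) (is : Coch S Q) (iu : Coch U Q) (iv : Coch V Q) (it : Coch T Q)
    (ps : Coch Q S) (pu : Coch Q U) (pv : Coch Q V) (pt : Coch Q T) : Prop where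
  d_is : dMor S Q is = compC iu b + compC iv a
  d_iu : dMor U Q iu = compC it e
  d_iv : dMor V Q iv = compC it c
  d_it : dMor T Q it = 0
  d_ps : dMor Q S ps = 0
  d_pu : dMor Q U pu = compC b ps
  d_pv : dMor Q V pv = compC a ps
  d_pt : dMor Q T pt = compC e pu + compC c pv
  uu : compC pu iu = idC U
  vv : compC pv iv = idC V
  uv : compC pu iv = 0
  vu : compC pv iu = 0
  sum : compC is ps + compC iu pu + compC iv pv + compC it pt = idC Q

lemma IsSquare.swap {A B : DGCat} {S U V T Q : ADRaw B A} {b : Coch S U} {a : Coch S V}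
    {e : Coch U T} {c : Coch V T} {is : Coch S Q} {iu : Coch U Q} {iv : Coch V Q} {it : Coch T Q}
    {ps : Coch Q S} {pu : Coch Q U} {pv : Coch Q V} {pt : Coch Q T}
    (h : IsSquare b a e c is iu iv it ps pu pv pt) :
    IsSquare a b c e is iv iu it ps pv pu pt where
  d_is := h.d_is.trans (add_comm _ _)
  d_iu := h.d_iv
  d_iv := h.d_iu
  d_it := h.d_it
  d_ps := h.d_ps
  d_pu := h.d_pv
  d_pv := h.d_pu
  d_pt := h.d_pt.trans (add_comm _ _)
  uu := h.vv
  vv := h.uu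
  uv := h.vu
  vu := h.uv
  sum := by rw [add_right_comm (compC is ps)]; exact h.sum

section Square

variable {A B : DGCat} {S U V T Q I : ADRaw B A} {b : Coch S U} {a : Coch S V}
    {e : Coch U T} {c : Coch V T} {is : Coch S Q} {iu : Coch U Q} {iv : Coch V Q} {it : Coch T Q}
    {ps : Coch Q S} {pu : Coch Q U} {pv : Coch Q V} {pt : Coch Q T}
    (h : IsSquare b a e c is iu iv it ps pu pv pt) {m : Coch V S} {p : Coch T V} {ι : Coch I U}
    {ι' : Coch U I} {cup : Coch I V} {cap : Coch V I}

include h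

lemma IsSquare.create_closed (hι : dMor I U ι = 0) (hcup : dMor I V cup = 0)
    (h1 : compC c p = idC T) (h2 : cup = compC p (compC e ι)) (he : BiC (compC e ι)) :
    dMor I Q (compC iu ι + compC iv cup) = 0 := by
  rw [map_add, dMor_compC, dMor_compC, hι, hcup, h.d_iu, h.d_iv, compC_zero, compC_zero, h2,
    compC_assoc, compC_assoc, ← compC_assoc c, h1, idC_compC he, add_zero,
    Coch.add_self]

lemma IsSquare.annih_closed (hι : dMor U I ι' = 0) (hcap : dMor V I cap = 0)
    (h1 : compC m a = idC S) (h2 : cap = compC (compC ι' b) m) (hb : BiC (compC ι' b)) :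
    dMor Q I (compC ι' pu + compC cap pv) = 0 := by
  rw [map_add, dMor_compC, dMor_compC, hι, hcap, h.d_pu, h.d_pv, zero_compC, zero_compC, h2,
    ← compC_assoc, ← compC_assoc, compC_assoc _ m, h1, compC_idC hb, zero_add,
    Coch.add_self]

lemma IsSquare.annih_create (hι : compC ι' ι = idC I) (h0 : compC cap cup = 0)
    (h1 : BiC ι) (h2 : BiC cup) :
    compC (compC ι' pu + compC cap pv) (compC iu ι + compC iv cup) = idC I := by
  rw [add_compC, compC_add, compC_add, compC_assoc, compC_assoc, compC_assoc, compC_assoc,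
    ← compC_assoc pu, ← compC_assoc pu, ← compC_assoc pv, ← compC_assoc pv, h.uu, h.uv, h.vu, h.vv,
    idC_compC h1, idC_compC h2, zero_compC, zero_compC, compC_zero, compC_zero, hι, h0]
  simp

lemma IsSquare.create_annih (hm : dMor V S m = 0) (hp : dMor T V p = 0)
    (hma : compC m a = idC S) (hcp : compC c p = idC T) (hιι : compC ι ι' = idC U)
    (hbm : compC b m = compC ι cap) (hpe : compC p e = compC cup ι')
    (hV : compC a m + compC p c = compC cup cap + idC V)
    (hs : BiC ps) (hu : BiC pu) (hv : BiC pv) (ht : BiC pt) :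
    dMor Q Q (compC is (compC m pv) + compC iv (compC p pt)) =
      compC (compC iu ι + compC iv cup) (compC ι' pu + compC cap pv) + idC Q := by
  have e1 : dMor Q Q (compC is (compC m pv) + compC iv (compC p pt)) =
      compC iu (compC (compC b m) pv) + compC iv (compC (compC a m) pv) +
      compC is (compC (compC m a) ps) + (compC it (compC (compC c p) pt) +
      (compC iv (compC (compC p e) pu) + compC iv (compC (compC p c) pv))) := by
    simp only [map_add, dMor_compC, hm, hp, h.d_is, h.d_pv, h.d_iv, h.d_pt, zero_compC, zero_add,
      add_compC, compC_add, compC_assoc]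
  have e2 : compC iv (compC (compC a m) pv) = compC iv (compC (compC p c) pv) +
      compC iv (compC (compC cup cap) pv) + compC iv pv := by
    have e3 : compC a m = compC p c + compC cup cap + idC V := by
      rw [add_assoc, ← hV, add_comm (compC a m), ← add_assoc, Coch.add_self, zero_add]
    rw [e3, add_compC, add_compC, compC_add, compC_add, idC_compC hv]
  have e4 : compC iu (compC (compC ι ι') pu) = compC iu pu := by rw [hιι, idC_compC hu]
  rw [e1, e2, hma, hcp, hbm, hpe, idC_compC hs, idC_compC ht, ← h.sum]
  simp only [add_compC, compC_add]
  rw [compC_assoc iu ι, ← compC_assoc ι ι', e4, compC_assoc iu ι, compC_assoc iv cup,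
    compC_assoc iv cup, compC_assoc ι, compC_assoc cup, compC_assoc cup]
  have k1 := Coch.add_self (compC iv (compC (compC p c) pv))
  have k2 := Coch.add_self (compC iu pu)
  generalize compC iv (compC (compC p c) pv) = x1 at k1 ⊢
  generalize compC iu pu = x2 at k2 ⊢
  calc _ = (compC iu (compC ι (compC cap pv)) + compC iv (compC cup (compC cap pv)) +
        compC iv pv + compC is ps + compC it pt + compC iv (compC cup (compC ι' pu))) +
        (x1 + x1) := by abel
    _ = (compC iu (compC ι (compC cap pv)) + compC iv (compC cup (compC cap pv)) +
        compC iv pv + compC is ps + compC it pt + compC iv (compC cup (compC ι' pu))) +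
        (x2 + x2) := by rw [k1, k2]
    _ = _ := by abel

end Square

section BoxCone

variable {A B C : DGCat} {N N' P : ADRaw C B} {f : Coch N N'} {i : N.G → P.G} {i' : N'.G → P.G}
  {M M' R : ADRaw B A} {g : Coch M M'} {k : M.G → R.G} {k' : M'.G → R.G}

/-! ### Box tensor products of cones -/

lemma IsCone.boxId_inI (hR : IsCone g k k') (hex : exBox f g = 0) (hF : BiC (boxId f R))
    (hf : BiC (boxId f M)) :
    compC (boxId f R) (hR.boxLeft N).inI = compC (hR.boxLeft N').inI (boxId f M) := by
  funext y x l
  rw [(hR.boxLeft N).comp_inI hF]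
  induction y using (hR.boxLeft N').cases with
  | h1 y =>
    rw [(hR.boxLeft N').inI_comp_i hf]
    exact congrArg (fun Φ => TF f y.1.1 x.1.1 Φ l) (hR.δ_ii y.1.2 x.1.2)
  | h2 y =>
    rw [(hR.boxLeft N').inI_comp_t]
    refine (congrArg (fun Φ => TF f y.1.1 x.1.1 Φ l) (hR.δ_ti y.1.2 x.1.2)).trans ?_
    exact congrFun (congrFun (congrFun hex y) x) l

lemma IsCone.boxId_inT (hR : IsCone g k k') (hF : BiC (boxId f R)) (hf : BiC (boxId f M')) :
    compC (boxId f R) (hR.boxLeft N).inT = compC (hR.boxLeft N').inT (boxId f M') := by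
  funext y x l
  rw [(hR.boxLeft N).comp_inT hF]
  induction y using (hR.boxLeft N').cases with
  | h1 y =>
    rw [(hR.boxLeft N').inT_comp_i]
    refine (congrArg (fun Φ => TF f y.1.1 x.1.1 Φ l) (funext (hR.δ_it y.1.2 x.1.2))).trans ?_
    exact (finsum_congr fun j => iterF_zero_fun f j _ _ l).trans finsum_zero
  | h2 y =>
    rw [(hR.boxLeft N').inT_comp_t hf]
    exact congrArg (fun Φ => TF f y.1.1 x.1.1 Φ l) (hR.δ_tt y.1.2 x.1.2)

lemma IsCone.prI_boxId (hR : IsCone g k k') (hF : BiC (boxId f R)) (hf : BiC (boxId f M)) :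
    compC (hR.boxLeft N').prI (boxId f R) = compC (boxId f M) (hR.boxLeft N).prI := by
  funext y x l
  rw [(hR.boxLeft N').prI_comp hF]
  induction x using (hR.boxLeft N).cases with
  | h1 x =>
    rw [(hR.boxLeft N).comp_prI_i hf]
    exact congrArg (fun Φ => TF f y.1.1 x.1.1 Φ l) (hR.δ_ii y.1.2 x.1.2)
  | h2 x =>
    rw [(hR.boxLeft N).comp_prI_t]
    refine (congrArg (fun Φ => TF f y.1.1 x.1.1 Φ l) (funext (hR.δ_it y.1.2 x.1.2))).trans ?_
    exact (finsum_congr fun j => iterF_zero_fun f j _ _ l).trans finsum_zero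

lemma IsCone.prT_boxId (hR : IsCone g k k') (hex : exBox f g = 0) (hF : BiC (boxId f R))
    (hf : BiC (boxId f M')) :
    compC (hR.boxLeft N').prT (boxId f R) = compC (boxId f M') (hR.boxLeft N).prT := by
  funext y x l
  rw [(hR.boxLeft N').prT_comp hF]
  induction x using (hR.boxLeft N).cases with
  | h1 x =>
    rw [(hR.boxLeft N).comp_prT_i]
    refine (congrArg (fun Φ => TF f y.1.1 x.1.1 Φ l) (hR.δ_ti y.1.2 x.1.2)).trans ?_
    exact congrFun (congrFun (congrFun hex y) x) l
  | h2 x =>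
    rw [(hR.boxLeft N).comp_prT_t hf]
    exact congrArg (fun Φ => TF f y.1.1 x.1.1 Φ l) (hR.δ_tt y.1.2 x.1.2)

lemma IsCone.square (hP : IsCone f i i') (hR : IsCone g k k') (hN : IsAD N) (hN' : IsAD N')
    (hM : IsAD M) (hM' : IsAD M') (hRA : IsAD R) (hf : f ∈ closed N N') (hg : g ∈ closed M M')
    (hex : exBox f g = 0) (O : IsCone (Q := P.box R) (boxId f R)
      (fun x : (N.box R).G => ⟨(i x.1.1, x.1.2), (hP.r_i _).trans x.2⟩)
      (fun x : (N'.box R).G => ⟨(i' x.1.1, x.1.2), (hP.r_t _).trans x.2⟩)) :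
    IsSquare (boxId f M) (idBox N g) (idBox N' g) (boxId f M')
      (compC O.inI (hR.boxLeft N).inI) (compC O.inT (hR.boxLeft N').inI)
      (compC O.inI (hR.boxLeft N).inT) (compC O.inT (hR.boxLeft N').inT)
      (compC (hR.boxLeft N).prI O.prI) (compC (hR.boxLeft N').prI O.prT)
      (compC (hR.boxLeft N).prT O.prI) (compC (hR.boxLeft N').prT O.prT) := by
  have hF := biC_of_mor (closed_boxId hN hN' hRA hf).1
  have hfM := biC_of_mor (closed_boxId hN hN' hM hf).1
  have hfM' := biC_of_mor (closed_boxId hN hN' hM' hf).1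
  have hNg := biC_of_mor (closed_idBox hN hM hM' hg).1
  have hNg' := biC_of_mor (closed_idBox hN' hM hM' hg).1
  have hNR := (hN.box hRA).cochain.biC
  have hNR' := (hN'.box hRA).cochain.biC
  constructor
  · rw [dMor_compC, O.dMor_inI hNR hF, (hR.boxLeft N).dMor_inI (hN.box hM).cochain.biC hNg,
      compC_assoc, hR.boxId_inI hex hF hfM, compC_assoc, compC_assoc]
  · rw [dMor_compC, O.dMor_inT hNR', (hR.boxLeft N').dMor_inI (hN'.box hM).cochain.biC hNg',
      zero_compC, zero_add, compC_assoc]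
  · rw [dMor_compC, O.dMor_inI hNR hF, (hR.boxLeft N).dMor_inT (hN.box hM').cochain.biC,
      compC_assoc, hR.boxId_inT hF hfM', compC_zero, add_zero, compC_assoc]
  · rw [dMor_compC, O.dMor_inT hNR', (hR.boxLeft N').dMor_inT (hN'.box hM').cochain.biC,
      zero_compC, zero_add, compC_zero]
  · rw [dMor_compC, O.dMor_prI hNR, (hR.boxLeft N).dMor_prI (hN.box hM).cochain.biC,
      zero_compC, zero_add, compC_zero]
  · rw [dMor_compC, O.dMor_prT hNR' hF, (hR.boxLeft N').dMor_prI (hN'.box hM).cochain.biC,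
      zero_compC, zero_add, ← compC_assoc, hR.prI_boxId hF hfM, compC_assoc]
  · rw [dMor_compC, O.dMor_prI hNR, (hR.boxLeft N).dMor_prT (hN.box hM').cochain.biC hNg,
      compC_zero, add_zero, compC_assoc]
  · rw [dMor_compC, O.dMor_prT hNR' hF, (hR.boxLeft N').dMor_prT (hN'.box hM').cochain.biC hNg',
      ← compC_assoc, hR.prT_boxId hex hF hfM', compC_assoc, compC_assoc]
  · rw [compC_assoc, ← compC_assoc O.prT, O.prT_inT, idC_compC (hR.boxLeft N').biC_inI,
      (hR.boxLeft N').prI_inI]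
  · rw [compC_assoc, ← compC_assoc O.prI, O.prI_inI, idC_compC (hR.boxLeft N).biC_inT,
      (hR.boxLeft N).prT_inT]
  · rw [compC_assoc, ← compC_assoc O.prT, O.prT_inI, zero_compC, compC_zero]
  · rw [compC_assoc, ← compC_assoc O.prI, O.prI_inT, zero_compC, compC_zero]
  · have e1 := (hR.boxLeft N).sum_in_pr
    have e2 := (hR.boxLeft N').sum_in_pr
    have e3 : compC O.inI (compC (idC (N.box R)) O.prI) = compC O.inI O.prI := by
      rw [idC_compC O.biC_prI]
    have e4 : compC O.inT (compC (idC (N'.box R)) O.prT) = compC O.inT O.prT := by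
      rw [idC_compC O.biC_prT]
    rw [← O.sum_in_pr, ← e3, ← e4, ← e1, ← e2]
    simp only [add_compC, compC_add, compC_assoc]
    abel

lemma IsCone.inI_homMor (hP : IsCone f i i') {p : ℤ × ℤ} (hd : ∀ x, P.deg (i x) = p + N.deg x) :
    hP.inI ∈ homMor N P p :=
  relabel_homMor (fun _ _ e => by rw [e, hP.l_i]) (fun _ _ e => by rw [e, hP.r_i])
    fun _ _ e => by rw [e, hd]

lemma IsCone.inT_homMor (hP : IsCone f i i') {p : ℤ × ℤ}
    (hd : ∀ x, P.deg (i' x) = p + N'.deg x) : hP.inT ∈ homMor N' P p :=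
  relabel_homMor (fun _ _ e => by rw [e, hP.l_t]) (fun _ _ e => by rw [e, hP.r_t])
    fun _ _ e => by rw [e, hd]

lemma IsCone.prI_homMor (hP : IsCone f i i') {p : ℤ × ℤ} (hd : ∀ x, P.deg (i x) = p + N.deg x) :
    hP.prI ∈ homMor P N (-p) :=
  relabel_homMor (fun _ _ e => by rw [e, hP.l_i]) (fun _ _ e => by rw [e, hP.r_i])
    fun _ _ e => by rw [e, hd, neg_add_cancel_left]

lemma IsCone.prT_homMor (hP : IsCone f i i') {p : ℤ × ℤ}
    (hd : ∀ x, P.deg (i' x) = p + N'.deg x) : hP.prT ∈ homMor P N' (-p) :=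
  relabel_homMor (fun _ _ e => by rw [e, hP.l_t]) (fun _ _ e => by rw [e, hP.r_t])
    fun _ _ e => by rw [e, hd, neg_add_cancel_left]

end BoxCone

/-! ### Relations between `η`, `ε'` and the trivalent vertices -/

lemma isAD_one11 : IsAD one11 := IsAD.one A11

lemma eta_closed : etaC ∈ closed Xbim one11 := mem_closed (homMor_le_mor eta_homMor) eta_dMor

lemma eps_closed : epsC ∈ closed one11 Xbim := mem_closed (homMor_le_mor eps_homMor) eps_dMor

lemma biC_eta : BiC etaC := eta_homMor.1.biC

lemma biC_eps : BiC epsC := eps_homMor.1.biC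

lemma splitC_inI : splitC = isCone_XX.inI := splitC_eq

lemma mergeC_prT : mergeC = isCone_XX.prT := mergeC_eq

lemma biC_boxId_eta : BiC (boxId etaC Xbim) :=
  biC_of_mor (closed_boxId isAD_Xbim isAD_one11 isAD_Xbim eta_closed).1

lemma biC_boxId_eps : BiC (boxId epsC Xbim) :=
  biC_of_mor (closed_boxId isAD_one11 isAD_Xbim isAD_Xbim eps_closed).1

lemma biC_idBox_eta : BiC (idBox Xbim etaC) :=
  biC_of_mor (closed_idBox isAD_Xbim isAD_Xbim isAD_one11 eta_closed).1

lemma biC_idBox_eps : BiC (idBox Xbim epsC) :=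
  biC_of_mor (closed_idBox isAD_Xbim isAD_one11 isAD_Xbim eps_closed).1

lemma boxId_eta_split : compC (boxId etaC Xbim) splitC = oneBoxInv Xbim := by
  funext y x l
  rw [splitC_inI, isCone_XX.comp_inI biC_boxId_eta, boxId_eta_xOne]

lemma idBox_eta_split : compC (idBox Xbim etaC) splitC = boxOneInv Xbim := by
  funext y x l
  rw [splitC_inI, isCone_XX.comp_inI biC_idBox_eta, idBox_eta_xOne]

lemma merge_boxId_eps : compC mergeC (boxId epsC Xbim) = oneBoxHom Xbim := by
  funext y x l
  rw [mergeC_prT, isCone_XX.prT_comp biC_boxId_eps, boxId_eps_xTwo]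

lemma merge_idBox_eps : compC mergeC (idBox Xbim epsC) = boxOneHom Xbim := by
  funext y x l
  rw [mergeC_prT, isCone_XX.prT_comp biC_idBox_eps, idBox_eps_xTwo]

lemma merge_split : compC mergeC splitC = 0 := by
  rw [mergeC_prT, splitC_inI, isCone_XX.prT_inI]

lemma biC_zero {A B : DGCat} {M N : ADRaw B A} : BiC (0 : Coch M N) :=
  (zero_mem (homMor M N 0)).1.biC

lemma X_biC : BiC (M := Xbim) (N := Xbim) Xbim.δ := isAD_Xbim.cochain.biC

lemma split_dMor : dMor Xbim (Xbim.box Xbim) splitC = 0 := by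
  rw [splitC_inI, isCone_XX.dMor_inI X_biC biC_zero, compC_zero]

lemma merge_dMor : dMor (Xbim.box Xbim) Xbim mergeC = 0 := by
  rw [mergeC_prT, isCone_XX.dMor_prT X_biC biC_zero, zero_compC]

lemma split_homMor : splitC ∈ homMor Xbim (Xbim.box Xbim) (1, -2) := by
  rw [splitC_inI]
  refine isCone_XX.inI_homMor fun x => ?_
  obtain ⟨⟨y, _ | _ | _⟩, h⟩ := x
  · change Ybim.deg y + (1, -1) + ((0, -1) + (1, -1)) = (1, -2) + (Ybim.deg y + (1, -1))
    ext <;> simp <;> ring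
  · change Ybim.deg y + (1, -1) + ((0, -1) + 0) = (1, -2) + (Ybim.deg y + 0)
    ext <;> simp <;> ring
  · change Ybim.deg y + 0 + ((1, -2) + 0) = (1, -2) + (Ybim.deg y + 0)
    ext <;> simp <;> ring

lemma merge_homMor : mergeC ∈ homMor (Xbim.box Xbim) Xbim (1, 0) := by
  rw [mergeC_prT]
  refine isCone_XX.prT_homMor (p := (-1, 0)) fun x => ?_
  obtain ⟨⟨y, _ | _ | _⟩, h⟩ := x
  · change Ybim.deg y + 0 + ((-1, 0) + (1, -1)) = (-1, 0) + (Ybim.deg y + (1, -1))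
    abel
  · change Ybim.deg y + 0 + ((-1, 0) + 0) = (-1, 0) + (Ybim.deg y + 0)
    abel
  · change Ybim.deg y + 0 + ((-1, 0) + 0) = (-1, 0) + (Ybim.deg y + 0)
    abel

lemma cup_homMor : cupC ∈ homMor one11 (Xbim.box Xbim) (0, -2) :=
  homMor_compC split_homMor eps_homMor

lemma cap_homMor : capC ∈ homMor (Xbim.box Xbim) one11 (0, 2) :=
  homMor_compC eta_homMor merge_homMor

lemma cup_dMor : dMor one11 (Xbim.box Xbim) cupC = 0 := by
  rw [cupC, dMor_compC, split_dMor, eps_dMor, zero_compC, compC_zero, add_zero]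

lemma cap_dMor : dMor (Xbim.box Xbim) one11 capC = 0 := by
  rw [capC, dMor_compC, eta_dMor, merge_dMor, zero_compC, compC_zero, add_zero]

lemma cap_cup : compC capC cupC = 0 := by
  rw [capC, cupC, compC_assoc, ← compC_assoc mergeC, merge_split, zero_compC, compC_zero]

/-! ### Unit isomorphisms as cochains -/

section Units

variable {A B : DGCat} {M M' : ADRaw B A}

lemma oneBoxHom_homMor (hM : IsAD M) : oneBoxHom M ∈ homMor ((ADRaw.one B).box M) M 0 :=
  (oneBoxIso hM).homMor fun _ _ => Iff.rfl

lemma oneBoxInv_homMor (hM : IsAD M) : oneBoxInv M ∈ homMor M ((ADRaw.one B).box M) 0 :=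
  (oneBoxIso hM).symm.homMor oneBoxInv_iff

lemma boxOneHom_homMor (hM : IsAD M) : boxOneHom M ∈ homMor (M.box (ADRaw.one A)) M 0 :=
  (boxOneIso hM).homMor fun _ _ => Iff.rfl

lemma boxOneInv_homMor (hM : IsAD M) : boxOneInv M ∈ homMor M (M.box (ADRaw.one A)) 0 :=
  (boxOneIso hM).symm.homMor boxOneInv_iff

lemma oneBoxHom_inv (hM : IsAD M) : compC (oneBoxHom M) (oneBoxInv M) = idC M :=
  (oneBoxIso hM).symm.inv_compC oneBoxInv_iff fun _ _ => Iff.rfl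

lemma oneBoxInv_hom (hM : IsAD M) : compC (oneBoxInv M) (oneBoxHom M) = idC _ :=
  (oneBoxIso hM).inv_compC (fun _ _ => Iff.rfl) oneBoxInv_iff

lemma boxOneHom_inv (hM : IsAD M) : compC (boxOneHom M) (boxOneInv M) = idC M :=
  (boxOneIso hM).symm.inv_compC boxOneInv_iff fun _ _ => Iff.rfl

lemma boxOneInv_hom (hM : IsAD M) : compC (boxOneInv M) (boxOneHom M) = idC _ :=
  (boxOneIso hM).inv_compC (fun _ _ => Iff.rfl) boxOneInv_iff

lemma idBox_one_eq (hM : IsAD M) (hM' : IsAD M') {f : Coch M M'} (hf : BiC f) :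
    idBox (ADRaw.one B) f = compC (oneBoxInv M') (compC f (oneBoxHom M)) := by
  funext y x l
  rw [← compC_assoc]
  refine (oneBox_idBox hf y x l).trans (((oneBoxIso hM).compC_right (fun _ _ => Iff.rfl)
    ((oneBoxInv_homMor hM').1.biC.compC hf) y x l).trans ?_).symm
  exact (oneBoxIso hM').symm.compC_left oneBoxInv_iff hf y _ l

lemma boxId_one_eq (hM : IsAD M) (hM' : IsAD M') {f : Coch M M'} (hf : BiC f) :
    boxId f (ADRaw.one A) = compC (boxOneInv M') (compC f (boxOneHom M)) := by
  funext y x l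
  rw [← compC_assoc]
  refine (boxOne_exBox hf y x l).trans (((boxOneIso hM).compC_right (fun _ _ => Iff.rfl)
    ((boxOneInv_homMor hM').1.biC.compC hf) y x l).trans ?_).symm
  exact (boxOneIso hM').symm.compC_left boxOneInv_iff hf y _ l

lemma oneBoxHom_dMor (hM : IsAD M) : dMor _ _ (oneBoxHom M) = 0 :=
  dMor_eq_zero (wellDefined.oneBoxHom_closed ⟨M, hM⟩)

lemma oneBoxInv_dMor (hM : IsAD M) : dMor _ _ (oneBoxInv M) = 0 :=
  dMor_eq_zero (wellDefined.oneBoxInv_closed ⟨M, hM⟩)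

lemma boxOneHom_dMor (hM : IsAD M) : dMor _ _ (boxOneHom M) = 0 :=
  dMor_eq_zero (wellDefined.boxOneHom_closed ⟨M, hM⟩)

lemma boxOneInv_dMor (hM : IsAD M) : dMor _ _ (boxOneInv M) = 0 :=
  dMor_eq_zero (wellDefined.boxOneInv_closed ⟨M, hM⟩)

lemma oneBoxHom_one (A : DGCat) : oneBoxHom (ADRaw.one A) = boxOneHom (ADRaw.one A) :=
  relabel_congr fun _ x => iff_of_eq (congrArg _ x.2.symm)

lemma oneBoxInv_one (A : DGCat) : oneBoxInv (ADRaw.one A) = boxOneInv (ADRaw.one A) :=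
  relabel_congr fun y _ => iff_of_eq (congrArg (· = _) y.2.symm)

end Units

/-! ### Crossings as cones -/

lemma cone_pos : IsCone (N := Xbim) (N' := one11) (Q := crossRaw .pos) etaC Sum.inr Sum.inl where
  bij := (Equiv.sumComm _ _).bijective
  δ_ii _ _ := rfl
  δ_tt _ _ := rfl
  δ_ti _ _ := rfl
  δ_it _ _ _ := rfl
  l_i _ := rfl
  l_t _ := rfl
  r_i _ := rfl
  r_t _ := rfl

lemma cone_neg : IsCone (N := one11) (N' := Xbim) (Q := crossRaw .neg) epsC Sum.inl Sum.inr where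
  bij := (congrArg Function.Bijective Sum.elim_inl_inr).mpr Function.bijective_id
  δ_ii _ _ := rfl
  δ_tt _ _ := rfl
  δ_ti _ _ := rfl
  δ_it _ _ _ := rfl
  l_i _ := rfl
  l_t _ := rfl
  r_i _ := rfl
  r_t _ := rfl

lemma isAD_cross : ∀ c, IsAD (crossRaw c)
  | .pos => PreAD.isAD (cone_pos.preAD isAD_Xbim.preAD isAD_one11.preAD eta_homMor (c := (0, 1))
      (fun _ => rfl) fun _ => rfl)
      (cone_pos.curv_eq_zero isAD_Xbim.curv isAD_one11.curv eta_dMor)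
  | .neg => PreAD.isAD (cone_neg.preAD isAD_one11.preAD isAD_Xbim.preAD eps_homMor (c := (-1, 0))
      (fun _ => rfl) fun x => by
        change Xbim.deg x + (0, 1) = Xbim.deg x + (-1, 0) + (0, 1) - (-1, 0)
        abel)
      (cone_neg.curv_eq_zero isAD_one11.curv isAD_Xbim.curv eps_dMor)

lemma birthC_pos : birthC .pos = cone_pos.inT := by
  funext y x l
  rcases y with y | y
  · exact congrFun (cone_pos.inT_t y x).symm l
  · exact (cone_pos.inT_i y x l).symm

lemma birthC_neg : birthC .neg = 0 := rfl

lemma deathC_neg : deathC .neg = cone_neg.prI := by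
  funext y x l
  rcases x with x | x
  · exact congrFun (cone_neg.prI_i y x).symm l
  · exact (cone_neg.prI_t y x l).symm

lemma deathC_pos : deathC .pos = 0 := rfl

/-! ### The cancelling pair -/

lemma XX_sum {α : Coch Xbim (Xbim.box Xbim)} {β : Coch (Xbim.box Xbim) Xbim} (hα : BiC α)
    (hβ : BiC β) (h1 : compC mergeC α = idC Xbim) (h2 : compC β splitC = idC Xbim)
    (h : compC isCone_XX.prI α + compC β isCone_XX.inT = compC epsC etaC) :
    compC α mergeC + compC splitC β = compC cupC capC + idC (Xbim.box Xbim) := by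
  have hm : BiC mergeC := merge_homMor.1.biC
  have e1 : compC α mergeC = compC (compC isCone_XX.inI isCone_XX.prI +
      compC isCone_XX.inT isCone_XX.prT) (compC α mergeC) := by
    rw [isCone_XX.sum_in_pr, idC_compC (hα.compC hm)]
  have e2 : compC splitC β = compC (compC splitC β) (compC isCone_XX.inI isCone_XX.prI +
      compC isCone_XX.inT isCone_XX.prT) := by
    rw [isCone_XX.sum_in_pr, compC_idC (split_homMor.1.biC.compC hβ)]
  rw [e1, e2, cupC, capC, compC_assoc splitC epsC, ← compC_assoc epsC, ← h, ← isCone_XX.sum_in_pr]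
  rw [splitC_inI] at h2 ⊢
  rw [mergeC_prT] at h1 ⊢
  simp only [add_compC, compC_add, compC_assoc]
  rw [← compC_assoc isCone_XX.prT α, h1, idC_compC isCone_XX.biC_prT,
    ← compC_assoc β, h2, idC_compC isCone_XX.biC_prI]
  abel

/-- `α` and `β` are closed and mutually inverse up to homotopy. -/
structure IsCancelling {A : DGCat} {I Q : ADRaw A A} (α : Coch I Q) (β : Coch Q I) : Prop where
  create : dMor I Q α = 0
  annih : dMor Q I β = 0
  annih_create : compC β α = idC I
  create_annih : ∃ H ∈ mor Q Q, dMor Q Q H = compC α β + idC Q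

section Reidemeister

variable {S U T Q : ADRaw A11 A11} {b : Coch S U} {a : Coch S (Xbim.box Xbim)} {e : Coch U T}
  {c : Coch (Xbim.box Xbim) T} {is : Coch S Q} {iu : Coch U Q} {iv : Coch (Xbim.box Xbim) Q}
  {it : Coch T Q} {ps : Coch Q S} {pu : Coch Q U} {pv : Coch Q (Xbim.box Xbim)} {pt : Coch Q T}
  {s : Coch S Xbim} {s' : Coch Xbim S} {t : Coch T Xbim} {t' : Coch Xbim T} {ι : Coch one11 U}
  {ι' : Coch U one11}

/-- A square whose corner maps are `η` and `ε'` up to isomorphism represents a cancelling pair. -/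
lemma IsSquare.cancelling (h : IsSquare b a e c is iu iv it ps pu pv pt)
    (hs's : compC s' s = idC S) (hss' : compC s s' = idC Xbim) (htt' : compC t t' = idC Xbim)
    (ht't : compC t' t = idC T) (hι : compC ι' ι = idC one11) (hι' : compC ι ι' = idC U)
    (hb : b = compC ι (compC etaC s)) (he : e = compC t' (compC epsC ι'))
    (ha : compC mergeC a = s) (hc : compC c splitC = t')
    (hV : compC isCone_XX.prI (compC a s') + compC (compC t c) isCone_XX.inT = compC epsC etaC)
    (ds : dMor _ _ s' = 0) (dt : dMor _ _ t = 0) (dι : dMor _ _ ι = 0) (dι' : dMor _ _ ι' = 0)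
    (ms : s' ∈ mor Xbim S) (mt : t ∈ mor T Xbim) (mι : ι ∈ mor one11 U) (mι' : ι' ∈ mor U one11)
    (bs : BiC s) (bt : BiC t') (hba : BiC a) (hbc : BiC c)
    (hs : ps ∈ mor Q S) (hu : pu ∈ mor Q U) (hv : pv ∈ mor Q (Xbim.box Xbim)) (ht : pt ∈ mor Q T)
    (js : is ∈ mor S Q) (jv : iv ∈ mor (Xbim.box Xbim) Q) :
    IsCancelling (compC iu ι + compC iv cupC) (compC ι' pu + compC capC pv) := by
  have bι := biC_of_mor mι
  have bι' := biC_of_mor mι'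
  have hma : compC (compC s' mergeC) a = idC S := by rw [compC_assoc, ha, hs's]
  have hcp : compC c (compC splitC t) = idC T := by rw [← compC_assoc, hc, ht't]
  have hbm : compC b (compC s' mergeC) = compC ι capC := by
    rw [hb, compC_assoc, compC_assoc etaC, ← compC_assoc s, hss', idC_compC merge_homMor.1.biC]; rfl
  have hpe : compC (compC splitC t) e = compC cupC ι' := by
    rw [he, compC_assoc, ← compC_assoc t, htt', idC_compC (biC_eps.compC bι'), ← compC_assoc]; rfl
  have hm : mergeC ∈ mor _ _ := homMor_le_mor merge_homMor
  have hp : splitC ∈ mor _ _ := homMor_le_mor split_homMor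
  have hcup : cupC ∈ mor _ _ := homMor_le_mor cup_homMor
  have hcap : capC ∈ mor _ _ := homMor_le_mor cap_homMor
  have bcup := biC_of_mor hcup
  have bcap := biC_of_mor hcap
  have dm : dMor _ _ (compC s' mergeC) = 0 := by
    rw [dMor_compC, ds, merge_dMor, zero_compC, compC_zero, add_zero]
  have dp : dMor _ _ (compC splitC t) = 0 := by
    rw [dMor_compC, dt, split_dMor, zero_compC, compC_zero, add_zero]
  have be : BiC e := he ▸ bt.compC (biC_eps.compC bι')
  have bb : BiC b := hb ▸ bι.compC (biC_eta.compC bs)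
  refine ⟨h.create_closed dι cup_dMor hcp ?_ (be.compC bι),
    h.annih_closed dι' cap_dMor hma ?_ (bι'.compC bb), h.annih_create hι cap_cup bι bcup, _,
    add_mem (mor_compC js (mor_compC (mor_compC ms hm) hv))
      (mor_compC jv (mor_compC (mor_compC hp mt) ht)),
    h.create_annih dm dp hma hcp hι' hbm hpe ?_ (biC_of_mor hs) (biC_of_mor hu) (biC_of_mor hv)
      (biC_of_mor ht)⟩
  · rw [← compC_assoc, hpe, compC_assoc, hι, compC_idC bcup]
  · rw [compC_assoc, hbm, ← compC_assoc, hι, idC_compC bcap]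
  · rw [← compC_assoc, compC_assoc splitC]
    refine XX_sum (hba.compC (biC_of_mor ms)) ((biC_of_mor mt).compC hbc) ?_ ?_ hV
    · rw [← compC_assoc, ha, hss']
    · rw [compC_assoc, hc, htt']

end Reidemeister

lemma Coch.add_apply {A B : DGCat} {M N : ADRaw B A} (f g : Coch M N) (y x l) : (f + g) y x l = f y
    x l + g y x l := rfl

/-! ### Degrees of the summands of a product of cones -/

section Degrees

variable {A B C : DGCat} {N N' P : ADRaw C B} {f : Coch N N'} {i : N.G → P.G} {i' : N'.G → P.G}
  {M M' R : ADRaw B A} {g : Coch M M'} {k : M.G → R.G} {k' : M'.G → R.G} {p p' q q' : ℤ × ℤ}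

lemma IsCone.boxRight_deg_i (hP : IsCone f i i') (hd : ∀ x, P.deg (i x) = p + N.deg x) (x) :
    (P.box R).deg ⟨(i x.1.1, x.1.2), (hP.r_i _).trans x.2⟩ = p + (N.box R).deg x :=
  (congrArg (· + R.deg x.1.2) (hd x.1.1)).trans (add_assoc _ _ _)

lemma IsCone.boxRight_deg_t (hP : IsCone f i i') (hd : ∀ x, P.deg (i' x) = p + N'.deg x) (x) :
    (P.box R).deg ⟨(i' x.1.1, x.1.2), (hP.r_t _).trans x.2⟩ = p + (N'.box R).deg x :=
  (congrArg (· + R.deg x.1.2) (hd x.1.1)).trans (add_assoc _ _ _)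

lemma IsCone.boxLeft_deg_i (hR : IsCone g k k') (hd : ∀ x, R.deg (k x) = q + M.deg x) (x) : (N.box
    R).deg ⟨(x.1.1, k x.1.2), x.2.trans (hR.l_i _).symm⟩ = q + (N.box M).deg x :=
  (congrArg (N.deg x.1.1 + ·) (hd x.1.2)).trans (add_left_comm _ _ _)

lemma IsCone.boxLeft_deg_t (hR : IsCone g k k') (hd : ∀ x, R.deg (k' x) = q + M'.deg x) (x) :
    (N.box R).deg ⟨(x.1.1, k' x.1.2), x.2.trans (hR.l_t _).symm⟩ = q + (N.box M').deg x :=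
  (congrArg (N.deg x.1.1 + ·) (hd x.1.2)).trans (add_left_comm _ _ _)

lemma IsCone.mor (h : IsCone f i i') (hi : ∀ x, P.deg (i x) = p + N.deg x)
    (ht : ∀ x, P.deg (i' x) = q + N'.deg x) : h.inI ∈ BraidAD.mor _ _ ∧ h.inT ∈ BraidAD.mor _ _ ∧
    h.prI ∈ BraidAD.mor _ _ ∧ h.prT ∈ BraidAD.mor _ _ :=
  ⟨homMor_le_mor (h.inI_homMor hi), homMor_le_mor (h.inT_homMor ht),
    homMor_le_mor (h.prI_homMor hi), homMor_le_mor (h.prT_homMor ht)⟩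

end Degrees

lemma pos_deg_i (x) : (crossRaw .pos).deg (Sum.inr x) = (0, 1) + Xbim.deg x :=
  add_comm _ _

lemma pos_deg_t (x) : (crossRaw .pos).deg (Sum.inl x) = (1, 0) + one11.deg x :=
  (add_zero _).symm

lemma neg_deg_i (x) : (crossRaw .neg).deg (Sum.inl x) = (-1, 0) + one11.deg x :=
  (add_zero _).symm

lemma neg_deg_t (x) : (crossRaw .neg).deg (Sum.inr x) = (0, 1) + Xbim.deg x :=
  add_comm _ _

/-- A product of crossings, the first of which is positive, as a cone. -/
lemma cone_pos_box (c : Crossing) : IsCone (Q := (crossRaw .pos).box (crossRaw c))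
    (boxId etaC (crossRaw c))
    (fun x : (Xbim.box (crossRaw c)).G => ⟨(Sum.inr x.1.1, x.1.2), (cone_pos.r_i _).trans x.2⟩)
    (fun x : (one11.box (crossRaw c)).G =>
      ⟨(Sum.inl x.1.1, x.1.2), (cone_pos.r_t _).trans x.2⟩) :=
  cone_pos.boxRight (isAD_cross c).cochain.biC.multiAdd

/-- A product of crossings, the first of which is negative, as a cone. -/
lemma cone_neg_box (c : Crossing) : IsCone (Q := (crossRaw .neg).box (crossRaw c))
    (boxId epsC (crossRaw c))
    (fun x : (one11.box (crossRaw c)).G => ⟨(Sum.inl x.1.1, x.1.2), (cone_neg.r_i _).trans x.2⟩)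
    (fun x : (Xbim.box (crossRaw c)).G =>
      ⟨(Sum.inr x.1.1, x.1.2), (cone_neg.r_t _).trans x.2⟩) :=
  cone_neg.boxRight (isAD_cross c).cochain.biC.multiAdd

lemma biC_boxOneInv_one : BiC (boxOneInv one11) := (boxOneInv_homMor isAD_one11).1.biC

lemma biC_boxOneHom_one : BiC (boxOneHom one11) := (boxOneHom_homMor isAD_one11).1.biC

lemma biC_cup : BiC cupC := cup_homMor.1.biC

lemma biC_cap : BiC capC := cap_homMor.1.biC

lemma createC_pos : (show Coch one11 ((crossRaw .pos).box (crossRaw .neg)) from createC .pos) =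
    compC (compC (cone_pos_box .neg).inT (cone_neg.boxLeft one11).inI) (boxOneInv one11) +
    compC (compC (cone_pos_box .neg).inI (cone_neg.boxLeft Xbim).inT) cupC := by
  have h1 := (cone_neg.boxLeft one11).biC_inI.compC biC_boxOneInv_one
  have h2 := (cone_neg.boxLeft Xbim).biC_inT.compC biC_cup
  funext y x l
  rw [compC_assoc, compC_assoc]
  refine Eq.trans ?_ (Coch.add_apply _ _ y x l).symm
  induction y using (cone_pos_box .neg).cases with
  | h1 y =>
    rw [(cone_pos_box .neg).inT_comp_i, (cone_pos_box .neg).inI_comp_i h2, zero_add]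
    induction y using (cone_neg.boxLeft Xbim).cases with
    | h1 y => exact ((cone_neg.boxLeft Xbim).inT_comp_i _ y x l).symm
    | h2 y => exact ((cone_neg.boxLeft Xbim).inT_comp_t biC_cup y x l).symm
  | h2 y =>
    rw [(cone_pos_box .neg).inI_comp_t, (cone_pos_box .neg).inT_comp_t h1, add_zero]
    induction y using (cone_neg.boxLeft one11).cases with
    | h1 y =>
      refine Eq.trans ?_ ((cone_neg.boxLeft one11).inI_comp_i biC_boxOneInv_one y x l).symm
      exact relabel_congr' (M := one11) (N := one11) (M' := one11) (N' := one11.box one11)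
        (φ := fun y x => y = x) Iff.rfl y.2 l
    | h2 y => exact ((cone_neg.boxLeft one11).inI_comp_t _ y x l).symm

lemma createC_neg : (show Coch one11 ((crossRaw .neg).box (crossRaw .pos)) from createC .neg) =
    compC (compC (cone_neg_box .pos).inI (cone_pos.boxLeft one11).inT) (boxOneInv one11) +
    compC (compC (cone_neg_box .pos).inT (cone_pos.boxLeft Xbim).inI) cupC := by
  have h1 := (cone_pos.boxLeft one11).biC_inT.compC biC_boxOneInv_one
  have h2 := (cone_pos.boxLeft Xbim).biC_inI.compC biC_cup
  funext y x l
  rw [compC_assoc, compC_assoc]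
  refine Eq.trans ?_ (Coch.add_apply _ _ y x l).symm
  induction y using (cone_neg_box .pos).cases with
  | h1 y =>
    rw [(cone_neg_box .pos).inT_comp_i, (cone_neg_box .pos).inI_comp_i h1, add_zero]
    induction y using (cone_pos.boxLeft one11).cases with
    | h1 y => exact ((cone_pos.boxLeft one11).inT_comp_i _ y x l).symm
    | h2 y =>
      refine Eq.trans ?_ ((cone_pos.boxLeft one11).inT_comp_t biC_boxOneInv_one y x l).symm
      exact relabel_congr' (M := one11) (N := one11) (M' := one11) (N' := one11.box one11)
        (φ := fun y x => y = x) Iff.rfl y.2 l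
  | h2 y =>
    rw [(cone_neg_box .pos).inI_comp_t, (cone_neg_box .pos).inT_comp_t h2, zero_add]
    induction y using (cone_pos.boxLeft Xbim).cases with
    | h1 y => exact ((cone_pos.boxLeft Xbim).inI_comp_i biC_cup y x l).symm
    | h2 y => exact ((cone_pos.boxLeft Xbim).inI_comp_t _ y x l).symm

lemma annihC_pos : (show Coch ((crossRaw .pos).box (crossRaw .neg)) one11 from annihC .pos) =
    compC (boxOneHom one11) (compC (cone_neg.boxLeft one11).prI (cone_pos_box .neg).prT) +
    compC capC (compC (cone_neg.boxLeft Xbim).prT (cone_pos_box .neg).prI) := by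
  have h1 := biC_boxOneHom_one.compC (cone_neg.boxLeft one11).biC_prI
  have h2 := biC_cap.compC (cone_neg.boxLeft Xbim).biC_prT
  funext y x l
  rw [← compC_assoc, ← compC_assoc]
  refine Eq.trans ?_ (Coch.add_apply _ _ y x l).symm
  induction x using (cone_pos_box .neg).cases with
  | h1 x =>
    rw [(cone_pos_box .neg).comp_prT_i, (cone_pos_box .neg).comp_prI_i h2, zero_add]
    induction x using (cone_neg.boxLeft Xbim).cases with
    | h1 x => exact ((cone_neg.boxLeft Xbim).comp_prT_i _ y x l).symm
    | h2 x => exact ((cone_neg.boxLeft Xbim).comp_prT_t biC_cap y x l).symm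
  | h2 x =>
    rw [(cone_pos_box .neg).comp_prI_t, (cone_pos_box .neg).comp_prT_t h1, add_zero]
    induction x using (cone_neg.boxLeft one11).cases with
    | h1 x => exact ((cone_neg.boxLeft one11).comp_prI_i biC_boxOneHom_one y x l).symm
    | h2 x => exact ((cone_neg.boxLeft one11).comp_prI_t _ y x l).symm

lemma annihC_neg : (show Coch ((crossRaw .neg).box (crossRaw .pos)) one11 from annihC .neg) =
    compC (boxOneHom one11) (compC (cone_pos.boxLeft one11).prT (cone_neg_box .pos).prI) +
    compC capC (compC (cone_pos.boxLeft Xbim).prI (cone_neg_box .pos).prT) := by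
  have h1 := biC_boxOneHom_one.compC (cone_pos.boxLeft one11).biC_prT
  have h2 := biC_cap.compC (cone_pos.boxLeft Xbim).biC_prI
  funext y x l
  rw [← compC_assoc, ← compC_assoc]
  refine Eq.trans ?_ (Coch.add_apply _ _ y x l).symm
  induction x using (cone_neg_box .pos).cases with
  | h1 x =>
    rw [(cone_neg_box .pos).comp_prT_i, (cone_neg_box .pos).comp_prI_i h1, add_zero]
    induction x using (cone_pos.boxLeft one11).cases with
    | h1 x => exact ((cone_pos.boxLeft one11).comp_prT_i _ y x l).symm
    | h2 x => exact ((cone_pos.boxLeft one11).comp_prT_t biC_boxOneHom_one y x l).symm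
  | h2 x =>
    rw [(cone_neg_box .pos).comp_prI_t, (cone_neg_box .pos).comp_prT_t h2, zero_add]
    induction x using (cone_pos.boxLeft Xbim).cases with
    | h1 x => exact ((cone_pos.boxLeft Xbim).comp_prI_i biC_cap y x l).symm
    | h2 x => exact ((cone_pos.boxLeft Xbim).comp_prI_t _ y x l).symm

lemma create_homMor : ∀ c, createC c ∈ homMor one11 ((crossRaw c).box (crossRaw c.inv)) 0
  | .pos => by
    refine Set.mem_of_eq_of_mem createC_pos ?_
    exact add_mem (homMor_compC (homMor_compC
        ((cone_pos_box .neg).inT_homMor (cone_pos.boxRight_deg_t pos_deg_t))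
        ((cone_neg.boxLeft one11).inI_homMor (cone_neg.boxLeft_deg_i neg_deg_i)))
        (boxOneInv_homMor isAD_one11))
      (homMor_compC (homMor_compC
        ((cone_pos_box .neg).inI_homMor (cone_pos.boxRight_deg_i pos_deg_i))
        ((cone_neg.boxLeft Xbim).inT_homMor (cone_neg.boxLeft_deg_t neg_deg_t))) cup_homMor)
  | .neg => by
    refine Set.mem_of_eq_of_mem createC_neg ?_
    exact add_mem (homMor_compC (homMor_compC
        ((cone_neg_box .pos).inI_homMor (cone_neg.boxRight_deg_i neg_deg_i))
        ((cone_pos.boxLeft one11).inT_homMor (cone_pos.boxLeft_deg_t pos_deg_t)))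
        (boxOneInv_homMor isAD_one11))
      (homMor_compC (homMor_compC
        ((cone_neg_box .pos).inT_homMor (cone_neg.boxRight_deg_t neg_deg_t))
        ((cone_pos.boxLeft Xbim).inI_homMor (cone_pos.boxLeft_deg_i pos_deg_i))) cup_homMor)

lemma annih_homMor : ∀ c, annihC c ∈ homMor ((crossRaw c).box (crossRaw c.inv)) one11 0
  | .pos => by
    refine Set.mem_of_eq_of_mem annihC_pos ?_
    exact add_mem (homMor_compC (boxOneHom_homMor isAD_one11) (homMor_compC
        ((cone_neg.boxLeft one11).prI_homMor (cone_neg.boxLeft_deg_i neg_deg_i))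
        ((cone_pos_box .neg).prT_homMor (cone_pos.boxRight_deg_t pos_deg_t))))
      (homMor_compC cap_homMor (homMor_compC
        ((cone_neg.boxLeft Xbim).prT_homMor (cone_neg.boxLeft_deg_t neg_deg_t))
        ((cone_pos_box .neg).prI_homMor (cone_pos.boxRight_deg_i pos_deg_i))))
  | .neg => by
    refine Set.mem_of_eq_of_mem annihC_neg ?_
    exact add_mem (homMor_compC (boxOneHom_homMor isAD_one11) (homMor_compC
        ((cone_pos.boxLeft one11).prT_homMor (cone_pos.boxLeft_deg_t pos_deg_t))
        ((cone_neg_box .pos).prI_homMor (cone_neg.boxRight_deg_i neg_deg_i))))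
      (homMor_compC cap_homMor (homMor_compC
        ((cone_pos.boxLeft Xbim).prI_homMor (cone_pos.boxLeft_deg_i pos_deg_i))
        ((cone_neg_box .pos).prT_homMor (cone_neg.boxRight_deg_t neg_deg_t))))

/-- The two Reidemeister 2 movies are closed and mutually inverse up to homotopy. -/
lemma cancelling : ∀ c, IsCancelling (createC c) (annihC c)
  | .pos => by
    obtain ⟨a1, a2, a3, a4⟩ := (cone_neg.boxLeft one11).mor (cone_neg.boxLeft_deg_i neg_deg_i)
      (cone_neg.boxLeft_deg_t neg_deg_t)
    obtain ⟨c1, c2, c3, c4⟩ := (cone_neg.boxLeft Xbim).mor (cone_neg.boxLeft_deg_i neg_deg_i)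
      (cone_neg.boxLeft_deg_t neg_deg_t)
    obtain ⟨b1, b2, b3, b4⟩ := (cone_pos_box .neg).mor (cone_pos.boxRight_deg_i pos_deg_i)
      (cone_pos.boxRight_deg_t pos_deg_t)
    have sq := cone_pos.square cone_neg isAD_Xbim isAD_one11 isAD_one11 isAD_Xbim (isAD_cross .neg)
      eta_closed eps_closed (exBox_eps fun _ _ _ => (eta_coeff _ _ _).1) (cone_pos_box .neg)
    have hV : compC isCone_XX.prI (compC (idBox Xbim epsC) (boxOneInv Xbim)) +
        compC (compC (oneBoxHom Xbim) (boxId etaC Xbim)) isCone_XX.inT = compC epsC etaC := by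
      funext y x l
      refine Eq.trans ?_ (eps_comp_eta_left y x l).symm
      rw [add_comm, Pi.add_apply, Pi.add_apply, Pi.add_apply, isCone_XX.comp_inT
        ((oneBoxHom_homMor isAD_Xbim).1.biC.compC biC_boxId_eta), isCone_XX.prI_comp
        (biC_idBox_eps.compC (boxOneInv_homMor isAD_Xbim).1.biC)]
      exact congrArg₂ (· + ·) ((oneBoxIso isAD_Xbim).compC_left (fun _ _ => Iff.rfl)
        biC_boxId_eta _ _ l) ((boxOneIso isAD_Xbim).symm.compC_right boxOneInv_iff biC_idBox_eps
          _ _ l)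
    have key := sq.cancelling (boxOneInv_hom isAD_Xbim) (boxOneHom_inv isAD_Xbim)
      (oneBoxHom_inv isAD_Xbim) (oneBoxInv_hom isAD_Xbim) (boxOneHom_inv isAD_one11)
      (boxOneInv_hom isAD_one11) (boxId_one_eq isAD_Xbim isAD_one11 biC_eta)
      ((idBox_one_eq isAD_one11 isAD_Xbim biC_eps).trans (by rw [oneBoxHom_one])) merge_idBox_eps
      boxId_eta_split hV (boxOneInv_dMor isAD_Xbim) (oneBoxHom_dMor isAD_Xbim)
      (boxOneInv_dMor isAD_one11) (boxOneHom_dMor isAD_one11)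
      (homMor_le_mor (boxOneInv_homMor isAD_Xbim)) (homMor_le_mor (oneBoxHom_homMor isAD_Xbim))
      (homMor_le_mor (boxOneInv_homMor isAD_one11)) (homMor_le_mor (boxOneHom_homMor isAD_one11))
      (boxOneHom_homMor isAD_Xbim).1.biC (oneBoxInv_homMor isAD_Xbim).1.biC biC_idBox_eps
      biC_boxId_eta
      (mor_compC c3 b3)
      (mor_compC a3 b4)
      (mor_compC c4 b3)
      (mor_compC a4 b4)
      (mor_compC b1 c1)
      (mor_compC b1 c2)
    rw [← createC_pos, ← annihC_pos] at key
    exact key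
  | .neg => by
    obtain ⟨a1, a2, a3, a4⟩ := (cone_pos.boxLeft one11).mor (cone_pos.boxLeft_deg_i pos_deg_i)
      (cone_pos.boxLeft_deg_t pos_deg_t)
    obtain ⟨c1, c2, c3, c4⟩ := (cone_pos.boxLeft Xbim).mor (cone_pos.boxLeft_deg_i pos_deg_i)
      (cone_pos.boxLeft_deg_t pos_deg_t)
    obtain ⟨b1, b2, b3, b4⟩ := (cone_neg_box .pos).mor (cone_neg.boxRight_deg_i neg_deg_i)
      (cone_neg.boxRight_deg_t neg_deg_t)
    have sq := (cone_neg.square cone_pos isAD_one11 isAD_Xbim isAD_Xbim isAD_one11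
      (isAD_cross .pos) eps_closed eta_closed (exBox_eta fun _ _ _ => (eps_coeff _ _ _).1)
        (cone_neg_box .pos)).swap
    have hV : compC isCone_XX.prI (compC (boxId epsC Xbim) (oneBoxInv Xbim)) +
        compC (compC (boxOneHom Xbim) (idBox Xbim etaC)) isCone_XX.inT = compC epsC etaC := by
      funext y x l
      refine Eq.trans ?_ (eps_comp_eta_right y x l).symm
      rw [Pi.add_apply, Pi.add_apply, Pi.add_apply, isCone_XX.comp_inT
        ((boxOneHom_homMor isAD_Xbim).1.biC.compC biC_idBox_eta), isCone_XX.prI_comp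
        (biC_boxId_eps.compC (oneBoxInv_homMor isAD_Xbim).1.biC)]
      exact congrArg₂ (· + ·) ((oneBoxIso isAD_Xbim).symm.compC_right oneBoxInv_iff biC_boxId_eps
          _ _ l) ((boxOneIso isAD_Xbim).compC_left (fun _ _ => Iff.rfl) biC_idBox_eta _ _ l)
    have key := sq.cancelling (oneBoxInv_hom isAD_Xbim) (oneBoxHom_inv isAD_Xbim)
      (boxOneHom_inv isAD_Xbim) (boxOneInv_hom isAD_Xbim) (boxOneHom_inv isAD_one11)
      (boxOneInv_hom isAD_one11)
      ((idBox_one_eq isAD_Xbim isAD_one11 biC_eta).trans (by rw [oneBoxInv_one]))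
      (boxId_one_eq isAD_one11 isAD_Xbim biC_eps) merge_boxId_eps
      idBox_eta_split hV (oneBoxInv_dMor isAD_Xbim) (boxOneHom_dMor isAD_Xbim)
      (boxOneInv_dMor isAD_one11) (boxOneHom_dMor isAD_one11)
      (homMor_le_mor (oneBoxInv_homMor isAD_Xbim)) (homMor_le_mor (boxOneHom_homMor isAD_Xbim))
      (homMor_le_mor (boxOneInv_homMor isAD_one11)) (homMor_le_mor (boxOneHom_homMor isAD_one11))
      (oneBoxHom_homMor isAD_Xbim).1.biC (boxOneInv_homMor isAD_Xbim).1.biC biC_boxId_eps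
      biC_idBox_eta
      (mor_compC a3 b3)
      (mor_compC a4 b3)
      (mor_compC c3 b4)
      (mor_compC c4 b4)
      (mor_compC b1 a1)
      (mor_compC b2 c1)
    rw [← createC_neg, ← annihC_neg] at key
    exact key

lemma birth_homMor : ∀ c, birthC c ∈ homMor one11 (crossRaw c) (MovieGen.birth c).deg
  | .pos => by rw [birthC_pos]; exact cone_pos.inT_homMor pos_deg_t
  | .neg => zero_mem _

lemma death_homMor : ∀ c, deathC c ∈ homMor (crossRaw c) one11 (MovieGen.death c).deg
  | .pos => zero_mem _
  | .neg => by rw [deathC_neg]; exact cone_neg.prI_homMor neg_deg_i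

lemma birth_dMor : ∀ c, dMor _ _ (birthC c) = 0
  | .pos => by rw [birthC_pos]; exact cone_pos.dMor_inT isAD_one11.cochain.biC
  | .neg => map_zero _

lemma death_dMor : ∀ c, dMor _ _ (deathC c) = 0
  | .pos => map_zero _
  | .neg => by rw [deathC_neg]; exact cone_neg.dMor_prI isAD_one11.cochain.biC

lemma crossingLaws : CrossingLaws where
  isAD := isAD_cross
  birth_closed c := mem_closed (homMor_le_mor (birth_homMor c)) (birth_dMor c)
  death_closed c := mem_closed (homMor_le_mor (death_homMor c)) (death_dMor c)
  create_closed c := mem_closed (homMor_le_mor (create_homMor c)) (cancelling c).create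
  annih_closed c := mem_closed (homMor_le_mor (annih_homMor c)) (cancelling c).annih
  birth_homog := birth_homMor
  death_homog := death_homMor
  create_homog := create_homMor
  annih_homog := annih_homMor
  eta_closed := eta_closed
  eta_homog := eta_homMor
  eps_closed := eps_closed
  eps_homog := eps_homMor

/-! ### Births and deaths next to cancelling pairs -/

section Relabel

variable {A B : DGCat} {M N K : ADRaw B A}

lemma compC_relabel_of {g : Coch N K} (hg : BiC g) {φ : N.G → M.G → Prop} {t : M.G → N.G} (hφ : ∀
    y x, φ y x ↔ y = t x) (z x l) : compC g (relabel φ) z x l = g z (t x) l := by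
  rw [compC_relabel g hφ, hg.out_right]

lemma relabel_compC_of {f : Coch M N} (hf : BiC f) {φ : K.G → N.G → Prop} {s : K.G → N.G} (hφ : ∀
    z y, φ z y ↔ y = s z) (hr : ∀ z, N.r (s z) = K.r z) (z x l) : compC (relabel φ : Coch N K) f z x
    l = f (s z) x l := by
  rw [relabel_compC f hφ, ← hr, hf.out_left]

end Relabel

/-- Insertion of an element of the identity summand of a crossing on the right. -/
def inlRight (c d : Crossing) (y : ((crossRaw c).box one11).G) :
    ((crossRaw c).box (crossRaw d)).G := ⟨(y.1.1, Sum.inl y.1.2), y.2⟩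

/-- Insertion of an element of the identity summand of a crossing on the left. -/
def inlLeft (c d : Crossing) (y : (one11.box (crossRaw d)).G) :
    ((crossRaw c).box (crossRaw d)).G := ⟨(Sum.inl y.1.1, y.1.2), y.2⟩

lemma idBox_death (c : Crossing) : idBox (crossRaw c) (deathC .neg) =
    relabel fun y x => x = inlRight c .neg y := by
  rw [deathC_neg]
  exact (idBox_relabel _ _).trans (relabel_congr fun y x =>
    ⟨fun h => box_ext h.1.symm h.2, fun h => by subst h; exact ⟨rfl, rfl⟩⟩)

lemma boxId_death (c : Crossing) : boxId (deathC .neg) (crossRaw c) =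
    relabel fun y x => x = inlLeft .neg c y := by
  rw [deathC_neg]
  exact (boxId_relabel (isAD_cross c).preAD _ fun y x e => by rw [e]; rfl).trans
    (relabel_congr fun y x =>
      ⟨fun h => box_ext h.1 h.2.symm, fun h => by subst h; exact ⟨rfl, rfl⟩⟩)

lemma idBox_birth (c : Crossing) : idBox (crossRaw c) (birthC .pos) =
    relabel fun y x => y = inlRight c .pos x := by
  rw [birthC_pos]
  exact (idBox_relabel _ _).trans (relabel_congr fun y x =>
    ⟨fun h => box_ext h.1 h.2, fun h => by subst h; exact ⟨rfl, rfl⟩⟩)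

lemma boxId_birth (c : Crossing) : boxId (birthC .pos) (crossRaw c) =
    relabel fun y x => y = inlLeft .pos c x := by
  rw [birthC_pos]
  exact (boxId_relabel (isAD_cross c).preAD _ fun y x e => by rw [e]; rfl).trans
    (relabel_congr fun y x =>
      ⟨fun h => box_ext h.1 h.2, fun h => by subst h; exact ⟨rfl, rfl⟩⟩)

lemma biC_createC (c : Crossing) : BiC (createC c) := (create_homMor c).1.biC

lemma biC_annihC (c : Crossing) : BiC (annihC c) := (annih_homMor c).1.biC

lemma biC_boxId_death (c : Crossing) : BiC (boxId (deathC .neg) (crossRaw c)) :=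
  (homMor_boxId (isAD_cross _).preAD isAD_one11.preAD (isAD_cross c).preAD
    (death_homMor .neg)).1.biC

lemma biC_idBox_death (c : Crossing) : BiC (idBox (crossRaw c) (deathC .neg)) :=
  (homMor_idBox (isAD_cross c).preAD (death_homMor .neg)).1.biC

lemma biC_boxId_birth (c : Crossing) : BiC (boxId (birthC .pos) (crossRaw c)) :=
  (homMor_boxId isAD_one11.preAD (isAD_cross _).preAD (isAD_cross c).preAD
    (birth_homMor .pos)).1.biC

lemma biC_idBox_birth (c : Crossing) : BiC (idBox (crossRaw c) (birthC .pos)) :=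
  (homMor_idBox (isAD_cross c).preAD (birth_homMor .pos)).1.biC

lemma create_death_left_neg : compC (oneBoxHom (crossRaw .pos))
    (compC (boxId (deathC .neg) (crossRaw .pos)) (createC .neg)) = birthC .pos := by
  have h : BiC (N := (crossRaw .neg).box (crossRaw .pos)) (createC .neg) := biC_createC .neg
  funext y x l
  refine ((oneBoxIso (isAD_cross .pos)).compC_left (fun _ _ => Iff.rfl)
    ((biC_boxId_death .pos).compC h) y x l).trans ?_
  rw [boxId_death]
  refine (relabel_compC_of h (fun _ _ => Iff.rfl) (fun _ => rfl) _ x l).trans ?_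
  rcases y with y | y <;> rfl

lemma create_death_left : ∀ c, compC (oneBoxHom (crossRaw c.inv))
    (compC (boxId (deathC c) (crossRaw c.inv)) (createC c)) = birthC c.inv
  | .pos => by
    rw [deathC_pos, boxId_zero (isAD_cross _), zero_compC, compC_zero]
    exact birthC_neg.symm
  | .neg => create_death_left_neg

lemma create_death_right_pos : compC (boxOneHom (crossRaw .pos))
    (compC (idBox (crossRaw .pos) (deathC .neg)) (createC .pos)) = birthC .pos := by
  have h : BiC (N := (crossRaw .pos).box (crossRaw .neg)) (createC .pos) := biC_createC .pos
  funext y x l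
  refine ((boxOneIso (isAD_cross .pos)).compC_left (fun _ _ => Iff.rfl)
    ((biC_idBox_death .pos).compC h) y x l).trans ?_
  rw [idBox_death]
  refine (relabel_compC_of h (fun _ _ => Iff.rfl) (fun _ => rfl) _ x l).trans ?_
  rcases y with y | y <;> rfl

lemma create_death_right : ∀ c, compC (boxOneHom (crossRaw c))
    (compC (idBox (crossRaw c) (deathC c.inv)) (createC c)) = birthC c
  | .pos => create_death_right_pos
  | .neg => by
    have h : compC (idBox (crossRaw .neg) (deathC .pos)) (createC .neg) = 0 := by
      rw [deathC_pos, idBox_zero]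
      exact zero_compC _
    exact (congrArg (compC _) h).trans (compC_zero _)

lemma birth_annih_right_neg : compC (annihC .neg)
    (compC (idBox (crossRaw .neg) (birthC .pos)) (boxOneInv (crossRaw .neg))) = deathC .neg := by
  have h : BiC (M := (crossRaw .neg).box (crossRaw .pos)) (annihC .neg) := biC_annihC .neg
  funext y x l
  refine congrFun (congrFun (congrFun (compC_assoc _ _ _).symm y) x) l |>.trans ?_
  refine ((boxOneIso (isAD_cross .neg)).symm.compC_right boxOneInv_iff
    (h.compC (biC_idBox_birth .neg)) y x l).trans ?_
  rw [idBox_birth]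
  refine (compC_relabel_of h (fun _ _ => Iff.rfl) y _ l).trans ?_
  rcases x with x | x <;> rfl

lemma birth_annih_right : ∀ c, compC (annihC c)
    (compC (idBox (crossRaw c) (birthC c.inv)) (boxOneInv (crossRaw c))) = deathC c
  | .pos => by
    have h : compC (idBox (crossRaw .pos) (birthC .neg)) (boxOneInv (crossRaw .pos)) = 0 := by
      rw [birthC_neg, idBox_zero, zero_compC]
    exact (congrArg (compC _) h).trans (compC_zero _)
  | .neg => birth_annih_right_neg

lemma birth_annih_left_pos : compC (annihC .pos)
    (compC (boxId (birthC .pos) (crossRaw .neg)) (oneBoxInv (crossRaw .neg))) = deathC .neg := by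
  have h : BiC (M := (crossRaw .pos).box (crossRaw .neg)) (annihC .pos) := biC_annihC .pos
  funext y x l
  refine congrFun (congrFun (congrFun (compC_assoc _ _ _).symm y) x) l |>.trans ?_
  refine ((oneBoxIso (isAD_cross .neg)).symm.compC_right oneBoxInv_iff
    (h.compC (biC_boxId_birth .neg)) y x l).trans ?_
  rw [boxId_birth]
  refine (compC_relabel_of h (fun _ _ => Iff.rfl) y _ l).trans ?_
  rcases x with x | x <;> rfl

lemma birth_annih_left : ∀ c, compC (annihC c)
    (compC (boxId (birthC c) (crossRaw c.inv)) (oneBoxInv (crossRaw c.inv))) = deathC c.inv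
  | .pos => birth_annih_left_pos
  | .neg => by
    rw [birthC_neg, boxId_zero (isAD_cross _), zero_compC, compC_zero]
    exact deathC_pos.symm

/-! ### Births and deaths next to a crossing of the same sign -/

lemma birth_past : ∀ c, ∃ H ∈ mor (crossRaw c) ((crossRaw c).box (crossRaw c)), dMor _ _ H =
    compC (boxId (birthC c) (crossRaw c)) (oneBoxInv (crossRaw c)) +
      compC (idBox (crossRaw c) (birthC c)) (boxOneInv (crossRaw c))
  | .neg => ⟨0, zero_mem _, by
      rw [map_zero, birthC_neg, idBox_zero, boxId_zero (isAD_cross _), zero_compC, zero_compC,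
        add_zero]⟩
  | .pos => by
    have sq := cone_pos.square cone_pos isAD_Xbim isAD_one11 isAD_Xbim isAD_one11 (isAD_cross .pos)
      eta_closed eta_closed (exBox_eta fun _ _ _ => (eta_coeff _ _ _).1) (cone_pos_box .pos)
    refine ⟨compC (compC (cone_pos_box .pos).inI (cone_pos.boxLeft Xbim).inI)
      (compC splitC cone_pos.prI), ?_, ?_⟩
    · exact mor_compC (mor_compC
        (homMor_le_mor ((cone_pos_box .pos).inI_homMor (cone_pos.boxRight_deg_i pos_deg_i)))
        (homMor_le_mor ((cone_pos.boxLeft _).inI_homMor (cone_pos.boxLeft_deg_i pos_deg_i))))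
        (mor_compC (homMor_le_mor split_homMor) (homMor_le_mor (cone_pos.prI_homMor pos_deg_i)))
    have b1 := (cone_pos_box .pos).biC_inT.compC
      ((cone_pos.boxLeft one11).biC_inI.compC (oneBoxInv_homMor isAD_Xbim).1.biC)
    have b2 := (cone_pos_box .pos).biC_inI.compC
      ((cone_pos.boxLeft Xbim).biC_inT.compC (boxOneInv_homMor isAD_Xbim).1.biC)
    have e : dMor _ _ (compC (compC (cone_pos_box .pos).inI (cone_pos.boxLeft Xbim).inI)
        (compC splitC cone_pos.prI)) =
        compC (compC (cone_pos_box .pos).inT (compC (cone_pos.boxLeft one11).inI (oneBoxInv Xbim)))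
          cone_pos.prI + compC (compC (cone_pos_box .pos).inI
            (compC (cone_pos.boxLeft Xbim).inT (boxOneInv Xbim))) cone_pos.prI := by
      rw [← boxId_eta_split, ← idBox_eta_split, dMor_compC, sq.d_is, dMor_compC, split_dMor,
        cone_pos.dMor_prI isAD_Xbim.cochain.biC]
      simp only [zero_compC, compC_zero, add_zero, add_compC, compC_assoc]
    rw [e, boxId_birth, idBox_birth]
    funext y x l
    refine Eq.trans ?_ (congrArg₂ (· + ·)
      (compC_relabel_of (boxId_birth .pos ▸ biC_boxId_birth .pos) oneBoxInv_iff y x l)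
      (compC_relabel_of (idBox_birth .pos ▸ biC_idBox_birth .pos) boxOneInv_iff y x l)).symm
    refine (Coch.add_apply _ _ y x l).trans ?_
    induction x using cone_pos.cases with
    | h1 x =>
      rw [cone_pos.comp_prI_i b1, cone_pos.comp_prI_i b2]
      rw [← compC_assoc, ← compC_assoc]
      refine congrArg₂ (· + ·)
        ((compC_relabel_of ((cone_pos_box .pos).biC_inT.compC (cone_pos.boxLeft one11).biC_inI)
          oneBoxInv_iff y x l).trans ?_)
        ((compC_relabel_of ((cone_pos_box .pos).biC_inI.compC (cone_pos.boxLeft Xbim).biC_inT)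
          boxOneInv_iff y x l).trans ?_)
      · exact ((cone_pos.boxLeft one11).comp_inI (cone_pos_box .pos).biC_inT y _ l).trans
          (relabel_congr' Iff.rfl rfl l)
      · exact ((cone_pos.boxLeft Xbim).comp_inT (cone_pos_box .pos).biC_inI y _ l).trans
          (relabel_congr' Iff.rfl rfl l)
    | h2 x =>
      rw [cone_pos.comp_prI_t, cone_pos.comp_prI_t, add_zero]
      exact (A11.add_self _).symm

lemma death_past : ∀ c, ∃ H ∈ mor ((crossRaw c).box (crossRaw c)) (crossRaw c), dMor _ _ H =
    compC (oneBoxHom (crossRaw c)) (boxId (deathC c) (crossRaw c)) +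
      compC (boxOneHom (crossRaw c)) (idBox (crossRaw c) (deathC c))
  | .pos => ⟨0, zero_mem _, by
      rw [map_zero, deathC_pos, idBox_zero, boxId_zero (isAD_cross _), compC_zero, compC_zero,
        add_zero]⟩
  | .neg => by
    have sq := cone_neg.square cone_neg isAD_one11 isAD_Xbim isAD_one11 isAD_Xbim (isAD_cross .neg)
      eps_closed eps_closed (exBox_eps fun _ _ _ => (eps_coeff _ _ _).1) (cone_neg_box .neg)
    refine ⟨compC cone_neg.inT (compC mergeC
      (compC (cone_neg.boxLeft Xbim).prT (cone_neg_box .neg).prT)), ?_, ?_⟩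
    · exact mor_compC (homMor_le_mor (cone_neg.inT_homMor neg_deg_t)) (mor_compC
        (homMor_le_mor merge_homMor) (mor_compC
        (homMor_le_mor ((cone_neg.boxLeft _).prT_homMor (cone_neg.boxLeft_deg_t neg_deg_t)))
        (homMor_le_mor ((cone_neg_box .neg).prT_homMor (cone_neg.boxRight_deg_t neg_deg_t)))))
    have b1 := ((boxOneHom_homMor isAD_Xbim).1.biC.compC (cone_neg.boxLeft Xbim).biC_prI).compC
      (cone_neg_box .neg).biC_prT
    have b2 := ((oneBoxHom_homMor isAD_Xbim).1.biC.compC (cone_neg.boxLeft one11).biC_prT).compC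
      (cone_neg_box .neg).biC_prI
    have e : dMor _ _ (compC cone_neg.inT (compC mergeC
        (compC (cone_neg.boxLeft Xbim).prT (cone_neg_box .neg).prT))) =
        compC cone_neg.inT (compC (compC (oneBoxHom Xbim) (cone_neg.boxLeft one11).prT)
          (cone_neg_box .neg).prI) + compC cone_neg.inT (compC (compC (boxOneHom Xbim)
            (cone_neg.boxLeft Xbim).prI) (cone_neg_box .neg).prT) := by
      rw [← merge_boxId_eps, ← merge_idBox_eps, dMor_compC, dMor_compC, sq.d_pt, merge_dMor,
        cone_neg.dMor_inT isAD_Xbim.cochain.biC]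
      simp only [zero_compC, zero_add, compC_add, compC_assoc]
      exact add_comm _ _
    rw [e, boxId_death, idBox_death]
    funext y x l
    refine Eq.trans ?_ (congrArg₂ (· + ·)
      ((oneBoxIso (isAD_cross .neg)).compC_left (fun _ _ => Iff.rfl)
        (boxId_death .neg ▸ biC_boxId_death .neg) y x l)
      ((boxOneIso (isAD_cross .neg)).compC_left (fun _ _ => Iff.rfl)
        (idBox_death .neg ▸ biC_idBox_death .neg) y x l)).symm
    refine (Coch.add_apply _ _ y x l).trans ?_
    induction y using cone_neg.cases with
    | h1 y =>
      rw [cone_neg.inT_comp_i, cone_neg.inT_comp_i, add_zero]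
      refine (A11.add_self _).symm.trans (congrArg₂ (· + ·) rfl ?_)
      exact relabel_congr' (φ := fun y x => x = inlLeft .neg .neg y)
        (ψ := fun y x => x = inlRight .neg .neg y) Iff.rfl rfl l
    | h2 y =>
      rw [cone_neg.inT_comp_t b2, cone_neg.inT_comp_t b1, compC_assoc, compC_assoc]
      refine congrArg₂ (· + ·)
        (((oneBoxIso isAD_Xbim).compC_left (fun _ _ => Iff.rfl)
          ((cone_neg.boxLeft one11).biC_prT.compC (cone_neg_box .neg).biC_prI) y x l).trans ?_)
        (((boxOneIso isAD_Xbim).compC_left (fun _ _ => Iff.rfl)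
          ((cone_neg.boxLeft Xbim).biC_prI.compC (cone_neg_box .neg).biC_prT) y x l).trans ?_)
      · exact ((cone_neg.boxLeft one11).prT_comp (cone_neg_box .neg).biC_prI _ x l).trans
          (relabel_congr' (φ := fun y x => x = _) (ψ := fun y x => x = inlLeft .neg .neg y)
            Iff.rfl rfl l)
      · exact ((cone_neg.boxLeft Xbim).prI_comp (cone_neg_box .neg).biC_prT _ x l).trans
          (relabel_congr' (φ := fun (y : (Xbim.box (crossRaw .neg)).G)
              (x : ((crossRaw .neg).box (crossRaw .neg)).G) =>
              x = ⟨(Sum.inr y.1.1, y.1.2), (cone_neg.r_t _).trans y.2⟩)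
            (ψ := fun y x => x = inlRight .neg .neg y) Iff.rfl rfl l)

/-! ### Endomorphisms of bidegree zero of the identity bimodule -/

lemma gr11_eq_zero {a : A11.Mor} {d : ℤ × ℤ} (ha : a ∈ A11.gr d)
    (h : ¬ (d.1 + d.2 = 0 ∧ 0 ≤ d.2)) (h' : d ≠ (1, 0)) : a = 0 := by
  obtain ⟨h1, h2, h3, h4, h5⟩ := mem_gr11.mp ha
  refine ext11 ?_ (Polynomial.ext fun n => ?_) (Polynomial.ext fun n => ?_) ?_
    (MvPolynomial.ext _ _ fun m => ?_) <;> by_contra e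
  · exact h (by rw [h1 e]; simp)
  · exact h (by rw [← h2 n e]; simp)
  · exact h (by rw [← h3 n e]; simp)
  · exact h' (h4 e).symm
  · exact h (by rw [← h5 m e]; simp; positivity)

lemma multiAdd_eq_zero {Φ : List A11.Mor → A11.Mor} (h : MultiAdd Φ) {c : ℤ × ℤ} (hΦ : HasDeg c Φ)
    (l) (hc : c.1 + c.2 ≤ 0) (hc' : c.1 + c.2 = 0 → c.2 < 0 ∨ c.2 = 0 ∧ l ≠ []) : Φ l = 0 := by
  induction l generalizing Φ c with
  | nil =>
    have h₀ := hΦ [] [] .nil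
    simp only [List.map_nil, List.sum_nil, add_zero] at h₀
    refine gr11_eq_zero h₀ (fun e => ?_) fun e => ?_
    · exact (hc' e.1).elim (fun h => absurd h (not_lt.mpr e.2)) fun h => h.2 rfl
    · simp [e] at hc
  | cons a l ih =>
    induction a using A11.gr_induction with
    | h p a ha =>
      by_cases h1 : a = 0
      · rw [h1]; exact h.zero_head l
      have h2 : (p.1 + p.2 = 0 ∧ 0 ≤ p.2) ∨ p = (1, 0) := by
        by_contra e
        rw [not_or] at e
        exact h1 (gr11_eq_zero ha e.1 e.2)
      have h3 : c.1 + c.2 = 0 → c.2 ≤ 0 := fun e => (hc' e).elim le_of_lt fun h => h.1.le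
      refine ih (h.tail a) (c := c + (p - (0, 1))) (fun l ds hl => ?_) ?_ fun e => .inl ?_
      · have := hΦ (a :: l) (p :: ds) (.cons ha hl)
        rwa [List.map_cons, List.sum_cons, ← add_assoc] at this
      · rcases h2 with h2 | rfl <;> simp <;> omega
      · rcases h2 with h2 | rfl <;> simp at e ⊢ <;> omega
    | h0 => exact h.zero_head l
    | hadd a b ha hb =>
      rw [h.head, ha fun e => (hc' e).imp_right fun h => ⟨h.1, List.cons_ne_nil a l⟩,
        hb fun e => (hc' e).imp_right fun h => ⟨h.1, List.cons_ne_nil b l⟩, add_zero]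

lemma gr11_idem {a : A11.Mor} (ha : a ∈ A11.gr 0) (s : A11.Obj)
    (hs : A11.idem s * a * A11.idem s = a) : a = 0 ∨ a = A11.idem s := by
  obtain ⟨-, h2, h3, h4, h5⟩ := mem_gr11.mp ha
  have z : ∀ c : ZMod 2, c = 0 ∨ c = 1 := by decide
  have e (f : Polynomial (ZMod 2)) (h : ∀ n, f.coeff n ≠ 0 → ((-2 * n, 2 * n) : ℤ × ℤ) = 0) :
      f = Polynomial.C (f.coeff 0) := Polynomial.ext fun n => by
    rw [Polynomial.coeff_C]
    split_ifs with h'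
    · rw [h']
    · by_contra e
      exact h' (by simpa using congrArg Prod.snd (h n e))
  have e2 := e _ h2
  have e3 := e _ h3
  have e5 : pOO a = MvPolynomial.C ((pOO a).coeff 0) := MvPolynomial.ext _ _ fun m => by
    rw [MvPolynomial.coeff_C]
    split_ifs with h
    · rw [h]
    · by_contra e
      have := congrArg Prod.snd (h5 m e)
      refine h (Finsupp.ext fun i => ?_)
      simp at this
      fin_cases i <;> simp <;> omega
  have e4 : pLam a = 0 := by
    by_contra e
    simpa using congrArg Prod.fst (h4 e)
  rw [← hs]
  cases s
  · refine (z (pUU a)).imp (fun h => ?_) fun h => ?_ <;> apply ext11 <;> simp [h, e4]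
    rfl
  · refine (z ((pOU a).coeff 0)).imp (fun h => ?_) fun h => ?_ <;> rw [h] at e2 <;>
      apply ext11 <;> simp [e2, e4]
  · refine (z ((pUO a).coeff 0)).imp (fun h => ?_) fun h => ?_ <;> rw [h] at e3 <;>
      apply ext11 <;> simp [e3, e4]
  · refine (z ((pOO a).coeff 0)).imp (fun h => ?_) fun h => ?_ <;> rw [h] at e5 <;>
      apply ext11 <;> simp [e5, e4]

/-- An invertible endomorphism of bidegree zero of the identity bimodule is the identity. -/
lemma one_eq_id {f g : Coch one11 one11} (hf : f ∈ homMor one11 one11 0) (h : Coch one11 one11)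
    (hh : dMor one11 one11 h = compC g f + idC one11) : f = idC one11 := by
  funext y x l
  rcases l with _ | ⟨a, l⟩
  · by_cases e : y = x
    · subst e
      have hm := hf.1.deg y y [] [] .nil
      simp only [List.map_nil, List.sum_nil, add_zero, add_sub_cancel_right] at hm
      refine (gr11_idem hm y (hf.1.out y y [])).elim (fun e => ?_) fun e => ?_
      · exfalso
        have h1 := congrFun (congrFun (congrFun hh y) y) []
        have h2 : dMor one11 one11 h y y [] = 0 := by
          have k1 : intD h y y [] = 0 := (add_zero _).trans (add_zero _)
          have k2 : compC (M := one11) (N := one11) (K := one11) one11.δ h y y [] = 0 :=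
            Finset.sum_eq_zero fun t _ => (splitSum_nil _).trans (zero_mul _)
          have k3 : compC (M := one11) (N := one11) (K := one11) h one11.δ y y [] = 0 :=
            Finset.sum_eq_zero fun t _ => (splitSum_nil _).trans (mul_zero _)
          rw [dMor_apply, Coch.add_apply, Coch.add_apply, k1, k2, k3, add_zero, add_zero]
        have h3 : compC g f y y [] = 0 := Finset.sum_eq_zero fun t _ => by
          rw [splitSum_nil]
          by_cases ht : t = y
          · rw [ht, e, mul_zero]
          · rw [hf.1.nil t y ht, mul_zero]
        have h4 : A11.idem y = 0 := by
          rw [h2, Coch.add_apply, h3, zero_add] at h1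
          exact (h1.trans (if_pos rfl)).symm
        have h5 := congrFun (congrArg A11.aug h4) y
        refine one_ne_zero (α := ZMod 2) (((A11.aug_idem y y).trans (if_pos rfl)).symm.trans
          (h5.trans ?_))
        rw [map_zero]
        rfl
      · exact e.trans (if_pos rfl).symm
    · exact (hf.1.nil y x e).trans (if_neg e).symm
  · exact multiAdd_eq_zero (c := 0) (hf.1.biC.multiAdd y x) (hf.1.deg y x) (a :: l) le_rfl
      fun _ => .inr ⟨rfl, List.cons_ne_nil a l⟩

/-! ### Evaluation of movies in a bicategory -/

section Words

open Bicategory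

universe w v u

variable {𝒞 : Type u} [Bicategory.{w, v} 𝒞] {X : 𝒞} (cr : Crossing → (X ⟶ X))

/-- The 1-morphism of a word. -/
def wd : BWord → (X ⟶ X)
  | [] => 𝟙 X
  | c :: w => wd w ≫ cr c

/-- Compatibility with concatenation of words. -/
def wdComp : ∀ x y : BWord, wd cr (x ++ y) ≅ wd cr y ≫ wd cr x
  | [], _ => (ρ_ _).symm
  | c :: x, y => whiskerRightIso (wdComp x y) (cr c) ≪≫ α_ _ _ _

variable {cr}

/-- Place a word on the left. -/
def wdL : ∀ (x : BWord) {w w' : BWord}, (wd cr w ⟶ wd cr w') → (wd cr (x ++ w) ⟶ wd cr (x ++ w'))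
  | [], _, _, f => f
  | c :: x, _, _, f => wdL x f ▷ cr c

/-- Place a word on the right. -/
def wdR (y : BWord) {w w' : BWord} (f : wd cr w ⟶ wd cr w') :
    wd cr (w ++ y) ⟶ wd cr (w' ++ y) :=
  (wdComp cr w y).hom ≫ wd cr y ◁ f ≫ (wdComp cr w' y).inv

/-- The identification of the 1-morphisms of equal words. -/
def wdCast {w w' : BWord} (h : w = w') : wd cr w ⟶ wd cr w' := eqToHom (congrArg (wd cr) h)

@[simp] lemma wdCast_rfl (w) : wdCast (cr := cr) (rfl : w = w) = 𝟙 _ := rfl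

@[simp] lemma wdCast_comp {w w' w'' : BWord} (h : w = w') (h' : w' = w'') :
    wdCast (cr := cr) h ≫ wdCast h' = wdCast (h.trans h') := by subst h h'; simp

@[simp] lemma wdCast_comp_assoc {w w' w'' : BWord} (h : w = w') (h' : w' = w'') {k : X ⟶ X}
    (f : wd cr w'' ⟶ k) : wdCast h ≫ wdCast h' ≫ f = wdCast (h.trans h') ≫ f := by
  subst h h'; simp

lemma wdCast_cons {w w' : BWord} (h : w = w') (c : Crossing) :
    wdCast (cr := cr) h ▷ cr c = wdCast (cr := cr) (congrArg (c :: ·) h) := by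
  subst h; exact id_whiskerRight _ _

lemma wdL_id : ∀ x w : BWord, wdL x (𝟙 (wd cr w)) = 𝟙 _
  | [], _ => rfl
  | c :: x, w => by rw [wdL, wdL_id x w]; exact id_whiskerRight _ _

lemma wdL_comp : ∀ (x) {w w' w'' : BWord} (f : wd cr w ⟶ wd cr w') (g : wd cr w' ⟶ wd cr w''), wdL
    x (f ≫ g) = wdL x f ≫ wdL x g
  | [], _, _, _, _, _ => rfl
  | c :: x, _, _, _, f, g => by rw [wdL, wdL_comp x f g]; exact comp_whiskerRight _ _ _

lemma wdR_id (y w) : wdR y (𝟙 (wd cr w)) = 𝟙 _ := by simp [wdR]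

lemma wdR_comp (y) {w w' w'' : BWord} (f : wd cr w ⟶ wd cr w')
    (g : wd cr w' ⟶ wd cr w'') : wdR y (f ≫ g) = wdR y f ≫ wdR y g := by simp [wdR]

lemma wdL_cast (x) {w w' : BWord} (h : w = w') :
    wdL x (wdCast (cr := cr) h) = wdCast (congrArg (x ++ ·) h) := by
  subst h; exact wdL_id x _

lemma wdR_cast (y) {w w' : BWord} (h : w = w') :
    wdR y (wdCast (cr := cr) h) = wdCast (congrArg (· ++ y) h) := by
  subst h; exact wdR_id y _

lemma wdL_eq : ∀ (x) {w w' : BWord} (f : wd cr w ⟶ wd cr w'), wdL x f = (wdComp cr x w).hom ≫ f ▷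
    wd cr x ≫ (wdComp cr x w').inv
  | [], _, _, f => by simp [wdL, wdComp, wd]
  | c :: x, _, _, f => by
    rw [wdL, wdL_eq x f]
    simp [wdComp, wd]

lemma wdR_cons (y) {w w' : BWord} (f : wd cr w ⟶ wd cr w') (c : Crossing) :
    wdR (w := c :: w) (w' := c :: w') y (f ▷ cr c) = wdR y f ▷ cr c := by
  simp [wdR, wdComp, wd]

lemma wdL_wdL : ∀ (x y) {w w' : BWord} (f : wd cr w ⟶ wd cr w'), wdL (x ++ y) f = wdCast
    (List.append_assoc x y w) ≫ wdL x (wdL y f) ≫ wdCast (List.append_assoc x y w').symm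
  | [], _, _, _, _ => by simp [wdL]
  | c :: x, y, w, w', f => by
    refine (congrArg (· ▷ cr c) (wdL_wdL x y f)).trans ?_
    simp only [comp_whiskerRight, wdCast_cons]
    rfl

lemma wdR_wdL : ∀ (x y) {w w' : BWord} (f : wd cr w ⟶ wd cr w'), wdR y (wdL x f) = wdCast
    (List.append_assoc x w y) ≫ wdL x (wdR y f) ≫ wdCast (List.append_assoc x w' y).symm
  | [], _, _, _, _ => by simp [wdL]
  | c :: x, y, w, w', f => by
    refine (wdR_cons y (wdL x f) c).trans ((congrArg (· ▷ cr c) (wdR_wdL x y f)).trans ?_)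
    simp only [comp_whiskerRight, wdCast_cons]
    rfl

lemma pentagon_cons {A A' E P x y z c : X ⟶ X} (p : A ⟶ z ≫ P) (q : P ⟶ y ≫ x) (k : A ⟶ A')
    (r : A' ⟶ E ≫ x) (s : E ⟶ z ≫ y) (h : p ≫ z ◁ q = k ≫ r ≫ s ▷ x ≫ (α_ z y x).hom) :
    (p ▷ c ≫ (α_ z P c).hom) ≫ z ◁ (q ▷ c ≫ (α_ y x c).hom) =
      k ▷ c ≫ (r ▷ c ≫ (α_ E x c).hom) ≫ s ▷ (x ≫ c) ≫ (α_ z y (x ≫ c)).hom := by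
  have e : (p ▷ c ≫ (α_ z P c).hom) ≫ z ◁ (q ▷ c ≫ (α_ y x c).hom) =
      (p ≫ z ◁ q) ▷ c ≫ (α_ z (y ≫ x) c).hom ≫ z ◁ (α_ y x c).hom := by simp
  rw [e, h]
  simp

lemma wdComp_assoc : ∀ x y z : BWord,
    (wdComp cr (x ++ y) z).hom ≫ wd cr z ◁ (wdComp cr x y).hom =
      wdCast (List.append_assoc x y z) ≫ (wdComp cr x (y ++ z)).hom ≫
        (wdComp cr y z).hom ▷ wd cr x ≫ (α_ _ _ _).hom
  | [], y, z => by simp [wdComp, wd]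
  | c :: x, y, z => by
    refine (pentagon_cons _ _ _ _ _ (wdComp_assoc x y z)).trans ?_
    rw [wdCast_cons]
    rfl

lemma wdR_wdR (x y) {w w' : BWord} (f : wd cr w ⟶ wd cr w') : wdR (x ++ y) f = wdCast
    (List.append_assoc w x y).symm ≫ wdR y (wdR x f) ≫ wdCast (List.append_assoc w' x y) := by
  rw [← cancel_mono ((wdComp cr w' (x ++ y)).hom ≫ (wdComp cr x y).hom ▷ wd cr w' ≫
    (α_ _ _ _).hom)]
  have h : wdR y (wdR x f) ≫ (wdComp cr (w' ++ x) y).hom ≫ wd cr y ◁ (wdComp cr w' x).hom =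
      ((wdComp cr (w ++ x) y).hom ≫ wd cr y ◁ (wdComp cr w x).hom) ≫ wd cr y ◁ wd cr x ◁ f := by
    simp [wdR, ← Bicategory.whiskerLeft_comp]
  simp only [Category.assoc]
  rw [← wdComp_assoc, h, wdComp_assoc]
  simp only [Category.assoc, wdCast_comp_assoc, wdCast_rfl, Category.id_comp]
  simp only [wdR, Category.assoc, Iso.inv_hom_id_assoc]
  rw [Bicategory.whisker_exchange_assoc]
  simp

lemma wdComp_nil : ∀ w : BWord,
    (wdComp cr w []).hom = wdCast (List.append_nil w) ≫ (λ_ (wd cr w)).inv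
  | [] => by simp [wdComp, wd, unitors_inv_equal]
  | c :: w => by
    have := congrArg (· ▷ cr c ≫ (α_ (𝟙 X) (wd cr w) (cr c)).hom) (wdComp_nil w)
    simp only [comp_whiskerRight, wdCast_cons, Category.assoc] at this
    refine this.trans ((Category.assoc _ _ _).trans ?_)
    exact congrArg (wdCast _ ≫ ·) (leftUnitor_comp_inv _ _).symm

lemma wdR_nil {w w' : BWord} (f : wd cr w ⟶ wd cr w') : wdR [] f =
    wdCast (List.append_nil w) ≫ f ≫ wdCast (List.append_nil w').symm := by
  rw [← cancel_mono (wdComp cr w' []).hom]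
  simp only [wdR, Category.assoc, Iso.inv_hom_id, Category.comp_id]
  rw [wdComp_nil, wdComp_nil]
  change (wdCast _ ≫ (λ_ (wd cr w)).inv) ≫ 𝟙 X ◁ f = _ ≫ _ ≫ _ ≫ _ ≫ (λ_ (wd cr w')).inv
  simp

lemma wd_exchange {w w' v v' : BWord} (f : wd cr w ⟶ wd cr w') (g : wd cr v ⟶ wd cr v') :
    wdR v f ≫ wdL w' g = wdL w g ≫ wdR v' f := by
  simp only [wdL_eq, wdR, Category.assoc, Iso.inv_hom_id_assoc]
  rw [whisker_exchange_assoc]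

lemma eq_id_of_wdR {y w : BWord} (i : wd cr y ≅ 𝟙 X) (f : wd cr w ⟶ wd cr w)
    (h : wdR y f = 𝟙 _) : f = 𝟙 _ := by
  have h1 : wd cr y ◁ f = 𝟙 _ := by
    rw [← cancel_epi (wdComp cr w y).hom, ← cancel_mono (wdComp cr w y).inv, Category.assoc]
    exact h.trans (by simp)
  have h2 : 𝟙 X ◁ f = 𝟙 _ := by
    rw [← cancel_epi (i.hom ▷ wd cr w), ← whisker_exchange, h1]
    simp
  rw [← cancel_epi (λ_ (wd cr w)).hom, ← cancel_mono (λ_ (wd cr w)).inv, Category.assoc,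
    ← id_whiskerLeft, h2]
  simp

/-! ### Movies -/

variable (γ : ∀ g : MovieGen, wd cr g.src ⟶ wd cr g.tgt)

/-- The 2-morphism of an event. -/
def evE (e : Event) : wd cr e.src ⟶ wd cr e.tgt := wdL e.left (wdR e.right (γ e.gen))

/-- The 2-morphism of a movie. -/
def evM : ∀ (es : List Event) {w w' : BWord}, IsMovie w es w' → (wd cr w ⟶ wd cr w')
  | [], _, _, h => wdCast h
  | e :: es, _, _, h => wdCast h.1 ≫ evE γ e ≫ evM es h.2

lemma cast_evM {es : List Event} {v w w' : BWord} (h : v = w) (m : IsMovie w es w')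
    (m' : IsMovie v es w') : wdCast h ≫ evM γ es m = evM γ es m' := by subst h; simp

lemma evM_cast {es : List Event} {v w w' v' : BWord} (h : v = w) (h' : w' = v')
    (m : IsMovie w es w') (m' : IsMovie v es v') :
    evM γ es m' = wdCast h ≫ evM γ es m ≫ wdCast h' := by subst h h'; simp

lemma evM_append : ∀ (es es' : List Event) {w w' w'' : BWord} (h : IsMovie w es w')
    (h' : IsMovie w' es' w''), evM γ (es ++ es') (h.append h') = evM γ es h ≫ evM γ es' h'
  | [], es', _, _, _, h, h' => by cases h; simp [evM]
  | e :: es, es', _, _, _, h, h' => by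
    simp only [List.cons_append, evM, evM_append es es' h.2 h', Category.assoc]

lemma evE_whisk (x y) (e : Event) (h : (e.whisk x y).src = x ++ (e.src ++ y)) (h' : x ++ (e.tgt ++
    y) = (e.whisk x y).tgt) : evE γ (e.whisk x y) = wdCast h ≫ wdL x (wdR y (evE γ e)) ≫ wdCast h'
    := by
  have h1 : wdL e.left (wdR (e.right ++ y) (γ e.gen)) = wdCast (by simp) ≫
      wdR y (wdL e.left (wdR e.right (γ e.gen))) ≫ wdCast (by simp) := by
    rw [wdR_wdR, wdR_wdL, wdL_comp, wdL_comp, wdL_cast, wdL_cast]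
    simp only [Category.assoc, wdCast_comp, wdCast_comp_assoc]
  refine (wdL_wdL x e.left (wdR (e.right ++ y) (γ e.gen))).trans ?_
  rw [h1, wdL_comp, wdL_comp, wdL_cast, wdL_cast]
  simp only [Category.assoc, wdCast_comp, wdCast_comp_assoc]
  rfl

lemma evM_whisk (x y) : ∀ (es : List Event) {w w' : BWord} (h : IsMovie w es w'), evM γ (es.map
    (Event.whisk x y)) (h.whisk x y) = wdL x (wdR y (evM γ es h))
  | [], _, _, h => by cases h; exact ((congrArg _ (wdR_id y _)).trans (wdL_id x _)).symm
  | e :: es, _, _, h => by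
    have h1 : (e.whisk x y).src = x ++ (e.src ++ y) := by simp [Event.src, Event.whisk]
    have h2 : x ++ (e.tgt ++ y) = (e.whisk x y).tgt := by simp [Event.tgt, Event.whisk]
    have ih := evM_whisk x y es h.2
    simp only [evM, List.map_cons, evE_whisk γ x y e h1 h2, wdR_comp, wdL_comp, wdR_cast, wdL_cast,
      ← ih, Category.assoc, wdCast_comp_assoc]
    exact congrArg (fun f => _ ≫ wdL x (wdR y (evE γ e)) ≫ f) (cast_evM γ _ _ _)

lemma evM_whiskL (x) {es : List Event} {w w' : BWord} (h : IsMovie w es w') : evM γ (es.map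
    (Event.whisk x [])) (h.whiskL x) = wdL x (evM γ es h) := by
  rw [evM_cast γ (by simp) (by simp) (h.whisk x []), evM_whisk γ x [] es h, wdR_nil, wdL_comp,
    wdL_comp,
    wdL_cast, wdL_cast]
  simp

lemma IsMovie.exists_of_append : ∀ {a b : List Event} {w w' : BWord}, IsMovie w (a ++ b) w' →
    ∃ u, IsMovie w a u ∧ IsMovie u b w'
  | [], _, _, _, h => ⟨_, rfl, h⟩
  | _ :: _, _, _, _, h => let ⟨u, h1, h2⟩ := IsMovie.exists_of_append h.2; ⟨u, ⟨h.1, h1⟩, h2⟩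

lemma IsMovie.tgt_unique : ∀ {a : List Event} {w v v' : BWord}, IsMovie w a v →
    IsMovie w a v' → v = v'
  | [], _, _, _, h, h' => h.symm.trans h'
  | _ :: _, _, _, _, h, h' => IsMovie.tgt_unique h.2 h'.2

lemma IsMovie.src_unique {a : List Event} (ha : a ≠ []) {w w' v v' : BWord}
    (h : IsMovie w a v) (h' : IsMovie w' a v') : w = w' := by
  cases a with
  | nil => exact absurd rfl ha
  | cons e es => exact h.1.trans h'.1.symm

lemma Crossing.inv_inv (c : Crossing) : c.inv.inv = c := by cases c <;> rfl

lemma BaseMove.isMovie {a b : List Event} (h : BaseMove a b) :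
    ∃ v v', IsMovie v a v' ∧ IsMovie v b v' ∧ a ≠ [] := by
  cases h <;> exact ⟨_, _, ⟨rfl, by simp [IsMovie, Event.src, Event.tgt, MovieGen.src,
    MovieGen.tgt, Crossing.inv_inv] <;> rfl⟩, by simp [IsMovie, Event.src, Event.tgt, MovieGen.src,
    MovieGen.tgt, Crossing.inv_inv], by simp⟩

lemma evM_move (H : ∀ a b, BaseMove a b → ∀ v v' (h : IsMovie v a v') (h' : IsMovie v b v'),
    evM γ a h = evM γ b h') {es es' : List Event} (hm : Move es es') {w w' : BWord}
    (h : IsMovie w es w') (h' : IsMovie w es' w') : evM γ es h = evM γ es' h' := by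
  cases hm with
  | mk pre post x y a b hab =>
    obtain ⟨v, v', h1, h2, h3⟩ := hab.isMovie
    obtain ⟨u, k1, k⟩ := h.exists_of_append
    obtain ⟨u', k2, k3⟩ := k.exists_of_append
    obtain rfl := k2.src_unique (by simpa using h3) (h1.whisk x y)
    obtain rfl := k2.tgt_unique (h1.whisk x y)
    refine (evM_append γ _ _ k1 ((h1.whisk x y).append k3)).trans
      (Eq.trans ?_ (evM_append γ _ _ k1 ((h2.whisk x y).append k3)).symm)
    rw [evM_append γ _ _ (h1.whisk x y) k3, evM_append γ _ _ (h2.whisk x y) k3, evM_whisk γ x y a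
      h1,
      evM_whisk γ x y b h2, H a b hab v v' h1 h2]

lemma evE_isIso (e : Event) (h : IsIso (γ e.gen)) : IsIso (evE γ e) := by
  have : IsIso (wdR e.right (γ e.gen)) := by unfold wdR; infer_instance
  have h' : IsIso (wdL e.left (wdR e.right (γ e.gen))) := by rw [wdL_eq]; infer_instance
  exact h'

lemma evM_isIso : ∀ (es : List Event) {w w' : BWord} (m : IsMovie w es w'),
    (∀ e ∈ es, IsIso (γ e.gen)) → IsIso (evM γ es m)
  | [], _, _, m, _ => by cases m; exact inferInstanceAs (IsIso (𝟙 _))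
  | e :: es, _, _, m, h => by
    have := evE_isIso γ e (h e (by simp))
    have := evM_isIso es m.2 fun e' he' => h e' (by simp [he'])
    have : IsIso (wdCast (cr := cr) m.1) := by unfold wdCast; infer_instance
    unfold evM
    infer_instance

lemma evE_left (x) (g : MovieGen) : evE γ ⟨x, g, []⟩ = wdCast (by simp [Event.src]) ≫ wdL x (γ g)
    ≫ wdCast (by simp [Event.tgt]) := by
  refine (congrArg (wdL x) (wdR_nil (γ g))).trans ?_
  rw [wdL_comp, wdL_comp, wdL_cast, wdL_cast]
  rfl

lemma evM_exchange (g1 g2 : MovieGen) (x v v') (h : IsMovie v [⟨[], g1, x ++ g2.src⟩, ⟨g1.tgt ++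
    x, g2, []⟩] v') (h' : IsMovie v [⟨g1.src ++ x, g2, []⟩, ⟨[], g1, x ++ g2.tgt⟩] v') : evM γ _ h =
    evM γ _ h' := by
  have key : ∀ s : BWord, evE γ ⟨s ++ x, g2, []⟩ =
      wdCast (by simp [Event.src]) ≫ wdL s (wdL x (γ g2)) ≫ wdCast (by simp [Event.tgt]) := by
    intro s
    rw [evE_left, wdL_wdL]
    simp only [Category.assoc, wdCast_comp, wdCast_comp_assoc]
  simp only [evM, key, Category.assoc, wdCast_comp, wdCast_comp_assoc]
  change wdCast _ ≫ wdR _ (γ g1) ≫ 𝟙 _ ≫ wdL g1.tgt (wdL x (γ g2)) ≫ wdCast _ ≫ wdCast _ =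
    wdCast _ ≫ wdL g1.src (wdL x (γ g2)) ≫ 𝟙 _ ≫ wdR _ (γ g1) ≫ wdCast _
  rw [Category.id_comp, Category.id_comp, ← Category.assoc (wdR _ _), wd_exchange, Category.assoc]
  exact congrArg (fun f => _ ≫ wdL g1.src (wdL x (γ g2)) ≫ wdR _ (γ g1) ≫ f) (wdCast_comp _ _)

end Words

section Generators

open Bicategory

universe w v u

variable {𝒞 : Type u} [Bicategory.{w, v} 𝒞] {X : 𝒞} {cr : Crossing → (X ⟶ X)}
  (bi : ∀ c, 𝟙 X ⟶ cr c) (de : ∀ c, cr c ⟶ 𝟙 X) (co : ∀ c, 𝟙 X ⟶ cr c.inv ≫ cr c)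
  (an : ∀ c, cr c.inv ≫ cr c ⟶ 𝟙 X)

/-- The 2-morphisms of the generating movies. -/
def genMap : ∀ g : MovieGen, wd cr g.src ⟶ wd cr g.tgt
  | .birth c => bi c ≫ (λ_ (cr c)).inv
  | .death c => (λ_ (cr c)).hom ≫ de c
  | .create c => co c ≫ (λ_ (cr c.inv)).inv ▷ cr c
  | .annih c => (λ_ (cr c.inv)).hom ▷ cr c ≫ an c

lemma evM_baseMove (hoop : ∀ c, co c ≫ an c = 𝟙 _) (saddle : ∀ c, an c ≫ co c = 𝟙 _) (zig : ∀ c v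
    (h : IsMovie v [⟨[], .create c, [c]⟩, ⟨[c], .annih c.inv, []⟩] v), evM (genMap bi de co an) _ h
    = 𝟙 _) (zag : ∀ c v (h : IsMovie v [⟨[c], .create c.inv, []⟩, ⟨[], .annih c, [c]⟩] v), evM
    (genMap bi de co an) _ h = 𝟙 _) (cdl : ∀ c, co c ≫ cr c.inv ◁ de c ≫ (ρ_ _).hom = bi c.inv) (cdr
    : ∀ c, co c ≫ de c.inv ▷ cr c ≫ (λ_ _).hom = bi c) (bar : ∀ c, (λ_ _).inv ≫ bi c.inv ▷ cr c ≫ an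
    c = de c) (bal : ∀ c, (ρ_ _).inv ≫ cr c.inv ◁ bi c ≫ an c = de c.inv) (bp : ∀ c, (ρ_ _).inv ≫ cr
    c ◁ bi c = (λ_ _).inv ≫ bi c ▷ cr c) (dp : ∀ c, cr c ◁ de c ≫ (ρ_ _).hom = de c ▷ cr c ≫ (λ_
    _).hom) (a b : List Event) (hab : BaseMove a b) (v v') (h : IsMovie v a v') (h' : IsMovie v b
    v') : evM (genMap bi de co an) a h = evM (genMap bi de co an) b h' := by
  cases hab with
  | exchange g1 g2 x => exact evM_exchange _ g1 g2 x v v' h h'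
  | zigzagLeft c => cases h'; exact zig c v h
  | zigzagRight c => cases h'; exact zag c v h
  | hoop c =>
    obtain ⟨rfl, _, rfl⟩ := h
    simp only [evM, evE_left]
    change 𝟙 (𝟙 X) ≫ (𝟙 _ ≫ (co c ≫ (λ_ (cr c.inv)).inv ▷ cr c) ≫ 𝟙 _) ≫ 𝟙 _ ≫
      (𝟙 _ ≫ ((λ_ (cr c.inv)).hom ▷ cr c ≫ an c) ≫ 𝟙 _) ≫ 𝟙 _ = 𝟙 (𝟙 X)
    simp [← comp_whiskerRight_assoc, hoop]
  | saddle c =>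
    obtain ⟨rfl, _, rfl⟩ := h
    simp only [evM, evE_left]
    change 𝟙 ((𝟙 X ≫ cr c.inv) ≫ cr c) ≫ (𝟙 _ ≫ ((λ_ (cr c.inv)).hom ▷ cr c ≫ an c) ≫ 𝟙 _) ≫ 𝟙 _ ≫
      (𝟙 _ ≫ (co c ≫ (λ_ (cr c.inv)).inv ▷ cr c) ≫ 𝟙 _) ≫ 𝟙 _ = 𝟙 ((𝟙 X ≫ cr c.inv) ≫ cr c)
    simp only [Category.assoc, Category.id_comp, Category.comp_id]
    rw [reassoc_of% saddle c]
    simp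
  | createDeathLeft c =>
    obtain ⟨rfl, _, rfl⟩ := h
    simp only [evM, evE_left]
    change 𝟙 (𝟙 X) ≫ (𝟙 _ ≫ (co c ≫ (λ_ (cr c.inv)).inv ▷ cr c) ≫ 𝟙 _) ≫ 𝟙 _ ≫
      (((ρ_ (𝟙 X ≫ cr c.inv)).inv ▷ cr c ≫ (α_ _ _ _).hom) ≫
        (𝟙 X ≫ cr c.inv) ◁ ((λ_ (cr c)).hom ≫ de c) ≫ (ρ_ _).hom) ≫ 𝟙 _ =
      𝟙 (𝟙 X) ≫ (𝟙 _ ≫ (bi c.inv ≫ (λ_ _).inv) ≫ 𝟙 _) ≫ 𝟙 _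
    rw [← cdl]
    bicategory
  | createDeathRight c =>
    obtain ⟨rfl, _, rfl⟩ := h
    simp only [evM, evE_left]
    change 𝟙 (𝟙 X) ≫ (𝟙 _ ≫ (co c ≫ (λ_ (cr c.inv)).inv ▷ cr c) ≫ 𝟙 _) ≫ 𝟙 _ ≫
      (𝟙 _ ≫ ((λ_ (cr c.inv)).hom ≫ de c.inv) ▷ cr c ≫ 𝟙 _) ≫ 𝟙 _ =
      𝟙 (𝟙 X) ≫ (𝟙 _ ≫ (bi c ≫ (λ_ _).inv) ≫ 𝟙 _) ≫ 𝟙 _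
    rw [← cdr]
    bicategory
  | birthAnnihRight c =>
    obtain ⟨rfl, _, rfl⟩ := h
    simp only [evM, evE_left]
    change 𝟙 (𝟙 X ≫ cr c) ≫ (𝟙 _ ≫ (bi c.inv ≫ (λ_ _).inv) ▷ cr c ≫ 𝟙 _) ≫ 𝟙 _ ≫
      (𝟙 _ ≫ ((λ_ (cr c.inv)).hom ▷ cr c ≫ an c) ≫ 𝟙 _) ≫ 𝟙 _ =
      𝟙 _ ≫ (𝟙 _ ≫ ((λ_ (cr c)).hom ≫ de c) ≫ 𝟙 _) ≫ 𝟙 _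
    rw [← bar]
    simp
  | birthAnnihLeft c =>
    obtain ⟨rfl, _, rfl⟩ := h
    simp only [evM, evE_left]
    change 𝟙 (𝟙 X ≫ cr c.inv) ≫ ((ρ_ _).inv ≫ (𝟙 X ≫ cr c.inv) ◁ (bi c ≫ (λ_ _).inv) ≫
        (α_ _ _ _).inv ≫ (ρ_ (𝟙 X ≫ cr c.inv)).hom ▷ cr c) ≫ 𝟙 _ ≫
      (𝟙 _ ≫ ((λ_ (cr c.inv)).hom ▷ cr c ≫ an c) ≫ 𝟙 _) ≫ 𝟙 _ =
      𝟙 _ ≫ (𝟙 _ ≫ ((λ_ (cr c.inv)).hom ≫ de c.inv) ≫ 𝟙 _) ≫ 𝟙 _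
    rw [← bal]
    bicategory
  | birthPast c =>
    obtain ⟨rfl, rfl⟩ := h
    simp only [evM, evE_left]
    change 𝟙 (𝟙 X ≫ cr c) ≫ ((ρ_ _).inv ≫ (𝟙 X ≫ cr c) ◁ (bi c ≫ (λ_ _).inv) ≫
        (α_ _ _ _).inv ≫ (ρ_ (𝟙 X ≫ cr c)).hom ▷ cr c) ≫ 𝟙 _ =
      𝟙 (𝟙 X ≫ cr c) ≫ (𝟙 _ ≫ (bi c ≫ (λ_ _).inv) ▷ cr c ≫ 𝟙 _) ≫ 𝟙 _
    have e : (λ_ (cr c)).hom ≫ ((ρ_ _).inv ≫ cr c ◁ bi c) ≫ (λ_ _).inv ▷ cr c =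
      (λ_ (cr c)).hom ≫ ((λ_ _).inv ≫ bi c ▷ cr c) ≫ (λ_ _).inv ▷ cr c := by rw [bp]
    refine Eq.trans ?_ (e.trans ?_) <;> bicategory
  | deathPast c =>
    obtain ⟨rfl, rfl⟩ := h
    simp only [evM, evE_left]
    change 𝟙 ((𝟙 X ≫ cr c) ≫ cr c) ≫ (((ρ_ (𝟙 X ≫ cr c)).inv ▷ cr c ≫ (α_ _ _ _).hom) ≫
        (𝟙 X ≫ cr c) ◁ ((λ_ (cr c)).hom ≫ de c) ≫ (ρ_ _).hom) ≫ 𝟙 _ =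
      𝟙 _ ≫ (𝟙 _ ≫ ((λ_ _).hom ≫ de c) ▷ cr c ≫ 𝟙 _) ≫ 𝟙 _
    have e : (λ_ _).hom ▷ cr c ≫ (cr c ◁ de c ≫ (ρ_ _).hom) ≫ (λ_ (cr c)).inv =
      (λ_ _).hom ▷ cr c ≫ (de c ▷ cr c ≫ (λ_ _).hom) ≫ (λ_ (cr c)).inv := by rw [dp]
    refine Eq.trans ?_ (e.trans ?_) <;> bicategory

end Generators

/-! ### The pseudofunctor -/

section Functor

open Bicategory

lemma HMor.add_self {A B : DGCat} {M N : ADRaw B A} (f : HMor M N) : f + f = 0 := by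
  obtain ⟨g, hg, rfl⟩ := f.exists_cls
  exact (cls_add hg hg).trans (cls_congr _ (zero_mem _) (Coch.add_self g))

lemma BrHom.eq_of_add {w w' : BWord} {G : Type*} [AddCommGroup G] (φ ψ : BrHom w w' → G)
    (hφ : ∀ f g, φ (f + g) = φ f + φ g) (hψ : ∀ f g, ψ (f + g) = ψ f + ψ g)
    (h : ∀ m, φ (.of m) = ψ (.of m)) (f : BrHom w w') : φ f = ψ f := by
  induction f using BrHom.ind with
  | h0 => exact (AddMonoidHom.mk' φ hφ).map_zero.trans (AddMonoidHom.mk' ψ hψ).map_zero.symm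
  | hadd f g hf hg => rw [hφ, hψ, hf, hg]
  | hof m => exact h m

variable {L : ADBimodLaws} {X : ADBimod L} (D : CrossingData X)

/-- The 2-morphism of a movie given by the values on generating movies. -/
def movieHom {es : List Event} {w w' : BWord} (h : IsMovie w es w') :
    wd D.cross w ⟶ wd D.cross w' :=
  evM (genMap D.birth D.death D.create D.annih) es h

/-- The movie moves hold for the values on generating movies. -/
def MoveInvariant : Prop := ∀ a b, BaseMove a b → ∀ v v' (h : IsMovie v a v') (h' : IsMovie v b v'),
  movieHom D h = movieHom D h'

variable {D} (hD : MoveInvariant D)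

/-- The 2-morphism of a movie up to movie moves. -/
def classHom {w w' : BWord} : MovieClass w w' → (wd D.cross w ⟶ wd D.cross w') :=
  Quot.lift (fun m => movieHom D m.2) fun m m' h => evM_move _ hD h m.2 m'.2

/-- The linear extension to combinations of movies. -/
def linHom {w w' : BWord} : BrHom w w' →+ (wd D.cross w ⟶ wd D.cross w') :=
  Finsupp.liftAddHom fun m => ZMod.lift 2 ⟨zmultiplesHom _ (classHom hD m), 
    (two_zsmul _).trans (HMor.add_self (classHom hD m))⟩

lemma linHom_of {w w' : BWord} (m : MovieClass w w') : linHom hD (.of m) = classHom hD m := by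
  refine (Finsupp.liftAddHom_apply_single _ _ _).trans ?_
  exact (ZMod.lift_coe 2 _ 1).trans (one_zsmul _)

lemma linHom_ofEq {w w' : BWord} (h : w = w') : linHom hD (.ofEq h) = wdCast h :=
  linHom_of hD _

lemma linHom_comp {w w' w'' : BWord} (f : BrHom w w') (g : BrHom w' w'') :
    linHom hD (f.comp g) = linHom hD f ≫ linHom hD g := by
  refine BrHom.eq_of_add (fun f => linHom hD (f.comp g)) (fun f => linHom hD f ≫ linHom hD g)
    (fun a b => by rw [BrHom.add_comp, map_add])
    (fun a b => by rw [map_add]; exact L.add_comp _ _ _) (fun m => ?_) f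
  refine BrHom.eq_of_add (fun g => linHom hD ((BrHom.of m).comp g))
    (fun g => linHom hD (.of m) ≫ linHom hD g) (fun a b => by rw [BrHom.comp_add, map_add])
    (fun a b => by rw [map_add]; exact L.comp_add _ _ _) (fun n => ?_) g
  rw [BrHom.of_comp_of, linHom_of, linHom_of, linHom_of]
  induction m using MovieClass.ind with | h es hes =>
  induction n using MovieClass.ind with | h es' hes' =>
  exact evM_append _ es es' hes hes'

lemma linHom_whiskR (y) {w w' : BWord} (f : BrHom w w') : linHom hD (f.map (MovieClass.whiskR y))
    = wdR y (linHom hD f) := by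
  refine BrHom.eq_of_add (fun f => linHom hD (f.map (MovieClass.whiskR y)))
    (fun f => wdR y (linHom hD f)) (fun a b => by rw [BrHom.map_add, map_add])
    (fun a b => ?_) (fun m => ?_) f
  · rw [map_add]
    exact (congrArg ((wdComp D.cross w y).hom ≫ ·) ((congrArg (· ≫ (wdComp D.cross w' y).inv)
      (L.boxId_add _ _ _)).trans (L.add_comp _ _ _))).trans (L.comp_add _ _ _)
  · rw [BrHom.map_of, linHom_of, linHom_of]
    induction m using MovieClass.ind with | h es hes =>
    exact evM_whisk _ [] y es hes

lemma linHom_whiskL (x) {w w' : BWord} (f : BrHom w w') : linHom hD (f.map (MovieClass.whiskL x))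
    = wdL x (linHom hD f) := by
  refine BrHom.eq_of_add (fun f => linHom hD (f.map (MovieClass.whiskL x)))
    (fun f => wdL x (linHom hD f)) (fun a b => by rw [BrHom.map_add, map_add])
    (fun a b => ?_) (fun m => ?_) f
  · rw [map_add, wdL_eq, wdL_eq, wdL_eq]
    exact (congrArg ((wdComp D.cross x w).hom ≫ ·) ((congrArg (· ≫ (wdComp D.cross x w').inv)
      (L.idBox_add _ _ _)).trans (L.add_comp _ _ _))).trans (L.comp_add _ _ _)
  · rw [BrHom.map_of, linHom_of, linHom_of]
    induction m using MovieClass.ind with | h es hes =>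
    exact evM_whiskL _ x hes

lemma assoc_rearrange {𝒞 : Type*} [Bicategory 𝒞] {X : 𝒞} {f g h P Q S T : X ⟶ X} {p : S ≅ f ≫ P}
    {q : P ≅ g ≫ h} {k : S ⟶ T} {r : T ⟶ Q ≫ h} {s : Q ⟶ f ≫ g}
    {k' : T ⟶ S} (hk : k' ≫ k = 𝟙 _)
    (e : p.hom ≫ f ◁ q.hom = k ≫ r ≫ s ▷ h ≫ (α_ f g h).hom) :
    k' = r ≫ s ▷ h ≫ (α_ f g h).hom ≫ f ◁ q.inv ≫ p.inv := by
  have : r ≫ s ▷ h ≫ (α_ f g h).hom ≫ f ◁ q.inv ≫ p.inv =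
      k' ≫ (k ≫ r ≫ s ▷ h ≫ (α_ f g h).hom) ≫ f ◁ q.inv ≫ p.inv := by
    simp only [Category.assoc, reassoc_of% hk]
  rw [this, ← e]
  simp

lemma unit_rearrange {𝒞 : Type*} [Bicategory 𝒞] {X : 𝒞} {f S : X ⟶ X} {p : S ⟶ 𝟙 X ≫ f}
    {k : S ⟶ f} (e : p = k ≫ (λ_ f).inv) : k = p ≫ 𝟙 (𝟙 X) ▷ f ≫ (λ_ f).hom := by
  simp [e]

/-- The pseudofunctor given by values on generating movies satisfying the movie moves. -/
def movieFunctor : Pseudofunctor BrCob (ADBimod L) where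
  obj _ := X
  map f := wd D.cross f
  map₂ η := linHom hD η
  map₂_id _ := linHom_ofEq hD rfl
  map₂_comp f g := linHom_comp hD f g
  mapId _ := Iso.refl _
  mapComp f g := wdComp D.cross g f
  map₂_whisker_left f _ _ η := linHom_whiskR hD f η
  map₂_whisker_right η h := (linHom_whiskL hD h η).trans (wdL_eq h _)
  map₂_associator f g h := by
    refine (linHom_ofEq hD _).trans ?_
    have e := wdComp_assoc (cr := D.cross) h g f
    exact assoc_rearrange (wdCast_comp _ _) e
  map₂_left_unitor f := by
    refine (linHom_ofEq hD _).trans ?_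
    exact unit_rearrange (wdComp_nil (cr := D.cross) f)
  map₂_right_unitor f := by
    refine (linHom_ofEq hD _).trans ?_
    change 𝟙 _ = (ρ_ (wd D.cross f)).inv ≫ wd D.cross f ◁ 𝟙 (𝟙 X) ≫ (ρ_ _).hom
    simp

end Functor

section Graded

open Bicategory

variable {L : ADBimodLaws} {X : ADBimod L} {D : CrossingData X}

lemma comp_mem_homog {f g h : X ⟶ X} {η : f ⟶ g} {θ : g ⟶ h} {p q : ℤ × ℤ}
    (hη : η ∈ ADBimod.homog p) (hθ : θ ∈ ADBimod.homog q) : η ≫ θ ∈ ADBimod.homog (p + q) :=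
  L.comp_homog p q η hη θ hθ

lemma comp_mem_homog_of_left {f g h : X ⟶ X} {η : f ⟶ g} {θ : g ⟶ h} {p : ℤ × ℤ}
    (hη : η ∈ ADBimod.homog 0) (hθ : θ ∈ ADBimod.homog p) : η ≫ θ ∈ ADBimod.homog p := by
  simpa using comp_mem_homog hη hθ

lemma comp_mem_homog_of_right {f g h : X ⟶ X} {η : f ⟶ g} {θ : g ⟶ h} {p : ℤ × ℤ}
    (hη : η ∈ ADBimod.homog p) (hθ : θ ∈ ADBimod.homog 0) : η ≫ θ ∈ ADBimod.homog p := by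
  simpa using comp_mem_homog hη hθ

lemma wdCast_homog {w w' : BWord} (h : w = w') :
    wdCast (cr := D.cross) h ∈ ADBimod.homog 0 := by
  subst h; exact L.id_homog _

lemma wdComp_homog : ∀ x y : BWord, (wdComp D.cross x y).hom ∈ ADBimod.homog 0 ∧
    (wdComp D.cross x y).inv ∈ ADBimod.homog 0
  | [], _ => (L.oneBox_homog _).symm
  | c :: x, y =>
    ⟨comp_mem_homog_of_left (L.idBox_homog (D.cross c) 0 _ (wdComp_homog x y).1)
      (L.assocHom_homog _ _ _).2, comp_mem_homog_of_left (L.assocHom_homog _ _ _).1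
        (L.idBox_homog (D.cross c) 0 _ (wdComp_homog x y).2)⟩

lemma wdR_homog (y) {w w' : BWord} {f : wd D.cross w ⟶ wd D.cross w'} {p : ℤ × ℤ} (h : f ∈
    ADBimod.homog p) : wdR y f ∈ ADBimod.homog p :=
  comp_mem_homog_of_left (wdComp_homog w y).1 (comp_mem_homog_of_right
    (L.boxId_homog p f h (wd D.cross y)) (wdComp_homog w' y).2)

lemma wdL_homog {w w' : BWord} {f : wd D.cross w ⟶ wd D.cross w'} {p : ℤ × ℤ}
    (h : f ∈ ADBimod.homog p) : ∀ x : BWord, wdL x f ∈ ADBimod.homog p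
  | [] => h
  | c :: x => L.idBox_homog (D.cross c) p _ (wdL_homog h x)

lemma movieHom_homog (hg : ∀ g, genMap D.birth D.death D.create D.annih g ∈ ADBimod.homog g.deg) :
    ∀ {es : List Event} {w w' : BWord} (h : IsMovie w es w'),
      movieHom D h ∈ ADBimod.homog (es.map fun e => e.gen.deg).sum
  | [], _, _, h => wdCast_homog h
  | e :: es, _, _, h => comp_mem_homog_of_left (wdCast_homog h.1) (comp_mem_homog
      (wdL_homog (wdR_homog e.right (hg e.gen)) e.left) (movieHom_homog hg h.2))

lemma movieFunctor_isGradedLinear (hD : MoveInvariant D)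
    (hg : ∀ g, genMap D.birth D.death D.create D.annih g ∈ ADBimod.homog g.deg) :
    IsGradedLinear (movieFunctor hD) where
  map₂_add η θ := map_add (linHom hD) η θ
  map₂_homog {f g} p η hη := by
    have : BrHom.homog f g p ≤ (HMor.homog _ _ p).comap (linHom hD) := by
      refine (AddSubgroup.closure_le _).2 ?_
      rintro _ ⟨es, hes, rfl, rfl⟩
      change linHom hD _ ∈ ADBimod.homog _
      rw [linHom_of]
      exact movieHom_homog hg hes
    exact this hη
  mapId_homog := ⟨L.id_homog _, L.id_homog _⟩
  mapComp_homog f g := wdComp_homog g f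

lemma linHom_gen (hD : MoveInvariant D) (g : MovieGen) :
    linHom hD (BrCob.gen g (f := g.src) (f' := g.tgt) rfl rfl) =
      genMap D.birth D.death D.create D.annih g := by
  have h : g.src = Event.src ⟨[], g, []⟩ := by simp [Event.src]
  have h' : Event.tgt ⟨[], g, []⟩ = g.tgt := by simp [Event.tgt]
  have e : wdCast h ≫ evE (genMap D.birth D.death D.create D.annih) ⟨[], g, []⟩ ≫ wdCast h' =
      genMap D.birth D.death D.create D.annih g := by
    rw [evE_left]
    simp [wdL]
  exact (linHom_of hD _).trans e

lemma movieFunctor_realizes (hD : MoveInvariant D) : Realizes (movieFunctor hD) D := by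
  refine ⟨fun c => λ_ (D.cross c), fun c => L.boxOne_homog (D.cross c), fun c => ?_, fun c => ?_,
    fun c => ?_, fun c => ?_⟩
  · refine (congrArg (fun t : 𝟙 X ⟶ 𝟙 X ≫ D.cross c => t ≫ (λ_ _).hom)
      (linHom_gen hD (.birth c))).trans ?_
    change (D.birth c ≫ (λ_ _).inv) ≫ (λ_ _).hom = 𝟙 _ ≫ D.birth c
    simp
  · refine (congrArg (fun t : 𝟙 X ≫ D.cross c ⟶ 𝟙 X => t ≫ 𝟙 _)
      (linHom_gen hD (.death c))).trans ?_
    exact Category.comp_id ((λ_ _).hom ≫ D.death c)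
  · refine (congrArg (fun t : 𝟙 X ⟶ (𝟙 X ≫ D.cross c.inv) ≫ D.cross c => t ≫
      ((ρ_ (𝟙 X ≫ D.cross c.inv)).inv ▷ D.cross c ≫ (α_ _ _ _).hom) ≫
      (λ_ (D.cross c.inv)).hom ▷ (𝟙 X ≫ D.cross c) ≫ D.cross c.inv ◁ (λ_ (D.cross c)).hom)
      (linHom_gen hD (.create c))).trans ?_
    change (D.create c ≫ (λ_ (D.cross c.inv)).inv ▷ D.cross c) ≫ _ = 𝟙 (𝟙 X) ≫ D.create c
    bicategory
  · refine (congrArg (fun t : (𝟙 X ≫ D.cross c.inv) ≫ D.cross c ⟶ 𝟙 X => t ≫ 𝟙 _)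
      (linHom_gen hD (.annih c))).trans ?_
    change ((λ_ (D.cross c.inv)).hom ▷ D.cross c ≫ D.annih c) ≫ 𝟙 _ =
      ((ρ_ (𝟙 X ≫ D.cross c.inv)).inv ▷ D.cross c ≫ (α_ _ _ _).hom) ≫
      (λ_ (D.cross c.inv)).hom ▷ (𝟙 X ≫ D.cross c) ≫ D.cross c.inv ◁ (λ_ (D.cross c)).hom ≫
      D.annih c
    bicategory

end Graded

section Moves

open Bicategory

/-- The generating data in the bicategory of AD bimodules. -/
abbrev cd : CrossingData (A11obj adBimodLaws) := crossingData adBimodLaws crossingLaws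

lemma cd_hoop (c : Crossing) : cd.create c ≫ cd.annih c = 𝟙 _ :=
  cls_congr _ _ (cancelling c).annih_create

lemma cd_saddle (c : Crossing) : cd.annih c ≫ cd.create c = 𝟙 _ :=
  (cls_eq_iff _ _).2 (cancelling c).create_annih

lemma cd_genMap_homog (g : MovieGen) :
    genMap cd.birth cd.death cd.create cd.annih g ∈ ADBimod.homog g.deg := by
  have L := adBimodLaws
  cases g with
  | birth c =>
    exact comp_mem_homog_of_right (cls_homog _ (crossingLaws.birth_homog c)) (L.boxOne_homog _).2
  | death c =>
    exact comp_mem_homog_of_left (L.boxOne_homog _).1 (cls_homog _ (crossingLaws.death_homog c))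
  | create c =>
    exact comp_mem_homog_of_right (cls_homog _ (crossingLaws.create_homog c))
      (L.idBox_homog (cd.cross c) 0 _ (L.boxOne_homog (cd.cross c.inv)).2)
  | annih c =>
    exact comp_mem_homog_of_left (L.idBox_homog (cd.cross c) 0 _ (L.boxOne_homog _).1)
      (cls_homog _ (crossingLaws.annih_homog c))

lemma id_end_eq {f : 𝟙 (A11obj adBimodLaws) ⟶ 𝟙 (A11obj adBimodLaws)}
    (hf : f ∈ ADBimod.homog 0) (h : IsIso f) : f = 𝟙 _ := by
  obtain ⟨u, hu, hu', rfl⟩ := HMor.exists_of_homog hf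
  obtain ⟨g, hg, e⟩ := HMor.exists_cls (inv (C := A11obj adBimodLaws ⟶ A11obj adBimodLaws)
    (cls u hu))
  have := IsIso.hom_inv_id (C := A11obj adBimodLaws ⟶ A11obj adBimodLaws) (cls u hu)
  rw [e] at this
  obtain ⟨H, -, hH⟩ := (cls_eq_iff _ _).1 this
  exact cls_congr _ _ (one_eq_id hu' H hH)

/-- The isomorphism of a cancelling pair with the identity. -/
def cdPair (c : Crossing) : wd cd.cross [c, c.inv] ≅ 𝟙 (A11obj adBimodLaws) where
  hom := genMap cd.birth cd.death cd.create cd.annih (.annih c)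
  inv := genMap cd.birth cd.death cd.create cd.annih (.create c)
  hom_inv_id := by
    change ((λ_ (cd.cross c.inv)).hom ▷ cd.cross c ≫ cd.annih c) ≫ cd.create c ≫ _ ▷ cd.cross c = 𝟙
      _
    rw [Category.assoc, ← Category.assoc (cd.annih c), cd_saddle]
    simp
  inv_hom_id := by
    change (cd.create c ≫ (λ_ (cd.cross c.inv)).inv ▷ cd.cross c) ≫ _ ▷ cd.cross c ≫ cd.annih c = 𝟙
      _
    rw [Category.assoc, ← Category.assoc (_ ▷ _), ← comp_whiskerRight, Iso.inv_hom_id,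
      id_whiskerRight, Category.id_comp, cd_hoop]

lemma cross_end_eq (c : Crossing) {f : wd cd.cross [c] ⟶ wd cd.cross [c]}
    (hf : f ∈ ADBimod.homog 0) (h : IsIso f) : f = 𝟙 _ := by
  have h1 : wdR [c.inv] f ∈ ADBimod.homog 0 := wdR_homog _ hf
  have : IsIso (wdR [c.inv] f) := by unfold wdR; infer_instance
  have h2 : (cdPair c).inv ≫ wdR [c.inv] f ≫ (cdPair c).hom = 𝟙 _ :=
    id_end_eq (comp_mem_homog_of_left (cd_genMap_homog (.create c))
      (comp_mem_homog_of_right h1 (cd_genMap_homog (.annih c)))) inferInstance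
  have h3 : wdR [c.inv] f = 𝟙 _ := by
    rw [← cancel_epi (cdPair c).inv, ← cancel_mono (cdPair c).hom, Category.assoc]
    exact h2.trans (by simp)
  refine eq_id_of_wdR (cdPair c.inv) f ?_
  refine (wdR_wdR [c.inv] [c.inv.inv] f).trans ?_
  rw [h3, wdR_id]
  simp

lemma cd_zigzag (c : Crossing) (g g' : MovieGen) (hg : IsIso (genMap cd.birth cd.death cd.create
    cd.annih g)) (hg' : IsIso (genMap cd.birth cd.death cd.create cd.annih g')) (hd : g.deg = 0)
    (hd' : g'.deg = 0) (x y x' y') (h : IsMovie [c] [⟨x, g, y⟩, ⟨x', g', y'⟩] [c]) : evM (genMap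
    cd.birth cd.death cd.create cd.annih) _ h = 𝟙 _ := by
  refine cross_end_eq c ?_ (evM_isIso _ _ _ (by simp [hg, hg']))
  have := movieHom_homog cd_genMap_homog h
  simp only [List.map_cons, List.map_nil, List.sum_cons, List.sum_nil, hd, hd', add_zero] at this
  exact this

lemma cd_moveInvariant : MoveInvariant cd := by
  refine evM_baseMove _ _ _ _ cd_hoop cd_saddle (fun c v h => ?_) (fun c v h => ?_)
    (fun c => (Category.assoc _ _ _).symm.trans (cls_congr _ _ (create_death_left c)))
      (fun c => (Category.assoc _ _ _).symm.trans (cls_congr _ _ (create_death_right c)))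
    (fun c => (Category.assoc _ _ _).symm.trans (cls_congr _ _ (birth_annih_right c)))
      (fun c => (Category.assoc _ _ _).symm.trans (cls_congr _ _ (birth_annih_left c)))
    (fun c => (cls_eq_iff _ _).2 (birth_past c)) (fun c => (cls_eq_iff _ _).2 (death_past c))
  · obtain rfl : v = [c] := h.1
    exact cd_zigzag c (.create c) (.annih c.inv) (cdPair c).isIso_inv (cdPair c.inv).isIso_hom rfl
      rfl _ _ _ _ h
  · obtain rfl : v = [c] := h.1
    exact cd_zigzag c (.create c.inv) (.annih c) (cdPair c.inv).isIso_inv (cdPair c).isIso_hom rfl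
      rfl _ _ _ _ h

lemma exists_functor : ∃ (L : ADBimodLaws) (W : CrossingLaws)
    (F : Pseudofunctor BrCob (ADBimod L)) (hF : A11obj L = F.obj BrCob.star),
    IsGradedLinear F ∧ Realizes F (hF ▸ crossingData L W) :=
  ⟨adBimodLaws, crossingLaws, movieFunctor cd_moveInvariant, rfl,
    movieFunctor_isGradedLinear _ cd_genMap_homog, movieFunctor_realizes _⟩

end Moves

end

end BraidAD

theorem mainTheorem5 :
    ∃ (L : BraidAD.ADBimodLaws) (W : BraidAD.CrossingLaws)
      (F : CategoryTheory.Pseudofunctor BraidAD.BrCob (BraidAD.ADBimod L))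
      (hF : BraidAD.A11obj L = F.obj BraidAD.BrCob.star),
      BraidAD.IsGradedLinear F ∧ BraidAD.Realizes F (hF ▸ BraidAD.crossingData L W) :=
  BraidAD.exists_functor
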